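/- **Setting.** Let $(X,\mathcal X,\mu)$ be a $\sigma$-finite measure space, $t_0>0$, and let $-A$ be the generator of a strongly continuous symmetric Markovian semigroup $(T(t))_{t\ge 0}$ on the real space $L_2(\mu)$ which is ultracontractive with spectral dimension $d_S>0$, i.e. there are $c>0$ and $0<\omega\le 1$ with $\|T(t)\|_{L_2(\mu)\to L_\infty(\mu)}\le c\,t^{-d_S/4}e^{\omega t}$ for all $t>0$. For $\sigma>0$ let $H^\sigma(\mu)=(A+I)^{-\sigma/2}(L_2(\mu))$, with a norm equivalent to $\|u\|_{L_2}+\|A^{\sigma/2}u\|_{L_2}$, let $H^{-\sigma}(\mu)=(H^\sigma(\mu))^*$, and let $H^\sigma_\infty(\mu)=H^\sigma(\mu)\cap L_\infty(\mu)$ with the norm $\|u\|_{H^\sigma}+\|u\|_{L_\infty}$. For a Banach space $E$ and $0<\eta<1$ let $C^\eta([0,t_0],E)$ be the space of $\eta$-Hölder continuous functions $[0,t_0]\to E$ and $W^\eta([0,t_0],E)$ the space of (strongly measurable) $v:[0,t_0]\to E$ with $$\sup_{0\le t\le t_0}\Big(\|v(t)\|_E+\int_0^t\frac{\|v(t)-v(\tau)\|_E}{(t-\tau)^{\eta+1}}\,d\tau\Big)<\infty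 .$$ For $w\in H^{-\beta}(\mu)$ and suitable $g$ and $r>0$, let $T(r)(gw)$ be given by $\langle T(r)(gw),v\rangle=(w,\,g\,T(r)v)$, $v\in L_2(\mu)$. For $u$ with values in $H^\delta_\infty(\mu)$ put $U(t;s)w=T(t-s)(G(u(s))\,w)$, an operator in $L(H^{-\beta}(\mu),H^\delta_\infty(\mu))$, and $$\int_0^tT(t-s)G(u(s))\,dz(s):=(-1)^\eta\int_0^t D^\eta_{0+}U(t;s)\,D^{1-\eta}_{t-}z_t(s)\,ds,\qquad z_t(s)=\mathbf 1_{(0,t)}(s)(z(s)-z(t)),$$ with Bochner integrals, $(-1)^\eta=e^{i\pi\eta}$ and the Weyl–Marchaud derivatives $$D^\eta_{0+}U(t;s)=\tfrac{1}{\Gamma(1-\eta)}\Big(\tfrac{U(t;s)}{s^\eta}+\eta\int_0^s\tfrac{U(t;s)-U(t;\tau)}{(s-\tau)^{\eta+1}}d\tau\Big),$$ $$D^{1-\eta}_{t-}z_t(s)=\tfrac{(-1)^{1-\eta}}{\Gamma(\eta)}\Big(\tfrac{z(s)-z(t)}{(t-s)^{1-\eta}}+(1-\eta)\int_s^t\tfrac{z(s)-z(\tau)}{(\tau-s)^{2-\eta}}d\tau\Big);$$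 the integral exists (with parameter $\eta$) if $D^\eta_{0+}U(t;\cdot)\in L_1([0,t],L(H^{-\beta}(\mu),H^\delta_\infty(\mu)))$ and $D^{1-\eta}_{t-}z_t\in L_\infty([0,t],H^{-\beta}(\mu))$. A mild solution of $$\frac{\partial u}{\partial t}=-Au+F(u)+G(u)\cdot\dot z\ \text{ on }(0,t_0)\times X,\qquad u(0)=f,$$ is a function $u$ with $u(0)=f$ for which the following terms exist and $$u(t)=T(t)f+\int_0^tT(t-s)F(u(s))\,ds+\int_0^tT(t-s)G(u(s))\,dz(s),\qquad t\in(0,t_0).$$ **Theorem.** Suppose $0<\alpha,\beta,\gamma,\delta,\varepsilon<1$ and $z\in C^{1-\alpha}([0,t_0],H^{-\beta}(\mu))$. Let $F\in C^1(\mathbb R)$, $F(0)=0$, have a bounded Lipschitz derivative $F'$, and let $G\in C^2(\mathbb R)$, $G(0)=0$, be Lipschitz with a bounded Lipschitz second derivative $G''$. Let $f\in H^{2\gamma+\delta+\varepsilon}(\mu)$, and assume that $\delta+\varepsilon>d_S/2$ (which is automatic if $\delta\ge d_S/2$) or, if this fails, that the function $t\mapsto T(t)f$ belongs to $W^\gamma([0,t_0],H^\delta_\infty(\mu))$.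 If $\alpha<\gamma<1-\alpha$, $\delta\ge\beta$ and $$2\gamma+\Big(\delta\vee\frac{d_S}{2}\Big)<2-2\alpha-\Big(\beta\vee\frac{d_S}{2}\Big),$$ then the problem has a unique mild solution $u$ in $W^\gamma([0,t_0],H^\delta_\infty(\mu))$. The solution does not depend on $\eta$: there is one $u\in W^\gamma([0,t_0],H^\delta_\infty(\mu))$ that is a mild solution for every parameter $\eta\in(\alpha,\gamma]$, and every $v\in W^\gamma([0,t_0],H^\delta_\infty(\mu))$ that is a mild solution for some $\eta\in(\alpha,\gamma]$ equals $u$ on $[0,t_0]$. -/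

import Mathlib

set_option maxSynthPendingDepth 3

open MeasureTheory Set Filter Topology
open scoped ENNReal

noncomputable section

/-- A strongly continuous symmetric Markovian semigroup `(T t)_{t ≥ 0}` on the real space `L₂(μ)`.
Only the values `T t` with `0 ≤ t` are meaningful. -/
structure SymmMarkovSemigroup {X : Type*} [MeasurableSpace X] (μ : Measure X) where
  T : ℝ → (Lp ℝ 2 μ →L[ℝ] Lp ℝ 2 μ)
  T_zero : ∀ u, T 0 u = u
  T_add : ∀ s t, 0 ≤ s → 0 ≤ t → ∀ u, T (s + t) u = T s (T t u)
  T_symm : ∀ t, 0 ≤ t → ∀ u v, inner ℝ (T t u) v = inner ℝ u (T t v)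
  T_tendsto : ∀ u, Tendsto (fun t => T t u) (𝓝[>] 0) (𝓝 u)
  T_markov : ∀ t, 0 ≤ t → ∀ u : Lp ℝ 2 μ, (∀ᵐ x ∂μ, 0 ≤ u x ∧ u x ≤ 1) →
    ∀ᵐ x ∂μ, 0 ≤ T t u x ∧ T t u x ≤ 1

namespace SymmMarkovSemigroup

variable {X : Type*} [MeasurableSpace X] {μ : Measure X}

/-- (Local) ultracontractivity with spectral dimension `dS`:
`‖T t‖_{L₂ → L_∞} ≤ c t^{-dS/4} e^{ω t}` for all `t > 0`, with `c > 0` and `0 < ω ≤ 1`. -/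
def Ultracontractive (S : SymmMarkovSemigroup μ) (dS : ℝ) : Prop :=
  ∃ c > 0, ∃ ω > 0, ω ≤ 1 ∧ ∀ t > 0, ∀ u : Lp ℝ 2 μ,
    eLpNorm (S.T t u) ∞ μ ≤ ENNReal.ofReal (c * t ^ (-dS / 4) * Real.exp (ω * t) * ‖u‖)

/-! ### Contractivity and Bessel potentials -/

theorem norm_T_sq (S : SymmMarkovSemigroup μ) {s : ℝ} (hs : 0 ≤ s) (u : Lp ℝ 2 μ) :
    ‖S.T s u‖ ^ 2 = inner ℝ (S.T (s + s) u) u := by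
  rw [← real_inner_self_eq_norm_sq, S.T_add s s hs hs, S.T_symm s hs (S.T s u) u]

theorem exists_bound_indicator (S : SymmMarkovSemigroup μ) {A : Set X} (hA : MeasurableSet A)
    (hμ : μ A ≠ ∞) : ∃ K : ℝ, ∀ s, 0 ≤ s → ‖S.T s (indicatorConstLp 2 hA hμ (1 : ℝ))‖ ≤ K := by
  refine ⟨Real.sqrt (μ.real A), fun s hs => ?_⟩
  apply Real.le_sqrt_of_sq_le
  rw [S.norm_T_sq hs, real_inner_comm, L2.inner_indicatorConstLp_one hA hμ]
  have hm := S.T_markov (s + s) (by positivity) (indicatorConstLp 2 hA hμ (1 : ℝ)) (by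
    filter_upwards [indicatorConstLp_coeFn (p := 2) (hs := hA) (hμs := hμ) (c := (1 : ℝ))]
      with x hx
    rw [hx]
    by_cases h : x ∈ A <;> simp [h])
  calc ∫ x in A, S.T (s + s) (indicatorConstLp 2 hA hμ (1 : ℝ)) x ∂μ
      ≤ ∫ _ in A, (1 : ℝ) ∂μ := by
        apply integral_mono_of_nonneg
        · exact ae_restrict_of_ae (hm.mono fun x hx => hx.1)
        · exact integrableOn_const hμ
        · exact ae_restrict_of_ae (hm.mono fun x hx => hx.2)
    _ = μ.real A := by simp

theorem norm_T_le (S : SymmMarkovSemigroup μ) {s : ℝ} (hs : 0 ≤ s) (u : Lp ℝ 2 μ) :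
    ‖S.T s u‖ ≤ ‖u‖ := by
  have key : ∀ u : Lp ℝ 2 μ, (∃ K : ℝ, ∀ s, 0 ≤ s → ‖S.T s u‖ ≤ K) →
      ∀ s, 0 ≤ s → ‖S.T s u‖ ≤ ‖u‖ := by
    rintro u ⟨K, hK⟩ s hs
    let f : {s : ℝ // 0 ≤ s} → ℝ := fun s => ‖S.T s u‖
    have hb : BddAbove (range f) := ⟨K, by rintro _ ⟨s, rfl⟩; exact hK s s.2⟩
    have hle : ∀ s : {s : ℝ // 0 ≤ s}, f s ≤ iSup f := fun s => le_ciSup hb s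
    have hsq : ∀ s : {s : ℝ // 0 ≤ s}, f s ^ 2 ≤ iSup f * ‖u‖ := by
      intro s
      have h1 : f s ^ 2 = inner ℝ (S.T (s + s) u) u := S.norm_T_sq s.2 u
      have h2 : inner ℝ (S.T (s + s) u) u ≤ ‖S.T (s + s) u‖ * ‖u‖ := real_inner_le_norm _ _
      have h3 : ‖S.T (s + s) u‖ ≤ iSup f := hle ⟨s + s, add_nonneg s.2 s.2⟩
      nlinarith [norm_nonneg u]
    have : Nonempty {s : ℝ // 0 ≤ s} := ⟨⟨0, le_rfl⟩⟩
    have h0 : 0 ≤ iSup f := (norm_nonneg _).trans (hle ⟨0, le_rfl⟩)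
    have h1 : iSup f ≤ Real.sqrt (iSup f * ‖u‖) :=
      ciSup_le fun s => Real.le_sqrt_of_sq_le (hsq s)
    have h2 : iSup f ^ 2 ≤ iSup f * ‖u‖ := by
      rwa [Real.le_sqrt h0 (by positivity)] at h1
    have h3 : iSup f ≤ ‖u‖ := by
      rcases h0.eq_or_lt with h | h
      · rw [← h]; positivity
      · nlinarith
    exact (hle ⟨s, hs⟩).trans h3
  have hd : DenseRange ((↑) : Lp.simpleFunc ℝ 2 μ → Lp ℝ 2 μ) :=
    Lp.simpleFunc.denseRange (by simp)
  refine hd.induction_on (p := fun u => ‖S.T s u‖ ≤ ‖u‖) u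
    (isClosed_le (by fun_prop) (by fun_prop)) fun g => ?_
  apply key _ _ s hs
  induction g using Lp.simpleFunc.induction (p := 2) (by simp) (by simp) with
  | @indicatorConst c A hs hμ =>
    obtain ⟨K, hK⟩ := S.exists_bound_indicator hs hμ.ne
    refine ⟨‖c‖ * K, fun s h0 => ?_⟩
    rw [Lp.simpleFunc.coe_indicatorConst]
    have : indicatorConstLp 2 hs hμ.ne c = c • indicatorConstLp 2 hs hμ.ne (1 : ℝ) := by
      ext1
      filter_upwards [indicatorConstLp_coeFn (p := 2) (hs := hs) (hμs := hμ.ne) (c := c),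
        Lp.coeFn_smul c (indicatorConstLp 2 hs hμ.ne (1 : ℝ)),
        indicatorConstLp_coeFn (p := 2) (hs := hs) (hμs := hμ.ne) (c := (1 : ℝ))] with x h1 h2 h3
      rw [h1, h2, Pi.smul_apply, h3]
      by_cases hx : x ∈ A <;> simp [hx]
    rw [this, map_smul, norm_smul]
    exact mul_le_mul_of_nonneg_left (hK s h0) (norm_nonneg _)
  | add hf hg hfg h1 h2 =>
    obtain ⟨K, hK⟩ := h1
    obtain ⟨L, hL⟩ := h2
    refine ⟨K + L, fun s h0 => ?_⟩
    rw [AddSubgroup.coe_add, map_add]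
    exact (norm_add_le _ _).trans (add_le_add (hK s h0) (hL s h0))

theorem continuousOn_T (S : SymmMarkovSemigroup μ) (u : Lp ℝ 2 μ) :
    ContinuousOn (fun t => S.T t u) (Ici 0) := by
  have hdist : ∀ s t, 0 ≤ s → 0 ≤ t → dist (S.T t u) (S.T s u) ≤ ‖S.T |t - s| u - u‖ := by
    have aux : ∀ s t, 0 ≤ s → s ≤ t → ‖S.T t u - S.T s u‖ ≤ ‖S.T (t - s) u - u‖ := by
      intro s t h0 h
      have : S.T t u = S.T s (S.T (t - s) u) := by
        rw [← S.T_add s (t - s) h0 (sub_nonneg.2 h)]; congr 2; ring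
      rw [this, ← map_sub]
      exact S.norm_T_le h0 _
    intro s t hs ht
    rcases le_total s t with h | h
    · rw [abs_of_nonneg (sub_nonneg.2 h), dist_eq_norm]; exact aux s t hs h
    · rw [abs_of_nonpos (sub_nonpos.2 h), neg_sub, dist_comm, dist_eq_norm]; exact aux t s ht h
  have h0 : Tendsto (fun t => ‖S.T t u - u‖) (𝓝[≥] 0) (𝓝 0) := by
    rw [← Ioi_insert, nhdsWithin_insert, tendsto_sup]
    constructor
    · rw [tendsto_pure_left]
      intro s hs
      simpa [S.T_zero] using mem_of_mem_nhds hs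
    · have := ((S.T_tendsto u).sub_const u).norm
      simpa using this
  intro s hs
  rw [ContinuousWithinAt, tendsto_iff_dist_tendsto_zero]
  refine squeeze_zero' (Eventually.of_forall fun _ => dist_nonneg)
    (eventually_nhdsWithin_of_forall fun t ht => hdist s t hs ht) (h0.comp ?_)
  refine tendsto_nhdsWithin_iff.2 ⟨?_, Eventually.of_forall fun t => Set.mem_Ici.2 (abs_nonneg (t - s))⟩
  have : Tendsto (fun t : ℝ => |t - s|) (𝓝 s) (𝓝 |s - s|) := by
    exact (continuous_abs.comp (continuous_id.sub continuous_const)).tendsto s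
  rw [sub_self, abs_zero] at this
  exact this.mono_left nhdsWithin_le_nhds

theorem integrableOn_bessel (S : SymmMarkovSemigroup μ) {σ : ℝ} (hσ : 0 < σ) (u : Lp ℝ 2 μ) :
    IntegrableOn (fun t : ℝ => (Real.exp (-t) * t ^ (σ / 2 - 1)) • S.T t u) (Ioi 0) := by
  have hg := Real.GammaIntegral_convergent (half_pos hσ)
  refine Integrable.mono' (hg.mul_const ‖u‖) (hg.aestronglyMeasurable.smul
    (((S.continuousOn_T u).mono Ioi_subset_Ici_self).aestronglyMeasurable measurableSet_Ioi)) ?_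
  refine ae_restrict_of_forall_mem measurableSet_Ioi fun t ht => ?_
  have ht : (0 : ℝ) < t := ht
  rw [norm_smul, Real.norm_of_nonneg (by positivity)]
  exact mul_le_mul_of_nonneg_left (S.norm_T_le ht.le u) (by positivity)

/-- The Bessel potential operator `J^σ = (A + I)^{-σ/2}`, where `-A` is the generator of the
semigroup: `J^σ u = Γ(σ/2)⁻¹ ∫₀^∞ t^{σ/2-1} e^{-t} T(t)u dt` for `σ > 0`, and `J^0 = I`.
Negative `σ` is not used. -/
def bessel (S : SymmMarkovSemigroup μ) (σ : ℝ) : Lp ℝ 2 μ →L[ℝ] Lp ℝ 2 μ :=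
  if hσ : 0 < σ then
    LinearMap.mkContinuous
      { toFun := fun u => (Real.Gamma (σ / 2))⁻¹ •
          ∫ t in Ioi (0 : ℝ), (Real.exp (-t) * t ^ (σ / 2 - 1)) • S.T t u
        map_add' := fun u v => by
          simp only [map_add, smul_add]
          rw [integral_add (S.integrableOn_bessel hσ u) (S.integrableOn_bessel hσ v), smul_add]
        map_smul' := fun c u => by
          simp only [map_smul, RingHom.id_apply]
          rw [smul_comm c, ← integral_smul c]
          congr 1
          refine integral_congr_ae (Eventually.of_forall fun t => ?_)
          exact smul_comm (Real.exp (-t) * t ^ (σ / 2 - 1)) c (S.T t u) }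
      1 (fun u => by
        have hg := Real.GammaIntegral_convergent (half_pos hσ)
        have hΓ : 0 < Real.Gamma (σ / 2) := Real.Gamma_pos_of_pos (half_pos hσ)
        simp only [LinearMap.coe_mk, AddHom.coe_mk]
        rw [norm_smul, norm_inv, Real.norm_of_nonneg hΓ.le, inv_mul_le_iff₀ hΓ, one_mul,
          Real.Gamma_eq_integral (half_pos hσ), ← integral_mul_const]
        refine norm_integral_le_of_norm_le (hg.mul_const ‖u‖)
          (ae_restrict_of_forall_mem measurableSet_Ioi fun t ht => ?_)
        have ht : (0 : ℝ) < t := ht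
        rw [norm_smul, Real.norm_of_nonneg (by positivity)]
        exact mul_le_mul_of_nonneg_left (S.norm_T_le ht.le u) (by positivity))
  else 1

theorem bessel_injective (S : SymmMarkovSemigroup μ) (σ : ℝ) :
    Function.Injective (S.bessel σ) := by
  by_cases hσ : 0 < σ
  · rw [injective_iff_map_eq_zero]
    intro u hu
    have hΓ : Real.Gamma (σ / 2) ≠ 0 := (Real.Gamma_pos_of_pos (half_pos hσ)).ne'
    have h1 : ∫ t in Ioi (0 : ℝ), (Real.exp (-t) * t ^ (σ / 2 - 1)) • S.T t u = 0 := by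
      simpa [bessel, hσ, hΓ] using hu
    have h2 : ∫ t in Ioi (0 : ℝ), (Real.exp (-t) * t ^ (σ / 2 - 1)) * inner ℝ u (S.T t u) = 0 := by
      have := integral_inner (𝕜 := ℝ) (S.integrableOn_bessel hσ u) u
      rw [h1, inner_zero_right] at this
      simpa [inner_smul_right] using this
    have hpos : ∀ t : ℝ, 0 < t → 0 ≤ inner ℝ u (S.T t u) := by
      intro t ht
      have := S.norm_T_sq (half_pos ht).le u
      rw [add_halves, real_inner_comm] at this
      rw [← this]; positivity
    have hint : IntegrableOn
        (fun t : ℝ => (Real.exp (-t) * t ^ (σ / 2 - 1)) * inner ℝ u (S.T t u)) (Ioi 0) := by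
      have := (S.integrableOn_bessel hσ u).const_inner (𝕜 := ℝ) u
      simpa only [IntegrableOn, inner_smul_right] using this
    have h3 := (setIntegral_eq_zero_iff_of_nonneg_ae
      (ae_restrict_of_forall_mem measurableSet_Ioi fun t (ht : (0 : ℝ) < t) =>
        mul_nonneg (by positivity) (hpos t ht)) hint).1 h2
    have h4 : (fun t : ℝ => inner ℝ u (S.T t u)) =ᵐ[volume.restrict (Ioi 0)] fun _ => (0 : ℝ) := by
      filter_upwards [h3, ae_restrict_mem measurableSet_Ioi] with t ht ht0
      have ht0 : (0 : ℝ) < t := ht0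
      have hne : Real.exp (-t) * t ^ (σ / 2 - 1) ≠ 0 := by positivity
      simpa [hne] using ht
    have h5 : EqOn (fun t : ℝ => inner ℝ u (S.T t u)) (fun _ => (0 : ℝ)) (Ioi 0) :=
      Measure.eqOn_open_of_ae_eq h4 isOpen_Ioi
        (continuousOn_const.inner ((S.continuousOn_T u).mono Ioi_subset_Ici_self))
        continuousOn_const
    have h6 : Tendsto (fun t : ℝ => inner ℝ u (S.T t u)) (𝓝[>] 0) (𝓝 (inner ℝ u u)) :=
      tendsto_const_nhds.inner (S.T_tendsto u)
    have h7 : Tendsto (fun t : ℝ => inner ℝ u (S.T t u)) (𝓝[>] 0) (𝓝 0) :=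
      tendsto_const_nhds.congr' (eventually_nhdsWithin_of_forall fun t ht => (h5 ht).symm)
    exact inner_self_eq_zero.1 (tendsto_nhds_unique h6 h7)
  · intro u v h
    simpa [bessel, hσ] using h

/-! ### Potential spaces -/

/-- The potential space `H^σ(μ) = J^σ(L₂(μ))`. -/
def Pot (S : SymmMarkovSemigroup μ) (σ : ℝ) : Type _ :=
  ↥(LinearMap.range (S.bessel σ : Lp ℝ 2 μ →ₗ[ℝ] Lp ℝ 2 μ))

namespace Pot

variable {S : SymmMarkovSemigroup μ} {σ : ℝ}

/-- `H^σ(μ)` with the Bessel potential norm `‖u‖ = ‖(A + I)^{σ/2} u‖_{L₂}`, which is equivalent to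
the graph norm `‖u‖_{L₂} + ‖A^{σ/2} u‖_{L₂}`. -/
instance : NormedAddCommGroup (S.Pot σ) :=
  NormedAddCommGroup.induced ↥(LinearMap.range (S.bessel σ : Lp ℝ 2 μ →ₗ[ℝ] Lp ℝ 2 μ)) (Lp ℝ 2 μ)
    (LinearEquiv.ofInjective (S.bessel σ : Lp ℝ 2 μ →ₗ[ℝ] Lp ℝ 2 μ) (S.bessel_injective σ)).symm
    (LinearEquiv.injective _)

instance : NormedSpace ℝ (S.Pot σ) :=
  NormedSpace.induced ℝ ↥(LinearMap.range (S.bessel σ : Lp ℝ 2 μ →ₗ[ℝ] Lp ℝ 2 μ)) (Lp ℝ 2 μ)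
    (LinearEquiv.ofInjective (S.bessel σ : Lp ℝ 2 μ →ₗ[ℝ] Lp ℝ 2 μ)
      (S.bessel_injective σ)).symm.toLinearMap

/-- The bijection `J^σ : L₂(μ) → H^σ(μ)`. -/
def equiv (S : SymmMarkovSemigroup μ) (σ : ℝ) : Lp ℝ 2 μ ≃ₗ[ℝ] S.Pot σ :=
  LinearEquiv.ofInjective (S.bessel σ : Lp ℝ 2 μ →ₗ[ℝ] Lp ℝ 2 μ) (S.bessel_injective σ)

theorem norm_def (u : S.Pot σ) : ‖u‖ = ‖(equiv S σ).symm u‖ := rfl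

instance : CompleteSpace (S.Pot σ) := by
  let e : Lp ℝ 2 μ ≃ₗᵢ[ℝ] S.Pot σ :=
    { equiv S σ with
      norm_map' := fun f => by
        change ‖equiv S σ f‖ = ‖f‖
        rw [norm_def, LinearEquiv.symm_apply_apply] }
  exact (completeSpace_congr (e := e.symm.toEquiv) e.symm.isometry.isUniformEmbedding).2
    inferInstance

/-- The inclusion `H^σ(μ) ⊆ L₂(μ)`. -/
def toL2 (S : SymmMarkovSemigroup μ) (σ : ℝ) : S.Pot σ →L[ℝ] Lp ℝ 2 μ :=
  LinearMap.mkContinuous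
    (LinearMap.range (S.bessel σ : Lp ℝ 2 μ →ₗ[ℝ] Lp ℝ 2 μ)).subtype ‖S.bessel σ‖ (fun u => by
      obtain ⟨f, rfl⟩ := (equiv S σ).surjective u
      rw [norm_def, LinearEquiv.symm_apply_apply]
      exact (S.bessel σ).le_opNorm f)

end Pot

/-- The space `H^σ_∞(μ) = H^σ(μ) ∩ L_∞(μ)` with the norm `‖u‖_{H^σ} + ‖u‖_{L_∞}`: pairs of an element
of `H^σ(μ)` and an element of `L_∞(μ)` that agree almost everywhere, with the `ℓ¹` sum norm. -/
def bddPotSubmodule (S : SymmMarkovSemigroup μ) (σ : ℝ) :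
    Submodule ℝ (WithLp 1 (S.Pot σ × Lp ℝ ∞ μ)) where
  carrier := {p | Pot.toL2 S σ p.fst =ᵐ[μ] p.snd}
  zero_mem' := by
    simp only [mem_ofPred_eq, WithLp.zero_fst, WithLp.zero_snd, map_zero]
    exact (Lp.coeFn_zero _ _ _).trans (Lp.coeFn_zero _ _ _).symm
  add_mem' := by
    intro p q hp hq
    simp only [mem_ofPred_eq, WithLp.add_fst, WithLp.add_snd, map_add] at hp hq ⊢
    exact (Lp.coeFn_add _ _).trans ((hp.add hq).trans (Lp.coeFn_add _ _).symm)
  smul_mem' := by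
    intro c p hp
    simp only [mem_ofPred_eq, WithLp.smul_fst, WithLp.smul_snd, map_smul] at hp ⊢
    exact (Lp.coeFn_smul _ _).trans ((hp.const_smul c).trans (Lp.coeFn_smul _ _).symm)

/-- The Banach space `H^σ_∞(μ)`. -/
def BddPot (S : SymmMarkovSemigroup μ) (σ : ℝ) : Type _ := ↥(S.bddPotSubmodule σ)

namespace BddPot

variable {S : SymmMarkovSemigroup μ} {σ : ℝ}

instance : NormedAddCommGroup (S.BddPot σ) :=
  inferInstanceAs (NormedAddCommGroup ↥(S.bddPotSubmodule σ))

instance : NormedSpace ℝ (S.BddPot σ) :=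
  inferInstanceAs (NormedSpace ℝ ↥(S.bddPotSubmodule σ))

theorem isClosed_coe :
    IsClosed (S.bddPotSubmodule σ : Set (WithLp 1 (S.Pot σ × Lp ℝ ∞ μ))) := by
  refine IsSeqClosed.isClosed fun p q hp hq => ?_
  have h1 : Tendsto (fun n => Pot.toL2 S σ (p n).fst) atTop (𝓝 (Pot.toL2 S σ q.fst)) :=
    (((Pot.toL2 S σ).continuous.comp
      (WithLp.prod_continuous_ofLp 1 (S.Pot σ) (Lp ℝ ∞ μ)).fst).tendsto q).comp hq
  have h2 : Tendsto (fun n => (p n).snd) atTop (𝓝 q.snd) :=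
    ((WithLp.prod_continuous_ofLp 1 (S.Pot σ) (Lp ℝ ∞ μ)).snd.tendsto q).comp hq
  have h3 := tendstoInMeasure_of_tendsto_Lp h1
  have h4 := tendstoInMeasure_of_tendsto_Lp h2
  exact tendstoInMeasure_ae_unique (h3.congr_left fun n => hp n) h4

instance : CompleteSpace (S.BddPot σ) :=
  (isClosed_coe (S := S) (σ := σ)).completeSpace_coe

/-- The inclusion `H^σ_∞(μ) ⊆ L₂(μ)`. -/
def toL2 (u : S.BddPot σ) : Lp ℝ 2 μ := Pot.toL2 S σ (u : ↥(S.bddPotSubmodule σ)).1.fst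

end BddPot

/-- The dual `H^{-σ}(μ) = (H^σ(μ))^*` with the operator norm. -/
abbrev NegPot (S : SymmMarkovSemigroup μ) (σ : ℝ) : Type _ := StrongDual ℝ (S.Pot σ)

/-! ### The operators `U(t;s) = T(t-s) G(u(s))` -/

/-- `z ∈ (H^β_∞)^*` is the product `g · w` of a function `g` and of `w ∈ H^{-β}`, that is,
`z(v) = (w, g v)` for all `v ∈ H^β_∞`; in particular `g v ∈ H^β` for these `v`. -/
def IsDualProduct (S : SymmMarkovSemigroup μ) (β : ℝ) (g : X → ℝ) (w : S.NegPot β)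
    (z : StrongDual ℝ (S.BddPot β)) : Prop :=
  ∀ v : S.BddPot β, ∃ k : S.Pot β,
    Pot.toL2 S β k =ᵐ[μ] (fun x => g x * v.toL2 x) ∧ z v = w k

/-- `h ∈ L₂` is `T(r) z` for `z ∈ (H^β_∞)^*`, that is, `⟨h, v⟩ = (z, T(r) v)` for all `v ∈ L₂`;
in particular `T(r) v ∈ H^β_∞` for these `v`. -/
def IsDualFlow (S : SymmMarkovSemigroup μ) (β r : ℝ) (z : StrongDual ℝ (S.BddPot β))
    (h : Lp ℝ 2 μ) : Prop :=
  ∀ v : Lp ℝ 2 μ, ∃ k : S.BddPot β, k.toL2 = S.T r v ∧ inner ℝ h v = z k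

/-- The bounded operator `L : H^{-β} → H^δ_∞` is `w ↦ T(r)(g w)`. -/
def IsSmoothedMul (S : SymmMarkovSemigroup μ) (β δ r : ℝ) (g : X → ℝ)
    (L : S.NegPot β →L[ℝ] S.BddPot δ) : Prop :=
  ∀ w : S.NegPot β, ∃ z, S.IsDualProduct β g w z ∧ S.IsDualFlow β r z (L w).toL2

open Classical in
/-- The operator `w ↦ T(r)(g w)` in `L(H^{-β}, H^δ_∞)` (zero if there is no such operator). -/
def smoothedMul (S : SymmMarkovSemigroup μ) (β δ r : ℝ) (g : X → ℝ) :
    S.NegPot β →L[ℝ] S.BddPot δ :=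
  if h : ∃ L, S.IsSmoothedMul β δ r g L then h.choose else 0

/-- `U(t;s) = T(t-s) G(u(s)) ∈ L(H^{-β}, H^δ_∞)`. -/
def opU (S : SymmMarkovSemigroup μ) (β δ : ℝ) (G : ℝ → ℝ) (u : ℝ → S.BddPot δ) (t s : ℝ) :
    S.NegPot β →L[ℝ] S.BddPot δ :=
  S.smoothedMul β δ (t - s) (fun x => G ((u s).toL2 x))

end SymmMarkovSemigroup

/-! ### Fractional calculus for Banach space valued functions -/

section Fractional

variable {E : Type*} [NormedAddCommGroup E] [NormedSpace ℝ E]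

/-- `v ∈ W^η([0,t₀],E)`: `v` is strongly measurable on `[0,t₀]` and
`sup_{0 ≤ t ≤ t₀} (‖v(t)‖ + ∫₀ᵗ ‖v(t) - v(τ)‖ / (t - τ)^{η+1} dτ) < ∞`. -/
def MemW (η t₀ : ℝ) (v : ℝ → E) : Prop :=
  AEStronglyMeasurable v (volume.restrict (Icc 0 t₀)) ∧
  ∃ C : ℝ, ∀ t ∈ Icc 0 t₀,
    IntegrableOn (fun τ => ‖v t - v τ‖ / (t - τ) ^ (η + 1)) (Ioo 0 t) ∧
    ‖v t‖ + ∫ τ in Ioo 0 t, ‖v t - v τ‖ / (t - τ) ^ (η + 1) ≤ C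

/-- `v ∈ C^η([0,t₀],E)`: `v` is bounded and Hölder continuous of order `η` on `[0,t₀]`. -/
def MemC (η t₀ : ℝ) (v : ℝ → E) : Prop :=
  ∃ C : ℝ, (∀ t ∈ Icc 0 t₀, ‖v t‖ ≤ C) ∧
    ∀ s ∈ Icc 0 t₀, ∀ t ∈ Icc 0 t₀, ‖v t - v s‖ ≤ C * |t - s| ^ η

/-- The integrand of the left-sided Weyl-Marchaud derivative `D_{0+}^η V(s)`. -/
def leftKernel (η : ℝ) (V : ℝ → E) (s τ : ℝ) : E :=
  ((s - τ) ^ (η + 1))⁻¹ • (V s - V τ)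

/-- The left-sided Weyl-Marchaud derivative
`D_{0+}^η V(s) = Γ(1-η)⁻¹ (V(s) / s^η + η ∫₀ˢ (V(s) - V(τ)) / (s - τ)^{η+1} dτ)`. -/
def leftDeriv (η : ℝ) (V : ℝ → E) (s : ℝ) : E :=
  (Real.Gamma (1 - η))⁻¹ • ((s ^ η)⁻¹ • V s + η • ∫ τ in Ioo 0 s, leftKernel η V s τ)

/-- The integrand of the right-sided Weyl-Marchaud derivative of order `1 - η`. -/
def rightKernel (η : ℝ) (z : ℝ → E) (s τ : ℝ) : E :=
  ((τ - s) ^ (1 - η + 1))⁻¹ • (z s - z τ)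

/-- The right-sided Weyl-Marchaud derivative `D_{t-}^{1-η} z_t(s)`, `z_t = z - z(t)`, without its
scalar factor `(-1)^{1-η}`:
`Γ(η)⁻¹ ((z(s) - z(t)) / (t - s)^{1-η} + (1-η) ∫ₛᵗ (z(s) - z(τ)) / (τ - s)^{(1-η)+1} dτ)`. -/
def rightDeriv (η : ℝ) (z : ℝ → E) (t s : ℝ) : E :=
  (Real.Gamma η)⁻¹ • (((t - s) ^ (1 - η))⁻¹ • (z s - z t) +
    (1 - η) • ∫ τ in Ioo s t, rightKernel η z s τ)

end Fractional

namespace SymmMarkovSemigroup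

variable {X : Type*} [MeasurableSpace X] {μ : Measure X}

/-- The integral `∫₀ᵗ T(t-s) G(u(s)) dz(s)` exists (with parameter `η`): all the operators `U(t;s)`
and the fractional derivatives in its definition exist, with
`D_{0+}^η U(t;·) ∈ L₁([0,t], L(H^{-β}, H^δ_∞))` and `D_{t-}^{1-η} z_t ∈ L_∞([0,t], H^{-β})`. -/
structure FracIntegrable (S : SymmMarkovSemigroup μ) (β δ η : ℝ) (G : ℝ → ℝ)
    (z : ℝ → S.NegPot β) (u : ℝ → S.BddPot δ) (t : ℝ) : Prop where
  exists_op : ∀ s ∈ Ioo 0 t, ∃ L, S.IsSmoothedMul β δ (t - s) (fun x => G ((u s).toL2 x)) L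
  left_conv : ∀ᵐ s ∂(volume.restrict (Ioo 0 t)),
    IntegrableOn (leftKernel η (S.opU β δ G u t) s) (Ioo 0 s)
  left_mem : IntegrableOn (leftDeriv η (S.opU β δ G u t)) (Ioo 0 t)
  right_conv : ∀ᵐ s ∂(volume.restrict (Ioo 0 t)), IntegrableOn (rightKernel η z s) (Ioo s t)
  right_mem : MemLp (rightDeriv η z t) ∞ (volume.restrict (Ioo 0 t))

/-- `∫₀ᵗ T(t-s) G(u(s)) dz(s) = (-1)^η ∫₀ᵗ D_{0+}^η U(t;s) D_{t-}^{1-η} z_t(s) ds`; the two scalar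
factors `(-1)^η = e^{iπη}` and `(-1)^{1-η} = e^{iπ(1-η)}` multiply to `-1`. -/
def fracIntegral (S : SymmMarkovSemigroup μ) (β δ η : ℝ) (G : ℝ → ℝ)
    (z : ℝ → S.NegPot β) (u : ℝ → S.BddPot δ) (t : ℝ) : S.BddPot δ :=
  -∫ s in Ioo 0 t, leftDeriv η (S.opU β δ G u t) s (rightDeriv η z t s)

open Classical in
/-- The superposition `F(u) = F ∘ u` in `L₂(μ)` (zero if `F ∘ u` is not in `L₂(μ)`). -/
def superpos (F : ℝ → ℝ) (u : Lp ℝ 2 μ) : Lp ℝ 2 μ :=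
  if h : MemLp (fun x => F (u x)) 2 μ then h.toLp _ else 0

/-- `u` is a mild solution on `[0,t₀]`, with initial value `f`, of
`∂u/∂t = -A u + F(u) + G(u) ż`: `u(0) = f` and
`u(t) = T(t) f + ∫₀ᵗ T(t-s) F(u(s)) ds + ∫₀ᵗ T(t-s) G(u(s)) dz(s)` for `t ∈ (0,t₀)`, all terms being
well defined and the last one being taken with the parameter `η`. -/
structure IsMildSolution (S : SymmMarkovSemigroup μ) (β δ η t₀ : ℝ) (F G : ℝ → ℝ)
    (z : ℝ → S.NegPot β) (f : Lp ℝ 2 μ) (u : ℝ → S.BddPot δ) : Prop where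
  init : (u 0).toL2 = f
  memLp_F : ∀ s ∈ Ioo 0 t₀, MemLp (fun x => F ((u s).toL2 x)) 2 μ
  integrable_F : ∀ t ∈ Ioo 0 t₀,
    IntegrableOn (fun s => S.T (t - s) (superpos F (u s).toL2)) (Ioo 0 t)
  integrable_G : ∀ t ∈ Ioo 0 t₀, S.FracIntegrable β δ η G z u t
  eqn : ∀ t ∈ Ioo 0 t₀, (u t).toL2 = S.T t f +
    (∫ s in Ioo 0 t, S.T (t - s) (superpos F (u s).toL2)) +
    (S.fracIntegral β δ η G z u t).toL2

end SymmMarkovSemigroup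

end

/-!
The mild equation is solved by a fixed point argument in exponentially weighted `W^γ` norms. Four
points carry the proof.

*Potential spaces and superposition operators.* By symmetry the function `t ↦ (T(t)u, u)` is
nonnegative and has nonnegative second differences, so it is convex, and this gives the bound
`‖T(r)u - T(r+h)u‖ ≤ (h/r) ‖u‖` of an analytic semigroup without the spectral theorem. For
`0 < σ < 1` the space `H^σ` is characterized by the finiteness of the energy
`∫ r^{-σ-1} (u - e^{-r} T(r)u, u) dr` (`energy_bessel_le`, `exists_bessel_eq_of_energy_le`). By
the Markov property the approximating forms `(u - e^{-r} T(r)u, u)` decrease under normal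
contractions (`form_le_sum`), hence a function whose values and increments are dominated by those
of finitely many elements of `H^σ_∞` is itself in `H^σ_∞` (`exists_bddPot_of_abs_le`). Products
and the operators `u ↦ G(u)` are estimated in this way, including the second differences of `G(u)`
(`exists_norm_nemytskii_sub_sub_sub_le`).

*Singular kernels.* Ultracontractivity makes `T(r)`, as an operator into `H^σ_∞`, of size `r^{-κ}`
with `κ = max σ (d_S/2) / 2`. Writing `T(r)(g w)` as `T(r/2)` applied to the element `T(r/2)(g w)`
of `L₂`, defined by duality, one finds that the bilinear maps `(g, w) ↦ T(r)(g w)` and their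
differences in `r` have the corresponding singularity at `r = 0` (`isSingularFamily_opM`). The
hypothesis on the exponents makes the resulting integrals in time converge with room to spare, and
this room is turned into a negative power of the weight `ρ` of the norms (`exists_drift_bound`,
`exists_noise_bound`).

*Global existence.* On bounded sets of `W^γ` the equation is a contraction for large `ρ`
(`exists_contraction`), but `G` is only locally Lipschitz there, so bounded sets need not be
mapped to themselves for all of `[0,t₀]`. This is overcome by an invariant set (`IsTame`) of
functions that are moreover Hölder continuous in `L₂` of order `γ + δ/2` and whose approximating
forms are `O(r^{δ₁})`, with some `δ₁ > β`. On it the increments of `G(u)` in `H^β_∞` grow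
linearly: the energy integral is split at a level `r` that depends on the time increment, the
forms being used below it and the Lipschitz bound in `L₂` above it
(`exists_norm_nemytskii_sub_le`). For large `ρ` the set is mapped to itself, and the Picard
iterates converge in it (`exists_fixed_point`). Two solutions agree on each `[0,t₁]` with
`t₁ < t₀` by contraction, and then at `t₀`, since a function of `W^γ` has no jump there:
`(t₀ - τ)^{-γ-1}` is not integrable (`MemW.eq_right`).

*Independence of `η`.* The Riemann-Liouville integral of order `η` recovers `V` almost everywhere
from its Weyl-Marchaud derivative (`IsFracDiff.ae_integral_leftDeriv`). When `z` is replaced by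
its averages over `(s, s + h)`, which are differentiable in `s`, the fractional integral therefore
turns into the integral of `V` against the difference quotients of `z`, where `η` does not occur.
Letting `h → 0` shows that the integral itself does not depend on `η`
(`IsFracDiff.tendsto_integral_diffQuot`, `noise_eq_noise`), so the map whose fixed point is the
solution can be set up with one parameter close to `α`.
-/

noncomputable section

namespace SymmMarkovSemigroup

variable {X : Type*} [MeasurableSpace X] {μ : Measure X}

/-! ### Symmetric semigroups and their approximating forms -/

theorem inner_T_T (S : SymmMarkovSemigroup μ) {a b : ℝ} (ha : 0 ≤ a) (hb : 0 ≤ b)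
    (u v : Lp ℝ 2 μ) : inner ℝ (S.T a u) (S.T b v) = inner ℝ (S.T (a + b) u) v := by
  rw [add_comm, S.T_add b a hb ha, S.T_symm b hb]

theorem inner_T_self_nonneg (S : SymmMarkovSemigroup μ) {t : ℝ} (ht : 0 ≤ t) (u : Lp ℝ 2 μ) :
    0 ≤ inner ℝ (S.T t u) u := by
  have := S.norm_T_sq (s := t / 2) (by positivity) u
  rw [add_halves] at this
  rw [← this]; positivity

theorem inner_T_self_le (S : SymmMarkovSemigroup μ) {t : ℝ} (ht : 0 ≤ t) (u : Lp ℝ 2 μ) :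
    inner ℝ (S.T t u) u ≤ ‖u‖ ^ 2 := by
  refine (real_inner_le_norm _ _).trans ?_
  rw [sq]
  exact mul_le_mul_of_nonneg_right (S.norm_T_le ht u) (norm_nonneg _)

theorem inner_T_self_antitone (S : SymmMarkovSemigroup μ) {s t : ℝ} (hs : 0 ≤ s) (hst : s ≤ t)
    (u : Lp ℝ 2 μ) : inner ℝ (S.T t u) u ≤ inner ℝ (S.T s u) u := by
  have h1 := S.norm_T_sq (s := s / 2) (by positivity) u
  have h2 := S.norm_T_sq (s := t / 2) (by linarith) u
  rw [add_halves] at h1 h2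
  rw [← h1, ← h2]
  have : S.T (t / 2) u = S.T ((t - s) / 2) (S.T (s / 2) u) := by
    rw [← S.T_add _ _ (by linarith) (by linarith)]; congr 2; ring
  rw [this]
  gcongr
  exact S.norm_T_le (by linarith) _

/-- The approximating form `E_r(u) = (u - T(r) u, u)`. -/
def form (S : SymmMarkovSemigroup μ) (r : ℝ) (u : Lp ℝ 2 μ) : ℝ := inner ℝ (u - S.T r u) u

theorem form_eq (S : SymmMarkovSemigroup μ) (r : ℝ) (u : Lp ℝ 2 μ) :
    S.form r u = ‖u‖ ^ 2 - inner ℝ (S.T r u) u := by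
  rw [form, inner_sub_left, real_inner_self_eq_norm_sq]

theorem form_nonneg (S : SymmMarkovSemigroup μ) {r : ℝ} (hr : 0 ≤ r) (u : Lp ℝ 2 μ) :
    0 ≤ S.form r u := by
  rw [form_eq]; linarith [S.inner_T_self_le hr u]

theorem form_le_norm_sq (S : SymmMarkovSemigroup μ) {r : ℝ} (hr : 0 ≤ r) (u : Lp ℝ 2 μ) :
    S.form r u ≤ ‖u‖ ^ 2 := by
  rw [form_eq]; linarith [S.inner_T_self_nonneg hr u]

theorem continuousOn_form (S : SymmMarkovSemigroup μ) (u : Lp ℝ 2 μ) :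
    ContinuousOn (fun r => S.form r u) (Ici 0) :=
  (continuousOn_const.sub (S.continuousOn_T u)).inner continuousOn_const

/-- The function `t ↦ (T(t) u, u)` is midpoint convex: its second differences are squares. -/
theorem inner_T_second_diff (S : SymmMarkovSemigroup μ) {t h : ℝ} (ht : 0 ≤ t) (hh : 0 ≤ h)
    (u : Lp ℝ 2 μ) :
    inner ℝ (S.T t u) u - 2 * inner ℝ (S.T (t + h) u) u + inner ℝ (S.T (t + 2 * h) u) u
      = ‖S.T (t / 2) u - S.T (t / 2 + h) u‖ ^ 2 := by
  rw [← real_inner_self_eq_norm_sq, inner_sub_left, inner_sub_right, inner_sub_right,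
    S.inner_T_T (by positivity) (by positivity), S.inner_T_T (by positivity) (by positivity),
    S.inner_T_T (by positivity) (by positivity), S.inner_T_T (by positivity) (by positivity),
    show t / 2 + t / 2 = t by ring, show t / 2 + (t / 2 + h) = t + h by ring,
    show t / 2 + h + t / 2 = t + h by ring, show t / 2 + h + (t / 2 + h) = t + 2 * h by ring]
  ring

theorem succ_mul_inner_T_diff_le (S : SymmMarkovSemigroup μ) {t h : ℝ} (ht : 0 ≤ t) (hh : 0 ≤ h)
    (u : Lp ℝ 2 μ) (n : ℕ) :
    (n + 1) * (inner ℝ (S.T (t + n * h) u) u - inner ℝ (S.T (t + (n + 1) * h) u) u)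
      ≤ inner ℝ (S.T t u) u - inner ℝ (S.T (t + (n + 1) * h) u) u := by
  induction n with
  | zero => simp
  | succ n ih =>
    have h2 := S.inner_T_second_diff (t := t + n * h) (by positivity) hh u
    rw [show t + n * h + h = t + (n + 1) * h by ring,
      show t + n * h + 2 * h = t + (n + 1 + 1) * h by ring] at h2
    push_cast
    have h3 : 0 ≤ ‖S.T ((t + n * h) / 2) u - S.T ((t + n * h) / 2 + h) u‖ ^ 2 := by positivity
    have hn : (0 : ℝ) ≤ n + 1 := by positivity
    nlinarith [mul_nonneg hn h3]

/-- By convexity of `t ↦ (T(t) u, u)`, its decrement over `[r, r + h]` is at most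
`h / r` times the total decrement. -/
theorem inner_T_diff_le (S : SymmMarkovSemigroup μ) {r h : ℝ} (hr : 0 < r) (hh : 0 ≤ h)
    (u : Lp ℝ 2 μ) :
    inner ℝ (S.T r u) u - inner ℝ (S.T (r + h) u) u ≤ h / r * ‖u‖ ^ 2 := by
  rcases hh.eq_or_lt with rfl | hh
  · simp
  set n := ⌊r / h⌋₊
  have h1 : (n : ℝ) ≤ r / h := Nat.floor_le (by positivity)
  have h2 : r / h < n + 1 := Nat.lt_floor_add_one _
  rw [le_div_iff₀ hh] at h1
  rw [div_lt_iff₀ hh] at h2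
  have h3 := S.succ_mul_inner_T_diff_le (t := r - n * h) (by linarith) hh.le u n
  rw [show r - n * h + n * h = r by ring, show r - n * h + (n + 1) * h = r + h by ring] at h3
  have h4 := S.inner_T_self_le (t := r - n * h) (by linarith) u
  have h5 := S.inner_T_self_nonneg (t := r + h) (by linarith) u
  have h6 := S.inner_T_self_antitone hr.le (le_add_of_nonneg_right hh.le) u
  rw [div_mul_eq_mul_div, le_div_iff₀ hr]
  nlinarith

/-- A symmetric operator with `0 ≤ (B u, u) ≤ c ‖u‖²` has norm at most `c`. -/
theorem norm_le_of_inner_le {H : Type*} [NormedAddCommGroup H] [InnerProductSpace ℝ H]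
    (B : H →L[ℝ] H) (hB : ∀ u v, inner ℝ (B u) v = inner ℝ u (B v)) {c : ℝ} (hc : 0 ≤ c)
    (h0 : ∀ u, 0 ≤ inner ℝ (B u) u) (h1 : ∀ u, inner ℝ (B u) u ≤ c * ‖u‖ ^ 2) (u : H) :
    ‖B u‖ ≤ c * ‖u‖ := by
  have key : ∀ s : ℝ, 0 ≤ c * ‖u‖ ^ 2 - 2 * s * ‖B u‖ ^ 2 + s ^ 2 * (c * ‖B u‖ ^ 2) := by
    intro s
    have h2 := h0 (u - s • B u)
    have h3 := h1 u
    have h4 := h1 (B u)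
    have h5 : inner ℝ (B (B u)) u = ‖B u‖ ^ 2 := by rw [hB, real_inner_self_eq_norm_sq]
    rw [map_sub, map_smul, inner_sub_left, inner_sub_right, inner_sub_right, inner_smul_right,
      inner_smul_left, inner_smul_left, inner_smul_right, h5, real_inner_self_eq_norm_sq] at h2
    simp only [conj_trivial] at h2
    nlinarith [mul_le_mul_of_nonneg_left h4 (sq_nonneg s)]
  rcases hc.eq_or_lt with rfl | hc
  · have h2 := key 1
    have : ‖B u‖ ^ 2 ≤ 0 := by nlinarith
    have : ‖B u‖ = 0 := by nlinarith [norm_nonneg (B u)]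
    simp [this]
  · have h2 := key c⁻¹
    have h3 : c * ‖u‖ ^ 2 - 2 * c⁻¹ * ‖B u‖ ^ 2 + c⁻¹ ^ 2 * (c * ‖B u‖ ^ 2)
        = c⁻¹ * ((c * ‖u‖) ^ 2 - ‖B u‖ ^ 2) := by field_simp; ring
    rw [h3] at h2
    have h4 : 0 ≤ (c * ‖u‖) ^ 2 - ‖B u‖ ^ 2 := by
      by_contra h
      push Not at h
      exact absurd h2 (not_le.2 (mul_neg_of_pos_of_neg (inv_pos.2 hc) h))
    exact abs_le_of_sq_le_sq' (by linarith) (by positivity) |>.2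

theorem norm_T_sub_le_of_inner (S : SymmMarkovSemigroup μ) {r h c : ℝ} (hr : 0 ≤ r) (hh : 0 ≤ h)
    (hc : 0 ≤ c)
    (H : ∀ u, inner ℝ (S.T r u) u - inner ℝ (S.T (r + h) u) u ≤ c * ‖u‖ ^ 2) (u : Lp ℝ 2 μ) :
    ‖S.T (r + h) u - S.T r u‖ ≤ c * ‖u‖ := by
  have := norm_le_of_inner_le (S.T r - S.T (r + h))
    (fun u v => by
      simp only [sub_apply, inner_sub_left, inner_sub_right,
        S.T_symm r hr, S.T_symm (r + h) (by positivity)]) hc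
    (fun u => by
      simp only [sub_apply, inner_sub_left]
      linarith [S.inner_T_self_antitone hr (le_add_of_nonneg_right hh) u])
    (fun u => by
      simp only [sub_apply, inner_sub_left]
      exact H u) u
  rwa [norm_sub_rev]

/-- Analyticity of the semigroup on `L₂`. -/
theorem norm_T_add_sub_le (S : SymmMarkovSemigroup μ) {r h : ℝ} (hr : 0 < r) (hh : 0 ≤ h)
    (u : Lp ℝ 2 μ) : ‖S.T (r + h) u - S.T r u‖ ≤ min 1 (h / r) * ‖u‖ := by
  rw [min_mul_of_nonneg _ _ (norm_nonneg _)]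
  refine le_min ?_ (S.norm_T_sub_le_of_inner hr.le hh (by positivity)
    (fun u => S.inner_T_diff_le hr hh u) u)
  refine S.norm_T_sub_le_of_inner hr.le hh zero_le_one (fun u => ?_) u
  linarith [S.inner_T_self_nonneg (t := r + h) (by positivity) u, S.inner_T_self_le hr.le u]

theorem form_T_le (S : SymmMarkovSemigroup μ) {r t : ℝ} (hr : 0 ≤ r) (ht : 0 < t)
    (u : Lp ℝ 2 μ) : S.form r (S.T t u) ≤ min 1 (r / t) * ‖u‖ ^ 2 := by
  have h2t : 0 < t + t := by positivity
  have h1 : S.form r (S.T t u) = inner ℝ (S.T (t + t) u) u - inner ℝ (S.T (t + t + r) u) u := by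
    rw [form, inner_sub_left, S.inner_T_T ht.le ht.le, ← S.T_add r t hr ht.le,
      S.inner_T_T (by positivity) ht.le]
    congr 4; ring
  rw [h1, min_mul_of_nonneg _ _ (by positivity)]
  refine le_min ?_ ?_
  · linarith [S.inner_T_self_nonneg (t := t + t + r) (by positivity) u,
      S.inner_T_self_le h2t.le u]
  · refine (S.inner_T_diff_le h2t hr u).trans ?_
    gcongr
    linarith

theorem inner_sub_T_sub_T_le (S : SymmMarkovSemigroup μ) {r s : ℝ} (hr : 0 ≤ r) (hs : 0 ≤ s)
    (u : Lp ℝ 2 μ) : inner ℝ (u - S.T r u) (u - S.T s u) ≤ S.form r u := by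
  have h1 : inner ℝ (u - S.T r u) (S.T s u) = S.form r (S.T (s / 2) u) := by
    rw [form, ← S.T_add r _ hr (by positivity), add_comm r, S.T_add _ r (by positivity) hr,
      ← map_sub, S.T_symm _ (by positivity), ← S.T_add _ _ (by positivity) (by positivity),
      add_halves]
  rw [inner_sub_right, h1]
  change S.form r u - _ ≤ _
  linarith [S.form_nonneg hr (S.T (s / 2) u)]

/-- The semigroup `e^{-t} T(t)`, generated by `-(A + I)`. -/
def damp (S : SymmMarkovSemigroup μ) : SymmMarkovSemigroup μ where
  T t := Real.exp (-t) • S.T t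
  T_zero u := by simp [S.T_zero]
  T_add s t hs ht u := by
    simp only [smul_apply, map_smul, S.T_add s t hs ht, smul_smul,
      ← Real.exp_add]
    congr 2; ring
  T_symm t ht u v := by
    simp only [smul_apply, inner_smul_left, inner_smul_right,
      conj_trivial, S.T_symm t ht]
  T_tendsto u := by
    have : Tendsto (fun t : ℝ => Real.exp (-t)) (𝓝[>] 0) (𝓝 1) := by
      have : Tendsto (fun t : ℝ => Real.exp (-t)) (𝓝 0) (𝓝 (Real.exp (-0))) :=
        (Real.continuous_exp.comp continuous_neg).tendsto 0
      rw [neg_zero, Real.exp_zero] at this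
      exact this.mono_left nhdsWithin_le_nhds
    simpa using this.smul (S.T_tendsto u)
  T_markov t ht u hu := by
    have h1 : Real.exp (-t) ≤ 1 := Real.exp_le_one_iff.2 (by linarith)
    filter_upwards [S.T_markov t ht u hu, Lp.coeFn_smul (Real.exp (-t)) (S.T t u)] with x hx h2
    rw [smul_apply, h2, Pi.smul_apply, smul_eq_mul]
    exact ⟨mul_nonneg (Real.exp_pos _).le hx.1, mul_le_one₀ h1 hx.1 hx.2⟩

theorem damp_T (S : SymmMarkovSemigroup μ) (t : ℝ) (u : Lp ℝ 2 μ) :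
    S.damp.T t u = Real.exp (-t) • S.T t u := rfl

theorem T_eq_damp (S : SymmMarkovSemigroup μ) (t : ℝ) (u : Lp ℝ 2 μ) :
    S.T t u = Real.exp t • S.damp.T t u := by
  rw [damp_T, smul_smul, ← Real.exp_add]; simp

/-! ### The contraction property of the approximating forms -/

theorem toLp_simpleFunc_eval_eq_sum {κ : Type*} [Fintype κ] (s : SimpleFunc X (κ → ℝ))
    (hsi : ∀ k, MemLp (fun x => s x k) 2 μ)
    (hA : ∀ a : {a // a ∈ s.range.filter (· ≠ 0)}, μ (s ⁻¹' {a.1}) ≠ ∞) (k : κ) :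
    (hsi k).toLp = ∑ a : {a // a ∈ s.range.filter (· ≠ 0)},
      a.1 k • indicatorConstLp 2 (s.measurableSet_preimage {a.1}) (hA a) (1 : ℝ) := by
  ext1
  refine (hsi k).coeFn_toLp.trans ?_
  refine EventuallyEq.symm ((Lp.coeFn_finsetSum _ _).trans ?_)
  have h1 : ∀ᵐ x ∂μ, ∀ a : {a // a ∈ s.range.filter (· ≠ 0)},
      (a.1 k • indicatorConstLp 2 (s.measurableSet_preimage {a.1}) (hA a) (1 : ℝ) : Lp ℝ 2 μ) x
        = a.1 k * (s ⁻¹' {a.1}).indicator (fun _ => (1 : ℝ)) x := by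
    rw [ae_all_iff]
    intro a
    filter_upwards [Lp.coeFn_smul (a.1 k)
      (indicatorConstLp 2 (s.measurableSet_preimage {a.1}) (hA a) (1 : ℝ)),
      indicatorConstLp_coeFn (p := 2) (hs := s.measurableSet_preimage {a.1}) (hμs := hA a)
        (c := (1 : ℝ))] with x h2 h3
    rw [h2, Pi.smul_apply, h3, smul_eq_mul]
  filter_upwards [h1] with x hx
  rw [Finset.sum_apply, Finset.sum_congr rfl fun a _ => hx a]
  by_cases h0 : s x = 0
  · rw [Finset.sum_eq_zero]
    · simp [h0]
    · intro a _
      have : s x ≠ a.1 := by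
        rw [h0]; exact fun h => (Finset.mem_filter.1 a.2).2 h.symm
      simp [this]
  · rw [Finset.sum_eq_single ⟨s x, Finset.mem_filter.2 ⟨s.mem_range_self x, h0⟩⟩]
    · simp
    · intro b _ hb
      have : s x ≠ b.1 := fun h => hb (Subtype.ext h.symm)
      simp [this]
    · simp

theorem sum_form_eq {I : Type*} [Fintype I] (m : I → ℝ) (p : I → I → ℝ)
    (hp : ∀ a b, p a b = p b a) (c : I → ℝ) :
    ∑ a, c a ^ 2 * m a - ∑ a, ∑ b, c a * c b * p a b
      = (∑ a, ∑ b, p a b * (c a - c b) ^ 2) / 2 + ∑ a, c a ^ 2 * (m a - ∑ b, p a b) := by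
  have h1 : ∑ a, ∑ b, p a b * c b ^ 2 = ∑ a, ∑ b, p a b * c a ^ 2 := by
    rw [Finset.sum_comm]
    exact Finset.sum_congr rfl fun a _ => Finset.sum_congr rfl fun b _ => by rw [hp]
  have h2 : ∑ a, ∑ b, p a b * (c a - c b) ^ 2
      = ∑ a, ∑ b, p a b * c a ^ 2 + ∑ a, ∑ b, p a b * c b ^ 2
        - 2 * ∑ a, ∑ b, c a * c b * p a b := by
    simp only [Finset.mul_sum, ← Finset.sum_add_distrib, ← Finset.sum_sub_distrib]
    exact Finset.sum_congr rfl fun a _ => Finset.sum_congr rfl fun b _ => by ring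
  have h3 : ∑ a, c a ^ 2 * (m a - ∑ b, p a b)
      = ∑ a, c a ^ 2 * m a - ∑ a, ∑ b, p a b * c a ^ 2 := by
    simp only [mul_sub, Finset.sum_sub_distrib, Finset.mul_sum]
    congr 1
    exact Finset.sum_congr rfl fun a _ => Finset.sum_congr rfl fun b _ => by ring
  rw [h2, h1, h3]; ring

theorem T_indicator_nonneg_le (S : SymmMarkovSemigroup μ) {t : ℝ} (ht : 0 ≤ t) {A : Set X}
    (hA : MeasurableSet A) (hμ : μ A ≠ ∞) :
    ∀ᵐ x ∂μ, 0 ≤ S.T t (indicatorConstLp 2 hA hμ (1 : ℝ)) x ∧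
      S.T t (indicatorConstLp 2 hA hμ (1 : ℝ)) x ≤ 1 := by
  refine S.T_markov t ht _ ?_
  filter_upwards [indicatorConstLp_coeFn (p := 2) (hs := hA) (hμs := hμ) (c := (1 : ℝ))]
    with x hx
  rw [hx]
  by_cases h : x ∈ A <;> simp [h]

theorem form_simpleFunc_le (S : SymmMarkovSemigroup μ) {t : ℝ} (ht : 0 ≤ t) {ι : Type*}
    [Fintype ι] (s : SimpleFunc X (Option ι → ℝ)) (hs : MemLp s 2 μ)
    (hsi : ∀ k, MemLp (fun x => s x k) 2 μ)
    (H : ∀ x y, (s x none - s y none) ^ 2 ≤ ∑ i, (s x (some i) - s y (some i)) ^ 2)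
    (H0 : ∀ x, (s x none) ^ 2 ≤ ∑ i, (s x (some i)) ^ 2) :
    S.form t (hsi none).toLp ≤ ∑ i, S.form t (hsi (some i)).toLp := by
  classical
  have hA : ∀ a : {a // a ∈ s.range.filter (· ≠ 0)}, μ (s ⁻¹' {a.1}) ≠ ∞ := fun a =>
    (s.measure_preimage_lt_top_of_memLp (by simp) (by simp) hs a.1
      (Finset.mem_filter.1 a.2).2).ne
  let e : {a // a ∈ s.range.filter (· ≠ 0)} → Lp ℝ 2 μ := fun a =>
    indicatorConstLp 2 (s.measurableSet_preimage {a.1}) (hA a) (1 : ℝ)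
  let m : {a // a ∈ s.range.filter (· ≠ 0)} → ℝ := fun a => μ.real (s ⁻¹' {a.1})
  let p : {a // a ∈ s.range.filter (· ≠ 0)} → {a // a ∈ s.range.filter (· ≠ 0)} → ℝ :=
    fun a b => inner ℝ (S.T t (e a)) (e b)
  have hpsymm : ∀ a b, p a b = p b a := fun a b => by
    simp only [p]; rw [S.T_symm t ht, real_inner_comm]
  have hp0 : ∀ a b, 0 ≤ p a b := fun a b => by
    simp only [p]
    rw [real_inner_comm, L2.inner_indicatorConstLp_one]
    exact integral_nonneg_of_ae (ae_restrict_of_ae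
      ((S.T_indicator_nonneg_le ht _ (hA a)).mono fun x hx => hx.1))
  have he : ∀ a b, inner ℝ (e a) (e b) = if a = b then m a else 0 := fun a b => by
    simp only [e]
    rw [L2.inner_indicatorConstLp_indicatorConstLp _ _ (hA a) (hA b)]
    split_ifs with h
    · subst h; simp [m]
    · have : (s ⁻¹' {a.1}) ∩ (s ⁻¹' {b.1}) = ∅ := by
        rw [← Set.preimage_inter]
        have : ({a.1} : Set (Option ι → ℝ)) ∩ {b.1} = ∅ := by
          simpa using fun h' => h h'.symm
        rw [this, Set.preimage_empty]
      simp [this]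
  have hsum : ∑ a, e a = indicatorConstLp 2 (s.measurableSet_preimage {0}ᶜ)
      (by
        have : s ⁻¹' {0}ᶜ = ⋃ a : {a // a ∈ s.range.filter (· ≠ 0)}, s ⁻¹' {a.1} := by
          ext x
          simp only [mem_preimage, mem_compl_iff, mem_singleton_iff, mem_iUnion]
          constructor
          · intro h
            exact ⟨⟨s x, Finset.mem_filter.2 ⟨s.mem_range_self x, h⟩⟩, rfl⟩
          · rintro ⟨a, ha⟩
            rw [ha]; exact (Finset.mem_filter.1 a.2).2
        rw [this]
        exact ((measure_iUnion_fintype_le μ _).trans_lt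
          (ENNReal.sum_lt_top.2 fun a _ => (hA a).lt_top)).ne) (1 : ℝ) := by
    ext1
    refine (Lp.coeFn_finsetSum _ _).trans ?_
    refine EventuallyEq.trans ?_ (indicatorConstLp_coeFn).symm
    have h1 : ∀ᵐ x ∂μ, ∀ a, e a x = (s ⁻¹' {a.1}).indicator (fun _ => (1 : ℝ)) x := by
      rw [ae_all_iff]
      exact fun a => indicatorConstLp_coeFn
    filter_upwards [h1] with x hx
    rw [Finset.sum_apply, Finset.sum_congr rfl fun a _ => hx a]
    by_cases h0 : s x = 0
    · rw [Finset.sum_eq_zero]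
      · simp [h0]
      · intro a _
        have : s x ≠ a.1 := by
          rw [h0]; exact fun h => (Finset.mem_filter.1 a.2).2 h.symm
        simp [this]
    · rw [Finset.sum_eq_single ⟨s x, Finset.mem_filter.2 ⟨s.mem_range_self x, h0⟩⟩]
      · simp [h0]
      · intro b _ hb
        have : s x ≠ b.1 := fun h => hb (Subtype.ext h.symm)
        simp [this]
      · simp
  have hpm : ∀ a, ∑ b, p a b ≤ m a := fun a => by
    simp only [p]
    rw [← inner_sum, hsum, S.T_symm t ht, L2.inner_indicatorConstLp_one]
    calc _ ≤ ∫ _ in s ⁻¹' {a.1}, (1 : ℝ) ∂μ := by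
          apply integral_mono_of_nonneg
          · exact ae_restrict_of_ae ((S.T_indicator_nonneg_le ht _ _).mono fun x hx => hx.1)
          · exact integrableOn_const (hA a)
          · exact ae_restrict_of_ae ((S.T_indicator_nonneg_le ht _ _).mono fun x hx => hx.2)
      _ = m a := by simp [m]
  have hform : ∀ k, S.form t (hsi k).toLp
      = (∑ a, ∑ b, p a b * (a.1 k - b.1 k) ^ 2) / 2
        + ∑ a, (a.1 k) ^ 2 * (m a - ∑ b, p a b) := fun k => by
    rw [← sum_form_eq m p hpsymm (fun a => a.1 k), toLp_simpleFunc_eval_eq_sum s hsi hA k, form,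
      inner_sub_left]
    change inner ℝ (∑ a, a.1 k • e a) (∑ a, a.1 k • e a)
      - inner ℝ (S.T t (∑ a, a.1 k • e a)) (∑ a, a.1 k • e a) = _
    congr 1
    · simp only [sum_inner, inner_sum, inner_smul_left, inner_smul_right, he, conj_trivial]
      refine Finset.sum_congr rfl fun a _ => ?_
      rw [Finset.sum_eq_single a]
      · simp; ring
      · intro b _ hb; simp [hb]
      · simp
    · simp only [map_sum, map_smul, sum_inner, inner_sum, inner_smul_left, inner_smul_right,
        conj_trivial, p]
      refine Finset.sum_congr rfl fun a _ => ?_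
      rw [Finset.mul_sum]
      refine Finset.sum_congr rfl fun b _ => ?_
      rw [show inner ℝ (S.T t (e a)) (e b) = inner ℝ (S.T t (e b)) (e a) from hpsymm a b]
      ring
  have hval : ∀ a : {a // a ∈ s.range.filter (· ≠ 0)}, ∃ x, s x = a.1 := fun a =>
    SimpleFunc.mem_range.1 (Finset.mem_filter.1 a.2).1
  choose x hx using hval
  simp only [hform, Finset.sum_add_distrib, ← Finset.sum_div]
  refine add_le_add (div_le_div_of_nonneg_right ?_ zero_le_two) ?_
  · rw [Finset.sum_comm (s := (Finset.univ : Finset ι))]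
    refine Finset.sum_le_sum fun a _ => ?_
    rw [Finset.sum_comm]
    refine Finset.sum_le_sum fun b _ => ?_
    rw [← Finset.mul_sum]
    refine mul_le_mul_of_nonneg_left ?_ (hp0 _ _)
    simpa only [hx] using H (x a) (x b)
  · rw [Finset.sum_comm]
    refine Finset.sum_le_sum fun a _ => ?_
    rw [← Finset.sum_mul]
    refine mul_le_mul_of_nonneg_right ?_ (sub_nonneg.2 (hpm a))
    simpa only [hx] using H0 (x a)

/-- The contraction property: if `h` is dominated by `w₁, …, wₙ`, in the sense that
`|h|² ≤ ∑ |wᵢ|²` and `|h(x) - h(y)|² ≤ ∑ |wᵢ(x) - wᵢ(y)|²`, then `E_t(h) ≤ ∑ E_t(wᵢ)`. -/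
theorem form_le_sum (S : SymmMarkovSemigroup μ) {t : ℝ} (ht : 0 ≤ t) {ι : Type*} [Fintype ι]
    (h : Lp ℝ 2 μ) (w : ι → Lp ℝ 2 μ) (p : X → Prop) (hp : ∀ᵐ x ∂μ, p x)
    (H : ∀ x y, p x → p y → (h x - h y) ^ 2 ≤ ∑ i, (w i x - w i y) ^ 2)
    (H0 : ∀ x, p x → (h x) ^ 2 ≤ ∑ i, (w i x) ^ 2) :
    S.form t h ≤ ∑ i, S.form t (w i) := by
  classical
  obtain ⟨A, hAp, hA, hAc⟩ : ∃ A ⊆ {x | p x}, MeasurableSet A ∧ μ Aᶜ = 0 := by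
    refine ⟨(toMeasurable μ {x | p x}ᶜ)ᶜ, ?_, (measurableSet_toMeasurable _ _).compl, ?_⟩
    · rw [compl_subset_comm]; exact subset_toMeasurable _ _
    · rw [compl_compl, measure_toMeasurable]; exact hp
  let g : Option ι → Lp ℝ 2 μ := fun k => k.elim h w
  let W : X → Option ι → ℝ := A.indicator fun x k => g k x
  have hWm : Measurable W :=
    (measurable_pi_iff.2 fun k => (Lp.stronglyMeasurable (g k)).measurable).indicator hA
  have hWg : ∀ k, (fun x => W x k) =ᵐ[μ] g k := fun k => by
    have : ∀ᵐ x ∂μ, x ∈ A := hAc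
    filter_upwards [this] with x hx
    simp [W, hx]
  have hWk : ∀ k, MemLp (fun x => W x k) 2 μ := fun k =>
    (memLp_congr_ae (hWg k)).2 (Lp.memLp (g k))
  have hWL : MemLp W 2 μ := MemLp.of_eval hWk
  let s : ℕ → SimpleFunc X (Option ι → ℝ) :=
    SimpleFunc.approxOn W hWm (range W ∪ {0}) 0 (by simp)
  have hsL : ∀ n, MemLp (s n) 2 μ := fun n => SimpleFunc.memLp_approxOn_range hWm hWL n
  have hsk : ∀ n k, MemLp (fun x => s n x k) 2 μ := fun n k => memLp_pi_iff.1 (hsL n) k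
  have hlim : Tendsto (fun n => eLpNorm (⇑(s n) - W) 2 μ) atTop (𝓝 0) :=
    SimpleFunc.tendsto_approxOn_range_Lp_eLpNorm (by simp) hWm hWL.2
  have hlimk : ∀ k, Tendsto (fun n => (hsk n k).toLp) atTop (𝓝 (g k)) := fun k => by
    have h1 : g k = (hWk k).toLp := by
      ext1; exact (hWg k).symm.trans (hWk k).coeFn_toLp.symm
    rw [h1, Lp.tendsto_Lp_iff_tendsto_eLpNorm'']
    refine tendsto_of_tendsto_of_tendsto_of_le_of_le tendsto_const_nhds hlim
      (fun _ => zero_le) fun n => ?_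
    refine eLpNorm_mono fun x => ?_
    exact norm_le_pi_norm ((⇑(s n) - W) x) k
  have hmem : ∀ n x, s n x = 0 ∨ ∃ y, p y ∧ s n x = fun k => g k y := fun n x => by
    have h1 : s n x ∈ range W ∪ {0} := SimpleFunc.approxOn_mem hWm _ n x
    rcases h1 with ⟨y, hy⟩ | h0
    · by_cases hyA : y ∈ A
      · refine Or.inr ⟨y, hAp hyA, ?_⟩
        rw [← hy]; simp [W, hyA]
      · left; rw [← hy]; simp [W, hyA]
    · exact Or.inl h0
  have hle : ∀ n, S.form t (hsk n none).toLp ≤ ∑ i, S.form t (hsk n (some i)).toLp := fun n => by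
    refine S.form_simpleFunc_le ht (s n) (hsL n) (hsk n) (fun x y => ?_) fun x => ?_
    · rcases hmem n x with hx | ⟨x', hx', hx⟩ <;> rcases hmem n y with hy | ⟨y', hy', hy⟩
      · simp [hx, hy]
      · simpa [hx, hy, g] using H0 y' hy'
      · simpa [hx, hy, g] using H0 x' hx'
      · simpa [hx, hy, g] using H x' y' hx' hy'
    · rcases hmem n x with hx | ⟨x', hx', hx⟩
      · simp [hx]
      · simpa [hx, g] using H0 x' hx'
  have hc : Continuous fun u => S.form t u :=
    (continuous_id.sub (S.T t).continuous).inner continuous_id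
  exact le_of_tendsto_of_tendsto' ((hc.tendsto _).comp (hlimk none))
    (tendsto_finsetSum _ fun i _ => (hc.tendsto _).comp (hlimk (some i))) hle

end SymmMarkovSemigroup

/-! ### Real integrals -/

theorem integral_rpow_mul_sub_rpow {a b x : ℝ} (ha : 0 < a) (hb : 0 < b) (hx : 0 < x) :
    ∫ r in Ioo 0 x, r ^ (a - 1) * (x - r) ^ (b - 1)
      = x ^ (a + b - 1) * (Real.Gamma a * Real.Gamma b / Real.Gamma (a + b)) := by
  have h1 := Complex.betaIntegral_scaled a b hx
  have h2 := Complex.Gamma_mul_Gamma_eq_betaIntegral (s := a) (t := b) (by simpa) (by simpa)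
  have h3 : (Complex.Gamma (a + b)) ≠ 0 := by
    rw [← Complex.ofReal_add, Complex.Gamma_ofReal]
    exact_mod_cast (Real.Gamma_pos_of_pos (by positivity)).ne'
  have h4 : ∫ r in (0 : ℝ)..x, ((r : ℂ)) ^ ((a : ℂ) - 1) * ((x : ℂ) - r) ^ ((b : ℂ) - 1)
      = ((∫ r in (0 : ℝ)..x, r ^ (a - 1) * (x - r) ^ (b - 1) : ℝ) : ℂ) := by
    rw [← intervalIntegral.integral_ofReal]
    refine intervalIntegral.integral_congr fun r hr => ?_
    rw [uIcc_of_le hx.le] at hr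
    simp only [Complex.ofReal_mul]
    rw [Complex.ofReal_cpow hr.1, Complex.ofReal_cpow (sub_nonneg.2 hr.2)]
    push_cast
    rfl
  rw [h4] at h1
  have h5 : Complex.betaIntegral a b
      = ((Real.Gamma a * Real.Gamma b / Real.Gamma (a + b) : ℝ) : ℂ) := by
    push_cast
    rw [eq_div_iff (by rw [← Complex.Gamma_ofReal]; push_cast; exact h3),
      ← Complex.Gamma_ofReal, ← Complex.Gamma_ofReal, ← Complex.Gamma_ofReal, h2]
    push_cast
    ring
  rw [h5, show ((a : ℂ) + b - 1) = ((a + b - 1 : ℝ) : ℂ) by push_cast; ring,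
    ← Complex.ofReal_cpow hx.le] at h1
  rw [← integral_Ioc_eq_integral_Ioo, ← intervalIntegral.integral_of_le hx.le]
  exact_mod_cast h1

theorem integral_rpow_neg_mul_sub_rpow {a e x : ℝ} (ha : 0 < a) (he : 0 < e) (hx : e < x) :
    IntegrableOn (fun r => r ^ (-a - 1) * (x - r) ^ (a - 1)) (Ioc e x) ∧
    ∫ r in Ioc e x, r ^ (-a - 1) * (x - r) ^ (a - 1) = ((x - e) / e) ^ a / (a * x) := by
  have hx0 : 0 < x := he.trans hx
  let g : ℝ → ℝ := fun r => - (((x - r) / r) ^ a / (a * x))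
  have hg : ContinuousOn g (Icc e x) := by
    intro r hr
    have : 0 < r := he.trans_le hr.1
    refine ContinuousAt.continuousWithinAt ?_
    refine (ContinuousAt.div_const (ContinuousAt.rpow_const ?_ (Or.inr ha.le)) _).neg
    exact (continuousAt_const.sub continuousAt_id).div continuousAt_id this.ne'
  have hd : ∀ r ∈ Ioo e x, HasDerivAt g (r ^ (-a - 1) * (x - r) ^ (a - 1)) r := by
    intro r hr
    have hr0 : 0 < r := he.trans hr.1
    have hxr : 0 < x - r := sub_pos.2 hr.2
    have h1 : HasDerivAt (fun r => (x - r) / r) (((-1) * r - (x - r) * 1) / r ^ 2) r :=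
      ((hasDerivAt_id r).const_sub x).div (hasDerivAt_id r) hr0.ne'
    have h2 := ((h1.rpow_const (p := a) (Or.inl (div_pos hxr hr0).ne')).div_const (a * x)).neg
    refine h2.congr_deriv ?_
    have h3 : r ^ (-a - 1) = (r ^ (a - 1))⁻¹ / r ^ 2 := by
      rw [← Real.rpow_neg hr0.le, ← Real.rpow_two, ← Real.rpow_sub hr0]; congr 1; ring
    rw [h3, Real.div_rpow hxr.le hr0.le]
    have := (Real.rpow_pos_of_pos hr0 (a - 1)).ne'
    field_simp
    ring
  have h0 : ∀ r ∈ Ioo e x, 0 ≤ r ^ (-a - 1) * (x - r) ^ (a - 1) := fun r hr =>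
    mul_nonneg (Real.rpow_nonneg (he.trans hr.1).le _) (Real.rpow_nonneg (sub_nonneg.2 hr.2.le) _)
  have hI := intervalIntegral.integrableOn_deriv_of_nonneg hg hd h0
  refine ⟨hI, ?_⟩
  rw [← intervalIntegral.integral_of_le hx.le,
    intervalIntegral.integral_eq_sub_of_hasDerivAt_of_le hx.le hg hd
      ((intervalIntegrable_iff_integrableOn_Ioc_of_le hx.le).2 hI)]
  simp [g, Real.zero_rpow ha.ne']

/-- The kernel `K_ε(x) = ε^{-a} (x^a - (x - ε)_+^a) / (a x)`. It arises from truncating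
a Marchaud type fractional derivative of order `a` of a fractional integral of order `a`. -/
def truncKernel (a e x : ℝ) : ℝ := e ^ (-a) * (x ^ a - (max (x - e) 0) ^ a) / (a * x)

theorem truncKernel_mul {a e y : ℝ} (he : 0 < e) (hy : 0 < y) :
    truncKernel a e (e * y) = e⁻¹ * truncKernel a 1 y := by
  have h1 : max (e * y - e) 0 = e * max (y - 1) 0 := by
    rw [mul_max_of_nonneg _ _ he.le]; simp [mul_sub]
  rw [truncKernel, truncKernel, h1, Real.mul_rpow he.le hy.le,
    Real.mul_rpow he.le (le_max_right _ _), Real.rpow_neg he.le, Real.one_rpow]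
  have : e ^ a ≠ 0 := (Real.rpow_pos_of_pos he a).ne'
  field_simp

theorem truncKernel_nonneg {a e x : ℝ} (ha : 0 < a) (he : 0 < e) (hx : 0 < x) :
    0 ≤ truncKernel a e x := by
  unfold truncKernel
  have : (max (x - e) 0) ^ a ≤ x ^ a :=
    Real.rpow_le_rpow (le_max_right _ _) (max_le (by linarith) hx.le) ha.le
  have h2 : 0 ≤ x ^ a - (max (x - e) 0) ^ a := sub_nonneg.2 this
  positivity

theorem measurable_truncKernel (a e : ℝ) : Measurable (truncKernel a e) := by
  unfold truncKernel
  fun_prop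

theorem truncKernel_one_le {a y : ℝ} (ha : 0 < a) (ha1 : a < 1) (hy : 0 < y) :
    truncKernel a 1 y ≤ if y ≤ 1 then y ^ (a - 1) / a else y ^ (a - 2) / a := by
  unfold truncKernel
  split_ifs with h
  · rw [max_eq_right (by linarith), Real.zero_rpow ha.ne', Real.one_rpow, Real.rpow_sub hy,
      Real.rpow_one]
    apply le_of_eq; field_simp; ring
  · push Not at h
    rw [max_eq_left (by linarith), Real.one_rpow, one_mul]
    have h1 : y ^ a - y ^ (a - 1) ≤ (y - 1) ^ a := by
      have h2 : (y - 1) = y * (1 - y⁻¹) := by field_simp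
      have h3 : 0 < 1 - y⁻¹ := sub_pos.2 (inv_lt_one_of_one_lt₀ h)
      rw [h2, Real.mul_rpow hy.le h3.le, Real.rpow_sub hy, Real.rpow_one]
      have h4 : (1 - y⁻¹) ≤ (1 - y⁻¹) ^ a := by
        conv_lhs => rw [← Real.rpow_one (1 - y⁻¹)]
        exact Real.rpow_le_rpow_of_exponent_ge h3 (by linarith [inv_pos.2 hy]) ha1.le
      have h5 := Real.rpow_pos_of_pos hy a
      have : y ^ a - y ^ a / y = y ^ a * (1 - y⁻¹) := by ring
      rw [this]
      gcongr
    have h6 : y ^ (a - 2) = y ^ (a - 1) / y := by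
      rw [show a - 2 = a - 1 - 1 by ring, Real.rpow_sub hy (a - 1), Real.rpow_one]
    rw [h6, div_div, mul_comm a y]
    gcongr
    linarith

theorem integrableOn_truncKernel_one {a : ℝ} (ha : 0 < a) (ha1 : a < 1) :
    IntegrableOn (truncKernel a 1) (Ioi 0) := by
  have hb : IntegrableOn (fun y : ℝ => if y ≤ 1 then y ^ (a - 1) / a else y ^ (a - 2) / a)
      (Ioi 0) := by
    rw [← Ioc_union_Ioi_eq_Ioi zero_le_one]
    refine IntegrableOn.union ?_ ?_
    · have h1 : IntegrableOn (fun y : ℝ => y ^ (a - 1) / a) (Ioc 0 1) := by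
        have := (intervalIntegral.intervalIntegrable_rpow' (a := 0) (b := 1)
          (r := a - 1) (by linarith)).div_const a
        exact (intervalIntegrable_iff_integrableOn_Ioc_of_le zero_le_one).1 this
      refine h1.congr_fun (fun y hy => ?_) measurableSet_Ioc
      simp [hy.2]
    · have h1 : IntegrableOn (fun y : ℝ => y ^ (a - 2) / a) (Ioi 1) :=
        (integrableOn_Ioi_rpow_of_lt (by linarith) zero_lt_one).div_const a
      refine h1.congr_fun (fun y hy => ?_) measurableSet_Ioi
      simp [not_le.2 (mem_Ioi.1 hy)]
  refine Integrable.mono' hb (measurable_truncKernel a 1).aestronglyMeasurable ?_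
  refine ae_restrict_of_forall_mem measurableSet_Ioi fun y hy => ?_
  rw [Real.norm_of_nonneg (truncKernel_nonneg ha zero_lt_one hy)]
  exact truncKernel_one_le ha ha1 hy

/-- The total mass of `truncKernel a ε`, which does not depend on `ε`. -/
def truncMass (a : ℝ) : ℝ := ∫ y in Ioi (0 : ℝ), truncKernel a 1 y

theorem integral_truncKernel_smul {E : Type*} [NormedAddCommGroup E] [NormedSpace ℝ E] {a e : ℝ}
    (he : 0 < e) (φ : ℝ → E) :
    ∫ x in Ioi (0 : ℝ), truncKernel a e x • φ x
      = ∫ y in Ioi (0 : ℝ), truncKernel a 1 y • φ (e * y) := by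
  have h := integral_comp_mul_left_Ioi (fun x => truncKernel a e x • φ x) 0 he
  rw [mul_zero] at h
  rw [← inv_smul_eq_iff₀ (inv_ne_zero he.ne')] at h
  rw [← h, inv_inv, ← integral_smul]
  refine setIntegral_congr_fun measurableSet_Ioi fun y hy => ?_
  rw [truncKernel_mul he hy, smul_smul, ← mul_assoc, mul_inv_cancel₀ he.ne', one_mul]

theorem integrableOn_truncKernel {a e : ℝ} (ha : 0 < a) (ha1 : a < 1) (he : 0 < e) :
    IntegrableOn (truncKernel a e) (Ioi 0) := by
  have h := (integrableOn_Ioi_comp_mul_left_iff (truncKernel a e) 0 he).1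
  rw [mul_zero] at h
  have h2 : IntegrableOn (fun y => e⁻¹ * truncKernel a 1 y) (Ioi 0) :=
    (integrableOn_truncKernel_one ha ha1).const_mul e⁻¹
  refine h (h2.congr_fun (fun y hy => ?_) measurableSet_Ioi)
  exact (truncKernel_mul he hy).symm

theorem integral_truncKernel {a e : ℝ} (he : 0 < e) :
    ∫ x in Ioi (0 : ℝ), truncKernel a e x = truncMass a := by
  simpa [truncMass] using integral_truncKernel_smul (a := a) he (fun _ => (1 : ℝ))

theorem truncMass_pos {a : ℝ} (ha : 0 < a) (ha1 : a < 1) : 0 < truncMass a := by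
  have h1 : ∫ y in Ioc (0 : ℝ) 1, truncKernel a 1 y ≤ truncMass a :=
    setIntegral_mono_set (integrableOn_truncKernel_one ha ha1)
      (ae_restrict_of_forall_mem measurableSet_Ioi
        fun y hy => truncKernel_nonneg ha zero_lt_one hy)
      (LE.le.eventuallyLE Ioc_subset_Ioi_self)
  have h2 : ∫ y in Ioc (0 : ℝ) 1, truncKernel a 1 y = ∫ y in Ioc (0 : ℝ) 1, y ^ (a - 1) / a := by
    refine setIntegral_congr_fun measurableSet_Ioc fun y hy => ?_
    simp only [truncKernel]
    rw [max_eq_right (by linarith [hy.2]), Real.zero_rpow ha.ne', Real.one_rpow,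
      Real.rpow_sub hy.1, Real.rpow_one]
    have := hy.1.ne'
    field_simp; ring
  have h3 : ∫ y in Ioc (0 : ℝ) 1, y ^ (a - 1) / a = a⁻¹ * a⁻¹ := by
    rw [← intervalIntegral.integral_of_le zero_le_one, intervalIntegral.integral_div,
      integral_rpow (Or.inl (by linarith))]
    simp [ha.ne']
    field_simp
  have : 0 < a⁻¹ * a⁻¹ := by positivity
  linarith

/-- `truncKernel a ε` is an approximate identity at `0` up to its mass. -/
theorem tendsto_integral_truncKernel {E : Type*} [NormedAddCommGroup E] [NormedSpace ℝ E]
    [CompleteSpace E] {a : ℝ} (ha : 0 < a) (ha1 : a < 1) {φ : ℝ → E} {φ₀ : E} {C : ℝ}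
    (hφm : AEStronglyMeasurable φ (volume.restrict (Ioi 0)))
    (hφC : ∀ s, 0 < s → ‖φ s‖ ≤ C) (hφ : Tendsto φ (𝓝[>] 0) (𝓝 φ₀)) :
    Tendsto (fun e => ∫ x in Ioi (0 : ℝ), truncKernel a e x • φ x) (𝓝[>] 0)
      (𝓝 (truncMass a • φ₀)) := by
  have h1 : Tendsto (fun e => ∫ y in Ioi (0 : ℝ), truncKernel a 1 y • φ (e * y)) (𝓝[>] 0)
      (𝓝 (∫ y in Ioi (0 : ℝ), truncKernel a 1 y • φ₀)) := by
    refine tendsto_integral_filter_of_dominated_convergence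
      (fun y => truncKernel a 1 y * C) ?_ ?_ ((integrableOn_truncKernel_one ha ha1).mul_const C) ?_
    · filter_upwards [self_mem_nhdsWithin] with e he
      have he : (0 : ℝ) < e := he
      refine (measurable_truncKernel a 1).aestronglyMeasurable.smul ?_
      have hq : Measure.QuasiMeasurePreserving (fun y : ℝ => e * y)
          (volume.restrict (Ioi 0)) (volume.restrict (Ioi 0)) := by
        refine ⟨measurable_const_mul e, ?_⟩
        refine Measure.AbsolutelyContinuous.mk fun s hs h0 => ?_
        rw [Measure.map_apply (measurable_const_mul e) hs,
          Measure.restrict_apply (measurable_const_mul e hs)]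
        rw [Measure.restrict_apply hs] at h0
        have : (fun y : ℝ => e * y) ⁻¹' s ∩ Ioi 0 = (fun y : ℝ => e * y) ⁻¹' (s ∩ Ioi 0) := by
          ext y; simp [he]
        rw [this, Real.volume_preimage_mul_left he.ne', h0, mul_zero]
      exact hφm.comp_quasiMeasurePreserving hq
    · filter_upwards [self_mem_nhdsWithin] with e he
      have he : (0 : ℝ) < e := he
      refine ae_restrict_of_forall_mem measurableSet_Ioi fun y hy => ?_
      have hy : (0 : ℝ) < y := hy
      rw [norm_smul, Real.norm_of_nonneg (truncKernel_nonneg ha zero_lt_one hy)]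
      exact mul_le_mul_of_nonneg_left (hφC _ (mul_pos he hy))
        (truncKernel_nonneg ha zero_lt_one hy)
    · refine ae_restrict_of_forall_mem measurableSet_Ioi fun y hy => ?_
      have hy : (0 : ℝ) < y := hy
      refine tendsto_const_nhds.smul (hφ.comp ?_)
      refine tendsto_nhdsWithin_iff.2 ⟨?_, ?_⟩
      · have : Tendsto (fun e : ℝ => e * y) (𝓝 0) (𝓝 (0 * y)) :=
          (continuous_mul_const y).tendsto 0
        rw [zero_mul] at this
        exact this.mono_left nhdsWithin_le_nhds
      · filter_upwards [self_mem_nhdsWithin] with e he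
        exact mul_pos he hy
  rw [integral_smul_const] at h1
  refine h1.congr' ?_
  filter_upwards [self_mem_nhdsWithin] with e he
  exact (integral_truncKernel_smul he φ).symm

namespace SymmMarkovSemigroup

variable {X : Type*} [MeasurableSpace X] {μ : Measure X}

/-! ### Bessel potentials -/

theorem aestronglyMeasurable_indicator_T (S : SymmMarkovSemigroup μ) (u : Lp ℝ 2 μ) :
    AEStronglyMeasurable ((Ici (0 : ℝ)).indicator fun s => S.T s u) volume :=
  (aestronglyMeasurable_indicator_iff measurableSet_Ici).2
    ((S.continuousOn_T u).aestronglyMeasurable measurableSet_Ici)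

theorem smul_T_eq_smul_indicator (S : SymmMarkovSemigroup μ) {k : ℝ → ℝ} (h0 : ∀ s ≤ 0, k s = 0)
    (u : Lp ℝ 2 μ) (s : ℝ) :
    k s • S.T s u = k s • (Ici (0 : ℝ)).indicator (fun s => S.T s u) s := by
  by_cases hs : 0 ≤ s
  · simp [hs]
  · simp [h0 s (not_le.1 hs).le]

theorem norm_indicator_T_le (S : SymmMarkovSemigroup μ) (u : Lp ℝ 2 μ) (s : ℝ) :
    ‖(Ici (0 : ℝ)).indicator (fun s => S.T s u) s‖ ≤ ‖u‖ := by
  by_cases hs : 0 ≤ s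
  · simpa [hs] using S.norm_T_le hs u
  · simp [hs]

theorem integrable_smul_T (S : SymmMarkovSemigroup μ) {k : ℝ → ℝ} (hk : Integrable k)
    (h0 : ∀ s ≤ 0, k s = 0) (u : Lp ℝ 2 μ) : Integrable fun s => k s • S.T s u := by
  simp_rw [S.smul_T_eq_smul_indicator h0]
  refine Integrable.mono' (hk.norm.mul_const ‖u‖)
    (hk.aestronglyMeasurable.smul (S.aestronglyMeasurable_indicator_T u)) ?_
  refine Eventually.of_forall fun s => ?_
  rw [norm_smul]
  exact mul_le_mul_of_nonneg_left (S.norm_indicator_T_le u s) (norm_nonneg _)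

theorem norm_integral_smul_T_le (S : SymmMarkovSemigroup μ) {k : ℝ → ℝ} (hk : Integrable k)
    (h0 : ∀ s ≤ 0, k s = 0) (u : Lp ℝ 2 μ) :
    ‖∫ s, k s • S.T s u‖ ≤ (∫ s, |k s|) * ‖u‖ := by
  simp_rw [S.smul_T_eq_smul_indicator h0]
  rw [← integral_mul_const]
  refine norm_integral_le_of_norm_le (hk.norm.mul_const ‖u‖) (Eventually.of_forall fun s => ?_)
  rw [norm_smul]
  exact mul_le_mul_of_nonneg_left (S.norm_indicator_T_le u s) (norm_nonneg _)

theorem T_integral_smul_T (S : SymmMarkovSemigroup μ) {k : ℝ → ℝ} (hk : Integrable k)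
    (h0 : ∀ s ≤ 0, k s = 0) (u : Lp ℝ 2 μ) {r : ℝ} (hr : 0 ≤ r) :
    S.T r (∫ s, k s • S.T s u) = ∫ s, k (s - r) • S.T s u := by
  rw [← (S.T r).integral_comp_comm (S.integrable_smul_T hk h0 u),
    ← integral_add_right_eq_self (fun s => k (s - r) • S.T s u) r]
  refine integral_congr_ae (Eventually.of_forall fun s => ?_)
  simp only [map_smul, add_sub_cancel_right]
  by_cases hs : 0 ≤ s
  · rw [add_comm s r, S.T_add r s hr hs]
  · simp [h0 s (not_le.1 hs).le]

theorem T_integral_smul_T' (S : SymmMarkovSemigroup μ) {k : ℝ → ℝ} (hk : Integrable k)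
    (h0 : ∀ s ≤ 0, k s = 0) (u : Lp ℝ 2 μ) {r : ℝ} (hr : 0 ≤ r) :
    S.T r (∫ s, k s • S.T s u) = ∫ s, k s • S.T s (S.T r u) := by
  rw [← (S.T r).integral_comp_comm (S.integrable_smul_T hk h0 u)]
  refine integral_congr_ae (Eventually.of_forall fun s => ?_)
  simp only [map_smul]
  by_cases hs : 0 ≤ s
  · rw [← S.T_add r s hr hs, add_comm, S.T_add s r hs hr]
  · simp [h0 s (not_le.1 hs).le]

/-- Functions of the semigroup, `k ↦ ∫ k(s) T(s) ds`, multiply by convolution of the densities. -/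
theorem integral_T_integral_T (S : SymmMarkovSemigroup μ) {F k : ℝ → ℝ} (hF : Integrable F)
    (hF0 : ∀ s ≤ 0, F s = 0) (hk : Integrable k) (hk0 : ∀ s ≤ 0, k s = 0) (u : Lp ℝ 2 μ) :
    ∫ r, F r • S.T r (∫ s, k s • S.T s u) = ∫ x, (∫ r, F r * k (x - r)) • S.T x u := by
  have hc : Integrable (fun p : ℝ × ℝ => F p.2 * k (p.1 - p.2)) (volume.prod volume) :=
    hF.convolution_integrand (ContinuousLinearMap.mul ℝ ℝ) hk
  have hz : ∀ x r, x ≤ 0 → F r * k (x - r) = 0 := fun x r hx => by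
    rcases le_or_gt r 0 with h | h
    · simp [hF0 r h]
    · simp [hk0 (x - r) (by linarith)]
  have hcT : Integrable (fun p : ℝ × ℝ => (F p.2 * k (p.1 - p.2)) • S.T p.1 u)
      (volume.prod volume) := by
    have h1 : (fun p : ℝ × ℝ => (F p.2 * k (p.1 - p.2)) • S.T p.1 u) = fun p : ℝ × ℝ =>
        (F p.2 * k (p.1 - p.2)) • (Ici (0 : ℝ)).indicator (fun s => S.T s u) p.1 := by
      funext p
      by_cases hs : 0 ≤ p.1
      · simp [hs]
      · rw [hz _ _ (not_le.1 hs).le]; simp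
    rw [h1]
    refine Integrable.mono' (hc.norm.mul_const ‖u‖)
      (hc.aestronglyMeasurable.smul (S.aestronglyMeasurable_indicator_T u).comp_fst) ?_
    refine Eventually.of_forall fun p => ?_
    rw [norm_smul]
    exact mul_le_mul_of_nonneg_left (S.norm_indicator_T_le u _) (norm_nonneg _)
  have hsw := integral_integral_swap
    (f := fun x r => (F r * k (x - r)) • S.T x u) hcT
  simp_rw [integral_smul_const] at hsw
  rw [hsw]
  refine integral_congr_ae (Eventually.of_forall fun r => ?_)
  rcases le_or_gt r 0 with h | h
  · simp [hF0 r h]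
  · simp only
    rw [S.T_integral_smul_T hk hk0 u h.le, ← integral_smul]
    simp only [smul_smul]

/-- The density `e^{-s} s^{a-1} 1_{s > 0}`. -/
def besselDensity (a s : ℝ) : ℝ := (Ioi (0 : ℝ)).indicator (fun s => Real.exp (-s) * s ^ (a - 1)) s

theorem besselDensity_of_nonpos (a : ℝ) {s : ℝ} (hs : s ≤ 0) : besselDensity a s = 0 := by
  simp [besselDensity, hs]

theorem besselDensity_of_pos (a : ℝ) {s : ℝ} (hs : 0 < s) :
    besselDensity a s = Real.exp (-s) * s ^ (a - 1) := by
  simp [besselDensity, hs]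

theorem besselDensity_nonneg (a s : ℝ) : 0 ≤ besselDensity a s :=
  indicator_nonneg (fun s (hs : (0 : ℝ) < s) => by positivity) s

theorem integrable_besselDensity {a : ℝ} (ha : 0 < a) : Integrable (besselDensity a) :=
  (integrable_indicator_iff measurableSet_Ioi).2 (Real.GammaIntegral_convergent ha)

theorem integral_besselDensity {a : ℝ} (ha : 0 < a) :
    ∫ s, besselDensity a s = Real.Gamma a := by
  rw [Real.Gamma_eq_integral ha, ← integral_indicator measurableSet_Ioi]
  rfl

theorem besselDensity_conv {a b : ℝ} (ha : 0 < a) (hb : 0 < b) (x : ℝ) :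
    ∫ r, besselDensity a r * besselDensity b (x - r)
      = Real.Gamma a * Real.Gamma b / Real.Gamma (a + b) * besselDensity (a + b) x := by
  have hsupp : ∀ r, besselDensity a r * besselDensity b (x - r)
      = (Ioo 0 x).indicator
        (fun r => Real.exp (-x) * (r ^ (a - 1) * (x - r) ^ (b - 1))) r := fun r => by
    by_cases hr : r ∈ Ioo 0 x
    · rw [indicator_of_mem hr, besselDensity_of_pos _ hr.1,
        besselDensity_of_pos _ (sub_pos.2 hr.2), show -x = -r + -(x - r) by ring, Real.exp_add]
      ring
    · rw [indicator_of_notMem hr]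
      rw [mem_Ioo, not_and_or, not_lt, not_lt] at hr
      rcases hr with h | h
      · simp [besselDensity_of_nonpos _ h]
      · simp [besselDensity_of_nonpos b (sub_nonpos.2 h)]
  simp_rw [hsupp]
  rw [integral_indicator measurableSet_Ioo, integral_const_mul]
  rcases le_or_gt x 0 with hx | hx
  · simp [besselDensity_of_nonpos _ hx, hx]
  · rw [integral_rpow_mul_sub_rpow ha hb hx, besselDensity_of_pos _ hx]
    ring

theorem bessel_eq (S : SymmMarkovSemigroup μ) {a : ℝ} (ha : 0 < a) (u : Lp ℝ 2 μ) :
    S.bessel (2 * a) u = (Real.Gamma a)⁻¹ • ∫ s, besselDensity a s • S.T s u := by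
  have h : 0 < 2 * a := by positivity
  have h2 : 2 * a / 2 = a := by ring
  simp only [bessel, h, dif_pos, h2, LinearMap.mkContinuous_apply, LinearMap.coe_mk,
    AddHom.coe_mk]
  rw [← integral_indicator measurableSet_Ioi]
  congr 2
  funext s
  by_cases hs : 0 < s <;> simp [besselDensity, hs]

theorem bessel_bessel (S : SymmMarkovSemigroup μ) {σ τ : ℝ} (hσ : 0 < σ) (hτ : 0 < τ)
    (u : Lp ℝ 2 μ) : S.bessel σ (S.bessel τ u) = S.bessel (σ + τ) u := by
  obtain ⟨a, rfl⟩ : ∃ a, σ = 2 * a := ⟨σ / 2, by ring⟩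
  obtain ⟨b, rfl⟩ : ∃ b, τ = 2 * b := ⟨τ / 2, by ring⟩
  have ha : 0 < a := by linarith
  have hb : 0 < b := by linarith
  rw [← mul_add, S.bessel_eq hb, map_smul, S.bessel_eq ha, S.bessel_eq (add_pos ha hb),
    S.integral_T_integral_T (integrable_besselDensity ha) (fun s => besselDensity_of_nonpos a)
      (integrable_besselDensity hb) (fun s => besselDensity_of_nonpos b)]
  simp_rw [besselDensity_conv ha hb, ← smul_smul]
  rw [integral_smul, smul_smul, smul_smul]
  congr 1
  have h1 := (Real.Gamma_pos_of_pos ha).ne'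
  have h2 := (Real.Gamma_pos_of_pos hb).ne'
  field_simp

theorem T_bessel (S : SymmMarkovSemigroup μ) {σ : ℝ} (hσ : 0 < σ) {r : ℝ} (hr : 0 ≤ r)
    (u : Lp ℝ 2 μ) : S.T r (S.bessel σ u) = S.bessel σ (S.T r u) := by
  obtain ⟨a, rfl⟩ : ∃ a, σ = 2 * a := ⟨σ / 2, by ring⟩
  have ha : 0 < a := by linarith
  rw [S.bessel_eq ha, S.bessel_eq ha, map_smul,
    S.T_integral_smul_T' (integrable_besselDensity ha) (fun s => besselDensity_of_nonpos a) u hr]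

theorem bessel_symm (S : SymmMarkovSemigroup μ) {σ : ℝ} (hσ : 0 < σ) (u v : Lp ℝ 2 μ) :
    inner ℝ (S.bessel σ u) v = inner ℝ u (S.bessel σ v) := by
  obtain ⟨a, rfl⟩ : ∃ a, σ = 2 * a := ⟨σ / 2, by ring⟩
  have ha : 0 < a := by linarith
  have hi := fun u => S.integrable_smul_T (integrable_besselDensity ha)
    (fun s => besselDensity_of_nonpos a) u
  rw [S.bessel_eq ha, S.bessel_eq ha, inner_smul_left, inner_smul_right, conj_trivial,
    ← integral_inner (hi v), real_inner_comm, ← integral_inner (hi u)]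
  congr 1
  refine integral_congr_ae (Eventually.of_forall fun s => ?_)
  simp only [inner_smul_right]
  rcases le_or_gt s 0 with h | h
  · simp [besselDensity_of_nonpos _ h]
  · rw [← S.T_symm s h.le u v, real_inner_comm]

theorem norm_bessel_le (S : SymmMarkovSemigroup μ) (σ : ℝ) (u : Lp ℝ 2 μ) :
    ‖S.bessel σ u‖ ≤ ‖u‖ := by
  by_cases hσ : 0 < σ
  · obtain ⟨a, rfl⟩ : ∃ a, σ = 2 * a := ⟨σ / 2, by ring⟩
    have ha : 0 < a := by linarith
    have hΓ := Real.Gamma_pos_of_pos ha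
    rw [S.bessel_eq ha, norm_smul, norm_inv, Real.norm_of_nonneg hΓ.le, inv_mul_le_iff₀ hΓ]
    refine (S.norm_integral_smul_T_le (integrable_besselDensity ha)
      (fun s => besselDensity_of_nonpos a) u).trans (le_of_eq ?_)
    simp_rw [abs_of_nonneg (besselDensity_nonneg a _)]
    rw [integral_besselDensity ha]
  · simp [bessel, hσ]

theorem besselDensity_anti {a : ℝ} (ha1 : a ≤ 1) {s t : ℝ} (hs : 0 < s) (hst : s ≤ t) :
    besselDensity a t ≤ besselDensity a s := by
  rw [besselDensity_of_pos _ hs, besselDensity_of_pos _ (hs.trans_le hst)]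
  exact mul_le_mul (Real.exp_le_exp.2 (by linarith))
    (Real.rpow_le_rpow_of_nonpos hs hst (by linarith)) (Real.rpow_nonneg (hs.le.trans hst) _)
    (Real.exp_pos _).le

theorem integral_abs_besselDensity_sub_le {a h : ℝ} (ha : 0 < a) (ha1 : a ≤ 1) (hh : 0 ≤ h) :
    ∫ s, |besselDensity a (s - h) - besselDensity a s| ≤ 2 / a * h ^ a := by
  have hi := integrable_besselDensity ha
  have hi' : Integrable fun s => besselDensity a (s - h) := hi.comp_sub_right h
  have h1 : ∀ᵐ s, |besselDensity a (s - h) - besselDensity a s|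
      = besselDensity a (s - h) - besselDensity a s
        + 2 * (Ioc 0 h).indicator (besselDensity a) s := by
    refine Eventually.of_forall fun s => ?_
    rcases le_or_gt s 0 with hs | hs
    · have : s ∉ Ioc 0 h := fun h' => absurd h'.1 (not_lt.2 hs)
      simp [this, besselDensity_of_nonpos a hs, besselDensity_of_nonpos a (s := s - h)
        (by linarith)]
    rcases le_or_gt s h with hsh | hsh
    · rw [indicator_of_mem (mem_Ioc.2 ⟨hs, hsh⟩),
        besselDensity_of_nonpos a (s := s - h) (by linarith), zero_sub, abs_neg,
        abs_of_nonneg (besselDensity_nonneg a s)]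
      ring
    · have : s ∉ Ioc 0 h := fun h' => absurd h'.2 (not_le.2 hsh)
      rw [indicator_of_notMem this, mul_zero, add_zero, abs_of_nonneg]
      exact sub_nonneg.2 (besselDensity_anti ha1 (sub_pos.2 hsh) (by linarith))
  have h2 : ∫ s, (Ioc 0 h).indicator (besselDensity a) s ≤ h ^ a / a := by
    rw [integral_indicator measurableSet_Ioc]
    have h3 : IntegrableOn (fun s : ℝ => s ^ (a - 1)) (Ioc 0 h) :=
      (intervalIntegrable_iff_integrableOn_Ioc_of_le hh).1
        (intervalIntegral.intervalIntegrable_rpow' (by linarith))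
    have h4 : ∫ s in Ioc 0 h, s ^ (a - 1) = h ^ a / a := by
      rw [← intervalIntegral.integral_of_le hh, integral_rpow (Or.inl (by linarith))]
      simp [Real.zero_rpow ha.ne']
    rw [← h4]
    refine setIntegral_mono_on hi.integrableOn h3 measurableSet_Ioc fun s hs => ?_
    rw [besselDensity_of_pos a hs.1]
    refine mul_le_of_le_one_left (Real.rpow_nonneg hs.1.le _)
      (Real.exp_le_one_iff.2 (by linarith [hs.1]))
  have h5 : Integrable fun s => besselDensity a (s - h) - besselDensity a s := hi'.sub hi
  rw [integral_congr_ae h1, integral_add h5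
    ((hi.indicator measurableSet_Ioc).const_mul 2), integral_sub hi' hi,
    integral_sub_right_eq_self, sub_self, zero_add, integral_const_mul]
  calc 2 * ∫ s, (Ioc 0 h).indicator (besselDensity a) s ≤ 2 * (h ^ a / a) := by gcongr
    _ = _ := by ring

/-- Elements of `H^{2a}` are `a`-Hölder continuous along the semigroup. -/
theorem norm_T_bessel_sub_le (S : SymmMarkovSemigroup μ) {a h : ℝ} (ha : 0 < a) (ha1 : a ≤ 1)
    (hh : 0 ≤ h) (u : Lp ℝ 2 μ) :
    ‖S.T h (S.bessel (2 * a) u) - S.bessel (2 * a) u‖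
      ≤ (Real.Gamma a)⁻¹ * (2 / a) * h ^ a * ‖u‖ := by
  have hΓ := Real.Gamma_pos_of_pos ha
  have hi := integrable_besselDensity ha
  have hi' : Integrable fun s => besselDensity a (s - h) := hi.comp_sub_right h
  have h0 := fun s => besselDensity_of_nonpos a (s := s)
  have h0' : ∀ s ≤ 0, besselDensity a (s - h) = 0 := fun s hs => h0 _ (by linarith)
  rw [S.bessel_eq ha, map_smul, S.T_integral_smul_T hi h0 u hh, ← smul_sub,
    ← integral_sub (S.integrable_smul_T hi' h0' u) (S.integrable_smul_T hi h0 u), norm_smul,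
    norm_inv, Real.norm_of_nonneg hΓ.le]
  simp_rw [← sub_smul]
  rw [mul_assoc, mul_assoc]
  gcongr
  refine (S.norm_integral_smul_T_le (hi'.sub hi) (fun s hs => ?_) u).trans ?_
  · simp [h0 s hs, h0' s hs]
  · rw [← mul_assoc]
    gcongr
    exact integral_abs_besselDensity_sub_le ha ha1 hh

theorem norm_damp_T_bessel_sub_le (S : SymmMarkovSemigroup μ) {a h : ℝ} (ha : 0 < a)
    (ha1 : a ≤ 1) (hh : 0 ≤ h) (u : Lp ℝ 2 μ) :
    ‖S.damp.T h (S.bessel (2 * a) u) - S.bessel (2 * a) u‖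
      ≤ ((Real.Gamma a)⁻¹ * (2 / a) + 1) * h ^ a * ‖u‖ := by
  have h1 : S.damp.T h (S.bessel (2 * a) u) - S.bessel (2 * a) u
      = Real.exp (-h) • (S.T h (S.bessel (2 * a) u) - S.bessel (2 * a) u)
        - (1 - Real.exp (-h)) • S.bessel (2 * a) u := by
    rw [damp_T]; module
  have he : Real.exp (-h) ≤ 1 := Real.exp_le_one_iff.2 (by linarith)
  have he0 := Real.exp_pos (-h)
  have h2 : 1 - Real.exp (-h) ≤ h ^ a := by
    rcases le_or_gt h 1 with h1 | h1
    · have := Real.add_one_le_exp (-h)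
      have h3 : h ^ (1 : ℝ) ≤ h ^ a := Real.rpow_le_rpow_of_exponent_ge' hh h1 ha.le ha1
      rw [Real.rpow_one] at h3
      linarith
    · have := Real.one_le_rpow h1.le ha.le
      linarith
  rw [h1]
  refine (norm_sub_le _ _).trans ?_
  rw [norm_smul, norm_smul, Real.norm_of_nonneg he0.le, Real.norm_of_nonneg (by linarith),
    add_mul, add_mul]
  refine add_le_add ?_ ?_
  · exact (mul_le_of_le_one_left (norm_nonneg _) he).trans (S.norm_T_bessel_sub_le ha ha1 hh u)
  · rw [one_mul]
    exact mul_le_mul h2 (S.norm_bessel_le _ u) (norm_nonneg _) (by positivity)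

end SymmMarkovSemigroup

/-! ### Characterization of the potential spaces by the approximating forms -/

theorem ofReal_integral_le_lintegral {α : Type*} [MeasurableSpace α] {ν : Measure α}
    (g : α → ℝ) : ENNReal.ofReal (∫ x, g x ∂ν) ≤ ∫⁻ x, ENNReal.ofReal (g x) ∂ν := by
  by_cases hg : Integrable g ν
  · rw [integral_eq_lintegral_pos_part_sub_lintegral_neg_part hg]
    refine (ENNReal.ofReal_le_ofReal (sub_le_self _ ENNReal.toReal_nonneg)).trans ?_
    exact ENNReal.ofReal_toReal_le
  · simp [integral_undef hg]

namespace SymmMarkovSemigroup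

variable {X : Type*} [MeasurableSpace X] {μ : Measure X}

theorem integrableOn_rpow_smul_sub (S : SymmMarkovSemigroup μ) {a e : ℝ} (ha : 0 < a)
    (he : 0 < e) (u : Lp ℝ 2 μ) :
    IntegrableOn (fun r : ℝ => r ^ (-a - 1) • (u - S.T r u)) (Ioi e) := by
  have h1 : IntegrableOn (fun r : ℝ => r ^ (-a - 1)) (Ioi e) :=
    integrableOn_Ioi_rpow_of_lt (by linarith) he
  refine Integrable.mono' (h1.mul_const (2 * ‖u‖)) (h1.aestronglyMeasurable.smul ?_) ?_
  · exact (continuousOn_const.sub ((S.continuousOn_T u).mono fun r (hr : e < r) =>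
      (he.trans hr).le)).aestronglyMeasurable measurableSet_Ioi
  · refine ae_restrict_of_forall_mem measurableSet_Ioi fun r (hr : e < r) => ?_
    have hr0 : 0 < r := he.trans hr
    rw [norm_smul, Real.norm_of_nonneg (Real.rpow_nonneg hr0.le _)]
    refine mul_le_mul_of_nonneg_left ?_ (Real.rpow_nonneg hr0.le _)
    refine (norm_sub_le _ _).trans ?_
    linarith [S.norm_T_le hr0.le u]

/-- The truncated Balakrishnan integral of order `a` of a Bessel potential of order `2a`. -/
theorem integral_rpow_smul_sub_eq (S : SymmMarkovSemigroup μ) {a e : ℝ} (ha : 0 < a)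
    (he : 0 < e) (u : Lp ℝ 2 μ) :
    ∫ r in Ioi e, r ^ (-a - 1) • ((∫ s, besselDensity a s • S.T s u)
        - S.damp.T r (∫ s, besselDensity a s • S.T s u))
      = ∫ x in Ioi (0 : ℝ), truncKernel a e x • S.damp.T x u := by
  set ψ : Lp ℝ 2 μ := ∫ s, besselDensity a s • S.T s u with hψ
  let F : ℝ → ℝ := (Ioi e).indicator fun r => r ^ (-a - 1) * Real.exp (-r)
  have hrp : IntegrableOn (fun r : ℝ => r ^ (-a - 1)) (Ioi e) :=
    integrableOn_Ioi_rpow_of_lt (by linarith) he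
  have hF : Integrable F := by
    refine (integrable_indicator_iff measurableSet_Ioi).2 ?_
    refine Integrable.mono' hrp (hrp.aestronglyMeasurable.mul (by fun_prop)) ?_
    refine ae_restrict_of_forall_mem measurableSet_Ioi fun r (hr : e < r) => ?_
    have hr0 : 0 < r := he.trans hr
    rw [Real.norm_of_nonneg (by positivity)]
    exact mul_le_of_le_one_right (by positivity) (Real.exp_le_one_iff.2 (by linarith))
  have hF0 : ∀ s ≤ 0, F s = 0 := fun s hs => indicator_of_notMem (by simp; linarith) _
  have h1 : ∫ r in Ioi e, r ^ (-a - 1) • S.damp.T r ψ = ∫ r, F r • S.T r ψ := by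
    rw [← integral_indicator measurableSet_Ioi]
    congr 1
    funext r
    by_cases hr : e < r
    · simp [F, hr, damp_T, smul_smul]
    · simp [F, hr]
  have hi1 : IntegrableOn (fun r : ℝ => r ^ (-a - 1) • ψ) (Ioi e) := hrp.smul_const ψ
  have hi2 : IntegrableOn (fun r : ℝ => r ^ (-a - 1) • S.damp.T r ψ) (Ioi e) := by
    have := hi1.sub (S.damp.integrableOn_rpow_smul_sub ha he ψ)
    refine this.congr (Eventually.of_forall fun r => ?_)
    simp [smul_sub]
  have hconv : ∀ x, 0 < x → ∫ r, F r * besselDensity a (x - r)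
      = Real.exp (-x) * (e ^ (-a) * (max (x - e) 0) ^ a / (a * x)) := fun x hx => by
    have hsupp : ∀ r, F r * besselDensity a (x - r) = (Ioo e x).indicator
        (fun r => Real.exp (-x) * (r ^ (-a - 1) * (x - r) ^ (a - 1))) r := fun r => by
      by_cases hr : r ∈ Ioo e x
      · rw [indicator_of_mem hr, besselDensity_of_pos _ (sub_pos.2 hr.2),
          show -x = -r + -(x - r) by ring, Real.exp_add]
        simp only [F]
        rw [indicator_of_mem (mem_Ioi.2 hr.1)]
        ring
      · rw [indicator_of_notMem hr]
        rw [mem_Ioo, not_and_or, not_lt, not_lt] at hr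
        rcases hr with h | h
        · simp [F, not_lt.2 h]
        · simp [besselDensity_of_nonpos a (sub_nonpos.2 h)]
    simp_rw [hsupp]
    rw [integral_indicator measurableSet_Ioo, integral_const_mul,
      ← integral_Ioc_eq_integral_Ioo]
    congr 1
    rcases le_or_gt x e with hxe | hxe
    · simp [hxe, Real.zero_rpow ha.ne']
    · rw [(integral_rpow_neg_mul_sub_rpow ha he hxe).2, max_eq_left (sub_pos.2 hxe).le,
        Real.div_rpow (sub_pos.2 hxe).le he.le, Real.rpow_neg he.le]
      have := (Real.rpow_pos_of_pos he a).ne'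
      field_simp
  have hd := integrable_besselDensity ha
  have hd0 := fun s => besselDensity_of_nonpos a (s := s)
  have hFd : Integrable fun x => ∫ r, F r * besselDensity a (x - r) :=
    (hF.convolution_integrand (ContinuousLinearMap.mul ℝ ℝ) hd).integral_prod_left
  have hFd0 : ∀ x ≤ 0, ∫ r, F r * besselDensity a (x - r) = 0 := fun x hx => by
    have : ∀ r, F r * besselDensity a (x - r) = 0 := fun r => by
      rcases le_or_gt r 0 with h | h
      · simp [hF0 r h]
      · simp [hd0 (x - r) (by linarith)]
    simp [this]
  have h4 : ∫ r in Ioi e, r ^ (-a - 1) = e ^ (-a) / a := by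
    rw [integral_Ioi_rpow_of_lt (by linarith) he, show -a - 1 + 1 = -a by ring]
    rw [neg_div_neg_eq]
  have hd1 : Integrable fun x => (e ^ (-a) / a) • besselDensity a x • S.T x u := by
    have := (S.integrable_smul_T hd hd0 u).smul (e ^ (-a) / a)
    exact this
  simp_rw [smul_sub]
  rw [integral_sub hi1 hi2, h1, integral_smul_const, h4, hψ,
    S.integral_T_integral_T hF hF0 hd hd0, ← integral_smul,
    ← integral_sub hd1 (S.integrable_smul_T hFd hFd0 u),
    ← integral_indicator measurableSet_Ioi]
  congr 1
  funext x
  rcases le_or_gt x 0 with hx | hx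
  · simp [hd0 x hx, hFd0 x hx, hx]
  · rw [hconv x hx, besselDensity_of_pos a hx, indicator_of_mem (mem_Ioi.2 hx), damp_T, smul_smul,
      smul_smul, ← sub_smul, truncKernel, Real.rpow_sub hx, Real.rpow_one]
    congr 1
    field_simp

/-- The energy `∫₀^∞ r^{-σ-1} E_r(u) dr`, where `E_r(u) = (u - e^{-r} T(r) u, u)`.
For `0 < σ < 1` it is comparable to the square of the norm of `H^σ(μ)`. -/
def energy (S : SymmMarkovSemigroup μ) (σ : ℝ) (u : Lp ℝ 2 μ) : ℝ≥0∞ :=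
  ∫⁻ r in Ioi (0 : ℝ), ENNReal.ofReal (r ^ (-σ - 1) * S.damp.form r u)

theorem form_bessel_eq (S : SymmMarkovSemigroup μ) {a r : ℝ} (ha : 0 < a) (hr : 0 ≤ r)
    (φ : Lp ℝ 2 μ) : S.damp.form r (S.bessel a φ)
      = inner ℝ (S.bessel (2 * a) φ - S.damp.T r (S.bessel (2 * a) φ)) φ := by
  have h1 : ∀ v, S.damp.T r (S.bessel a v) = S.bessel a (S.damp.T r v) := fun v => by
    rw [damp_T, damp_T, S.T_bessel ha hr, map_smul]
  rw [two_mul, ← S.bessel_bessel ha ha, form, ← S.bessel_symm ha, map_sub, h1 (S.bessel a φ)]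

theorem form_bessel_le (S : SymmMarkovSemigroup μ) {a r : ℝ} (ha : 0 < a) (ha1 : a ≤ 1)
    (hr : 0 ≤ r) (φ : Lp ℝ 2 μ) : S.damp.form r (S.bessel a φ)
      ≤ ((Real.Gamma a)⁻¹ * (2 / a) + 1) * r ^ a * ‖φ‖ ^ 2 := by
  rw [S.form_bessel_eq ha hr]
  refine (real_inner_le_norm _ _).trans ?_
  rw [norm_sub_rev, sq, ← mul_assoc]
  exact mul_le_mul_of_nonneg_right (S.norm_damp_T_bessel_sub_le ha ha1 hr φ) (norm_nonneg _)

theorem energy_bessel_le (S : SymmMarkovSemigroup μ) {σ : ℝ} (hσ : 0 < σ) (hσ1 : σ < 1)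
    (φ : Lp ℝ 2 μ) :
    S.energy σ (S.bessel σ φ) ≤ ENNReal.ofReal ((Real.Gamma σ)⁻¹ * truncMass σ * ‖φ‖ ^ 2) := by
  have hΓ := Real.Gamma_pos_of_pos hσ
  set ψ : Lp ℝ 2 μ := ∫ s, besselDensity σ s • S.T s φ with hψ
  have hform : ∀ r, 0 ≤ r → S.damp.form r (S.bessel σ φ)
      = (Real.Gamma σ)⁻¹ * inner ℝ φ (ψ - S.damp.T r ψ) := fun r hr => by
    rw [S.form_bessel_eq hσ hr, S.bessel_eq hσ, map_smul, ← smul_sub, inner_smul_left,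
      real_inner_comm]
    simp [hψ]
  have key : ∀ e, 0 < e → ∫⁻ r in Ioi e, ENNReal.ofReal (r ^ (-σ - 1) * S.damp.form r
      (S.bessel σ φ)) ≤ ENNReal.ofReal ((Real.Gamma σ)⁻¹ * truncMass σ * ‖φ‖ ^ 2) := by
    intro e he
    have hi := S.damp.integrableOn_rpow_smul_sub hσ he ψ
    have hi2 : IntegrableOn (fun r : ℝ => r ^ (-σ - 1) * S.damp.form r (S.bessel σ φ)) (Ioi e) := by
      have h2 := (hi.const_inner (𝕜 := ℝ) φ).const_mul (Real.Gamma σ)⁻¹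
      refine IntegrableOn.congr_fun h2 (fun r (hr : e < r) => ?_) measurableSet_Ioi
      simp only [inner_smul_right, hform r (he.trans hr).le]
      ring
    rw [← ofReal_integral_eq_lintegral_ofReal hi2]
    · refine ENNReal.ofReal_le_ofReal ?_
      have h3 : ∫ r in Ioi e, r ^ (-σ - 1) * S.damp.form r (S.bessel σ φ)
          = (Real.Gamma σ)⁻¹ * inner ℝ φ
            (∫ x in Ioi (0 : ℝ), truncKernel σ e x • S.damp.T x φ) := by
        rw [← S.integral_rpow_smul_sub_eq hσ he, ← integral_inner hi, ← integral_const_mul]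
        refine setIntegral_congr_fun measurableSet_Ioi fun r (hr : e < r) => ?_
        simp only [inner_smul_right, hform r (he.trans hr).le]
        ring
      rw [h3, mul_assoc]
      refine mul_le_mul_of_nonneg_left ?_ (by positivity)
      refine (real_inner_le_norm _ _).trans ?_
      have h4 : ‖∫ x in Ioi (0 : ℝ), truncKernel σ e x • S.damp.T x φ‖ ≤ truncMass σ * ‖φ‖ := by
        rw [← integral_truncKernel he, ← integral_mul_const]
        refine norm_integral_le_of_norm_le ((integrableOn_truncKernel hσ hσ1 he).mul_const _)
          (ae_restrict_of_forall_mem measurableSet_Ioi fun x (hx : 0 < x) => ?_)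
        rw [norm_smul, Real.norm_of_nonneg (truncKernel_nonneg hσ he hx)]
        exact mul_le_mul_of_nonneg_left (S.damp.norm_T_le hx.le φ) (truncKernel_nonneg hσ he hx)
      nlinarith [norm_nonneg φ]
    · refine ae_restrict_of_forall_mem measurableSet_Ioi fun r (hr : e < r) => ?_
      exact mul_nonneg (Real.rpow_nonneg (he.trans hr).le _)
        (S.damp.form_nonneg (he.trans hr).le _)
  have hU : Ioi (0 : ℝ) = ⋃ n : ℕ, Ioi (1 / ((n : ℝ) + 1)) := by
    ext x
    simp only [mem_Ioi, mem_iUnion]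
    constructor
    · exact fun hx => exists_nat_one_div_lt hx
    · rintro ⟨n, hn⟩
      exact lt_trans (by positivity) hn
  rw [energy, hU, setLIntegral_iUnion_of_directed]
  · exact iSup_le fun n => key _ (by positivity)
  · refine Monotone.directed_le fun m n hmn => Ioi_subset_Ioi ?_
    exact one_div_le_one_div_of_le (by positivity) (by simpa using hmn)

theorem norm_sq_integral_le (S : SymmMarkovSemigroup μ) {a : ℝ} (ha : 0 < a) {s : Set ℝ}
    (hs : MeasurableSet s) (hs0 : s ⊆ Ioi 0) (u : Lp ℝ 2 μ)
    (hi : IntegrableOn (fun r : ℝ => r ^ (-a - 1) • (u - S.T r u)) s) :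
    ENNReal.ofReal (‖∫ r in s, r ^ (-a - 1) • (u - S.T r u)‖ ^ 2)
      ≤ ENNReal.ofReal (2 / a) * ∫⁻ r in s, ENNReal.ofReal (r ^ (-(2 * a) - 1) * S.form r u) := by
  let x : ℝ → Lp ℝ 2 μ := fun r => r ^ (-a - 1) • (u - S.T r u)
  let e : ℝ → ℝ≥0∞ := fun r => ENNReal.ofReal (r ^ (-a - 1) * S.form r u)
  let k : ℝ → ℝ≥0∞ := fun r => ENNReal.ofReal (r ^ (-a - 1))
  let f : ℝ → ℝ → ℝ≥0∞ := fun r r' => e r * (Ici r).indicator k r'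
  have hem : AEMeasurable e (volume.restrict s) := by
    refine AEMeasurable.ennreal_ofReal (AEMeasurable.mul (by fun_prop) ?_)
    exact ((S.continuousOn_form u).mono fun r hr => mem_Ici.2 (mem_Ioi.1 (hs0 hr)).le).aemeasurable
      hs
  have hfm : AEMeasurable (Function.uncurry f) ((volume.restrict s).prod (volume.restrict s)) := by
    have h1 : Function.uncurry f = fun p : ℝ × ℝ =>
        e p.1 * {p : ℝ × ℝ | p.1 ≤ p.2}.indicator (fun p => k p.2) p := by
      funext p
      simp only [Function.uncurry, f]
      congr 1
    rw [h1]
    refine AEMeasurable.mul (hem.comp_quasiMeasurePreserving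
      Measure.quasiMeasurePreserving_fst) ?_
    refine AEMeasurable.indicator ?_ (measurableSet_le measurable_fst measurable_snd)
    exact Measurable.aemeasurable (by fun_prop)
  have hle : ∀ r ∈ s, ∀ r' ∈ s, ENNReal.ofReal (inner ℝ (x r) (x r')) ≤ f r r' + f r' r := by
    intro r hr r' hr'
    have hr0 : 0 < r := hs0 hr
    have hr0' : 0 < r' := hs0 hr'
    simp only [x, inner_smul_left, inner_smul_right, conj_trivial]
    rcases le_total r r' with h | h
    · refine le_add_right ?_
      simp only [f, e, k]
      rw [indicator_of_mem (mem_Ici.2 h), ← ENNReal.ofReal_mul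
        (mul_nonneg (by positivity) (S.form_nonneg hr0.le u))]
      refine ENNReal.ofReal_le_ofReal ?_
      have := S.inner_sub_T_sub_T_le hr0.le hr0'.le u
      calc _ ≤ r' ^ (-a - 1) * (r ^ (-a - 1) * S.form r u) := by gcongr
        _ = _ := by ring
    · refine le_add_left ?_
      simp only [f, e, k]
      rw [indicator_of_mem (mem_Ici.2 h), ← ENNReal.ofReal_mul
        (mul_nonneg (by positivity) (S.form_nonneg hr0'.le u))]
      refine ENNReal.ofReal_le_ofReal ?_
      have := S.inner_sub_T_sub_T_le hr0'.le hr0.le u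
      rw [real_inner_comm] at this
      calc _ ≤ r' ^ (-a - 1) * (r ^ (-a - 1) * S.form r' u) := by gcongr
        _ = _ := by ring
  have hsq : ‖∫ r in s, x r‖ ^ 2 = ∫ r in s, ∫ r' in s, inner ℝ (x r) (x r') := by
    rw [← real_inner_self_eq_norm_sq, ← integral_inner hi]
    refine integral_congr_ae (Eventually.of_forall fun r => ?_)
    simp only
    rw [real_inner_comm, ← integral_inner hi]
  have hf1 : ∫⁻ r in s, ∫⁻ r' in s, f r r' ≤
      ENNReal.ofReal (1 / a) * ∫⁻ r in s, ENNReal.ofReal (r ^ (-(2 * a) - 1) * S.form r u) := by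
    rw [← lintegral_const_mul' _ _ ENNReal.ofReal_ne_top]
    refine setLIntegral_mono' hs fun r hr => ?_
    have hr0 : 0 < r := hs0 hr
    have h2 : ∫⁻ r' in s, (Ici r).indicator k r' ≤ ENNReal.ofReal (r ^ (-a) / a) := by
      calc _ ≤ ∫⁻ r', (Ici r).indicator k r' := setLIntegral_le_lintegral _ _
        _ = ∫⁻ r' in Ioi r, k r' := by
          rw [lintegral_indicator measurableSet_Ici]
          exact setLIntegral_congr Ioi_ae_eq_Ici.symm
        _ = ENNReal.ofReal (∫ r' in Ioi r, r' ^ (-a - 1)) := by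
          rw [ofReal_integral_eq_lintegral_ofReal
            (integrableOn_Ioi_rpow_of_lt (by linarith) hr0)]
          exact ae_restrict_of_forall_mem measurableSet_Ioi fun r' (hr' : r < r') =>
            Real.rpow_nonneg (hr0.trans hr').le _
        _ ≤ _ := by
          rw [integral_Ioi_rpow_of_lt (by linarith) hr0, show -a - 1 + 1 = -a by ring,
            neg_div_neg_eq]
    simp only [f]
    rw [lintegral_const_mul' _ _ ENNReal.ofReal_ne_top]
    refine (mul_le_mul_right h2 _).trans ?_
    rw [← ENNReal.ofReal_mul (mul_nonneg (by positivity) (S.form_nonneg hr0.le u)),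
      ← ENNReal.ofReal_mul (by positivity)]
    refine ENNReal.ofReal_le_ofReal (le_of_eq ?_)
    rw [show -(2 * a) - 1 = (-a - 1) + -a by ring, Real.rpow_add hr0]
    ring
  calc ENNReal.ofReal (‖∫ r in s, x r‖ ^ 2)
      ≤ ∫⁻ r in s, ∫⁻ r' in s, ENNReal.ofReal (inner ℝ (x r) (x r')) := by
        rw [hsq]
        exact (ofReal_integral_le_lintegral _).trans
          (lintegral_mono fun r => ofReal_integral_le_lintegral _)
    _ ≤ ∫⁻ r in s, ∫⁻ r' in s, (f r r' + f r' r) :=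
        setLIntegral_mono' hs fun r hr => setLIntegral_mono' hs fun r' hr' => hle r hr r' hr'
    _ = (∫⁻ r in s, ∫⁻ r' in s, f r r') + ∫⁻ r in s, ∫⁻ r' in s, f r' r := by
        have h5 : ∀ r, AEMeasurable (f r) (volume.restrict s) := fun r =>
          ((Measurable.indicator (by fun_prop) measurableSet_Ici).const_mul _).aemeasurable
        simp_rw [fun r => lintegral_add_left' (h5 r) (fun r' => f r' r)]
        exact lintegral_add_left' hfm.lintegral_prod_right' _
    _ = 2 * ∫⁻ r in s, ∫⁻ r' in s, f r r' := by
        rw [lintegral_lintegral_swap hfm, two_mul]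
    _ ≤ _ := by
        refine (mul_le_mul_right hf1 2).trans (le_of_eq ?_)
        rw [← mul_assoc, show (2 : ℝ≥0∞) = ENNReal.ofReal 2 by simp,
          ← ENNReal.ofReal_mul zero_le_two]
        congr 2; ring

/-- Balakrishnan's construction: a vector of finite energy is a Bessel potential. -/
theorem exists_bessel_eq_of_energy_le (S : SymmMarkovSemigroup μ) {σ : ℝ} (hσ : 0 < σ)
    (hσ1 : σ < 1) : ∃ C, 0 < C ∧ ∀ (u : Lp ℝ 2 μ) (M : ℝ), 0 ≤ M →
      S.energy σ u ≤ ENNReal.ofReal M → ∃ φ, S.bessel σ φ = u ∧ ‖φ‖ ^ 2 ≤ C * M := by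
  obtain ⟨a, rfl⟩ : ∃ a, σ = 2 * a := ⟨σ / 2, by ring⟩
  have ha : 0 < a := by linarith
  have ha1 : a < 1 := by linarith
  have hΓ := Real.Gamma_pos_of_pos ha
  have hm := truncMass_pos ha ha1
  set c : ℝ := Real.Gamma a / truncMass a with hc
  have hc0 : 0 < c := div_pos hΓ hm
  refine ⟨c ^ 2 * (2 / a), by positivity, fun u M hM hE => ?_⟩
  let x : ℝ → Lp ℝ 2 μ := fun r => r ^ (-a - 1) • (u - S.damp.T r u)
  let ε : ℕ → ℝ := fun n => 1 / ((n : ℝ) + 1)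
  have hε : ∀ n, 0 < ε n := fun n => by positivity
  have hεlim : Tendsto ε atTop (𝓝 0) := tendsto_one_div_add_atTop_nhds_zero_nat
  have hi : ∀ n, IntegrableOn x (Ioi (ε n)) := fun n =>
    S.damp.integrableOn_rpow_smul_sub ha (hε n) u
  let φ : ℕ → Lp ℝ 2 μ := fun n => ∫ r in Ioi (ε n), x r
  let e : ℝ → ℝ≥0∞ := fun r => ENNReal.ofReal (r ^ (-(2 * a) - 1) * S.damp.form r u)
  have hefin : ∫⁻ r in Ioi (0 : ℝ), e r ≠ ∞ := (hE.trans_lt ENNReal.ofReal_lt_top).ne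
  have hnorm : ∀ n, ‖φ n‖ ^ 2 ≤ 2 / a * M := fun n => by
    have h1 := S.damp.norm_sq_integral_le ha measurableSet_Ioi
      (Ioi_subset_Ioi (hε n).le) u (hi n)
    have h2 : ∫⁻ r in Ioi (ε n), e r ≤ ENNReal.ofReal M :=
      (lintegral_mono_set (Ioi_subset_Ioi (hε n).le)).trans hE
    have h3 := h1.trans (mul_le_mul_right h2 _)
    rw [← ENNReal.ofReal_mul (by positivity)] at h3
    exact (ENNReal.ofReal_le_ofReal_iff (by positivity)).1 h3
  let b : ℕ → ℝ := fun N => Real.sqrt (2 / a * (∫⁻ r in Ioc 0 (ε N), e r).toReal)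
  have hεanti : ∀ m n, m ≤ n → ε n ≤ ε m := fun m n hmn =>
    one_div_le_one_div_of_le (by positivity) (by simpa using hmn)
  have hdist : ∀ m n, m ≤ n → ‖φ n - φ m‖ ≤ b m := fun m n hmn => by
    have hle := hεanti m n hmn
    have h0 : φ n - φ m = ∫ r in Ioc (ε n) (ε m), x r := by
      have h1 : Ioi (ε n) = Ioc (ε n) (ε m) ∪ Ioi (ε m) := (Ioc_union_Ioi_eq_Ioi hle).symm
      simp only [φ]
      rw [h1, setIntegral_union (by
        rw [Set.disjoint_left]; intro y hy hy'; exact absurd hy.2 (not_le.2 hy'))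
        measurableSet_Ioi ((hi n).mono_set Ioc_subset_Ioi_self) (hi m), add_sub_cancel_right]
    have h1 := S.damp.norm_sq_integral_le ha (measurableSet_Ioc (a := ε n) (b := ε m))
      (fun r hr => (hε n).trans hr.1) u ((hi n).mono_set Ioc_subset_Ioi_self)
    have hsub : Ioc (ε n) (ε m) ⊆ Ioc 0 (ε m) := Ioc_subset_Ioc_left (hε n).le
    have hfin : ∫⁻ r in Ioc 0 (ε m), e r ≠ ∞ :=
      ((lintegral_mono_set Ioc_subset_Ioi_self).trans_lt hefin.lt_top).ne
    have h3 := h1.trans (mul_le_mul_right (lintegral_mono_set hsub) _)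
    rw [h0]
    refine Real.le_sqrt_of_sq_le ?_
    rw [← ENNReal.ofReal_toReal hfin, ← ENNReal.ofReal_mul (by positivity)] at h3
    exact (ENNReal.ofReal_le_ofReal_iff (by positivity)).1 h3
  have hb : Tendsto b atTop (𝓝 0) := by
    have h1 : Tendsto (fun N => ∫⁻ r in Ioc 0 (ε N), e r) atTop (𝓝 0) := by
      have h2 : Tendsto (fun N => ∫⁻ r in Ioc 0 (ε N), e r ∂(volume.restrict (Ioi 0))) atTop
          (𝓝 0) := by
        refine tendsto_setLIntegral_zero hefin ?_
        refine tendsto_of_tendsto_of_tendsto_of_le_of_le tendsto_const_nhds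
          (h := fun N => ENNReal.ofReal (ε N)) ?_ (fun _ => zero_le) fun N => ?_
        · simpa using ENNReal.tendsto_ofReal hεlim
        · refine (Measure.restrict_apply_le _ _).trans ?_
          simp
      refine h2.congr fun N => ?_
      rw [Measure.restrict_restrict measurableSet_Ioc,
        inter_eq_self_of_subset_left Ioc_subset_Ioi_self]
    have h3 := ((ENNReal.tendsto_toReal ENNReal.zero_ne_top).comp h1).const_mul (2 / a)
    have h4 := (Real.continuous_sqrt.tendsto _).comp h3
    simpa [b, Function.comp_def] using h4
  have hcau : CauchySeq φ := by
    refine cauchySeq_of_le_tendsto_0' b (fun m n hmn => ?_) hb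
    rw [dist_comm, dist_eq_norm]
    exact hdist m n hmn
  obtain ⟨φ₀, hφ₀⟩ := cauchySeq_tendsto_of_complete hcau
  have hJ : ∀ n, S.bessel (2 * a) (φ n)
      = (Real.Gamma a)⁻¹ • ∫ y in Ioi (0 : ℝ), truncKernel a (ε n) y • S.damp.T y u := fun n => by
    rw [← S.integral_rpow_smul_sub_eq ha (hε n), ← integral_smul,
      ← (S.bessel (2 * a)).integral_comp_comm (hi n)]
    refine setIntegral_congr_fun measurableSet_Ioi fun r (hr : ε n < r) => ?_
    have hr0 : 0 < r := (hε n).trans hr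
    have h1 : S.bessel (2 * a) (S.damp.T r u) = S.damp.T r (S.bessel (2 * a) u) := by
      rw [damp_T, damp_T, S.T_bessel hσ hr0.le, map_smul]
    simp only [x, map_smul, map_sub, h1]
    rw [S.bessel_eq ha, map_smul]
    module
  have hlim1 : Tendsto (fun n => S.bessel (2 * a) (φ n)) atTop (𝓝 (S.bessel (2 * a) φ₀)) :=
    ((S.bessel (2 * a)).continuous.tendsto _).comp hφ₀
  have hlim2 : Tendsto (fun n => S.bessel (2 * a) (φ n)) atTop
      (𝓝 ((Real.Gamma a)⁻¹ • truncMass a • u)) := by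
    simp_rw [hJ]
    refine Tendsto.const_smul ?_ _
    have h1 := tendsto_integral_truncKernel ha ha1 (φ := fun s => S.damp.T s u) (C := ‖u‖)
      (((S.damp.continuousOn_T u).mono Ioi_subset_Ici_self).aestronglyMeasurable
        measurableSet_Ioi) (fun s hs => S.damp.norm_T_le hs.le u) (S.damp.T_tendsto u)
    exact h1.comp (tendsto_nhdsWithin_iff.2 ⟨hεlim, Eventually.of_forall hε⟩)
  have heq := tendsto_nhds_unique hlim1 hlim2
  refine ⟨c • φ₀, ?_, ?_⟩
  · rw [map_smul, heq, smul_smul, smul_smul, hc]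
    have : Real.Gamma a / truncMass a * (Real.Gamma a)⁻¹ * truncMass a = 1 := by
      field_simp
    rw [this, one_smul]
  · have h1 : ‖φ₀‖ ^ 2 ≤ 2 / a * M :=
      le_of_tendsto' ((hφ₀.norm).pow 2) hnorm
    rw [norm_smul, Real.norm_of_nonneg hc0.le, mul_pow, mul_assoc]
    gcongr

theorem lintegral_min_rpow_le {σ r : ℝ} (hσ : 0 < σ) (hσ1 : σ < 1) (hr : 0 < r) {M : ℝ}
    (hM : 0 ≤ M) :
    ∫⁻ ρ in Ioi (0 : ℝ), ENNReal.ofReal (ρ ^ (-σ - 1) * (min 1 (ρ / r) * M))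
      ≤ ENNReal.ofReal ((1 / (1 - σ) + 1 / σ) * r ^ (-σ) * M) := by
  have h1σ : 0 < 1 - σ := by linarith
  rw [← Ioc_union_Ioi_eq_Ioi hr.le]
  refine (lintegral_union_le _ _ _).trans ?_
  rw [mul_assoc, add_mul, ENNReal.ofReal_add (by positivity) (by positivity)]
  refine add_le_add ?_ ?_
  · have hI : IntegrableOn (fun ρ : ℝ => ρ ^ (-σ) * (r⁻¹ * M)) (Ioc 0 r) :=
      ((intervalIntegrable_iff_integrableOn_Ioc_of_le hr.le).1
        (intervalIntegral.intervalIntegrable_rpow' (by linarith))).mul_const _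
    have h2 : ∫ ρ in Ioc 0 r, ρ ^ (-σ) * (r⁻¹ * M) = 1 / (1 - σ) * (r ^ (-σ) * M) := by
      rw [integral_mul_const, ← intervalIntegral.integral_of_le hr.le,
        integral_rpow (Or.inl (by linarith)), show -σ + 1 = 1 - σ by ring,
        Real.zero_rpow h1σ.ne', sub_eq_add_neg (1 : ℝ) σ, Real.rpow_add hr, Real.rpow_one]
      field_simp; ring
    rw [← h2, ofReal_integral_eq_lintegral_ofReal hI (ae_restrict_of_forall_mem measurableSet_Ioc
      fun ρ hρ => mul_nonneg (Real.rpow_nonneg hρ.1.le _) (by positivity))]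
    refine setLIntegral_mono' measurableSet_Ioc fun ρ hρ => ENNReal.ofReal_le_ofReal ?_
    have hρ0 : 0 < ρ := hρ.1
    calc ρ ^ (-σ - 1) * (min 1 (ρ / r) * M) ≤ ρ ^ (-σ - 1) * (ρ / r * M) := by
          gcongr; exact min_le_right _ _
      _ = ρ ^ (-σ) * (r⁻¹ * M) := by
          rw [Real.rpow_sub hρ0, Real.rpow_one]; field_simp
  · have hI : IntegrableOn (fun ρ : ℝ => ρ ^ (-σ - 1) * M) (Ioi r) :=
      (integrableOn_Ioi_rpow_of_lt (by linarith) hr).mul_const _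
    have h2 : ∫ ρ in Ioi r, ρ ^ (-σ - 1) * M = 1 / σ * (r ^ (-σ) * M) := by
      rw [integral_mul_const, integral_Ioi_rpow_of_lt (by linarith) hr,
        show -σ - 1 + 1 = -σ by ring, neg_div_neg_eq]
      ring
    rw [← h2, ofReal_integral_eq_lintegral_ofReal hI (ae_restrict_of_forall_mem measurableSet_Ioi
      fun ρ (hρ : r < ρ) => mul_nonneg (Real.rpow_nonneg (hr.trans hρ).le _) hM)]
    refine setLIntegral_mono' measurableSet_Ioi fun ρ (hρ : r < ρ) => ENNReal.ofReal_le_ofReal ?_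
    have hρ0 : 0 < ρ := hr.trans hρ
    gcongr
    exact mul_le_of_le_one_left hM (min_le_left _ _)

theorem energy_damp_T_le (S : SymmMarkovSemigroup μ) {σ r : ℝ} (hσ : 0 < σ) (hσ1 : σ < 1)
    (hr : 0 < r) (u : Lp ℝ 2 μ) : S.energy σ (S.damp.T r u)
      ≤ ENNReal.ofReal ((1 / (1 - σ) + 1 / σ) * r ^ (-σ) * ‖u‖ ^ 2) := by
  refine le_trans ?_ (lintegral_min_rpow_le hσ hσ1 hr (sq_nonneg ‖u‖))
  refine setLIntegral_mono' measurableSet_Ioi fun ρ (hρ : 0 < ρ) => ENNReal.ofReal_le_ofReal ?_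
  gcongr
  exact S.damp.form_T_le hρ.le hr u

theorem exists_bessel_eq_damp_T (S : SymmMarkovSemigroup μ) {σ : ℝ} (hσ : 0 < σ) (hσ1 : σ < 1) :
    ∃ C, 0 < C ∧ ∀ r, 0 < r → ∀ u, ∃ φ, S.bessel σ φ = S.damp.T r u ∧
      ‖φ‖ ≤ C * r ^ (-σ / 2) * ‖u‖ := by
  obtain ⟨C, hC, h⟩ := S.exists_bessel_eq_of_energy_le hσ hσ1
  have h1σ : 0 < 1 - σ := by linarith
  refine ⟨Real.sqrt (C * (1 / (1 - σ) + 1 / σ)), by positivity, fun r hr u => ?_⟩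
  obtain ⟨φ, h1, h2⟩ := h (S.damp.T r u) _ (by positivity) (S.energy_damp_T_le hσ hσ1 hr u)
  refine ⟨φ, h1, ?_⟩
  refine abs_le_of_sq_le_sq' ?_ (by positivity) |>.2
  rw [mul_pow, mul_pow, Real.sq_sqrt (by positivity), ← Real.rpow_natCast (r ^ (-σ / 2)),
    ← Real.rpow_mul hr.le]
  refine h2.trans (le_of_eq ?_)
  rw [show -σ / 2 * ((2 : ℕ) : ℝ) = -σ by push_cast; ring]
  ring

/-! ### The spaces of bounded potentials -/

namespace Pot

variable {S : SymmMarkovSemigroup μ} {σ : ℝ}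

theorem toL2_equiv (φ : Lp ℝ 2 μ) : toL2 S σ (equiv S σ φ) = S.bessel σ φ := rfl

theorem norm_equiv (φ : Lp ℝ 2 μ) : ‖equiv S σ φ‖ = ‖φ‖ := by
  rw [norm_def, LinearEquiv.symm_apply_apply]

theorem toL2_injective : Function.Injective (toL2 S σ) := fun u v h => by
  obtain ⟨f, rfl⟩ := (equiv S σ).surjective u
  obtain ⟨g, rfl⟩ := (equiv S σ).surjective v
  rw [toL2_equiv, toL2_equiv] at h
  rw [S.bessel_injective σ h]

end Pot

namespace BddPot

variable {S : SymmMarkovSemigroup μ} {σ : ℝ}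

/-- The element of `H^σ_∞` given by a Bessel potential and its bounded version. -/
def mk (φ : Lp ℝ 2 μ) (b : Lp ℝ ∞ μ) (h : S.bessel σ φ =ᵐ[μ] b) : S.BddPot σ :=
  ⟨WithLp.toLp 1 (Pot.equiv S σ φ, b), h⟩

theorem toL2_mk (φ : Lp ℝ 2 μ) (b : Lp ℝ ∞ μ) (h : S.bessel σ φ =ᵐ[μ] b) :
    (mk φ b h).toL2 = S.bessel σ φ := rfl

theorem norm_eq (u : S.BddPot σ) :
    ‖u‖ = ‖(u : ↥(S.bddPotSubmodule σ)).1.fst‖ + ‖(u : ↥(S.bddPotSubmodule σ)).1.snd‖ :=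
  WithLp.prod_norm_eq_of_L1 _

theorem norm_mk (φ : Lp ℝ 2 μ) (b : Lp ℝ ∞ μ) (h : S.bessel σ φ =ᵐ[μ] b) :
    ‖mk φ b h‖ = ‖φ‖ + ‖b‖ := by
  rw [norm_eq]
  exact congrArg₂ _ (Pot.norm_equiv φ) rfl

/-- The inclusion `H^σ_∞(μ) ⊆ L₂(μ)` as a continuous linear map. -/
def toL2L (S : SymmMarkovSemigroup μ) (σ : ℝ) : S.BddPot σ →L[ℝ] Lp ℝ 2 μ :=
  (Pot.toL2 S σ) ∘L (WithLp.fstL 1 ℝ (S.Pot σ) (Lp ℝ ∞ μ)) ∘L (S.bddPotSubmodule σ).subtypeL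

theorem toL2L_apply (u : S.BddPot σ) : toL2L S σ u = u.toL2 := rfl

theorem toL2_injective : Function.Injective (toL2 : S.BddPot σ → Lp ℝ 2 μ) := fun u v h => by
  have h1 := Pot.toL2_injective h
  have h2 : (u : ↥(S.bddPotSubmodule σ)).1.snd = (v : ↥(S.bddPotSubmodule σ)).1.snd := by
    ext1
    have hu : Pot.toL2 S σ (u : ↥(S.bddPotSubmodule σ)).1.fst =ᵐ[μ] _ := u.2
    have hv : Pot.toL2 S σ (v : ↥(S.bddPotSubmodule σ)).1.fst =ᵐ[μ] _ := v.2
    rw [h1] at hu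
    exact hu.symm.trans hv
  refine Subtype.ext ?_
  exact (WithLp.ofLp_injective 1) (Prod.ext h1 h2)

theorem ae_abs_le (u : S.BddPot σ) : ∀ᵐ x ∂μ, |u.toL2 x| ≤ ‖u‖ := by
  have h1 : u.toL2 =ᵐ[μ] (u : ↥(S.bddPotSubmodule σ)).1.snd := u.2
  have h2 := ae_le_eLpNormEssSup (f := (u : ↥(S.bddPotSubmodule σ)).1.snd) (μ := μ)
  filter_upwards [h1, h2] with x hx h3
  rw [hx, norm_eq]
  have h4 : ‖(u : ↥(S.bddPotSubmodule σ)).1.snd x‖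
      ≤ ‖(u : ↥(S.bddPotSubmodule σ)).1.snd‖ := by
    rw [Lp.norm_def, eLpNorm_exponent_top]
    rw [← toReal_enorm]
    refine ENNReal.toReal_mono ?_ h3
    have := Lp.eLpNorm_ne_top (u : ↥(S.bddPotSubmodule σ)).1.snd
    rwa [eLpNorm_exponent_top] at this
  rw [Real.norm_eq_abs] at h4
  linarith [norm_nonneg (u : ↥(S.bddPotSubmodule σ)).1.fst]

theorem exists_bessel_eq (u : S.BddPot σ) : ∃ φ, S.bessel σ φ = u.toL2 ∧ ‖φ‖ ≤ ‖u‖ := by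
  refine ⟨(Pot.equiv S σ).symm (u : ↥(S.bddPotSubmodule σ)).1.fst, ?_, ?_⟩
  · rw [← Pot.toL2_equiv, LinearEquiv.apply_symm_apply]; rfl
  · rw [← Pot.norm_def, norm_eq]
    linarith [norm_nonneg (u : ↥(S.bddPotSubmodule σ)).1.snd]

theorem norm_toL2_le (u : S.BddPot σ) : ‖u.toL2‖ ≤ ‖u‖ := by
  obtain ⟨φ, h, h'⟩ := u.exists_bessel_eq
  rw [← h]
  exact (S.norm_bessel_le σ φ).trans h'

theorem toL2_add (u v : S.BddPot σ) : (u + v).toL2 = u.toL2 + v.toL2 := (toL2L S σ).map_add u v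
theorem toL2_sub (u v : S.BddPot σ) : (u - v).toL2 = u.toL2 - v.toL2 := (toL2L S σ).map_sub u v
theorem toL2_smul (c : ℝ) (u : S.BddPot σ) : (c • u).toL2 = c • u.toL2 :=
  (toL2L S σ).map_smul c u
theorem toL2_zero : (0 : S.BddPot σ).toL2 = 0 := (toL2L S σ).map_zero

theorem exists_of_bessel_eq (φ w : Lp ℝ 2 μ) (h : S.bessel σ φ = w) {M : ℝ} (hM : 0 ≤ M)
    (hw : ∀ᵐ x ∂μ, |w x| ≤ M) : ∃ u : S.BddPot σ, u.toL2 = w ∧ ‖u‖ ≤ ‖φ‖ + M := by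
  have hb : MemLp w ∞ μ := memLp_top_of_bound (Lp.aestronglyMeasurable w) M hw
  refine ⟨mk φ (hb.toLp w) (by rw [h]; exact hb.coeFn_toLp.symm), by rw [toL2_mk, h], ?_⟩
  rw [norm_mk]
  gcongr
  rw [Lp.norm_toLp]
  refine ENNReal.toReal_le_of_le_ofReal hM ?_
  rw [eLpNorm_exponent_top]
  exact eLpNormEssSup_le_of_ae_bound hw

/-- The inclusion `H^δ_∞ ⊆ H^σ_∞` for `σ ≤ δ`. -/
theorem exists_incl {δ : ℝ} (hσ : 0 < σ) (hσδ : σ ≤ δ) (u : S.BddPot δ) :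
    ∃ v : S.BddPot σ, v.toL2 = u.toL2 ∧ ‖v‖ ≤ ‖u‖ := by
  rcases hσδ.eq_or_lt with rfl | hlt
  · exact ⟨u, rfl, le_rfl⟩
  have hsum : σ + (δ - σ) = δ := by ring
  let φ := (Pot.equiv S δ).symm (u : ↥(S.bddPotSubmodule δ)).1.fst
  have hφ : S.bessel δ φ = u.toL2 := by
    rw [← Pot.toL2_equiv, LinearEquiv.apply_symm_apply]; rfl
  have h1 : S.bessel σ (S.bessel (δ - σ) φ) = u.toL2 := by
    rw [S.bessel_bessel hσ (sub_pos.2 hlt), hsum, hφ]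
  refine ⟨mk (S.bessel (δ - σ) φ) (u : ↥(S.bddPotSubmodule δ)).1.snd ?_, by rw [toL2_mk, h1], ?_⟩
  · rw [h1]; exact u.2
  · rw [norm_mk, norm_eq, Pot.norm_def (u : ↥(S.bddPotSubmodule δ)).1.fst]
    gcongr
    exact S.norm_bessel_le _ _

theorem energy_toL2_le (hσ : 0 < σ) (hσ1 : σ < 1) (u : S.BddPot σ) :
    S.energy σ u.toL2 ≤ ENNReal.ofReal ((Real.Gamma σ)⁻¹ * truncMass σ * ‖u‖ ^ 2) := by
  obtain ⟨φ, h, h'⟩ := u.exists_bessel_eq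
  rw [← h]
  refine (S.energy_bessel_le hσ hσ1 φ).trans (ENNReal.ofReal_le_ofReal ?_)
  have := truncMass_pos hσ hσ1
  have := Real.Gamma_pos_of_pos hσ
  gcongr

end BddPot

theorem form_smul (S : SymmMarkovSemigroup μ) (r c : ℝ) (u : Lp ℝ 2 μ) :
    S.form r (c • u) = c ^ 2 * S.form r u := by
  simp only [form, map_smul, ← smul_sub, inner_smul_left, inner_smul_right, conj_trivial]
  ring

theorem energy_le_of_abs_le (S : SymmMarkovSemigroup μ) {ι : Type*} [Fintype ι] (σ : ℝ)
    (h : Lp ℝ 2 μ) (w : ι → Lp ℝ 2 μ) {c N : ι → ℝ} (hc : ∀ i, 0 ≤ c i) (hN : ∀ i, 0 ≤ N i)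
    (hE : ∀ i, S.energy σ (w i) ≤ ENNReal.ofReal (N i ^ 2))
    (p : X → Prop) (hp : ∀ᵐ x ∂μ, p x)
    (H : ∀ x y, p x → p y → |h x - h y| ≤ ∑ i, c i * |w i x - w i y|)
    (H0 : ∀ x, p x → |h x| ≤ ∑ i, c i * |w i x|) :
    S.energy σ h ≤ ENNReal.ofReal (Fintype.card ι * (∑ i, c i * N i) ^ 2) := by
  set n : ℝ := (Fintype.card ι : ℝ) with hn
  have hn0 : 0 ≤ n := Nat.cast_nonneg _
  have hsq : ∀ (t : ℝ) (a : ι → ℝ), |t| ≤ ∑ i, c i * |a i| →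
      t ^ 2 ≤ ∑ i, (Real.sqrt n * c i * a i) ^ 2 := fun t a ht => by
    have h1 : t ^ 2 ≤ (∑ i, c i * |a i|) ^ 2 := by
      rw [← sq_abs t]; gcongr
    refine h1.trans ((sq_sum_le_card_mul_sum_sq).trans (le_of_eq ?_))
    rw [Finset.mul_sum]
    refine Finset.sum_congr rfl fun i _ => ?_
    rw [mul_pow, mul_pow, mul_pow, Real.sq_sqrt hn0, sq_abs, Finset.card_univ]
    ring
  have hform : ∀ r, 0 < r → S.damp.form r h ≤ ∑ i, n * c i ^ 2 * S.damp.form r (w i) := by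
    intro r hr
    have h1 := S.damp.form_le_sum hr.le h (fun i => (Real.sqrt n * c i) • w i)
      (fun x => p x ∧ ∀ i, ((Real.sqrt n * c i) • w i : Lp ℝ 2 μ) x = Real.sqrt n * c i * w i x)
      (hp.and (ae_all_iff.2 fun i => Lp.coeFn_smul _ _))
      (fun x y hx hy => by
        refine (hsq _ (fun i => w i x - w i y) (H x y hx.1 hy.1)).trans (le_of_eq ?_)
        refine Finset.sum_congr rfl fun i _ => ?_
        rw [hx.2 i, hy.2 i]; ring)
      (fun x hx => by
        refine (hsq _ (fun i => w i x) (H0 x hx.1)).trans (le_of_eq ?_)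
        refine Finset.sum_congr rfl fun i _ => ?_
        rw [hx.2 i])
    refine h1.trans (le_of_eq (Finset.sum_congr rfl fun i _ => ?_))
    rw [form_smul, mul_pow, Real.sq_sqrt hn0]
  calc S.energy σ h
      ≤ ∫⁻ r in Ioi (0 : ℝ), ∑ i, ENNReal.ofReal (n * c i ^ 2) *
          ENNReal.ofReal (r ^ (-σ - 1) * S.damp.form r (w i)) := by
        refine setLIntegral_mono' measurableSet_Ioi fun r (hr : 0 < r) => ?_
        simp_rw [← ENNReal.ofReal_mul (mul_nonneg hn0 (sq_nonneg _))]
        rw [← ENNReal.ofReal_sum_of_nonneg fun i _ => mul_nonneg (mul_nonneg hn0 (sq_nonneg _))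
          (mul_nonneg (Real.rpow_nonneg hr.le _) (S.damp.form_nonneg hr.le _))]
        refine ENNReal.ofReal_le_ofReal ?_
        calc r ^ (-σ - 1) * S.damp.form r h
            ≤ r ^ (-σ - 1) * ∑ i, n * c i ^ 2 * S.damp.form r (w i) := by
              gcongr; exact hform r hr
          _ = _ := by
              rw [Finset.mul_sum]
              exact Finset.sum_congr rfl fun i _ => by ring
    _ = ∑ i, ENNReal.ofReal (n * c i ^ 2) * S.energy σ (w i) := by
        rw [lintegral_finsetSum']
        · exact Finset.sum_congr rfl fun i _ => lintegral_const_mul' _ _ ENNReal.ofReal_ne_top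
        · intro i _
          refine AEMeasurable.const_mul (AEMeasurable.ennreal_ofReal
            (AEMeasurable.mul (by fun_prop) ?_)) _
          exact ((S.damp.continuousOn_form (w i)).mono Ioi_subset_Ici_self).aemeasurable
            measurableSet_Ioi
    _ ≤ ∑ i, ENNReal.ofReal (n * c i ^ 2) * ENNReal.ofReal (N i ^ 2) := by
        gcongr with i; exact hE i
    _ ≤ _ := by
        simp_rw [← ENNReal.ofReal_mul (mul_nonneg hn0 (sq_nonneg _))]
        rw [← ENNReal.ofReal_sum_of_nonneg fun i _ =>
          mul_nonneg (mul_nonneg hn0 (sq_nonneg _)) (sq_nonneg _)]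
        refine ENNReal.ofReal_le_ofReal ?_
        have h2 : ∑ i, (c i * N i) ^ 2 ≤ (∑ i, c i * N i) ^ 2 :=
          Finset.sum_sq_le_sq_sum_of_nonneg fun i _ => mul_nonneg (hc i) (hN i)
        calc ∑ i, n * c i ^ 2 * N i ^ 2 = n * ∑ i, (c i * N i) ^ 2 := by
              rw [Finset.mul_sum]; exact Finset.sum_congr rfl fun i _ => by ring
          _ ≤ _ := by gcongr

/-- A function dominated by elements of `H^σ_∞`, in the sense of normal contractions,
belongs to `H^σ_∞`. -/
theorem exists_bddPot_of_abs_le (S : SymmMarkovSemigroup μ) {σ : ℝ} (hσ : 0 < σ) (hσ1 : σ < 1)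
    (ι : Type*) [Fintype ι] : ∃ C, 0 < C ∧ ∀ (h : X → ℝ) (w : ι → S.BddPot σ) (c : ι → ℝ)
      (p : X → Prop), AEStronglyMeasurable h μ → (∀ i, 0 ≤ c i) → (∀ᵐ x ∂μ, p x) →
      (∀ x y, p x → p y → |h x - h y| ≤ ∑ i, c i * |(w i).toL2 x - (w i).toL2 y|) →
      (∀ x, p x → |h x| ≤ ∑ i, c i * |(w i).toL2 x|) →
      ∃ u : S.BddPot σ, u.toL2 =ᵐ[μ] h ∧ ‖u‖ ≤ C * ∑ i, c i * ‖w i‖ := by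
  obtain ⟨C, hC, hCE⟩ := S.exists_bessel_eq_of_energy_le hσ hσ1
  have hm := truncMass_pos hσ hσ1
  have hΓ := Real.Gamma_pos_of_pos hσ
  set K : ℝ := (Real.Gamma σ)⁻¹ * truncMass σ with hK
  have hK0 : 0 < K := by positivity
  refine ⟨Real.sqrt (C * (Fintype.card ι * K)) + 1, by positivity, ?_⟩
  intro h w c p hh hc hp H H0
  have hL : MemLp h 2 μ := by
    have h1 : MemLp (fun x => ∑ i, c i * |(w i).toL2 x|) 2 μ :=
      memLp_finsetSum _ fun i _ => (Lp.memLp (w i).toL2).abs.const_mul (c i)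
    refine h1.mono hh (hp.mono fun x hx => ?_)
    rw [Real.norm_eq_abs]
    exact (H0 x hx).trans (le_abs_self _)
  have hpp : ∀ᵐ x ∂μ, p x ∧ hL.toLp h x = h x := hp.and hL.coeFn_toLp
  set A : ℝ := ∑ i, c i * ‖w i‖ with hA
  have hA0 : 0 ≤ A := Finset.sum_nonneg fun i _ => mul_nonneg (hc i) (norm_nonneg _)
  have hE := S.energy_le_of_abs_le σ (hL.toLp h) (fun i => (w i).toL2) (c := c)
    (N := fun i => Real.sqrt K * ‖w i‖) hc (fun i => by positivity)
    (fun i => by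
      refine ((w i).energy_toL2_le hσ hσ1).trans (le_of_eq ?_)
      rw [mul_pow, Real.sq_sqrt hK0.le]) _ hpp
    (fun x y hx hy => by rw [hx.2, hy.2]; exact H x y hx.1 hy.1)
    (fun x hx => by rw [hx.2]; exact H0 x hx.1)
  have h2 : (∑ i, c i * (Real.sqrt K * ‖w i‖)) ^ 2 = K * A ^ 2 := by
    have : ∑ i, c i * (Real.sqrt K * ‖w i‖) = Real.sqrt K * A := by
      rw [hA, Finset.mul_sum]; exact Finset.sum_congr rfl fun i _ => by ring
    rw [this, mul_pow, Real.sq_sqrt hK0.le]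
  rw [h2] at hE
  obtain ⟨φ, h3, h4⟩ := hCE _ _ (by positivity) hE
  have hbd : ∀ᵐ x ∂μ, |hL.toLp h x| ≤ A := by
    filter_upwards [hpp, ae_all_iff.2 fun i => (w i).ae_abs_le] with x hx hw
    rw [hx.2]
    refine (H0 x hx.1).trans (Finset.sum_le_sum fun i _ => ?_)
    exact mul_le_mul_of_nonneg_left (hw i) (hc i)
  obtain ⟨u, hu, hu'⟩ := BddPot.exists_of_bessel_eq φ _ h3 hA0 hbd
  refine ⟨u, by rw [hu]; exact hL.coeFn_toLp, hu'.trans ?_⟩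
  rw [add_mul, one_mul]
  gcongr
  refine abs_le_of_sq_le_sq' ?_ (by positivity) |>.2
  rw [mul_pow, Real.sq_sqrt (by positivity)]
  refine h4.trans (le_of_eq ?_)
  ring

/-! ### Smoothing properties of the semigroup -/

/-- `P r : L₂ → Y` is the operator `T(r)`, regarded as an operator into a space `Y` that is mapped
to `L₂` by `ι`, and its norm is at most `K r^{-κ}` for `0 < r ≤ t₀`. -/
structure IsSmoothing (S : SymmMarkovSemigroup μ) {Y : Type*} [NormedAddCommGroup Y]
    [NormedSpace ℝ Y] (ι : Y →L[ℝ] Lp ℝ 2 μ) (t₀ κ K : ℝ) (P : ℝ → Lp ℝ 2 μ →L[ℝ] Y) : Prop where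
  apply_eq : ∀ r, 0 < r → ∀ v, ι (P r v) = S.T r v
  add_eq : ∀ r s, 0 < r → 0 ≤ s → ∀ v, P (r + s) v = P r (S.T s v)
  norm_le : ∀ r, 0 < r → r ≤ t₀ → ‖P r‖ ≤ K * r ^ (-κ)

theorem isSmoothing_id (S : SymmMarkovSemigroup μ) (t₀ : ℝ) :
    S.IsSmoothing (ContinuousLinearMap.id ℝ _) t₀ 0 1 S.T where
  apply_eq _ _ _ := rfl
  add_eq r s hr hs v := S.T_add r s hr.le hs v
  norm_le r hr _ := by
    simpa using ContinuousLinearMap.opNorm_le_bound _ zero_le_one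
      (fun u => by simpa using S.norm_T_le hr.le u)

theorem exists_isSmoothing (S : SymmMarkovSemigroup μ) {Y : Type*} [NormedAddCommGroup Y]
    [NormedSpace ℝ Y] (ι : Y →L[ℝ] Lp ℝ 2 μ) (hι : Function.Injective ι) {t₀ κ K : ℝ}
    (B : ℝ → ℝ) (hB0 : ∀ r, 0 < r → 0 ≤ B r) (hBK : ∀ r, 0 < r → r ≤ t₀ → B r ≤ K * r ^ (-κ))
    (hB : ∀ r, 0 < r → ∀ v, ∃ y, ι y = S.T r v ∧ ‖y‖ ≤ B r * ‖v‖) :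
    ∃ P, S.IsSmoothing ι t₀ κ K P := by
  choose! y hy hyB using hB
  let P : ℝ → Lp ℝ 2 μ →L[ℝ] Y := fun r =>
    if hr : 0 < r then
      LinearMap.mkContinuous
        { toFun := y r
          map_add' := fun u v => hι (by rw [map_add, hy r hr, hy r hr, hy r hr, map_add])
          map_smul' := fun c u => hι (by
            rw [map_smul, hy r hr, hy r hr, map_smul, RingHom.id_apply]) }
        (B r) (hyB r hr)
    else 0
  have hP : ∀ r, 0 < r → ∀ v, P r v = y r v := fun r hr v => by
    simp only [P, dif_pos hr]; rfl
  refine ⟨P, ⟨fun r hr v => by rw [hP r hr, hy r hr], fun r s hr hs v => hι ?_, fun r hr hrt => ?_⟩⟩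
  · rw [hP r hr, hP _ (by positivity), hy _ (by positivity), hy r hr, S.T_add r s hr.le hs]
  · refine (ContinuousLinearMap.opNorm_le_bound _ (hB0 r hr) fun v => ?_).trans (hBK r hr hrt)
    rw [hP r hr]; exact hyB r hr v

theorem rpow_neg_le_mul {a m r t₀ : ℝ} (ham : a ≤ m) (hr : 0 < r) (hrt : r ≤ t₀) :
    r ^ (-a) ≤ t₀ ^ (m - a) * r ^ (-m) := by
  have h1 : r ^ (-a) = r ^ (m - a) * r ^ (-m) := by
    rw [← Real.rpow_add hr]; congr 1; ring
  rw [h1]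
  exact mul_le_mul_of_nonneg_right (Real.rpow_le_rpow hr.le hrt (by linarith))
    (Real.rpow_nonneg hr.le _)

theorem exists_bessel_eq_T (S : SymmMarkovSemigroup μ) {σ : ℝ} (hσ : 0 < σ) (hσ1 : σ < 1) :
    ∃ C, 0 < C ∧ ∀ r, 0 < r → ∀ u, ∃ φ, S.bessel σ φ = S.T r u ∧
      ‖φ‖ ≤ C * Real.exp r * r ^ (-σ / 2) * ‖u‖ := by
  obtain ⟨C, hC, h⟩ := S.exists_bessel_eq_damp_T hσ hσ1
  refine ⟨C, hC, fun r hr u => ?_⟩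
  obtain ⟨φ, h1, h2⟩ := h r hr u
  refine ⟨Real.exp r • φ, by rw [map_smul, h1, ← T_eq_damp], ?_⟩
  rw [norm_smul, Real.norm_of_nonneg (Real.exp_pos r).le]
  calc _ ≤ Real.exp r * (C * r ^ (-σ / 2) * ‖u‖) := by gcongr
    _ = _ := by ring

theorem exists_isSmoothing_pot (S : SymmMarkovSemigroup μ) {σ : ℝ} (hσ : 0 < σ) (hσ1 : σ < 1)
    (t₀ : ℝ) : ∃ K, 0 < K ∧ ∃ P, S.IsSmoothing (Pot.toL2 S σ) t₀ (σ / 2) K P := by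
  obtain ⟨C, hC, h⟩ := S.exists_bessel_eq_T hσ hσ1
  refine ⟨C * Real.exp t₀, by positivity, S.exists_isSmoothing _ Pot.toL2_injective
    (fun r => C * Real.exp r * r ^ (-σ / 2)) (fun r hr => by positivity) (fun r hr hrt => ?_)
    fun r hr v => ?_⟩
  · rw [neg_div]
    gcongr
  · obtain ⟨φ, h1, h2⟩ := h r hr v
    exact ⟨Pot.equiv S σ φ, by rw [Pot.toL2_equiv, h1], by rwa [Pot.norm_equiv]⟩

theorem exists_isSmoothing_bddPot (S : SymmMarkovSemigroup μ) {dS : ℝ}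
    (hS : S.Ultracontractive dS) {σ : ℝ} (hσ : 0 < σ) (hσ1 : σ < 1) (t₀ : ℝ) :
    ∃ K, 0 < K ∧ ∃ P, S.IsSmoothing (BddPot.toL2L S σ) t₀ (max σ (dS / 2) / 2) K P := by
  obtain ⟨C, hC, h⟩ := S.exists_bessel_eq_T hσ hσ1
  obtain ⟨c, hc, ω, hω, -, hU⟩ := hS
  set m := max σ (dS / 2) with hm
  let K := C * Real.exp t₀ * t₀ ^ (m / 2 - σ / 2)
    + c * Real.exp (ω * t₀) * t₀ ^ (m / 2 - dS / 4)
  have hKr : ∀ r, 0 < r → r ≤ t₀ → C * Real.exp r * r ^ (-σ / 2)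
      + c * r ^ (-dS / 4) * Real.exp (ω * r) ≤ (|K| + 1) * r ^ (-(m / 2)) := by
    intro r hr hrt
    have ht₀ : 0 < t₀ := hr.trans_le hrt
    have h1 : r ^ (-σ / 2) ≤ t₀ ^ (m / 2 - σ / 2) * r ^ (-(m / 2)) := by
      rw [neg_div]
      exact rpow_neg_le_mul (by linarith [le_max_left σ (dS / 2)]) hr hrt
    have h2 : r ^ (-dS / 4) ≤ t₀ ^ (m / 2 - dS / 4) * r ^ (-(m / 2)) := by
      rw [neg_div]
      exact rpow_neg_le_mul (by linarith [le_max_right σ (dS / 2)]) hr hrt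
    have h3 : Real.exp r ≤ Real.exp t₀ := Real.exp_le_exp.2 hrt
    have h4 : Real.exp (ω * r) ≤ Real.exp (ω * t₀) := Real.exp_le_exp.2 (by gcongr)
    calc _ ≤ C * Real.exp t₀ * (t₀ ^ (m / 2 - σ / 2) * r ^ (-(m / 2)))
          + c * (t₀ ^ (m / 2 - dS / 4) * r ^ (-(m / 2))) * Real.exp (ω * t₀) := by
          gcongr
      _ = K * r ^ (-(m / 2)) := by simp only [K]; ring
      _ ≤ _ := by
          gcongr
          linarith [le_abs_self K]
  refine ⟨|K| + 1, by positivity, S.exists_isSmoothing _ BddPot.toL2_injective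
    (fun r => C * Real.exp r * r ^ (-σ / 2) + c * r ^ (-dS / 4) * Real.exp (ω * r))
    (fun r hr => by positivity) hKr fun r hr v => ?_⟩
  obtain ⟨φ, h1, h2⟩ := h r hr v
  have h3 : ∀ᵐ x ∂μ, |S.T r v x| ≤ c * r ^ (-dS / 4) * Real.exp (ω * r) * ‖v‖ := by
    have h4 := hU r hr v
    rw [eLpNorm_exponent_top] at h4
    filter_upwards [ae_le_eLpNormEssSup (f := S.T r v) (μ := μ)] with x hx
    have h5 := hx.trans h4
    rw [← ofReal_norm, Real.norm_eq_abs] at h5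
    exact (ENNReal.ofReal_le_ofReal_iff (by positivity)).1 h5
  obtain ⟨y, hy1, hy2⟩ := BddPot.exists_of_bessel_eq φ _ h1 (by positivity) h3
  refine ⟨y, hy1, hy2.trans ?_⟩
  rw [add_mul]
  gcongr

/-! ### Products with distributions and the operators `w ↦ T(r)(g w)` -/

/-- The pointwise product on `H^σ_∞`, with values in `H^σ`. -/
theorem exists_mul (S : SymmMarkovSemigroup μ) {σ : ℝ} (hσ : 0 < σ) (hσ1 : σ < 1) :
    ∃ m : S.BddPot σ →L[ℝ] S.BddPot σ →L[ℝ] S.Pot σ,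
      ∀ g v, Pot.toL2 S σ (m g v) =ᵐ[μ] fun x => g.toL2 x * v.toL2 x := by
  obtain ⟨C, hC, h⟩ := S.exists_bddPot_of_abs_le hσ hσ1 (Fin 2)
  have key : ∀ g v : S.BddPot σ, ∃ u : S.Pot σ,
      (Pot.toL2 S σ u =ᵐ[μ] fun x => g.toL2 x * v.toL2 x) ∧ ‖u‖ ≤ C * 2 * ‖g‖ * ‖v‖ := by
    intro g v
    obtain ⟨u, hu, hu'⟩ := h (fun x => g.toL2 x * v.toL2 x) ![g, v] ![‖v‖, ‖g‖]
      (fun x => |g.toL2 x| ≤ ‖g‖ ∧ |v.toL2 x| ≤ ‖v‖)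
      ((Lp.aestronglyMeasurable _).mul (Lp.aestronglyMeasurable _))
      (by intro i; fin_cases i <;> simp) (g.ae_abs_le.and v.ae_abs_le)
      (fun x y hx hy => by
        simp only [Fin.sum_univ_two, Matrix.cons_val_zero, Matrix.cons_val_one]
        have h1 : g.toL2 x * v.toL2 x - g.toL2 y * v.toL2 y
          = v.toL2 x * (g.toL2 x - g.toL2 y) + g.toL2 y * (v.toL2 x - v.toL2 y) := by ring
        rw [h1]
        refine (abs_add_le _ _).trans ?_
        rw [abs_mul, abs_mul]
        gcongr
        · exact hx.2
        · exact hy.1)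
      (fun x hx => by
        simp only [Fin.sum_univ_two, Matrix.cons_val_zero, Matrix.cons_val_one]
        rw [abs_mul]
        have h1 : |g.toL2 x| * |v.toL2 x| ≤ ‖v‖ * |g.toL2 x| := by
          rw [mul_comm]; gcongr; exact hx.2
        have h2 : 0 ≤ ‖g‖ * |v.toL2 x| := by positivity
        linarith)
    refine ⟨(u : ↥(S.bddPotSubmodule σ)).1.fst, hu, ?_⟩
    have h3 : ‖(u : ↥(S.bddPotSubmodule σ)).1.fst‖ ≤ ‖u‖ := by
      rw [BddPot.norm_eq]
      linarith [norm_nonneg (u : ↥(S.bddPotSubmodule σ)).1.snd]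
    refine h3.trans (hu'.trans (le_of_eq ?_))
    simp only [Fin.sum_univ_two, Matrix.cons_val_zero, Matrix.cons_val_one]
    ring
  choose m hm hmC using key
  have hinj : ∀ {a b : S.Pot σ}, Pot.toL2 S σ a =ᵐ[μ] Pot.toL2 S σ b → a = b := fun hab =>
    Pot.toL2_injective (Lp.ext hab)
  let mL : S.BddPot σ →ₗ[ℝ] S.BddPot σ →ₗ[ℝ] S.Pot σ := LinearMap.mk₂ ℝ m
    (fun g g' v => hinj (by
      rw [map_add]
      filter_upwards [hm (g + g') v, hm g v, hm g' v, Lp.coeFn_add (Pot.toL2 S σ (m g v))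
        (Pot.toL2 S σ (m g' v)), Lp.coeFn_add g.toL2 g'.toL2] with x h1 h2 h3 h4 h5
      rw [h1, h4, Pi.add_apply, h2, h3, BddPot.toL2_add, h5, Pi.add_apply, add_mul]))
    (fun c g v => hinj (by
      rw [map_smul]
      filter_upwards [hm (c • g) v, hm g v, Lp.coeFn_smul c (Pot.toL2 S σ (m g v)),
        Lp.coeFn_smul c g.toL2] with x h1 h2 h3 h4
      rw [h1, h3, Pi.smul_apply, h2, BddPot.toL2_smul, h4, Pi.smul_apply, smul_eq_mul,
        smul_eq_mul, mul_assoc]))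
    (fun g v v' => hinj (by
      rw [map_add]
      filter_upwards [hm g (v + v'), hm g v, hm g v', Lp.coeFn_add (Pot.toL2 S σ (m g v))
        (Pot.toL2 S σ (m g v')), Lp.coeFn_add v.toL2 v'.toL2] with x h1 h2 h3 h4 h5
      rw [h1, h4, Pi.add_apply, h2, h3, BddPot.toL2_add, h5, Pi.add_apply, mul_add]))
    (fun c g v => hinj (by
      rw [map_smul]
      filter_upwards [hm g (c • v), hm g v, Lp.coeFn_smul c (Pot.toL2 S σ (m g v)),
        Lp.coeFn_smul c v.toL2] with x h1 h2 h3 h4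
      rw [h1, h3, Pi.smul_apply, h2, BddPot.toL2_smul, h4, Pi.smul_apply, smul_eq_mul,
        smul_eq_mul, mul_left_comm]))
  exact ⟨mL.mkContinuous₂ (C * 2) hmC, hm⟩

/-- The operators `N(r) g w = T(r)(g w) ∈ L₂` for `g ∈ H^β_∞` and `w ∈ H^{-β}`. They are built
from the smoothing operators `Pβ : L₂ → H^β_∞` and the product `m` on `H^β_∞`. -/
theorem exists_dualFlow (S : SymmMarkovSemigroup μ) {β t₀ κ K : ℝ}
    {Pβ : ℝ → Lp ℝ 2 μ →L[ℝ] S.BddPot β} (hP : S.IsSmoothing (BddPot.toL2L S β) t₀ κ K Pβ)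
    (m : S.BddPot β →L[ℝ] S.BddPot β →L[ℝ] S.Pot β) :
    ∃ N : ℝ → S.BddPot β →L[ℝ] S.NegPot β →L[ℝ] Lp ℝ 2 μ,
      (∀ r g w v, inner ℝ (N r g w) v = w (m g (Pβ r v))) ∧
      (∀ r, 0 < r → r ≤ t₀ → ∀ g w, ‖N r g w‖ ≤ ‖m‖ * K * r ^ (-κ) * ‖g‖ * ‖w‖) ∧
      (∀ r s, 0 < r → 0 ≤ s → ∀ g w, N (r + s) g w = S.T s (N r g w)) := by
  let f : ℝ → S.BddPot β → S.NegPot β → Lp ℝ 2 μ := fun r g w =>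
    (InnerProductSpace.toDual ℝ (Lp ℝ 2 μ)).symm (w ∘L m g ∘L Pβ r)
  have hf : ∀ r g w v, inner ℝ (f r g w) v = w (m g (Pβ r v)) := fun r g w v => by
    simp only [f, InnerProductSpace.toDual_symm_apply]; rfl
  have hfn : ∀ r g w, ‖f r g w‖ ≤ ‖m‖ * ‖Pβ r‖ * ‖g‖ * ‖w‖ := fun r g w => by
    simp only [f, LinearIsometryEquiv.norm_map]
    calc ‖w ∘L m g ∘L Pβ r‖ ≤ ‖w‖ * (‖m g‖ * ‖Pβ r‖) :=
          (ContinuousLinearMap.opNorm_comp_le _ _).trans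
            (mul_le_mul_of_nonneg_left (ContinuousLinearMap.opNorm_comp_le _ _) (norm_nonneg _))
      _ ≤ ‖w‖ * ((‖m‖ * ‖g‖) * ‖Pβ r‖) := by
          gcongr; exact m.le_opNorm g
      _ = _ := by ring
  have hext : ∀ {a b : Lp ℝ 2 μ}, (∀ v, inner ℝ a v = inner ℝ b v) → a = b := fun h =>
    ext_inner_right ℝ h
  let fL : ℝ → S.BddPot β →ₗ[ℝ] S.NegPot β →ₗ[ℝ] Lp ℝ 2 μ := fun r => LinearMap.mk₂ ℝ (f r)
    (fun g g' w => hext fun v => by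
      rw [inner_add_left, hf, hf, hf, map_add, add_apply, map_add])
    (fun c g w => hext fun v => by
      rw [inner_smul_left, hf, hf, map_smul, smul_apply, map_smul]; rfl)
    (fun g w w' => hext fun v => by
      rw [inner_add_left, hf, hf, hf, add_apply])
    (fun c g w => hext fun v => by
      rw [inner_smul_left, hf, hf, smul_apply]; rfl)
  refine ⟨fun r => (fL r).mkContinuous₂ (‖m‖ * ‖Pβ r‖) (hfn r), hf, fun r hr hrt g w => ?_,
    fun r s hr hs g w => ?_⟩
  · refine (hfn r g w).trans ?_
    rw [mul_assoc ‖m‖ K]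
    gcongr
    exact hP.norm_le r hr hrt
  · refine hext fun v => ?_
    change inner ℝ (f (r + s) g w) v = inner ℝ (S.T s (f r g w)) v
    rw [S.T_symm s hs, hf, hf, hP.add_eq r s hr hs]

end SymmMarkovSemigroup

/-- A family of bounded bilinear operators `M r`, `r > 0`, with the singularity `r^{-κ}` at `0` and
with the first and second differences of an analytic family. -/
structure IsSingularFamily {𝔾 Z Y : Type*} [NormedAddCommGroup 𝔾] [NormedSpace ℝ 𝔾]
    [NormedAddCommGroup Z] [NormedSpace ℝ Z] [NormedAddCommGroup Y] [NormedSpace ℝ Y]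
    (t₀ κ K : ℝ) (M : ℝ → 𝔾 →L[ℝ] Z →L[ℝ] Y) : Prop where
  norm_le : ∀ r, 0 < r → r ≤ t₀ → ‖M r‖ ≤ K * r ^ (-κ)
  diff_le : ∀ r h, 0 < r → r ≤ t₀ → 0 ≤ h → ‖M (r + h) - M r‖ ≤ K * r ^ (-κ) * min 1 (h / r)
  diff_diff_le : ∀ r h k, 0 < r → r ≤ t₀ → 0 ≤ h → 0 ≤ k →
    ‖M (r + h + k) - M (r + h) - M (r + k) + M r‖
      ≤ K * r ^ (-κ) * min 1 (h / r) * min 1 (k / r)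

namespace SymmMarkovSemigroup

variable {X : Type*} [MeasurableSpace X] {μ : Measure X}

section opM

variable {𝔾 Z Y : Type*} [NormedAddCommGroup 𝔾] [NormedSpace ℝ 𝔾]
    [NormedAddCommGroup Z] [NormedSpace ℝ Z] [NormedAddCommGroup Y] [NormedSpace ℝ Y]

/-- The operator `P(r/2) N(r/2)`. -/
def opM (P : ℝ → Lp ℝ 2 μ →L[ℝ] Y) (N : ℝ → 𝔾 →L[ℝ] Z →L[ℝ] Lp ℝ 2 μ) (r : ℝ) :
    𝔾 →L[ℝ] Z →L[ℝ] Y :=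
  (ContinuousLinearMap.compL ℝ Z (Lp ℝ 2 μ) Y (P (r / 2))) ∘L N (r / 2)

theorem opM_apply (P : ℝ → Lp ℝ 2 μ →L[ℝ] Y) (N : ℝ → 𝔾 →L[ℝ] Z →L[ℝ] Lp ℝ 2 μ) (r : ℝ) (g : 𝔾)
    (w : Z) : opM P N r g w = P (r / 2) (N (r / 2) g w) := rfl

variable {S : SymmMarkovSemigroup μ} {ι : Y →L[ℝ] Lp ℝ 2 μ} {t₀ κP KP κN KN : ℝ}
  {P : ℝ → Lp ℝ 2 μ →L[ℝ] Y} {N : ℝ → 𝔾 →L[ℝ] Z →L[ℝ] Lp ℝ 2 μ}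

theorem ι_opM (hP : S.IsSmoothing ι t₀ κP KP P)
    (hN : ∀ r s, 0 < r → 0 ≤ s → ∀ g w, N (r + s) g w = S.T s (N r g w)) {r : ℝ} (hr : 0 < r)
    (g : 𝔾) (w : Z) : ι (opM P N r g w) = N r g w := by
  rw [opM_apply, hP.apply_eq _ (by positivity), ← hN _ _ (by positivity) (by positivity),
    add_halves]

theorem opM_add (hP : S.IsSmoothing ι t₀ κP KP P)
    (hN : ∀ r s, 0 < r → 0 ≤ s → ∀ g w, N (r + s) g w = S.T s (N r g w)) {r h : ℝ} (hr : 0 < r)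
    (hh : 0 ≤ h) (g : 𝔾) (w : Z) :
    opM P N (r + h) g w = P (r / 4) (S.T (r / 2 + h) (N (r / 4) g w)) := by
  rw [opM_apply, show (r + h) / 2 = r / 4 + (r / 4 + h / 2) by ring,
    hN _ _ (by positivity) (by positivity), hP.add_eq _ _ (by positivity) (by positivity),
    ← S.T_add _ _ (by positivity) (by positivity)]
  congr 3; ring

theorem isSingularFamily_opM (hKP : 0 ≤ KP) (hKN : 0 ≤ KN)
    (hP : S.IsSmoothing ι t₀ κP KP P)
    (hN : ∀ r s, 0 < r → 0 ≤ s → ∀ g w, N (r + s) g w = S.T s (N r g w))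
    (hNb : ∀ r, 0 < r → r ≤ t₀ → ∀ g w, ‖N r g w‖ ≤ KN * r ^ (-κN) * ‖g‖ * ‖w‖) :
    IsSingularFamily t₀ (κP + κN) (16 * (KP * KN * 4 ^ (κP + κN))) (opM P N) := by
  have hmin4 : ∀ r h : ℝ, 0 < r → 0 ≤ h → min 1 (h / (r / 4)) ≤ 4 * min 1 (h / r) := by
    intro r h hr hh
    rw [mul_min_of_nonneg _ _ (by norm_num : (0 : ℝ) ≤ 4)]
    refine min_le_min (by norm_num) (le_of_eq ?_)
    field_simp
  have key : ∀ r, 0 < r → r ≤ t₀ → ∀ (L : Lp ℝ 2 μ → Lp ℝ 2 μ) (c : ℝ), 0 ≤ c →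
      (∀ v, ‖L v‖ ≤ c * ‖v‖) → ∀ g w, ‖P (r / 4) (L (N (r / 4) g w))‖
        ≤ KP * KN * 4 ^ (κP + κN) * r ^ (-(κP + κN)) * c * ‖g‖ * ‖w‖ := by
    intro r hr hrt L c hc hL g w
    have h4 : r / 4 ≤ t₀ := by linarith
    have hr4 : 0 < r / 4 := by positivity
    have hpow : ∀ κ : ℝ, (r / 4) ^ (-κ) = 4 ^ κ * r ^ (-κ) := fun κ => by
      rw [Real.div_rpow hr.le (by norm_num), Real.rpow_neg (by norm_num : (0 : ℝ) ≤ 4),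
        div_inv_eq_mul, mul_comm]
    calc ‖P (r / 4) (L (N (r / 4) g w))‖ ≤ ‖P (r / 4)‖ * ‖L (N (r / 4) g w)‖ :=
          (P (r / 4)).le_opNorm _
      _ ≤ (KP * (r / 4) ^ (-κP)) * (c * (KN * (r / 4) ^ (-κN) * ‖g‖ * ‖w‖)) := by
          gcongr
          · exact hP.norm_le _ hr4 h4
          · exact (hL _).trans (mul_le_mul_of_nonneg_left (hNb _ hr4 h4 g w) hc)
      _ = _ := by
          rw [hpow, hpow, Real.rpow_add (by norm_num : (0 : ℝ) < 4),
            show -(κP + κN) = -κP + -κN by ring, Real.rpow_add hr]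
          ring
  have hC : 0 ≤ KP * KN * 4 ^ (κP + κN) := by positivity
  have h0 : ∀ r, 0 < r → ∀ g w, opM P N r g w = P (r / 4) (S.T (r / 2) (N (r / 4) g w)) :=
    fun r hr g w => by simpa using opM_add hP hN hr le_rfl g w
  constructor
  · intro r hr hrt
    refine ContinuousLinearMap.opNorm_le_bound₂ _ (by positivity) fun g w => ?_
    rw [h0 r hr]
    refine (key r hr hrt (S.T (r / 2)) 1 zero_le_one
      (fun v => by simpa using S.norm_T_le (by positivity) v) g w).trans ?_
    have h5 : 0 ≤ KP * KN * 4 ^ (κP + κN) * r ^ (-(κP + κN)) := by positivity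
    calc _ = 1 * (KP * KN * 4 ^ (κP + κN) * r ^ (-(κP + κN))) * ‖g‖ * ‖w‖ := by ring
      _ ≤ 16 * (KP * KN * 4 ^ (κP + κN) * r ^ (-(κP + κN))) * ‖g‖ * ‖w‖ := by
          gcongr; norm_num
      _ = _ := by ring
  · intro r h hr hrt hh
    have hm : 0 ≤ min 1 (h / r) := le_min zero_le_one (by positivity)
    refine ContinuousLinearMap.opNorm_le_bound₂ _ (by positivity) fun g w => ?_
    rw [sub_apply, sub_apply, h0 r hr, opM_add hP hN hr hh, ← map_sub]
    refine (key r hr hrt (fun v => S.T (r / 2 + h) v - S.T (r / 2) v) (4 * min 1 (h / r))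
      (by positivity) (fun v => ?_) g w).trans ?_
    · refine (S.norm_T_add_sub_le (by positivity) hh v).trans ?_
      gcongr
      refine le_trans (min_le_min le_rfl ?_) (hmin4 r h hr hh)
      gcongr
      norm_num
    · have : 0 ≤ KP * KN * 4 ^ (κP + κN) * r ^ (-(κP + κN)) * min 1 (h / r) := by positivity
      calc _ = 4 * (KP * KN * 4 ^ (κP + κN) * r ^ (-(κP + κN)) * min 1 (h / r)) * ‖g‖ * ‖w‖ := by
            ring
        _ ≤ 16 * (KP * KN * 4 ^ (κP + κN) * r ^ (-(κP + κN)) * min 1 (h / r)) * ‖g‖ * ‖w‖ := by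
            gcongr; norm_num
        _ = _ := by ring
  · intro r h k hr hrt hh hk
    have hm : 0 ≤ min 1 (h / r) := le_min zero_le_one (by positivity)
    have hm' : 0 ≤ min 1 (k / r) := le_min zero_le_one (by positivity)
    have hr4 : 0 < r / 4 := by positivity
    refine ContinuousLinearMap.opNorm_le_bound₂ _ (by positivity) fun g w => ?_
    let D : ℝ → Lp ℝ 2 μ → Lp ℝ 2 μ := fun h v => S.T (r / 4 + h) v - S.T (r / 4) v
    have hD : ∀ h, 0 ≤ h → ∀ v, ‖D h v‖ ≤ 4 * min 1 (h / r) * ‖v‖ := fun h hh v =>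
      (S.norm_T_add_sub_le hr4 hh v).trans
        (mul_le_mul_of_nonneg_right (hmin4 r h hr hh) (norm_nonneg _))
    have hDD : ∀ v, S.T (r / 2 + (h + k)) v - S.T (r / 2 + h) v - S.T (r / 2 + k) v
        + S.T (r / 2) v = D h (D k v) := fun v => by
      simp only [D, map_sub]
      rw [← S.T_add _ _ (by positivity) (by positivity), ← S.T_add _ _ (by positivity) hr4.le,
        ← S.T_add _ _ hr4.le (by positivity), ← S.T_add _ _ hr4.le hr4.le,
        show r / 4 + h + (r / 4 + k) = r / 2 + (h + k) by ring,
        show r / 4 + h + r / 4 = r / 2 + h by ring,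
        show r / 4 + (r / 4 + k) = r / 2 + k by ring, show r / 4 + r / 4 = r / 2 by ring]
      abel
    have hrew : (opM P N (r + h + k) - opM P N (r + h) - opM P N (r + k) + opM P N r) g w
        = P (r / 4) (D h (D k (N (r / 4) g w))) := by
      rw [← hDD, map_add, map_sub, map_sub, ← h0 r hr, ← opM_add hP hN hr hh,
        ← opM_add hP hN hr hk, ← opM_add hP hN hr (add_nonneg hh hk), ← add_assoc]
      rfl
    rw [hrew]
    refine (key r hr hrt (fun v => D h (D k v)) (4 * min 1 (h / r) * (4 * min 1 (k / r)))
      (by positivity) (fun v => ?_) g w).trans (le_of_eq (by ring))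
    refine (hD h hh _).trans ?_
    rw [mul_assoc (4 * min 1 (h / r))]
    exact mul_le_mul_of_nonneg_left (hD k hk v) (by positivity)

end opM

theorem IsSmoothedMul.eq {S : SymmMarkovSemigroup μ} {β δ r : ℝ} {g : X → ℝ}
    {L L' : S.NegPot β →L[ℝ] S.BddPot δ} (h : S.IsSmoothedMul β δ r g L)
    (h' : S.IsSmoothedMul β δ r g L') : L = L' := by
  ext1 w
  refine BddPot.toL2_injective (ext_inner_right ℝ fun v => ?_)
  obtain ⟨z, hz, hL⟩ := h w
  obtain ⟨z', hz', hL'⟩ := h' w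
  obtain ⟨k, hk, hk'⟩ := hL v
  obtain ⟨l, hl, hl'⟩ := hL' v
  have hkl : k = l := BddPot.toL2_injective (hk.trans hl.symm)
  subst hkl
  rw [hk', hl']
  obtain ⟨a, ha, ha'⟩ := hz k
  obtain ⟨b, hb, hb'⟩ := hz' k
  rw [ha', hb', Pot.toL2_injective (Lp.ext (ha.trans hb.symm))]

theorem smoothedMul_eq {S : SymmMarkovSemigroup μ} {β δ r : ℝ} {g : X → ℝ}
    {L : S.NegPot β →L[ℝ] S.BddPot δ} (h : S.IsSmoothedMul β δ r g L) :
    S.smoothedMul β δ r g = L := by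
  have hex : ∃ L, S.IsSmoothedMul β δ r g L := ⟨L, h⟩
  rw [smoothedMul, dif_pos hex]
  exact hex.choose_spec.eq h

theorem isSmoothedMul_opM {S : SymmMarkovSemigroup μ} {β δ t₀ κ K κ' K' : ℝ}
    {Pβ : ℝ → Lp ℝ 2 μ →L[ℝ] S.BddPot β} (hPβ : S.IsSmoothing (BddPot.toL2L S β) t₀ κ K Pβ)
    {P : ℝ → Lp ℝ 2 μ →L[ℝ] S.BddPot δ} (hP : S.IsSmoothing (BddPot.toL2L S δ) t₀ κ' K' P)
    {m : S.BddPot β →L[ℝ] S.BddPot β →L[ℝ] S.Pot β}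
    (hm : ∀ g v, Pot.toL2 S β (m g v) =ᵐ[μ] fun x => g.toL2 x * v.toL2 x)
    {N : ℝ → S.BddPot β →L[ℝ] S.NegPot β →L[ℝ] Lp ℝ 2 μ}
    (hNi : ∀ r g w v, inner ℝ (N r g w) v = w (m g (Pβ r v)))
    (hN : ∀ r s, 0 < r → 0 ≤ s → ∀ g w, N (r + s) g w = S.T s (N r g w))
    {r : ℝ} (hr : 0 < r) {g : X → ℝ} {g' : S.BddPot β} (hg : g'.toL2 =ᵐ[μ] g) :
    S.IsSmoothedMul β δ r g (opM P N r g') := by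
  intro w
  refine ⟨w ∘L m g', fun v => ⟨m g' v, ?_, rfl⟩, fun v => ⟨Pβ r v, hPβ.apply_eq r hr v, ?_⟩⟩
  · filter_upwards [hm g' v, hg] with x h1 h2
    rw [h1, h2]
  · have h1 := ι_opM hP hN hr g' w
    rw [BddPot.toL2L_apply] at h1
    rw [h1, hNi]
    rfl

end SymmMarkovSemigroup

/-! ### Superposition operators -/

/-- A second difference of a function with bounded Lipschitz derivative. -/
theorem abs_sub_sub_sub_le {g : ℝ → ℝ} (hg : Differentiable ℝ g) {B : ℝ}
    (hB : ∀ x, |deriv g x| ≤ B) {K : ℝ} (hK : ∀ x y, |deriv g x - deriv g y| ≤ K * |x - y|)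
    (p₁ p₂ q₁ q₂ : ℝ) :
    |(g p₁ - g p₂) - (g q₁ - g q₂)| ≤
      B * |(p₁ - p₂) - (q₁ - q₂)| + K * |q₁ - q₂| * (|p₁ - q₁| + |p₂ - q₂|) := by
  have hK0 : 0 ≤ K := by simpa using (abs_nonneg _).trans (hK 1 0)
  have hd : ∀ p₁ p₂ θ : ℝ, HasDerivAt (fun θ => g (p₂ + θ * (p₁ - p₂)))
      (deriv g (p₂ + θ * (p₁ - p₂)) * (p₁ - p₂)) θ := fun p₁ p₂ θ => by
    have h1 : HasDerivAt (fun θ : ℝ => p₂ + θ * (p₁ - p₂)) (p₁ - p₂) θ := by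
      simpa using ((hasDerivAt_id θ).mul_const (p₁ - p₂)).const_add p₂
    exact (hg _).hasDerivAt.comp θ h1
  have h := (convex_Icc (0 : ℝ) 1).norm_image_sub_le_of_norm_hasDerivWithin_le
    (f := fun θ => g (p₂ + θ * (p₁ - p₂)) - g (q₂ + θ * (q₁ - q₂)))
    (C := B * |(p₁ - p₂) - (q₁ - q₂)| + K * |q₁ - q₂| * (|p₁ - q₁| + |p₂ - q₂|))
    (fun θ _ => ((hd p₁ p₂ θ).sub (hd q₁ q₂ θ)).hasDerivWithinAt) (fun θ hθ => ?_)
    (left_mem_Icc.2 zero_le_one) (right_mem_Icc.2 zero_le_one)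
  · simp only [one_mul, zero_mul, add_zero, sub_zero, norm_one, mul_one, Real.norm_eq_abs] at h
    convert h using 1
    congr 1; ring_nf
  · set P := p₂ + θ * (p₁ - p₂)
    set Q := q₂ + θ * (q₁ - q₂)
    have h1 : |P - Q| ≤ |p₁ - q₁| + |p₂ - q₂| := by
      have : P - Q = θ * (p₁ - q₁) + (1 - θ) * (p₂ - q₂) := by simp only [P, Q]; ring
      rw [this]
      refine (abs_add_le _ _).trans ?_
      rw [abs_mul, abs_mul, abs_of_nonneg hθ.1, abs_of_nonneg (sub_nonneg.2 hθ.2)]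
      have := hθ.1; have := hθ.2
      nlinarith [abs_nonneg (p₁ - q₁), abs_nonneg (p₂ - q₂)]
    rw [Real.norm_eq_abs, show deriv g P * (p₁ - p₂) - deriv g Q * (q₁ - q₂)
      = deriv g P * ((p₁ - p₂) - (q₁ - q₂)) + (deriv g P - deriv g Q) * (q₁ - q₂) by ring]
    refine (abs_add_le _ _).trans ?_
    rw [abs_mul, abs_mul]
    calc _ ≤ B * |(p₁ - p₂) - (q₁ - q₂)| + (K * (|p₁ - q₁| + |p₂ - q₂|)) * |q₁ - q₂| := by
          gcongr
          · exact hB P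
          · exact (hK P Q).trans (by gcongr)
      _ = _ := by ring

/-- The mixed difference of third order which controls the increments in the space variable of the
second differences of a superposition operator. The letters `a`, `b` denote the functions, the
indices the two points of time, and a prime the second point of space. -/
theorem abs_third_diff_le {G : ℝ → ℝ} (hG : Differentiable ℝ G) (hG' : Differentiable ℝ (deriv G))
    {L B K : ℝ} (hL : ∀ x, |deriv G x| ≤ L) (hB : ∀ x, |deriv (deriv G) x| ≤ B)
    (hK : ∀ x y, |deriv (deriv G) x - deriv (deriv G) y| ≤ K * |x - y|)
    (a₁ b₁ a₂ b₂ a₁' b₁' a₂' b₂' : ℝ) {W V D : ℝ}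
    (hW : |(a₁' - b₁') - (a₂' - b₂')| ≤ W) (hV : |a₂' - b₂'| ≤ V)
    (hD : |a₁ - a₂| + |b₁ - b₂| ≤ D) (hD' : |a₁' - a₂'| + |b₁' - b₂'| ≤ D) :
    |(G a₁ - G b₁ - (G a₂ - G b₂)) - (G a₁' - G b₁' - (G a₂' - G b₂'))| ≤
      L * |((a₁ - b₁) - (a₂ - b₂)) - ((a₁' - b₁') - (a₂' - b₂'))|
      + B * W * (|a₁ - a₁'| + |b₁ - b₁'|)
      + B * D * |(a₂ - b₂) - (a₂' - b₂')|
      + V * (B * (|(a₁ - a₂) - (a₁' - a₂')| + |(b₁ - b₂) - (b₁' - b₂')|)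
        + K * D * (|a₁ - a₁'| + |b₁ - b₁'| + |a₂ - a₂'| + |b₂ - b₂'|)) := by
  have hL0 : 0 ≤ L := (abs_nonneg _).trans (hL 0)
  have hB0 : 0 ≤ B := (abs_nonneg _).trans (hB 0)
  have hK0 : 0 ≤ K := by simpa using (abs_nonneg _).trans (hK 1 0)
  have hW0 : 0 ≤ W := (abs_nonneg _).trans hW
  have hV0 : 0 ≤ V := (abs_nonneg _).trans hV
  have hLip : ∀ x y, |deriv G x - deriv G y| ≤ B * |x - y| := fun x y => by
    simpa using convex_univ.norm_image_sub_le_of_norm_deriv_le (f := deriv G)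
      (fun x _ => hG' x) (fun x _ => hB x) (mem_univ y) (mem_univ x)
  -- `c a b θ` runs from `b` to `a`
  let c : ℝ → ℝ → ℝ → ℝ := fun a b θ => b + θ * (a - b)
  have hc : ∀ a b a' b' θ, θ ∈ Icc (0 : ℝ) 1 → |c a b θ - c a' b' θ| ≤ |a - a'| + |b - b'| := by
    intro a b a' b' θ hθ
    have : c a b θ - c a' b' θ = θ * (a - a') + (1 - θ) * (b - b') := by simp only [c]; ring
    rw [this]
    refine (abs_add_le _ _).trans ?_
    rw [abs_mul, abs_mul, abs_of_nonneg hθ.1, abs_of_nonneg (sub_nonneg.2 hθ.2)]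
    have := hθ.1; have := hθ.2
    nlinarith [abs_nonneg (a - a'), abs_nonneg (b - b')]
  have hd : ∀ a b θ : ℝ, HasDerivAt (fun θ => G (c a b θ)) (deriv G (c a b θ) * (a - b)) θ := by
    intro a b θ
    have h1 : HasDerivAt (fun θ : ℝ => c a b θ) (a - b) θ := by
      simpa [c] using ((hasDerivAt_id θ).mul_const (a - b)).const_add b
    exact (hG _).hasDerivAt.comp θ h1
  set R : ℝ := L * |((a₁ - b₁) - (a₂ - b₂)) - ((a₁' - b₁') - (a₂' - b₂'))|
      + B * W * (|a₁ - a₁'| + |b₁ - b₁'|)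
      + B * D * |(a₂ - b₂) - (a₂' - b₂')|
      + V * (B * (|(a₁ - a₂) - (a₁' - a₂')| + |(b₁ - b₂) - (b₁' - b₂')|)
        + K * D * (|a₁ - a₁'| + |b₁ - b₁'| + |a₂ - a₂'| + |b₂ - b₂'|)) with hR
  have h := (convex_Icc (0 : ℝ) 1).norm_image_sub_le_of_norm_hasDerivWithin_le
    (f := fun θ => (G (c a₁ b₁ θ) - G (c a₂ b₂ θ)) - (G (c a₁' b₁' θ) - G (c a₂' b₂' θ)))
    (C := R)
    (fun θ _ => (((hd a₁ b₁ θ).sub (hd a₂ b₂ θ)).sub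
      ((hd a₁' b₁' θ).sub (hd a₂' b₂' θ))).hasDerivWithinAt) (fun θ hθ => ?_)
    (left_mem_Icc.2 zero_le_one) (right_mem_Icc.2 zero_le_one)
  · simp only [c, one_mul, zero_mul, add_zero, sub_zero, norm_one, mul_one, Real.norm_eq_abs,
      add_sub_cancel] at h
    refine le_trans (le_of_eq ?_) h
    congr 1; ring
  · set p₁ := c a₁ b₁ θ
    set p₂ := c a₂ b₂ θ
    set q₁ := c a₁' b₁' θ
    set q₂ := c a₂' b₂' θ
    have e1 : |p₁ - q₁| ≤ |a₁ - a₁'| + |b₁ - b₁'| := hc _ _ _ _ θ hθ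
    have e2 : |p₂ - q₂| ≤ |a₂ - a₂'| + |b₂ - b₂'| := hc _ _ _ _ θ hθ
    have e3 : |p₁ - p₂| ≤ D := (hc _ _ _ _ θ hθ).trans hD
    have e4 : |q₁ - q₂| ≤ D := (hc _ _ _ _ θ hθ).trans hD'
    have e5 : |(p₁ - p₂) - (q₁ - q₂)|
        ≤ |(a₁ - a₂) - (a₁' - a₂')| + |(b₁ - b₂) - (b₁' - b₂')| := by
      refine le_trans (le_of_eq ?_) (hc (a₁ - a₂) (b₁ - b₂) (a₁' - a₂') (b₁' - b₂') θ hθ)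
      congr 1; simp only [p₁, p₂, q₁, q₂, c]; ring
    have e6 := abs_sub_sub_sub_le hG' hB hK p₁ p₂ q₁ q₂
    have key : deriv G p₁ * (a₁ - b₁) - deriv G p₂ * (a₂ - b₂)
        - (deriv G q₁ * (a₁' - b₁') - deriv G q₂ * (a₂' - b₂'))
        = deriv G p₁ * (((a₁ - b₁) - (a₂ - b₂)) - ((a₁' - b₁') - (a₂' - b₂')))
          + (deriv G p₁ - deriv G q₁) * ((a₁' - b₁') - (a₂' - b₂'))
          + (deriv G p₁ - deriv G p₂) * ((a₂ - b₂) - (a₂' - b₂'))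
          + (a₂' - b₂') * ((deriv G p₁ - deriv G p₂) - (deriv G q₁ - deriv G q₂)) := by ring
    rw [Real.norm_eq_abs, key]
    refine (abs_add_le _ _).trans (add_le_add ((abs_add_le _ _).trans
      (add_le_add ((abs_add_le _ _).trans (add_le_add ?_ ?_)) ?_)) ?_)
    · rw [abs_mul]; gcongr; exact hL _
    · rw [abs_mul]
      calc _ ≤ (B * (|a₁ - a₁'| + |b₁ - b₁'|)) * W := by
            gcongr; exact (hLip _ _).trans (by gcongr)
        _ = _ := by ring
    · rw [abs_mul]; gcongr; exact (hLip _ _).trans (by gcongr)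
    · rw [abs_mul]
      gcongr
      refine e6.trans ?_
      have hD0 : 0 ≤ D := (abs_nonneg _).trans e3
      gcongr B * ?_ + K * ?_ * ?_
      linarith

namespace SymmMarkovSemigroup

variable {X : Type*} [MeasurableSpace X] {μ : Measure X}

theorem abs_sub_le_of_abs_deriv_le {G : ℝ → ℝ} (hG : Differentiable ℝ G) {L : ℝ}
    (hL : ∀ x, |deriv G x| ≤ L) (x y : ℝ) : |G x - G y| ≤ L * |x - y| := by
  simpa using convex_univ.norm_image_sub_le_of_norm_deriv_le (f := G)
    (fun x _ => hG x) (fun x _ => hL x) (mem_univ y) (mem_univ x)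

/-- The superposition operator `u ↦ G ∘ u` of a Lipschitz function acts in `H^β_∞`. -/
theorem exists_nemytskii (S : SymmMarkovSemigroup μ) {β : ℝ} (hβ : 0 < β) (hβ1 : β < 1)
    {G : ℝ → ℝ} (hG0 : G 0 = 0) (hG : Differentiable ℝ G) {L : ℝ} (hL : ∀ x, |deriv G x| ≤ L) :
    ∃ C, 0 ≤ C ∧ ∃ n : S.BddPot β → S.BddPot β,
      (∀ u, (n u).toL2 =ᵐ[μ] fun x => G (u.toL2 x)) ∧ ∀ u, ‖n u‖ ≤ C * ‖u‖ := by
  have hL0 : 0 ≤ L := (abs_nonneg _).trans (hL 0)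
  obtain ⟨C, hC, h⟩ := S.exists_bddPot_of_abs_le hβ hβ1 (Fin 1)
  have h2 : ∀ u : S.BddPot β, ∃ v : S.BddPot β, v.toL2 =ᵐ[μ] (fun x => G (u.toL2 x)) ∧
      ‖v‖ ≤ C * L * ‖u‖ := by
    intro u
    obtain ⟨v, hv, hv'⟩ := h (fun x => G (u.toL2 x)) (fun _ => u) (fun _ => L) (fun _ => True)
      (hG.continuous.comp_aestronglyMeasurable (Lp.aestronglyMeasurable _)) (fun _ => hL0)
      (by simp) (fun x y _ _ => by simpa using abs_sub_le_of_abs_deriv_le hG hL _ _)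
      (fun x _ => by simpa [hG0] using abs_sub_le_of_abs_deriv_le hG hL (u.toL2 x) 0)
    exact ⟨v, hv, by simpa [mul_assoc] using hv'⟩
  choose n hn hn' using h2
  exact ⟨C * L, by positivity, n, hn, hn'⟩

/-- Second differences of a superposition operator in `H^β_∞`. -/
theorem exists_norm_nemytskii_sub_sub_sub_le (S : SymmMarkovSemigroup μ) {β : ℝ} (hβ : 0 < β)
    (hβ1 : β < 1) {G : ℝ → ℝ} (hG : Differentiable ℝ G)
    (hG' : Differentiable ℝ (deriv G))
    {L B K : ℝ} (hL : ∀ x, |deriv G x| ≤ L) (hB : ∀ x, |deriv (deriv G) x| ≤ B)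
    (hK : ∀ x y, |deriv (deriv G) x - deriv (deriv G) y| ≤ K * |x - y|)
    {n : S.BddPot β → S.BddPot β} (hn : ∀ u, (n u).toL2 =ᵐ[μ] fun x => G (u.toL2 x)) :
    ∃ C, 0 ≤ C ∧ ∀ (a₁ b₁ a₂ b₂ : S.BddPot β) (M : ℝ), ‖a₁‖ ≤ M → ‖b₁‖ ≤ M → ‖a₂‖ ≤ M →
      ‖b₂‖ ≤ M → ‖(n a₁ - n b₁) - (n a₂ - n b₂)‖ ≤ C * (1 + M) *
        (‖(a₁ - b₁) - (a₂ - b₂)‖ + ‖a₂ - b₂‖ * (‖a₁ - a₂‖ + ‖b₁ - b₂‖)) := by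
  have hL0 : 0 ≤ L := (abs_nonneg _).trans (hL 0)
  have hB0 : 0 ≤ B := (abs_nonneg _).trans (hB 0)
  have hK0 : 0 ≤ K := by simpa using (abs_nonneg _).trans (hK 1 0)
  have hLip : ∀ x y, |deriv G x - deriv G y| ≤ B * |x - y| := abs_sub_le_of_abs_deriv_le hG' hB
  obtain ⟨C, hC, h⟩ := S.exists_bddPot_of_abs_le hβ hβ1 (Fin 8)
  refine ⟨C * (L + 2 * B + 4 * K), by positivity, fun a₁ b₁ a₂ b₂ M h1 h2 h3 h4 => ?_⟩
  have hM : 0 ≤ M := (norm_nonneg _).trans h1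
  set W := ‖(a₁ - b₁) - (a₂ - b₂)‖
  set V := ‖a₂ - b₂‖
  set D := ‖a₁ - a₂‖ + ‖b₁ - b₂‖
  obtain ⟨v, hv, hv'⟩ := h (fun x => (G (a₁.toL2 x) - G (b₁.toL2 x))
      - (G (a₂.toL2 x) - G (b₂.toL2 x)))
    ![(a₁ - b₁) - (a₂ - b₂), a₁, b₁, a₂ - b₂, a₁ - a₂, b₁ - b₂, a₂, b₂]
    ![L, B * W + K * V * D, B * W + K * V * D, B * D, B * V, B * V, K * V * D, K * V * D]
    (fun x => ((a₁ - b₁) - (a₂ - b₂)).toL2 x = (a₁.toL2 x - b₁.toL2 x) - (a₂.toL2 x - b₂.toL2 x) ∧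
      (a₂ - b₂).toL2 x = a₂.toL2 x - b₂.toL2 x ∧ (a₁ - a₂).toL2 x = a₁.toL2 x - a₂.toL2 x ∧
      (b₁ - b₂).toL2 x = b₁.toL2 x - b₂.toL2 x ∧
      |((a₁ - b₁) - (a₂ - b₂)).toL2 x| ≤ W ∧ |(a₂ - b₂).toL2 x| ≤ V ∧
      |(a₁ - a₂).toL2 x| ≤ ‖a₁ - a₂‖ ∧ |(b₁ - b₂).toL2 x| ≤ ‖b₁ - b₂‖)
    (by
      have hc : ∀ u : S.BddPot β, AEStronglyMeasurable (fun x => G (u.toL2 x)) μ := fun u =>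
        hG.continuous.comp_aestronglyMeasurable (Lp.aestronglyMeasurable _)
      exact ((hc _).sub (hc _)).sub ((hc _).sub (hc _)))
    (fun i => by fin_cases i <;> simp <;> positivity)
    (by
      have e : ∀ a b : S.BddPot β, ∀ᵐ x ∂μ, (a - b).toL2 x = a.toL2 x - b.toL2 x := fun a b => by
        rw [BddPot.toL2_sub]; exact Lp.coeFn_sub _ _
      filter_upwards [e (a₁ - b₁) (a₂ - b₂), e a₁ b₁, e a₂ b₂, e a₁ a₂, e b₁ b₂,
        ((a₁ - b₁) - (a₂ - b₂)).ae_abs_le, (a₂ - b₂).ae_abs_le, (a₁ - a₂).ae_abs_le,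
        (b₁ - b₂).ae_abs_le] with x e1 e2 e3 e4 e5 e6 e7 e8 e9
      exact ⟨by rw [e1, e2, e3], e3, e4, e5, e6, e7, e8, e9⟩)
    (by
      rintro x y ⟨x1, x2, x3, x4, x5, x6, x7, x8⟩ ⟨y1, y2, y3, y4, y5, y6, y7, y8⟩
      simp only [Fin.sum_univ_eight, Matrix.cons_val]
      rw [x1, x2, x3, x4, y1, y2, y3, y4]
      rw [x3] at x7
      rw [x4] at x8
      rw [y1] at y5
      rw [y2] at y6
      rw [y3] at y7
      rw [y4] at y8
      refine (abs_third_diff_le hG hG' hL hB hK _ _ _ _ _ _ _ _ y5 y6 (add_le_add x7 x8)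
        (add_le_add y7 y8)).trans (le_of_eq ?_)
      simp only [D]
      ring)
    (by
      rintro x ⟨x1, x2, x3, x4, x5, x6, x7, x8⟩
      simp only [Fin.sum_univ_eight, Matrix.cons_val]
      rw [x1, x2, x3, x4]
      rw [x3] at x7
      rw [x4] at x8
      have h5 := abs_sub_sub_sub_le hG hL hLip (a₁.toL2 x) (b₁.toL2 x) (a₂.toL2 x) (b₂.toL2 x)
      have h6 : B * |a₂.toL2 x - b₂.toL2 x| * (|a₁.toL2 x - a₂.toL2 x| + |b₁.toL2 x - b₂.toL2 x|)
          ≤ B * |a₂.toL2 x - b₂.toL2 x| * D := by gcongr; exact add_le_add x7 x8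
      have h7 : 0 ≤ (B * W + K * V * D) * |a₁.toL2 x| := by positivity
      have h8 : 0 ≤ (B * W + K * V * D) * |b₁.toL2 x| := by positivity
      have h9 : 0 ≤ B * V * |a₁.toL2 x - a₂.toL2 x| := by positivity
      have h10 : 0 ≤ B * V * |b₁.toL2 x - b₂.toL2 x| := by positivity
      have h11 : 0 ≤ K * V * D * |a₂.toL2 x| := by positivity
      have h12 : 0 ≤ K * V * D * |b₂.toL2 x| := by positivity
      linarith)
  have hveq : v = (n a₁ - n b₁) - (n a₂ - n b₂) := by
    apply BddPot.toL2_injective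
    ext1
    rw [BddPot.toL2_sub, BddPot.toL2_sub, BddPot.toL2_sub]
    filter_upwards [hv, hn a₁, hn b₁, hn a₂, hn b₂,
      Lp.coeFn_sub ((n a₁).toL2 - (n b₁).toL2) ((n a₂).toL2 - (n b₂).toL2),
      Lp.coeFn_sub (n a₁).toL2 (n b₁).toL2, Lp.coeFn_sub (n a₂).toL2 (n b₂).toL2]
      with x e1 e2 e3 e4 e5 e6 e7 e8
    rw [e6, Pi.sub_apply, e7, e8, Pi.sub_apply, Pi.sub_apply, e1, e2, e3, e4, e5]
  rw [← hveq]
  refine hv'.trans ?_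
  simp only [Fin.sum_univ_eight, Matrix.cons_val]
  have hD : 0 ≤ D := by positivity
  have hV : 0 ≤ V := norm_nonneg _
  have hW : 0 ≤ W := norm_nonneg _
  rw [mul_assoc C, mul_assoc C]
  refine mul_le_mul_of_nonneg_left ?_ hC.le
  have e1 : (B * W + K * V * D) * ‖a₁‖ ≤ (B * W + K * V * D) * M := by gcongr
  have e2 : (B * W + K * V * D) * ‖b₁‖ ≤ (B * W + K * V * D) * M := by gcongr
  have e3 : K * V * D * ‖a₂‖ ≤ K * V * D * M := by gcongr
  have e4 : K * V * D * ‖b₂‖ ≤ K * V * D * M := by gcongr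
  have e5 : B * V * ‖a₁ - a₂‖ + B * V * ‖b₁ - b₂‖ = B * V * D := by simp only [D]; ring
  calc _ ≤ L * W + 2 * (B * W + K * V * D) * M + 2 * (K * V * D) * M + 2 * (B * V * D) := by
        linarith
    _ ≤ _ := by
        have p1 : 0 ≤ V * D := by positivity
        have p2 : 0 ≤ M * (V * D) := by positivity
        have p3 : 0 ≤ M * W := by positivity
        have q1 := mul_nonneg hL0 p1
        have q2 := mul_nonneg hL0 p2
        have q3 := mul_nonneg hL0 p3
        have q4 := mul_nonneg hB0 p1
        have q5 := mul_nonneg hB0 p2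
        have q6 := mul_nonneg hB0 p3
        have q7 := mul_nonneg hB0 hW
        have q8 := mul_nonneg hK0 p1
        have q9 := mul_nonneg hK0 p2
        have q10 := mul_nonneg hK0 p3
        have q11 := mul_nonneg hK0 hW
        nlinarith

/-- The increments of `G ∘ u` in `H^β_∞` depend linearly on the size `N` of `u` if `u` has more
than `β` derivatives; here the time increment `h^{γ₀}` of `u` in `L₂` enters with the exponent that
results from interpolation. -/
theorem exists_norm_nemytskii_sub_le (S : SymmMarkovSemigroup μ) {β δ₁ : ℝ} (hβ : 0 < β)
    (hβ1 : β < 1) (hδ : β < δ₁) {G : ℝ → ℝ} (hG0 : G 0 = 0) (hG : Differentiable ℝ G)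
    {L : ℝ} (hL : ∀ x, |deriv G x| ≤ L)
    {n : S.BddPot β → S.BddPot β} (hn : ∀ u, (n u).toL2 =ᵐ[μ] fun x => G (u.toL2 x)) :
    ∃ C, 0 ≤ C ∧ ∀ (a b : S.BddPot β) (N h γ₀ : ℝ), 0 ≤ N → 0 < h →
      (∀ r, 0 < r → S.damp.form r a.toL2 ≤ N ^ 2 * r ^ δ₁) →
      (∀ r, 0 < r → S.damp.form r b.toL2 ≤ N ^ 2 * r ^ δ₁) →
      ‖a.toL2 - b.toL2‖ ≤ N * h ^ γ₀ →
      ‖n a - n b‖ ≤ C * (‖a - b‖ + N * h ^ (γ₀ * (1 - β / δ₁))) := by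
  have hL0 : 0 ≤ L := (abs_nonneg _).trans (hL 0)
  obtain ⟨C, hC, hCE⟩ := S.exists_bessel_eq_of_energy_le hβ hβ1
  have hδ0 : 0 < δ₁ := hβ.trans hδ
  set c : ℝ := C * (L ^ 2 * (4 / (δ₁ - β) + 1 / β)) with hc
  have hδβ : 0 < δ₁ - β := by linarith
  have hc0 : 0 ≤ c := by positivity
  refine ⟨√c + L, by positivity, fun a b N h γ₀ hN hh ha hb hab => ?_⟩
  have hLn : ∀ u v : S.BddPot β, ∀ᵐ x ∂μ, |((n u).toL2 - (n v).toL2) x|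
      ≤ L * |(u.toL2 - v.toL2) x| := by
    intro u v
    filter_upwards [hn u, hn v, Lp.coeFn_sub (n u).toL2 (n v).toL2, Lp.coeFn_sub u.toL2 v.toL2]
      with x e1 e2 e3 e4
    rw [e3, e4, Pi.sub_apply, Pi.sub_apply, e1, e2]
    exact abs_sub_le_of_abs_deriv_le hG hL _ _
  have hL2 : ‖(n a).toL2 - (n b).toL2‖ ≤ L * (N * h ^ γ₀) := by
    refine (Lp.norm_le_mul_norm_of_ae_le_mul (c := L) (g := a.toL2 - b.toL2)
      (by simpa only [Real.norm_eq_abs] using hLn a b)).trans ?_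
    gcongr
  have hf1 : ∀ (u : S.BddPot β) r, 0 ≤ r →
      S.damp.form r (n u).toL2 ≤ L ^ 2 * S.damp.form r u.toL2 := by
    intro u r hr
    have h1 := S.damp.form_le_sum hr (n u).toL2 (fun _ : Fin 1 => L • u.toL2)
      (fun x => (n u).toL2 x = G (u.toL2 x) ∧ (L • u.toL2) x = L * u.toL2 x)
      (by
        filter_upwards [hn u, Lp.coeFn_smul L u.toL2] with x e1 e2
        exact ⟨e1, by rw [e2, Pi.smul_apply, smul_eq_mul]⟩)
      (fun x y hx hy => by
        rw [hx.1, hy.1]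
        simp only [Fin.sum_univ_one]
        rw [hx.2, hy.2, ← mul_sub, ← sq_abs, ← sq_abs (L * _), abs_mul, abs_of_nonneg hL0]
        gcongr
        exact abs_sub_le_of_abs_deriv_le hG hL _ _)
      (fun x hx => by
        rw [hx.1]
        simp only [Fin.sum_univ_one]
        rw [hx.2, ← sq_abs, ← sq_abs (L * _), abs_mul, abs_of_nonneg hL0]
        gcongr
        simpa [hG0] using abs_sub_le_of_abs_deriv_le hG hL (u.toL2 x) 0)
    simpa [form_smul] using h1
  have hf2 : ∀ r, 0 < r → S.damp.form r ((n a).toL2 - (n b).toL2) ≤ 4 * L ^ 2 * N ^ 2 * r ^ δ₁ := by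
    intro r hr
    have h1 := S.damp.form_le_sum hr.le ((n a).toL2 - (n b).toL2)
      ![(2 : ℝ).sqrt • (n a).toL2, (2 : ℝ).sqrt • (n b).toL2]
      (fun x => ((n a).toL2 - (n b).toL2) x = (n a).toL2 x - (n b).toL2 x ∧
        ((2 : ℝ).sqrt • (n a).toL2) x = (2 : ℝ).sqrt * (n a).toL2 x ∧
        ((2 : ℝ).sqrt • (n b).toL2) x = (2 : ℝ).sqrt * (n b).toL2 x)
      (by
        filter_upwards [Lp.coeFn_sub (n a).toL2 (n b).toL2,
          Lp.coeFn_smul (2 : ℝ).sqrt (n a).toL2, Lp.coeFn_smul (2 : ℝ).sqrt (n b).toL2]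
          with x e1 e2 e3
        exact ⟨e1, e2, e3⟩)
      (fun x y hx hy => by
        simp only [Fin.sum_univ_two, Matrix.cons_val_zero, Matrix.cons_val_one]
        rw [hx.1, hy.1, hx.2.1, hx.2.2, hy.2.1, hy.2.2, ← mul_sub, ← mul_sub, mul_pow, mul_pow,
          Real.sq_sqrt zero_le_two]
        nlinarith [sq_nonneg ((n a).toL2 x - (n a).toL2 y + ((n b).toL2 x - (n b).toL2 y))])
      (fun x hx => by
        simp only [Fin.sum_univ_two, Matrix.cons_val_zero, Matrix.cons_val_one]
        rw [hx.1, hx.2.1, hx.2.2, mul_pow, mul_pow, Real.sq_sqrt zero_le_two]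
        nlinarith [sq_nonneg ((n a).toL2 x + (n b).toL2 x)])
    simp only [Fin.sum_univ_two, Matrix.cons_val_zero, Matrix.cons_val_one, form_smul,
      Real.sq_sqrt zero_le_two] at h1
    have h2 := (hf1 a r hr.le).trans (mul_le_mul_of_nonneg_left (ha r hr) (sq_nonneg L))
    have h3 := (hf1 b r hr.le).trans (mul_le_mul_of_nonneg_left (hb r hr) (sq_nonneg L))
    linarith
  set ρ : ℝ := h ^ (2 * γ₀ / δ₁) with hρ
  have hρ0 : 0 < ρ := Real.rpow_pos_of_pos hh _
  set Q : ℝ := N ^ 2 * h ^ (2 * γ₀ * (1 - β / δ₁)) with hQ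
  have hQ0 : 0 ≤ Q := by positivity
  have hen : S.energy β ((n a).toL2 - (n b).toL2)
      ≤ ENNReal.ofReal (L ^ 2 * (4 / (δ₁ - β) + 1 / β) * Q) := by
    have hi1 : IntegrableOn (fun r : ℝ => 4 * L ^ 2 * N ^ 2 * r ^ (δ₁ - β - 1)) (Ioc 0 ρ) :=
      ((intervalIntegrable_iff_integrableOn_Ioc_of_le hρ0.le).1
        (intervalIntegral.intervalIntegrable_rpow' (by linarith))).const_mul _
    have hi2 : IntegrableOn (fun r : ℝ => (L * (N * h ^ γ₀)) ^ 2 * r ^ (-β - 1)) (Ioi ρ) :=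
      (integrableOn_Ioi_rpow_of_lt (by linarith) hρ0).const_mul _
    have hv1 : ∫ r in Ioc 0 ρ, 4 * L ^ 2 * N ^ 2 * r ^ (δ₁ - β - 1)
        = L ^ 2 * (4 / (δ₁ - β)) * Q := by
      rw [integral_const_mul, ← intervalIntegral.integral_of_le hρ0.le,
        integral_rpow (Or.inl (by linarith)), Real.zero_rpow (by linarith), hρ,
        ← Real.rpow_mul hh.le, hQ,
        show 2 * γ₀ / δ₁ * (δ₁ - β - 1 + 1) = 2 * γ₀ * (1 - β / δ₁) by field_simp; ring,
        show δ₁ - β - 1 + 1 = δ₁ - β by ring]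
      field_simp
      ring
    have hv2 : ∫ r in Ioi ρ, (L * (N * h ^ γ₀)) ^ 2 * r ^ (-β - 1) = L ^ 2 * (1 / β) * Q := by
      rw [integral_const_mul, integral_Ioi_rpow_of_lt (by linarith) hρ0, hρ, ← Real.rpow_mul hh.le,
        hQ, show 2 * γ₀ * (1 - β / δ₁) = γ₀ + γ₀ + 2 * γ₀ / δ₁ * (-β - 1 + 1) by
          field_simp; ring, Real.rpow_add hh, Real.rpow_add hh, show -β - 1 + 1 = -β by ring]
      field_simp
    rw [energy, ← Ioc_union_Ioi_eq_Ioi hρ0.le, lintegral_union measurableSet_Ioi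
      (Ioc_disjoint_Ioi le_rfl), mul_add, add_mul, ENNReal.ofReal_add (by positivity)
      (by positivity), ← hv1, ← hv2]
    refine add_le_add ?_ ?_
    · rw [ofReal_integral_eq_lintegral_ofReal hi1 (ae_restrict_of_forall_mem measurableSet_Ioc
        fun r hr => by have := hr.1; positivity)]
      refine setLIntegral_mono_ae' measurableSet_Ioc (Eventually.of_forall fun r hr => ?_)
      refine ENNReal.ofReal_le_ofReal ?_
      have hr0 : 0 < r := hr.1
      calc _ ≤ r ^ (-β - 1) * (4 * L ^ 2 * N ^ 2 * r ^ δ₁) := by gcongr; exact hf2 r hr0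
        _ = _ := by
          rw [show δ₁ - β - 1 = (-β - 1) + δ₁ by ring, Real.rpow_add hr0]; ring
    · rw [ofReal_integral_eq_lintegral_ofReal hi2 (ae_restrict_of_forall_mem measurableSet_Ioi
        fun r hr => by have : 0 < r := hρ0.trans hr; positivity)]
      refine setLIntegral_mono_ae' measurableSet_Ioi (Eventually.of_forall fun r hr => ?_)
      refine ENNReal.ofReal_le_ofReal ?_
      have hr0 : 0 < r := hρ0.trans hr
      rw [mul_comm]
      gcongr
      refine (S.damp.form_le_norm_sq hr0.le _).trans ?_
      gcongr
  obtain ⟨φ, hφ, hφ'⟩ := hCE _ _ (by positivity) hen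
  have hsup : ∀ᵐ x ∂μ, |((n a).toL2 - (n b).toL2) x| ≤ L * ‖a - b‖ := by
    have := (a - b).ae_abs_le
    rw [BddPot.toL2_sub] at this
    filter_upwards [hLn a b, this] with x e1 e2
    exact e1.trans (by gcongr)
  obtain ⟨w, hw, hw'⟩ := BddPot.exists_of_bessel_eq φ _ hφ (by positivity) hsup
  have hweq : w = n a - n b := BddPot.toL2_injective (by rw [hw, BddPot.toL2_sub])
  rw [← hweq]
  refine hw'.trans ?_
  have hφ2 : ‖φ‖ ≤ √c * (N * h ^ (γ₀ * (1 - β / δ₁))) := by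
    refine le_of_sq_le_sq ?_ (by positivity)
    rw [mul_pow, Real.sq_sqrt hc0]
    refine hφ'.trans (le_of_eq ?_)
    rw [hc, hQ, mul_pow N, ← Real.rpow_natCast (h ^ _), ← Real.rpow_mul hh.le,
      show γ₀ * (1 - β / δ₁) * (2 : ℕ) = 2 * γ₀ * (1 - β / δ₁) by push_cast; ring]
    ring
  have h1 : 0 ≤ N * h ^ (γ₀ * (1 - β / δ₁)) := by positivity
  have h2 : 0 ≤ √c := Real.sqrt_nonneg _
  nlinarith [mul_nonneg h2 (norm_nonneg (a - b)), mul_nonneg hL0 h1]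

theorem norm_superpos_sub_le {F : ℝ → ℝ} (hF0 : F 0 = 0) (hF : Differentiable ℝ F) {L : ℝ}
    (hL : ∀ x, |deriv F x| ≤ L) :
    (∀ u : Lp ℝ 2 μ, MemLp (fun x => F (u x)) 2 μ) ∧
      (∀ u v : Lp ℝ 2 μ, ‖superpos F u - superpos F v‖ ≤ L * ‖u - v‖) ∧
      (superpos F (0 : Lp ℝ 2 μ) = 0) := by
  have hL0 : 0 ≤ L := (abs_nonneg _).trans (hL 0)
  have hm : ∀ u : Lp ℝ 2 μ, MemLp (fun x => F (u x)) 2 μ := fun u => by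
    refine MemLp.of_le_mul (c := L) (Lp.memLp u)
      (hF.continuous.comp_aestronglyMeasurable (Lp.aestronglyMeasurable _))
      (Eventually.of_forall fun x => ?_)
    simpa [hF0] using abs_sub_le_of_abs_deriv_le hF hL (u x) 0
  refine ⟨hm, fun u v => ?_, ?_⟩
  · refine Lp.norm_le_mul_norm_of_ae_le_mul ?_
    rw [superpos, dif_pos (hm u), superpos, dif_pos (hm v)]
    filter_upwards [Lp.coeFn_sub ((hm u).toLp _) ((hm v).toLp _), Lp.coeFn_sub u v,
      (hm u).coeFn_toLp, (hm v).coeFn_toLp] with x e1 e2 e3 e4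
    rw [e1, e2, Pi.sub_apply, Pi.sub_apply, e3, e4]
    exact abs_sub_le_of_abs_deriv_le hF hL _ _
  · rw [superpos, dif_pos (hm 0)]
    ext1
    filter_upwards [(hm 0).coeFn_toLp, Lp.coeFn_zero ℝ 2 μ] with x e1 e2
    rw [e1, e2, Pi.zero_apply, hF0]

/-- The inclusion `H^δ_∞ ⊆ H^σ_∞` for `σ ≤ δ`. -/
theorem exists_inclL (S : SymmMarkovSemigroup μ) {σ δ : ℝ} (hσ : 0 < σ) (hσδ : σ ≤ δ) :
    ∃ i : S.BddPot δ →L[ℝ] S.BddPot σ, (∀ u, (i u).toL2 = u.toL2) ∧ ∀ u, ‖i u‖ ≤ ‖u‖ := by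
  choose i hi hi' using fun u : S.BddPot δ => BddPot.exists_incl hσ hσδ u
  refine ⟨LinearMap.mkContinuous
    { toFun := i
      map_add' := fun u v => BddPot.toL2_injective (by
        rw [hi, BddPot.toL2_add, BddPot.toL2_add, hi, hi])
      map_smul' := fun c u => BddPot.toL2_injective (by
        rw [hi, RingHom.id_apply, BddPot.toL2_smul, BddPot.toL2_smul, hi]) }
    1 (fun u => by simpa using hi' u), hi, hi'⟩

end SymmMarkovSemigroup

/-! ### Singular integrals in time -/

theorem rpow_neg_mul_rpow_neg_le {x y a b : ℝ} (hx : 0 < x) (hy : 0 < y) (ha : 0 ≤ a) (hb : 0 ≤ b) :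
    x ^ (-a) * y ^ (-b) ≤ x ^ (-(a + b)) + y ^ (-(a + b)) := by
  rcases le_total x y with h | h
  · calc x ^ (-a) * y ^ (-b) ≤ x ^ (-a) * x ^ (-b) := by
          gcongr 1
          exact Real.rpow_le_rpow_of_nonpos hx h (by linarith)
      _ = x ^ (-(a + b)) := by rw [← Real.rpow_add hx]; congr 1; ring
      _ ≤ _ := le_add_of_nonneg_right (by positivity)
  · calc x ^ (-a) * y ^ (-b) ≤ y ^ (-a) * y ^ (-b) := by
          gcongr 1
          exact Real.rpow_le_rpow_of_nonpos hy h (by linarith)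
      _ = y ^ (-(a + b)) := by rw [← Real.rpow_add hy]; congr 1; ring
      _ ≤ _ := le_add_of_nonneg_left (by positivity)

theorem exp_neg_le_rpow {x l : ℝ} (hx : 0 < x) (hl : 0 ≤ l) (hl1 : l ≤ 1) :
    Real.exp (-x) ≤ x ^ (-l) := by
  rw [Real.exp_neg, Real.rpow_neg hx.le]
  gcongr
  rcases le_total x 1 with h | h
  · exact (Real.rpow_le_one hx.le h hl).trans (Real.one_le_exp hx.le)
  · calc x ^ l ≤ x ^ (1 : ℝ) := Real.rpow_le_rpow_of_exponent_le h hl1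
      _ = x := Real.rpow_one x
      _ ≤ _ := (le_add_of_nonneg_right zero_le_one).trans (Real.add_one_le_exp x)

theorem exp_le_exp_mul_rpow {ρ s t l : ℝ} (hρ : 0 < ρ) (hst : s < t) (hl : 0 ≤ l) (hl1 : l ≤ 1) :
    Real.exp (ρ * s) ≤ ρ ^ (-l) * Real.exp (ρ * t) * (t - s) ^ (-l) := by
  have h := exp_neg_le_rpow (x := ρ * (t - s)) (mul_pos hρ (sub_pos.2 hst)) hl hl1
  rw [Real.mul_rpow hρ.le (sub_pos.2 hst).le] at h
  calc Real.exp (ρ * s) = Real.exp (ρ * t) * Real.exp (-(ρ * (t - s))) := by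
        rw [← Real.exp_add]; congr 1; ring
    _ ≤ Real.exp (ρ * t) * (ρ ^ (-l) * (t - s) ^ (-l)) := by gcongr
    _ = _ := by ring

theorem integrableOn_sub_rpow {a t c : ℝ} (hat : a ≤ t) (hc : -1 < c) :
    IntegrableOn (fun s => (t - s) ^ c) (Ioo a t) ∧
      ∫ s in Ioo a t, (t - s) ^ c = (t - a) ^ (c + 1) / (c + 1) := by
  constructor
  · refine IntegrableOn.mono_set ?_ Ioo_subset_Ioc_self
    rw [← intervalIntegrable_iff_integrableOn_Ioc_of_le hat]
    have h := (intervalIntegral.intervalIntegrable_rpow' (a := t - a) (b := t - t)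
      hc).comp_sub_left t
    simpa using h
  · rw [← integral_Ioc_eq_integral_Ioo, ← intervalIntegral.integral_of_le hat,
      intervalIntegral.integral_comp_sub_left (fun x => x ^ c) t, sub_self,
      integral_rpow (Or.inl hc), Real.zero_rpow (by linarith), sub_zero]

theorem integrableOn_sub_rpow' {a t c : ℝ} (hat : a ≤ t) (hc : -1 < c) :
    IntegrableOn (fun s => (s - a) ^ c) (Ioo a t) ∧
      ∫ s in Ioo a t, (s - a) ^ c = (t - a) ^ (c + 1) / (c + 1) := by
  constructor
  · refine IntegrableOn.mono_set ?_ Ioo_subset_Ioc_self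
    rw [← intervalIntegrable_iff_integrableOn_Ioc_of_le hat]
    have h := (intervalIntegral.intervalIntegrable_rpow' (a := a - a) (b := t - a)
      hc).comp_sub_right a
    simpa using h
  · rw [← integral_Ioc_eq_integral_Ioo, ← intervalIntegral.integral_of_le hat,
      intervalIntegral.integral_comp_sub_right (fun x => x ^ c) a, sub_self,
      integral_rpow (Or.inl hc), Real.zero_rpow (by linarith), sub_zero]

section Singular

variable {Y : Type*} [NormedAddCommGroup Y] [NormedSpace ℝ Y]

theorem integrableOn_singular {a t c : ℝ} (hat : a ≤ t) (hc : c < 1) :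
    IntegrableOn (fun s => (t - s) ^ (-c) + (s - a) ^ (-c)) (Ioo a t) :=
  (integrableOn_sub_rpow hat (by linarith)).1.add (integrableOn_sub_rpow' hat (by linarith)).1

/-- A singular integral with the weight `e^{ρ s}` gains the factor `ρ^{-l}`. -/
theorem norm_integral_le_of_singular {a t c l ρ B : ℝ} (hat : a ≤ t) (hc : 0 ≤ c) (hl : 0 ≤ l)
    (hcl : c + l < 1) (hρ : 0 < ρ) (hB : 0 ≤ B) {q : ℝ → Y}
    (hq : ∀ s ∈ Ioo a t, ‖q s‖ ≤ B * Real.exp (ρ * s) * ((t - s) ^ (-c) + (s - a) ^ (-c))) :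
    ‖∫ s in Ioo a t, q s‖ ≤
      4 / (1 - (c + l)) * (t - a) ^ (1 - (c + l)) * B * ρ ^ (-l) * Real.exp (ρ * t) := by
  have h1 := integrableOn_sub_rpow (a := a) (t := t) (c := -(c + l)) hat (by linarith)
  have h2 := integrableOn_sub_rpow' (a := a) (t := t) (c := -(c + l)) hat (by linarith)
  have hint : IntegrableOn (fun s => 2 * B * ρ ^ (-l) * Real.exp (ρ * t) *
      ((t - s) ^ (-(c + l)) + (s - a) ^ (-(c + l)))) (Ioo a t) := (h1.1.add h2.1).const_mul _
  refine (norm_integral_le_of_norm_le hint (ae_restrict_of_forall_mem measurableSet_Ioo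
    fun s hs => ?_)).trans (le_of_eq ?_)
  · have hts : 0 < t - s := sub_pos.2 hs.2
    have hsa : 0 < s - a := sub_pos.2 hs.1
    have e1 := exp_le_exp_mul_rpow hρ hs.2 hl (by linarith)
    have e2 := rpow_neg_mul_rpow_neg_le hts hsa hl hc
    have e3 : (t - s) ^ (-l) * (t - s) ^ (-c) = (t - s) ^ (-(c + l)) := by
      rw [← Real.rpow_add hts]; congr 1; ring
    rw [add_comm l c] at e2
    have hp1 : 0 ≤ (t - s) ^ (-(c + l)) := by positivity
    have hp2 : 0 ≤ (s - a) ^ (-(c + l)) := by positivity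
    calc ‖q s‖ ≤ B * Real.exp (ρ * s) * ((t - s) ^ (-c) + (s - a) ^ (-c)) := hq s hs
      _ ≤ B * (ρ ^ (-l) * Real.exp (ρ * t) * (t - s) ^ (-l)) *
          ((t - s) ^ (-c) + (s - a) ^ (-c)) := by gcongr
      _ = B * ρ ^ (-l) * Real.exp (ρ * t) *
          ((t - s) ^ (-l) * (t - s) ^ (-c) + (t - s) ^ (-l) * (s - a) ^ (-c)) := by ring
      _ ≤ B * ρ ^ (-l) * Real.exp (ρ * t) *
          (2 * ((t - s) ^ (-(c + l)) + (s - a) ^ (-(c + l)))) := by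
          gcongr
          linarith
      _ = _ := by ring
  · rw [integral_const_mul, integral_add h1.1 h2.1, h1.2, h2.2,
      show -(c + l) + 1 = 1 - (c + l) by ring]
    have : (1 - (c + l)) ≠ 0 := by linarith
    field_simp
    ring

/-- Hölder continuity in time of a singular convolution integral. -/
theorem norm_integral_sub_le_of_singular {t' t c₀ c l ρ B γ : ℝ} (ht' : 0 ≤ t') (htt : t' < t)
    (hc₀ : 0 ≤ c₀) (hγ : 0 ≤ γ) (hl : 0 ≤ l) (hcc : c₀ + γ ≤ c) (hcl : c + l < 1)
    (hρ : 0 < ρ) (hB : 0 ≤ B) {q q' : ℝ → Y} (hqi : IntegrableOn q (Ioo 0 t))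
    (hqi' : IntegrableOn q' (Ioo 0 t'))
    (hq : ∀ s ∈ Ioo 0 t, ‖q s‖ ≤ B * Real.exp (ρ * s) * ((t - s) ^ (-c₀) + s ^ (-c₀)))
    (hqq : ∀ s ∈ Ioo 0 t', ‖q s - q' s‖ ≤
      B * (t - t') ^ γ * Real.exp (ρ * s) * ((t' - s) ^ (-c) + s ^ (-c))) :
    ‖(∫ s in Ioo 0 t, q s) - ∫ s in Ioo 0 t', q' s‖ ≤
      (4 / (1 - (c + l)) * t ^ (1 - (c + l)) + 4 / (1 - (c₀ + l)) * t ^ (1 - (c₀ + l) - γ))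
        * B * ρ ^ (-l) * Real.exp (ρ * t) * (t - t') ^ γ := by
  have ht : 0 < t := ht'.trans_lt htt
  have hd : 0 < t - t' := sub_pos.2 htt
  have hsplit : ∫ s in Ioo 0 t, q s = (∫ s in Ioo 0 t', q s) + ∫ s in Ioo t' t, q s := by
    rw [← integral_Ioc_eq_integral_Ioo, ← integral_Ioc_eq_integral_Ioo,
      ← integral_Ioc_eq_integral_Ioo, ← Ioc_union_Ioc_eq_Ioc ht' htt.le]
    have hi : IntegrableOn q (Ioc 0 t) := (integrableOn_Ioc_iff_integrableOn_Ioo).2 hqi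
    exact setIntegral_union (Ioc_disjoint_Ioc_of_le le_rfl) measurableSet_Ioc
      (hi.mono_set (Ioc_subset_Ioc_right htt.le)) (hi.mono_set (Ioc_subset_Ioc_left ht'))
  have hi1 : IntegrableOn q (Ioo 0 t') := hqi.mono_set (Ioo_subset_Ioo_right htt.le)
  rw [hsplit, add_sub_right_comm, ← integral_sub hi1 hqi']
  have b1 := norm_integral_le_of_singular (q := fun s => q s - q' s) (c := c) ht'
    (by linarith) hl hcl hρ (B := B * (t - t') ^ γ) (by positivity)
    (fun s hs => by simpa using hqq s hs)
  have b2 := norm_integral_le_of_singular (q := q) (c := c₀) htt.le hc₀ hl (by linarith) hρ hB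
    (fun s hs => by
      have hs0 : 0 < s := ht'.trans_lt hs.1
      refine (hq s ⟨hs0, hs.2⟩).trans ?_
      have : s ^ (-c₀) ≤ (s - t') ^ (-c₀) :=
        Real.rpow_le_rpow_of_nonpos (sub_pos.2 hs.1) (by linarith) (by linarith)
      gcongr)
  have hcl0 : 0 < 1 - (c + l) := by linarith
  have hcl1 : 0 < 1 - (c₀ + l) := by linarith
  have e1 : (t' - 0) ^ (1 - (c + l)) ≤ t ^ (1 - (c + l)) :=
    Real.rpow_le_rpow (by linarith) (by linarith) hcl0.le
  have e2 : (t - t') ^ (1 - (c₀ + l)) ≤ t ^ (1 - (c₀ + l) - γ) * (t - t') ^ γ := by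
    rw [show (t - t') ^ (1 - (c₀ + l)) = (t - t') ^ (1 - (c₀ + l) - γ) * (t - t') ^ γ by
      rw [← Real.rpow_add hd]; congr 1; ring]
    gcongr
    · linarith
    · linarith
  have e3 : Real.exp (ρ * t') ≤ Real.exp (ρ * t) := by gcongr
  refine (norm_add_le _ _).trans ((add_le_add b1 b2).trans ?_)
  have hρl : 0 ≤ ρ ^ (-l) := by positivity
  calc _ ≤ 4 / (1 - (c + l)) * t ^ (1 - (c + l)) * (B * (t - t') ^ γ) * ρ ^ (-l)
        * Real.exp (ρ * t) + 4 / (1 - (c₀ + l)) * (t ^ (1 - (c₀ + l) - γ) * (t - t') ^ γ)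
        * B * ρ ^ (-l) * Real.exp (ρ * t) := by gcongr
    _ = _ := by ring

end Singular

/-! ### The weighted spaces -/

section Weighted

variable {E : Type*} [NormedAddCommGroup E]

/-- The ball of radius `A` of `W^η([0,t₀],E)` in the norm with the weight `e^{-ρ t}`. -/
structure IsWeighted (η t₀ ρ A : ℝ) (g : ℝ → E) : Prop where
  aestronglyMeasurable : AEStronglyMeasurable g (volume.restrict (Icc 0 t₀))
  nonneg : 0 ≤ A
  norm_le : ∀ t ∈ Icc 0 t₀, ‖g t‖ ≤ A * Real.exp (ρ * t)
  lintegral_le : ∀ t ∈ Icc 0 t₀, ∫⁻ τ in Ioo 0 t, ‖g t - g τ‖ₑ *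
    ENNReal.ofReal ((t - τ) ^ (-(η + 1))) ≤ ENNReal.ofReal (A * Real.exp (ρ * t))

namespace IsWeighted

variable {η t₀ ρ A : ℝ} {g : ℝ → E}

theorem integrableOn (hg : IsWeighted η t₀ ρ A g) {t : ℝ} (ht : t ∈ Icc 0 t₀) :
    IntegrableOn (fun τ => (t - τ) ^ (-(η + 1)) * ‖g t - g τ‖) (Ioo 0 t) ∧
      ∫ τ in Ioo 0 t, (t - τ) ^ (-(η + 1)) * ‖g t - g τ‖ ≤ A * Real.exp (ρ * t) := by
  have hm : AEStronglyMeasurable g (volume.restrict (Ioo 0 t)) :=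
    hg.aestronglyMeasurable.mono_measure (Measure.restrict_mono
      (Ioo_subset_Icc_self.trans (Icc_subset_Icc_right ht.2)) le_rfl)
  have hm' : AEStronglyMeasurable (fun τ => (t - τ) ^ (-(η + 1)) * ‖g t - g τ‖)
      (volume.restrict (Ioo 0 t)) := by
    refine AEStronglyMeasurable.mul ?_ (aestronglyMeasurable_const.sub hm).norm
    exact (Measurable.pow_const (measurable_const.sub measurable_id) _).aestronglyMeasurable
  have heq : ∫⁻ τ in Ioo 0 t, ‖(t - τ) ^ (-(η + 1)) * ‖g t - g τ‖‖ₑ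
      = ∫⁻ τ in Ioo 0 t, ‖g t - g τ‖ₑ * ENNReal.ofReal ((t - τ) ^ (-(η + 1))) := by
    refine setLIntegral_congr_fun measurableSet_Ioo fun τ hτ => ?_
    have : 0 ≤ (t - τ) ^ (-(η + 1)) := Real.rpow_nonneg (sub_pos.2 hτ.2).le _
    rw [enorm_mul, Real.enorm_of_nonneg this, enorm_norm, mul_comm]
  have hb := hg.lintegral_le t ht
  have hi : IntegrableOn (fun τ => (t - τ) ^ (-(η + 1)) * ‖g t - g τ‖) (Ioo 0 t) :=
    ⟨hm', by rw [HasFiniteIntegral, heq]; exact hb.trans_lt ENNReal.ofReal_lt_top⟩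
  refine ⟨hi, ?_⟩
  have h0 : 0 ≤ᵐ[volume.restrict (Ioo 0 t)] fun τ => (t - τ) ^ (-(η + 1)) * ‖g t - g τ‖ :=
    ae_restrict_of_forall_mem measurableSet_Ioo fun τ hτ =>
      mul_nonneg (Real.rpow_nonneg (sub_pos.2 hτ.2).le _) (norm_nonneg _)
  have hA : 0 ≤ A * Real.exp (ρ * t) := mul_nonneg hg.nonneg (Real.exp_pos _).le
  rw [← ENNReal.ofReal_le_ofReal_iff hA]
  refine le_trans (le_of_eq ?_) hb
  rw [ofReal_integral_eq_lintegral_ofReal hi h0, ← heq]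
  refine lintegral_congr_ae ?_
  filter_upwards [h0] with τ hτ
  rw [Real.enorm_of_nonneg hτ]

/-- A pointwise estimate of the increments gives membership in the weighted ball. -/
theorem of_integrableOn (hm : AEStronglyMeasurable g (volume.restrict (Icc 0 t₀))) (hA : 0 ≤ A)
    (hn : ∀ t ∈ Icc 0 t₀, ‖g t‖ ≤ A * Real.exp (ρ * t)) (b : ℝ → ℝ → ℝ)
    (hb : ∀ t ∈ Icc 0 t₀, ∀ τ ∈ Ioo 0 t, (t - τ) ^ (-(η + 1)) * ‖g t - g τ‖ ≤ b t τ)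
    (hbi : ∀ t ∈ Icc 0 t₀, IntegrableOn (b t) (Ioo 0 t))
    (hbA : ∀ t ∈ Icc 0 t₀, ∫ τ in Ioo 0 t, b t τ ≤ A * Real.exp (ρ * t)) :
    IsWeighted η t₀ ρ A g where
  aestronglyMeasurable := hm
  nonneg := hA
  norm_le := hn
  lintegral_le t ht := by
    refine le_trans ?_ (ENNReal.ofReal_le_ofReal (hbA t ht))
    have h0 : ∀ τ ∈ Ioo 0 t, 0 ≤ b t τ := fun τ hτ =>
      (mul_nonneg (Real.rpow_nonneg (sub_pos.2 hτ.2).le _) (norm_nonneg _)).trans (hb t ht τ hτ)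
    rw [ofReal_integral_eq_lintegral_ofReal (hbi t ht)
      (ae_restrict_of_forall_mem measurableSet_Ioo h0)]
    refine setLIntegral_mono_ae' measurableSet_Ioo (Eventually.of_forall fun τ hτ => ?_)
    rw [← ofReal_norm, mul_comm, ← ENNReal.ofReal_mul (Real.rpow_nonneg (sub_pos.2 hτ.2).le _)]
    exact ENNReal.ofReal_le_ofReal (hb t ht τ hτ)

theorem mono {A' : ℝ} (hg : IsWeighted η t₀ ρ A g) (h : A ≤ A') : IsWeighted η t₀ ρ A' g where
  aestronglyMeasurable := hg.aestronglyMeasurable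
  nonneg := hg.nonneg.trans h
  norm_le t ht := (hg.norm_le t ht).trans (by gcongr)
  lintegral_le t ht := (hg.lintegral_le t ht).trans (ENNReal.ofReal_le_ofReal (by gcongr))

theorem mono_right {t₁ : ℝ} (hg : IsWeighted η t₀ ρ A g) (h : t₁ ≤ t₀) :
    IsWeighted η t₁ ρ A g where
  aestronglyMeasurable := hg.aestronglyMeasurable.mono_measure
    (Measure.restrict_mono (Icc_subset_Icc_right h) le_rfl)
  nonneg := hg.nonneg
  norm_le t ht := hg.norm_le t ⟨ht.1, ht.2.trans h⟩
  lintegral_le t ht := hg.lintegral_le t ⟨ht.1, ht.2.trans h⟩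

theorem mono_weight {ρ' : ℝ} (hg : IsWeighted η t₀ ρ A g) (h : ρ ≤ ρ') :
    IsWeighted η t₀ ρ' A g where
  aestronglyMeasurable := hg.aestronglyMeasurable
  nonneg := hg.nonneg
  norm_le t ht := (hg.norm_le t ht).trans (by have := hg.nonneg; have := ht.1; gcongr)
  lintegral_le t ht := (hg.lintegral_le t ht).trans (ENNReal.ofReal_le_ofReal
    (by have := hg.nonneg; have := ht.1; gcongr))

theorem mono_exponent {η' : ℝ} (hg : IsWeighted η t₀ ρ A g) (h : η' ≤ η) :
    IsWeighted η' t₀ ρ (max 1 (t₀ ^ (η - η')) * A) g where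
  aestronglyMeasurable := hg.aestronglyMeasurable
  nonneg := mul_nonneg (zero_le_one.trans (le_max_left _ _)) hg.nonneg
  norm_le t ht := by
    refine (hg.norm_le t ht).trans ?_
    have := hg.nonneg
    gcongr
    exact le_mul_of_one_le_left this (le_max_left _ _)
  lintegral_le t ht := by
    rw [mul_assoc, ENNReal.ofReal_mul (zero_le_one.trans (le_max_left _ _))]
    refine le_trans ?_ (mul_le_mul_right (hg.lintegral_le t ht) _)
    rw [← lintegral_const_mul' _ _ ENNReal.ofReal_ne_top]
    refine setLIntegral_mono_ae' measurableSet_Ioo (Eventually.of_forall fun τ hτ => ?_)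
    have h0 : 0 < t - τ := sub_pos.2 hτ.2
    rw [mul_left_comm, ← ENNReal.ofReal_mul (zero_le_one.trans (le_max_left _ _))]
    refine mul_le_mul_right (ENNReal.ofReal_le_ofReal ?_) _
    rw [show -(η' + 1) = (η - η') + -(η + 1) by ring, Real.rpow_add h0]
    gcongr
    refine le_trans ?_ (le_max_right _ _)
    exact Real.rpow_le_rpow h0.le (by linarith [hτ.1, ht.2]) (by linarith)

theorem add {A' : ℝ} {g' : ℝ → E} (hg : IsWeighted η t₀ ρ A g) (hg' : IsWeighted η t₀ ρ A' g') :
    IsWeighted η t₀ ρ (A + A') (fun t => g t + g' t) where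
  aestronglyMeasurable := hg.aestronglyMeasurable.add hg'.aestronglyMeasurable
  nonneg := add_nonneg hg.nonneg hg'.nonneg
  norm_le t ht := by
    rw [add_mul]
    exact (norm_add_le _ _).trans (add_le_add (hg.norm_le t ht) (hg'.norm_le t ht))
  lintegral_le t ht := by
    have h1 := hg.nonneg
    have h2 := hg'.nonneg
    rw [add_mul, ENNReal.ofReal_add (by positivity) (by positivity)]
    refine le_trans ?_ (add_le_add (hg.lintegral_le t ht) (hg'.lintegral_le t ht))
    have hm : AEStronglyMeasurable g (volume.restrict (Ioo 0 t)) :=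
      hg.aestronglyMeasurable.mono_measure (Measure.restrict_mono
        (Ioo_subset_Icc_self.trans (Icc_subset_Icc_right ht.2)) le_rfl)
    have hm' : AEMeasurable (fun τ => ‖g t - g τ‖ₑ * ENNReal.ofReal ((t - τ) ^ (-(η + 1))))
        (volume.restrict (Ioo 0 t)) :=
      (aestronglyMeasurable_const.sub hm).enorm.mul (by fun_prop)
    rw [← lintegral_add_left' hm']
    refine lintegral_mono fun τ => ?_
    dsimp only
    rw [← add_mul, add_sub_add_comm]
    gcongr
    exact enorm_add_le _ _

theorem neg (hg : IsWeighted η t₀ ρ A g) : IsWeighted η t₀ ρ A (fun t => -g t) where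
  aestronglyMeasurable := hg.aestronglyMeasurable.neg
  nonneg := hg.nonneg
  norm_le t ht := by simpa using hg.norm_le t ht
  lintegral_le t ht := by
    refine le_trans (le_of_eq ?_) (hg.lintegral_le t ht)
    congr 1; ext τ
    rw [← enorm_neg]; congr 2; abel

theorem sub {A' : ℝ} {g' : ℝ → E} (hg : IsWeighted η t₀ ρ A g) (hg' : IsWeighted η t₀ ρ A' g') :
    IsWeighted η t₀ ρ (A + A') (fun t => g t - g' t) := by
  simpa only [sub_eq_add_neg] using hg.add hg'.neg

theorem congr {g' : ℝ → E} (hg : IsWeighted η t₀ ρ A g) (h : EqOn g g' (Icc 0 t₀)) :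
    IsWeighted η t₀ ρ A g' where
  aestronglyMeasurable := hg.aestronglyMeasurable.congr
    (ae_restrict_of_forall_mem measurableSet_Icc h)
  nonneg := hg.nonneg
  norm_le t ht := by rw [← h ht]; exact hg.norm_le t ht
  lintegral_le t ht := by
    refine le_trans (le_of_eq ?_) (hg.lintegral_le t ht)
    refine setLIntegral_congr_fun measurableSet_Ioo fun τ hτ => ?_
    rw [← h ht, ← h ⟨hτ.1.le, hτ.2.le.trans ht.2⟩]

theorem of_tendsto {gn : ℕ → ℝ → E} (hg : ∀ n, IsWeighted η t₀ ρ A (gn n))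
    (h : ∀ t ∈ Icc 0 t₀, Tendsto (fun n => gn n t) atTop (𝓝 (g t))) : IsWeighted η t₀ ρ A g where
  aestronglyMeasurable := aestronglyMeasurable_of_tendsto_ae atTop
    (fun n => (hg n).aestronglyMeasurable) (ae_restrict_of_forall_mem measurableSet_Icc h)
  nonneg := (hg 0).nonneg
  norm_le t ht := le_of_tendsto' (h t ht).norm fun n => (hg n).norm_le t ht
  lintegral_le t ht := by
    have hm : ∀ n, AEStronglyMeasurable (gn n) (volume.restrict (Ioo 0 t)) := fun n =>
      (hg n).aestronglyMeasurable.mono_measure (Measure.restrict_mono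
        (Ioo_subset_Icc_self.trans (Icc_subset_Icc_right ht.2)) le_rfl)
    calc _ = ∫⁻ τ in Ioo 0 t, liminf (fun n => ‖gn n t - gn n τ‖ₑ *
          ENNReal.ofReal ((t - τ) ^ (-(η + 1)))) atTop := by
          refine setLIntegral_congr_fun measurableSet_Ioo fun τ hτ => ?_
          refine (Tendsto.liminf_eq ?_).symm
          refine ENNReal.Tendsto.mul_const ?_ (Or.inr ENNReal.ofReal_ne_top)
          exact ((h t ht).sub (h τ ⟨hτ.1.le, hτ.2.le.trans ht.2⟩)).enorm
      _ ≤ liminf (fun n => ∫⁻ τ in Ioo 0 t, ‖gn n t - gn n τ‖ₑ *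
          ENNReal.ofReal ((t - τ) ^ (-(η + 1)))) atTop :=
          lintegral_liminf_le' fun n => ((aestronglyMeasurable_const.sub (hm n)).enorm.mul
            (by fun_prop))
      _ ≤ _ := by
          refine liminf_le_of_le (by isBoundedDefault) fun b hb => ?_
          obtain ⟨n, hn⟩ := hb.exists
          exact hn.trans ((hg n).lintegral_le t ht)

/-- Hölder continuous functions belong to the weighted spaces of smaller exponent. -/
theorem of_holder {γ : ℝ} (hη : 0 ≤ η) (hηγ : η < γ) (ht₀ : 0 < t₀) (hρ : 0 ≤ ρ) (hA : 0 ≤ A)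
    (hn : ∀ t ∈ Icc 0 t₀, ‖g t‖ ≤ A * Real.exp (ρ * t))
    (hh : ∀ t' ∈ Icc 0 t₀, ∀ t ∈ Icc 0 t₀, t' < t →
      ‖g t - g t'‖ ≤ A * Real.exp (ρ * t) * (t - t') ^ γ) :
    IsWeighted η t₀ ρ (A * (1 + t₀ ^ (γ - η) / (γ - η))) g := by
  have hγη : 0 < γ - η := by linarith
  have hγ : 0 < γ := by linarith
  have hc : ContinuousOn g (Icc 0 t₀) := by
    have hle : ∀ t' ∈ Icc 0 t₀, ∀ t ∈ Icc 0 t₀, ‖g t - g t'‖ ≤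
        A * Real.exp (ρ * t₀) * |t - t'| ^ γ := by
      have aux : ∀ t' ∈ Icc 0 t₀, ∀ t ∈ Icc 0 t₀, t' < t → ‖g t - g t'‖ ≤
          A * Real.exp (ρ * t₀) * |t - t'| ^ γ := by
        intro t' ht' t ht h
        rw [abs_of_pos (sub_pos.2 h)]
        refine (hh t' ht' t ht h).trans ?_
        have := ht.2
        have := sub_pos.2 h
        gcongr
      intro t' ht' t ht
      rcases lt_trichotomy t' t with h | h | h
      · exact aux t' ht' t ht h
      · rw [h]; simp; positivity
      · rw [norm_sub_rev, abs_sub_comm]; exact aux t ht t' ht' h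
    intro t' ht'
    rw [ContinuousWithinAt, tendsto_iff_norm_sub_tendsto_zero]
    refine squeeze_zero' (Eventually.of_forall fun _ => norm_nonneg _)
      (eventually_nhdsWithin_of_forall fun t ht => hle t' ht' t ht) ?_
    have : Continuous fun t : ℝ => A * Real.exp (ρ * t₀) * |t - t'| ^ γ := by
      refine continuous_const.mul (Continuous.rpow_const (by fun_prop) fun _ => Or.inr hγ.le)
    have h0 := (this.tendsto t').mono_left (nhdsWithin_le_nhds (s := Icc 0 t₀))
    simpa [Real.zero_rpow hγ.ne'] using h0
  refine of_integrableOn (hc.aestronglyMeasurable measurableSet_Icc) (by positivity)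
    (fun t ht => (hn t ht).trans ?_)
    (fun t τ => A * Real.exp (ρ * t) * (t - τ) ^ (γ - η - 1)) (fun t ht τ hτ => ?_)
    (fun t ht => (integrableOn_sub_rpow ht.1 (by linarith)).1.const_mul _) (fun t ht => ?_)
  · have h1 : 0 ≤ t₀ ^ (γ - η) / (γ - η) := by positivity
    gcongr
    nlinarith
  · have h0 : 0 < t - τ := sub_pos.2 hτ.2
    calc _ ≤ (t - τ) ^ (-(η + 1)) * (A * Real.exp (ρ * t) * (t - τ) ^ γ) := by
          gcongr
          exact hh τ ⟨hτ.1.le, hτ.2.le.trans ht.2⟩ t ht hτ.2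
      _ = _ := by
          rw [show γ - η - 1 = -(η + 1) + γ by ring, Real.rpow_add h0]; ring
  · rw [integral_const_mul, (integrableOn_sub_rpow ht.1 (by linarith)).2,
      show γ - η - 1 + 1 = γ - η by ring, sub_zero]
    have h1 : t ^ (γ - η) ≤ t₀ ^ (γ - η) := Real.rpow_le_rpow ht.1 ht.2 hγη.le
    calc A * Real.exp (ρ * t) * (t ^ (γ - η) / (γ - η))
        ≤ A * Real.exp (ρ * t) * (t₀ ^ (γ - η) / (γ - η)) := by gcongr
      _ ≤ A * Real.exp (ρ * t) * (1 + t₀ ^ (γ - η) / (γ - η)) := by gcongr; linarith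
      _ = _ := by ring

end IsWeighted

theorem MemW.exists_isWeighted {η t₀ : ℝ} {v : ℝ → E} (hv : MemW η t₀ v) :
    ∃ A, IsWeighted η t₀ 0 A v := by
  obtain ⟨hm, C, hC⟩ := hv
  refine ⟨max C 0, IsWeighted.of_integrableOn hm (le_max_right _ _) (fun t ht => ?_)
    (fun t τ => ‖v t - v τ‖ / (t - τ) ^ (η + 1)) (fun t ht τ hτ => le_of_eq ?_)
    (fun t ht => (hC t ht).1) (fun t ht => ?_)⟩
  · have h0 : 0 ≤ ∫ τ in Ioo 0 t, ‖v t - v τ‖ / (t - τ) ^ (η + 1) :=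
      setIntegral_nonneg measurableSet_Ioo fun τ hτ =>
        div_nonneg (norm_nonneg _) (Real.rpow_nonneg (sub_pos.2 hτ.2).le _)
    have := (hC t ht).2
    simp only [zero_mul, Real.exp_zero, mul_one]
    exact le_max_of_le_left (by linarith)
  · rw [Real.rpow_neg (sub_pos.2 hτ.2).le, div_eq_inv_mul]
  · have := (hC t ht).2
    simp only [zero_mul, Real.exp_zero, mul_one]
    exact le_max_of_le_left (by linarith [norm_nonneg (v t)])

theorem IsWeighted.memW {η t₀ ρ A : ℝ} {v : ℝ → E} (hρ : 0 ≤ ρ) (hv : IsWeighted η t₀ ρ A v) :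
    MemW η t₀ v := by
  have heq : ∀ t, EqOn (fun τ => (t - τ) ^ (-(η + 1)) * ‖v t - v τ‖)
      (fun τ => ‖v t - v τ‖ / (t - τ) ^ (η + 1)) (Ioo 0 t) := fun t τ hτ => by
    simp only [Real.rpow_neg (sub_pos.2 hτ.2).le, div_eq_inv_mul]
  refine ⟨hv.aestronglyMeasurable, A * Real.exp (ρ * t₀) + A * Real.exp (ρ * t₀), fun t ht => ?_⟩
  obtain ⟨h1, h2⟩ := hv.integrableOn ht
  have h3 : A * Real.exp (ρ * t) ≤ A * Real.exp (ρ * t₀) := by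
    have := hv.nonneg; have := ht.2; gcongr
  refine ⟨h1.congr_fun (heq t) measurableSet_Ioo, add_le_add ((hv.norm_le t ht).trans h3) ?_⟩
  rw [← setIntegral_congr_fun measurableSet_Ioo (heq t)]
  exact h2.trans h3

end Weighted

/-! ### Weyl-Marchaud derivatives -/

section Measurability

variable {E : Type*} [NormedAddCommGroup E] [NormedSpace ℝ E]

theorem aestronglyMeasurable_leftDeriv {η t : ℝ} {V : ℝ → E}
    (hV : AEStronglyMeasurable V (volume.restrict (Ioo 0 t))) :
    AEStronglyMeasurable (leftDeriv η V) (volume.restrict (Ioo 0 t)) := by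
  have hk : AEStronglyMeasurable (fun p : ℝ × ℝ => {p : ℝ × ℝ | p.2 < p.1}.indicator
      (fun p => leftKernel η V p.1 p.2) p)
      ((volume.restrict (Ioo 0 t)).prod (volume.restrict (Ioo 0 t))) := by
    refine AEStronglyMeasurable.indicator ?_ (measurableSet_lt measurable_snd measurable_fst)
    have h1 : Measurable fun p : ℝ × ℝ => ((p.1 - p.2) ^ (η + 1))⁻¹ := by fun_prop
    exact h1.aestronglyMeasurable.smul (hV.comp_fst.sub hV.comp_snd)
  have h2 : AEStronglyMeasurable (fun s => ∫ τ in Ioo 0 s, leftKernel η V s τ)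
      (volume.restrict (Ioo 0 t)) := by
    refine hk.integral_prod_right'.congr (ae_restrict_of_forall_mem measurableSet_Ioo
      fun s hs => ?_)
    have : ∀ τ, {p : ℝ × ℝ | p.2 < p.1}.indicator (fun p => leftKernel η V p.1 p.2) (s, τ)
        = (Iio s).indicator (leftKernel η V s) τ := fun τ => by
      simp [indicator_apply]
    simp only [this]
    rw [setIntegral_indicator measurableSet_Iio]
    congr 2
    ext τ
    simp only [mem_inter_iff, mem_Ioo, mem_Iio]
    exact ⟨fun h => ⟨h.1.1, h.2⟩, fun h => ⟨⟨h.1, h.2.trans hs.2⟩, h.2⟩⟩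
  have h3 : Measurable fun s : ℝ => (s ^ η)⁻¹ := by fun_prop
  exact ((h3.aestronglyMeasurable.smul hV).add (h2.const_smul η)).const_smul _

theorem aestronglyMeasurable_rightDeriv {η t : ℝ} {z : ℝ → E}
    (hz : AEStronglyMeasurable z (volume.restrict (Ioo 0 t))) :
    AEStronglyMeasurable (rightDeriv η z t) (volume.restrict (Ioo 0 t)) := by
  have hk : AEStronglyMeasurable (fun p : ℝ × ℝ => {p : ℝ × ℝ | p.1 < p.2}.indicator
      (fun p => rightKernel η z p.1 p.2) p)
      ((volume.restrict (Ioo 0 t)).prod (volume.restrict (Ioo 0 t))) := by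
    refine AEStronglyMeasurable.indicator ?_ (measurableSet_lt measurable_fst measurable_snd)
    have h1 : Measurable fun p : ℝ × ℝ => ((p.2 - p.1) ^ (1 - η + 1))⁻¹ := by fun_prop
    exact h1.aestronglyMeasurable.smul (hz.comp_fst.sub hz.comp_snd)
  have h2 : AEStronglyMeasurable (fun s => ∫ τ in Ioo s t, rightKernel η z s τ)
      (volume.restrict (Ioo 0 t)) := by
    refine hk.integral_prod_right'.congr (ae_restrict_of_forall_mem measurableSet_Ioo
      fun s hs => ?_)
    have : ∀ τ, {p : ℝ × ℝ | p.1 < p.2}.indicator (fun p => rightKernel η z p.1 p.2) (s, τ)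
        = (Ioi s).indicator (rightKernel η z s) τ := fun τ => by
      simp [indicator_apply]
    simp only [this]
    rw [setIntegral_indicator measurableSet_Ioi]
    congr 2
    ext τ
    simp only [mem_inter_iff, mem_Ioo, mem_Ioi]
    exact ⟨fun h => ⟨h.2, h.1.2⟩, fun h => ⟨⟨hs.1.trans h.1, h.2⟩, h.1⟩⟩
  have h3 : Measurable fun s : ℝ => ((t - s) ^ (1 - η))⁻¹ := by fun_prop
  exact ((h3.aestronglyMeasurable.smul (hz.sub aestronglyMeasurable_const)).add
    (h2.const_smul (1 - η))).const_smul _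

theorem leftDeriv_sub {η s : ℝ} {V V' : ℝ → E} (h : IntegrableOn (leftKernel η V s) (Ioo 0 s))
    (h' : IntegrableOn (leftKernel η V' s) (Ioo 0 s)) :
    leftDeriv η (fun s => V s - V' s) s = leftDeriv η V s - leftDeriv η V' s := by
  have : leftKernel η (fun s => V s - V' s) s
      = fun τ => leftKernel η V s τ - leftKernel η V' s τ := by
    ext τ; simp only [leftKernel, ← smul_sub]; congr 1; abel
  rw [leftDeriv, leftDeriv, leftDeriv, this, integral_sub h h']
  simp only [smul_sub, smul_add]
  abel

theorem leftDeriv_congr {η t s : ℝ} {V V' : ℝ → E} (h : EqOn V V' (Ioo 0 t)) (hs : s ∈ Ioo 0 t) :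
    leftDeriv η V s = leftDeriv η V' s := by
  have : ∫ τ in Ioo 0 s, leftKernel η V s τ = ∫ τ in Ioo 0 s, leftKernel η V' s τ :=
    setIntegral_congr_fun measurableSet_Ioo fun τ hτ => by
      simp only [leftKernel, h hs, h ⟨hτ.1, hτ.2.trans hs.2⟩]
  rw [leftDeriv, leftDeriv, this, h hs]

end Measurability

theorem min_one_le_rpow {x θ : ℝ} (hx : 0 ≤ x) (hθ : 0 ≤ θ) (hθ1 : θ ≤ 1) :
    min 1 x ≤ x ^ θ := by
  rcases le_total x 1 with h | h
  · rw [min_eq_right h]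
    calc x = x ^ (1 : ℝ) := (Real.rpow_one x).symm
      _ ≤ x ^ θ := Real.rpow_le_rpow_of_exponent_ge' hx h hθ hθ1
  · rw [min_eq_left h]; exact Real.one_le_rpow h hθ

/-- A family `m r`, `r > 0`, with the singularity `r^{-κ}` at `0` and with the first differences of
an analytic family. -/
structure IsSingularOp {W : Type*} [NormedAddCommGroup W] (t₀ κ K : ℝ) (m : ℝ → W) : Prop where
  norm_le : ∀ r, 0 < r → r ≤ t₀ → ‖m r‖ ≤ K * r ^ (-κ)
  diff_le : ∀ r h, 0 < r → r ≤ t₀ → 0 ≤ h → ‖m (r + h) - m r‖ ≤ K * r ^ (-κ) * min 1 (h / r)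

theorem IsSingularOp.diff_le_rpow {W : Type*} [NormedAddCommGroup W] {t₀ κ K : ℝ} {m : ℝ → W}
    (hm : IsSingularOp t₀ κ K m) (hK : 0 ≤ K) {r h θ : ℝ} (hr : 0 < r) (hrt : r ≤ t₀) (hh : 0 ≤ h)
    (hθ : 0 ≤ θ) (hθ1 : θ ≤ 1) : ‖m (r + h) - m r‖ ≤ K * r ^ (-(κ + θ)) * h ^ θ := by
  refine (hm.diff_le r h hr hrt hh).trans ?_
  calc _ ≤ K * r ^ (-κ) * (h / r) ^ θ := by
        gcongr; exact min_one_le_rpow (by positivity) hθ hθ1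
    _ = _ := by
        rw [Real.div_rpow hh hr.le, show -(κ + θ) = -κ - θ by ring, Real.rpow_sub hr]
        ring

theorem IsSingularOp.continuousOn {W : Type*} [NormedAddCommGroup W] {t₀ κ K : ℝ} {m : ℝ → W}
    (hm : IsSingularOp t₀ κ K m) (hκ : 0 ≤ κ) (hK : 0 ≤ K) : ContinuousOn m (Ioc 0 t₀) := by
  intro r₀ hr₀
  have h0 : 0 < r₀ / 2 := half_pos hr₀.1
  have aux : ∀ a b, r₀ / 2 ≤ a → a ≤ t₀ → a ≤ b →
      ‖m b - m a‖ ≤ K * (r₀ / 2) ^ (-(κ + 1)) * |b - a| := by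
    intro a b ha hat hab
    have h1 := hm.diff_le_rpow hK (h := b - a) (θ := 1) (h0.trans_le ha) hat (sub_nonneg.2 hab)
      zero_le_one le_rfl
    rw [add_sub_cancel, Real.rpow_one] at h1
    refine h1.trans ?_
    rw [abs_of_nonneg (sub_nonneg.2 hab)]
    have : a ^ (-(κ + 1)) ≤ (r₀ / 2) ^ (-(κ + 1)) :=
      Real.rpow_le_rpow_of_nonpos h0 ha (by linarith)
    have := sub_nonneg.2 hab
    gcongr
  rw [ContinuousWithinAt, tendsto_iff_norm_sub_tendsto_zero]
  have hc : Tendsto (fun r => K * (r₀ / 2) ^ (-(κ + 1)) * |r - r₀|) (𝓝[Ioc 0 t₀] r₀) (𝓝 0) := by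
    have : Continuous fun r => K * (r₀ / 2) ^ (-(κ + 1)) * |r - r₀| := by fun_prop
    have h1 := (this.tendsto r₀).mono_left (nhdsWithin_le_nhds (s := Ioc 0 t₀))
    simpa using h1
  refine squeeze_zero' (Eventually.of_forall fun _ => norm_nonneg _) ?_ hc
  have hev : ∀ᶠ r in 𝓝[Ioc 0 t₀] r₀, r₀ / 2 < r :=
    nhdsWithin_le_nhds (lt_mem_nhds (half_lt_self hr₀.1))
  filter_upwards [hev, self_mem_nhdsWithin] with r hr hr'
  rcases le_total r₀ r with h | h
  · exact aux r₀ r (half_le_self hr₀.1.le) hr₀.2 h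
  · rw [norm_sub_rev, abs_sub_comm]; exact aux r r₀ hr.le hr'.2 h

section LeftDeriv

variable {𝔾 W : Type*} [NormedAddCommGroup 𝔾] [NormedSpace ℝ 𝔾] [NormedAddCommGroup W]
  [NormedSpace ℝ W]

theorem aestronglyMeasurable_apply {t t₀ η ρ A : ℝ} (htt : t ≤ t₀) {m : ℝ → 𝔾 →L[ℝ] W}
    (hmc : ContinuousOn m (Ioo 0 t)) {g : ℝ → 𝔾} (hg : IsWeighted η t₀ ρ A g) :
    AEStronglyMeasurable (fun s => m s (g s)) (volume.restrict (Ioo 0 t)) := by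
  have h1 : AEStronglyMeasurable g (volume.restrict (Ioo 0 t)) :=
    hg.aestronglyMeasurable.mono_measure (Measure.restrict_mono
      (Ioo_subset_Icc_self.trans (Icc_subset_Icc_right htt)) le_rfl)
  exact (ContinuousLinearMap.id ℝ (𝔾 →L[ℝ] W)).aestronglyMeasurable_comp₂
    (hmc.aestronglyMeasurable measurableSet_Ioo) h1

variable {t t₀ η κ θ ρ A K : ℝ} {m : ℝ → 𝔾 →L[ℝ] W} {g : ℝ → 𝔾}

theorem norm_integral_leftKernel_le (htt : t ≤ t₀) (hηθ : η < θ) (hρ : 0 ≤ ρ)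
    (hK : 0 ≤ K) (hm1 : ∀ s ∈ Ioo 0 t, ‖m s‖ ≤ K * (t - s) ^ (-κ))
    (hm2 : ∀ s ∈ Ioo 0 t, ∀ τ ∈ Ioo 0 s, ‖m s - m τ‖ ≤ K * (t - s) ^ (-(κ + θ)) * (s - τ) ^ θ)
    (hmc : ContinuousOn m (Ioo 0 t)) (hg : IsWeighted η t₀ ρ A g) {s : ℝ} (hs : s ∈ Ioo 0 t) :
    IntegrableOn (leftKernel η (fun s => m s (g s)) s) (Ioo 0 s) ∧
    ∫ τ in Ioo 0 s, ‖leftKernel η (fun s => m s (g s)) s τ‖ ≤ K * A * Real.exp (ρ * s) *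
      ((t - s) ^ (-(κ + θ)) * (s ^ (θ - η) / (θ - η)) + (t - s) ^ (-κ)) := by
  have hts : 0 < t - s := sub_pos.2 hs.2
  have hst : s ∈ Icc 0 t₀ := ⟨hs.1.le, hs.2.le.trans htt⟩
  have hA := hg.nonneg
  obtain ⟨i1, i2⟩ := hg.integrableOn hst
  have j := integrableOn_sub_rpow (a := 0) (t := s) (c := θ - η - 1) hs.1.le (by linarith)
  set b : ℝ → ℝ := fun τ => K * A * Real.exp (ρ * s) * (t - s) ^ (-(κ + θ)) *
    (s - τ) ^ (θ - η - 1) + K * (t - s) ^ (-κ) * ((s - τ) ^ (-(η + 1)) * ‖g s - g τ‖) with hb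
  have hbi : IntegrableOn b (Ioo 0 s) := (j.1.const_mul _).add (i1.const_mul _)
  have hle : ∀ τ ∈ Ioo 0 s, ‖leftKernel η (fun s => m s (g s)) s τ‖ ≤ b τ := by
    intro τ hτ
    have hsτ : 0 < s - τ := sub_pos.2 hτ.2
    have hgτ : ‖g τ‖ ≤ A * Real.exp (ρ * s) := (hg.norm_le τ ⟨hτ.1.le, hτ.2.le.trans hst.2⟩).trans
      (by have := hτ.2.le; gcongr)
    rw [leftKernel, norm_smul, Real.norm_of_nonneg (by positivity), ← Real.rpow_neg hsτ.le]
    have e1 : m s (g s) - m τ (g τ) = (m s - m τ) (g τ) + m s (g s - g τ) := by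
      rw [sub_apply, map_sub]; abel
    have e2 : ‖m s (g s) - m τ (g τ)‖ ≤ K * (t - s) ^ (-(κ + θ)) * (s - τ) ^ θ *
        (A * Real.exp (ρ * s)) + K * (t - s) ^ (-κ) * ‖g s - g τ‖ := by
      rw [e1]
      refine (norm_add_le _ _).trans (add_le_add ?_ ?_)
      · refine ((m s - m τ).le_opNorm _).trans ?_
        gcongr
        exact hm2 s hs τ hτ
      · refine ((m s).le_opNorm _).trans ?_
        gcongr
        exact hm1 s hs
    calc _ ≤ (s - τ) ^ (-(η + 1)) * (K * (t - s) ^ (-(κ + θ)) * (s - τ) ^ θ *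
        (A * Real.exp (ρ * s)) + K * (t - s) ^ (-κ) * ‖g s - g τ‖) := by gcongr
      _ = b τ := by
        rw [hb]
        simp only
        rw [show θ - η - 1 = -(η + 1) + θ by ring, Real.rpow_add hsτ]
        ring
  have hV : AEStronglyMeasurable (fun s => m s (g s)) (volume.restrict (Ioo 0 s)) :=
    (aestronglyMeasurable_apply htt hmc hg).mono_measure
      (Measure.restrict_mono (Ioo_subset_Ioo_right hs.2.le) le_rfl)
  have hkm : AEStronglyMeasurable (leftKernel η (fun s => m s (g s)) s)
      (volume.restrict (Ioo 0 s)) := by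
    have h1 : Measurable fun τ : ℝ => ((s - τ) ^ (η + 1))⁻¹ := by fun_prop
    exact h1.aestronglyMeasurable.smul (aestronglyMeasurable_const.sub hV)
  have hi : IntegrableOn (leftKernel η (fun s => m s (g s)) s) (Ioo 0 s) :=
    Integrable.mono' hbi hkm (ae_restrict_of_forall_mem measurableSet_Ioo hle)
  refine ⟨hi, (setIntegral_mono_on hi.norm hbi measurableSet_Ioo hle).trans ?_⟩
  rw [hb, integral_add (j.1.const_mul _) (i1.const_mul _), integral_const_mul, integral_const_mul,
    j.2, sub_zero, show θ - η - 1 + 1 = θ - η by ring]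
  calc _ ≤ K * A * Real.exp (ρ * s) * (t - s) ^ (-(κ + θ)) * (s ^ (θ - η) / (θ - η))
        + K * (t - s) ^ (-κ) * (A * Real.exp (ρ * s)) := by gcongr
    _ = _ := by ring

/-- The constant in `norm_leftDeriv_le`. -/
def leftConst (η θ t₀ : ℝ) : ℝ :=
  (Real.Gamma (1 - η))⁻¹ * (t₀ ^ (θ - η) + η * (t₀ ^ (θ - η) / (θ - η) + t₀ ^ θ))

theorem leftConst_nonneg (hη : 0 < η) (hη1 : η < 1) (hηθ : η < θ) (ht₀ : 0 ≤ t₀) :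
    0 ≤ leftConst η θ t₀ := by
  have h1 := Real.Gamma_pos_of_pos (s := 1 - η) (by linarith)
  have h2 : 0 < θ - η := by linarith
  unfold leftConst
  positivity

theorem norm_leftDeriv_le (htt : t ≤ t₀) (hη : 0 < η) (hη1 : η < 1) (hηθ : η < θ) (hκ : 0 ≤ κ)
    (hρ : 0 ≤ ρ)
    (hK : 0 ≤ K) (hm1 : ∀ s ∈ Ioo 0 t, ‖m s‖ ≤ K * (t - s) ^ (-κ))
    (hm2 : ∀ s ∈ Ioo 0 t, ∀ τ ∈ Ioo 0 s, ‖m s - m τ‖ ≤ K * (t - s) ^ (-(κ + θ)) * (s - τ) ^ θ)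
    (hmc : ContinuousOn m (Ioo 0 t)) (hg : IsWeighted η t₀ ρ A g) {s : ℝ} (hs : s ∈ Ioo 0 t) :
    ‖leftDeriv η (fun s => m s (g s)) s‖ ≤ leftConst η θ t₀ * K * A * Real.exp (ρ * s) *
      ((t - s) ^ (-(κ + θ)) + s ^ (-(κ + θ))) := by
  obtain ⟨hi, hb⟩ := norm_integral_leftKernel_le htt hηθ hρ hK hm1 hm2 hmc hg hs
  have hts : 0 < t - s := sub_pos.2 hs.2
  have hs0 : 0 < s := hs.1
  have hst₀ : s ≤ t₀ := hs.2.le.trans htt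
  have hA := hg.nonneg
  have hΓ := Real.Gamma_pos_of_pos (s := 1 - η) (by linarith)
  have hθη : 0 < θ - η := by linarith
  have ht₀ : 0 < t₀ := hs0.trans_le hst₀
  set x := (t - s) ^ (-(κ + θ)) with hx
  set y := s ^ (-(κ + θ)) with hy
  have hx0 : 0 ≤ x := by positivity
  have hy0 : 0 ≤ y := by positivity
  have e1 : s ^ (-η) * (t - s) ^ (-κ) ≤ t₀ ^ (θ - η) * (x + y) := by
    refine (rpow_neg_mul_rpow_neg_le hs0 hts hη.le hκ).trans ?_
    have h1 := SymmMarkovSemigroup.rpow_neg_le_mul (a := η + κ) (m := κ + θ) (by linarith) hs0 hst₀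
    have h2 := SymmMarkovSemigroup.rpow_neg_le_mul (a := η + κ) (m := κ + θ) (by linarith) hts
      (t₀ := t₀) (by linarith)
    rw [show κ + θ - (η + κ) = θ - η by ring] at h1 h2
    rw [mul_add]; linarith
  have e2 : (t - s) ^ (-κ) ≤ t₀ ^ θ * x := by
    have h2 := SymmMarkovSemigroup.rpow_neg_le_mul (a := κ) (m := κ + θ) (by linarith) hts
      (t₀ := t₀) (by linarith)
    rwa [show κ + θ - κ = θ by ring] at h2
  have e3 : s ^ (θ - η) ≤ t₀ ^ (θ - η) := Real.rpow_le_rpow hs0.le hst₀ hθη.le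
  rw [leftDeriv, norm_smul, norm_inv, Real.norm_of_nonneg hΓ.le, leftConst]
  have n1 : ‖(s ^ η)⁻¹ • (m s (g s))‖ ≤ K * A * Real.exp (ρ * s) * (t₀ ^ (θ - η) * (x + y)) := by
    rw [norm_smul, Real.norm_of_nonneg (by positivity), ← Real.rpow_neg hs0.le]
    calc _ ≤ s ^ (-η) * ((K * (t - s) ^ (-κ)) * (A * Real.exp (ρ * s))) := by
          gcongr
          refine ((m s).le_opNorm _).trans ?_
          gcongr
          · exact hm1 s hs
          · exact hg.norm_le s ⟨hs0.le, hst₀⟩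
      _ = K * A * Real.exp (ρ * s) * (s ^ (-η) * (t - s) ^ (-κ)) := by ring
      _ ≤ _ := by gcongr
  have n2 : ‖η • ∫ τ in Ioo 0 s, leftKernel η (fun s => m s (g s)) s τ‖ ≤
      η * (K * A * Real.exp (ρ * s) * ((t₀ ^ (θ - η) / (θ - η) + t₀ ^ θ) * (x + y))) := by
    rw [norm_smul, Real.norm_of_nonneg hη.le]
    refine mul_le_mul_of_nonneg_left ((norm_integral_le_integral_norm _).trans (hb.trans ?_)) hη.le
    refine mul_le_mul_of_nonneg_left ?_ (by positivity)
    calc x * (s ^ (θ - η) / (θ - η)) + (t - s) ^ (-κ)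
        ≤ x * (t₀ ^ (θ - η) / (θ - η)) + t₀ ^ θ * x := by gcongr
      _ = (t₀ ^ (θ - η) / (θ - η) + t₀ ^ θ) * x := by ring
      _ ≤ _ := by gcongr; linarith
  calc _ ≤ (Real.Gamma (1 - η))⁻¹ * (K * A * Real.exp (ρ * s) * (t₀ ^ (θ - η) * (x + y)) +
        η * (K * A * Real.exp (ρ * s) * ((t₀ ^ (θ - η) / (θ - η) + t₀ ^ θ) * (x + y)))) := by
        gcongr
        exact (norm_add_le _ _).trans (add_le_add n1 n2)
    _ = _ := by ring

end LeftDeriv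

theorem MemC.continuousOn {Z : Type*} [NormedAddCommGroup Z] {z : ℝ → Z} {t₀ a : ℝ} (ha : 0 < a)
    (hz : MemC a t₀ z) : ContinuousOn z (Icc 0 t₀) := by
  obtain ⟨C, -, hC⟩ := hz
  intro s hs
  rw [ContinuousWithinAt, tendsto_iff_norm_sub_tendsto_zero]
  have hc : Continuous fun t : ℝ => C * |t - s| ^ a :=
    continuous_const.mul (Continuous.rpow_const (by fun_prop) fun _ => Or.inr ha.le)
  have h0 := (hc.tendsto s).mono_left (nhdsWithin_le_nhds (s := Icc 0 t₀))
  simp only [sub_self, abs_zero, Real.zero_rpow ha.ne', mul_zero] at h0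
  exact squeeze_zero' (Eventually.of_forall fun _ => norm_nonneg _)
    (eventually_nhdsWithin_of_forall fun t ht => hC s hs t ht) h0

section RightDeriv

variable {Z : Type*} [NormedAddCommGroup Z] [NormedSpace ℝ Z] {z : ℝ → Z} {t₀ α η C : ℝ}

theorem norm_rightKernel_le
    (hz : ∀ s ∈ Icc 0 t₀, ∀ t ∈ Icc 0 t₀, ‖z t - z s‖ ≤ C * |t - s| ^ (1 - α)) {s τ : ℝ}
    (hs : 0 ≤ s) (hsτ : s < τ) (hτ : τ ≤ t₀) :
    ‖rightKernel η z s τ‖ ≤ C * (τ - s) ^ (η - α - 1) := by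
  have h0 : 0 < τ - s := sub_pos.2 hsτ
  rw [rightKernel, norm_smul, Real.norm_of_nonneg (by positivity), ← Real.rpow_neg h0.le]
  have h1 := hz τ ⟨hs.trans hsτ.le, hτ⟩ s ⟨hs, hsτ.le.trans hτ⟩
  rw [abs_sub_comm, abs_of_pos h0] at h1
  calc _ ≤ (τ - s) ^ (-(1 - η + 1)) * (C * (τ - s) ^ (1 - α)) := by gcongr
    _ = _ := by
      rw [show η - α - 1 = -(1 - η + 1) + (1 - α) by ring, Real.rpow_add h0]; ring

theorem integrableOn_rightKernel (hη : α < η)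
    (hz : ∀ s ∈ Icc 0 t₀, ∀ t ∈ Icc 0 t₀, ‖z t - z s‖ ≤ C * |t - s| ^ (1 - α))
    (hzc : ContinuousOn z (Icc 0 t₀))
    {s t : ℝ} (hs : 0 ≤ s) (hst : s ≤ t) (ht : t ≤ t₀) :
    IntegrableOn (rightKernel η z s) (Ioo s t) ∧
      ‖∫ τ in Ioo s t, rightKernel η z s τ‖ ≤ C * ((t - s) ^ (η - α) / (η - α)) := by
  have j := integrableOn_sub_rpow' (a := s) (t := t) (c := η - α - 1) hst (by linarith)
  have hle : ∀ τ ∈ Ioo s t, ‖rightKernel η z s τ‖ ≤ C * (τ - s) ^ (η - α - 1) := fun τ hτ =>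
    norm_rightKernel_le hz hs hτ.1 (hτ.2.le.trans ht)
  have hzm : AEStronglyMeasurable z (volume.restrict (Ioo s t)) :=
    (hzc.mono (Ioo_subset_Icc_self.trans (Icc_subset_Icc hs ht))).aestronglyMeasurable
      measurableSet_Ioo
  have hm : AEStronglyMeasurable (rightKernel η z s) (volume.restrict (Ioo s t)) := by
    have h1 : Measurable fun τ : ℝ => ((τ - s) ^ (1 - η + 1))⁻¹ := by fun_prop
    exact h1.aestronglyMeasurable.smul (aestronglyMeasurable_const.sub hzm)
  refine ⟨Integrable.mono' (j.1.const_mul C) hm (ae_restrict_of_forall_mem measurableSet_Ioo hle),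
    (norm_integral_le_of_norm_le (j.1.const_mul C)
      (ae_restrict_of_forall_mem measurableSet_Ioo hle)).trans (le_of_eq ?_)⟩
  rw [integral_const_mul, j.2, show η - α - 1 + 1 = η - α by ring]

/-- The constant in the estimates of `rightDeriv`. -/
def rightConst (α η C : ℝ) : ℝ := (Real.Gamma η)⁻¹ * C * (3 + 2 / (η - α))

theorem rightConst_nonneg (hC : 0 ≤ C) (hα : 0 < α) (hη : α < η) : 0 ≤ rightConst α η C := by
  have hΓ := Real.Gamma_pos_of_pos (hα.trans hη)
  have : 0 < η - α := by linarith
  unfold rightConst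
  positivity

theorem norm_rightDeriv_le (hC : 0 ≤ C) (hα : 0 < α) (hη : α < η) (hη1 : η < 1)
    (hz : ∀ s ∈ Icc 0 t₀, ∀ t ∈ Icc 0 t₀, ‖z t - z s‖ ≤ C * |t - s| ^ (1 - α))
    (hzc : ContinuousOn z (Icc 0 t₀))
    {s t : ℝ} (hs : 0 ≤ s) (hst : s < t) (ht : t ≤ t₀) :
    ‖rightDeriv η z t s‖ ≤ (Real.Gamma η)⁻¹ * C * (1 + 1 / (η - α)) * t₀ ^ (η - α) := by
  have h0 : 0 < t - s := sub_pos.2 hst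
  have hΓ := Real.Gamma_pos_of_pos (hα.trans hη)
  have hηα : 0 < η - α := by linarith
  have h1 := hz t ⟨hs.trans hst.le, ht⟩ s ⟨hs, hst.le.trans ht⟩
  rw [abs_sub_comm, abs_of_pos h0] at h1
  have h2 := (integrableOn_rightKernel hη hz hzc hs hst.le ht).2
  have e : (t - s) ^ (η - α) ≤ t₀ ^ (η - α) := Real.rpow_le_rpow h0.le (by linarith) hηα.le
  rw [rightDeriv, norm_smul, norm_inv, Real.norm_of_nonneg hΓ.le, mul_assoc, mul_assoc]
  refine mul_le_mul_of_nonneg_left ((norm_add_le _ _).trans ?_) (by positivity)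
  rw [norm_smul, norm_smul, Real.norm_of_nonneg (by positivity), ← Real.rpow_neg h0.le,
    Real.norm_of_nonneg (by linarith : 0 ≤ 1 - η)]
  calc _ ≤ (t - s) ^ (-(1 - η)) * (C * (t - s) ^ (1 - α)) +
        1 * (C * ((t - s) ^ (η - α) / (η - α))) := by gcongr; linarith
    _ = C * ((1 + 1 / (η - α)) * (t - s) ^ (η - α)) := by
        rw [show η - α = -(1 - η) + (1 - α) by ring, Real.rpow_add h0]; ring
    _ ≤ _ := by gcongr

theorem norm_rightDeriv_sub_le (hC : 0 ≤ C) (hα : 0 < α) (hη : α < η) (hη1 : η < 1)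
    (hz : ∀ s ∈ Icc 0 t₀, ∀ t ∈ Icc 0 t₀, ‖z t - z s‖ ≤ C * |t - s| ^ (1 - α))
    (hzc : ContinuousOn z (Icc 0 t₀)) {γ : ℝ} (hγ : 0 ≤ γ) (hγα : γ ≤ 1 - α)
    {s t' t : ℝ} (hs : 0 ≤ s) (hst : s < t') (htt : t' < t) (ht : t ≤ t₀) :
    ‖rightDeriv η z t s - rightDeriv η z t' s‖ ≤
      rightConst α η C * t₀ ^ (η - α) * (t - t') ^ γ * (t' - s) ^ (-γ) := by
  have hr : 0 < t' - s := sub_pos.2 hst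
  have hh : 0 < t - t' := sub_pos.2 htt
  have hrh : 0 < t - s := by linarith
  have hΓ := Real.Gamma_pos_of_pos (hα.trans hη)
  have hηα : 0 < η - α := by linarith
  have ht₀ : 0 < t₀ := by linarith
  have hform : (t - t') ^ γ * (t' - s) ^ (-γ) = ((t - t') / (t' - s)) ^ γ := by
    rw [Real.div_rpow hh.le hr.le, Real.rpow_neg hr.le, div_eq_mul_inv]
  rw [mul_assoc, hform]
  set x := (t - t') / (t' - s) with hx
  have hx0 : 0 < x := by positivity
  rcases le_total 1 x with h1x | hx1
  · have e : 1 ≤ x ^ γ := Real.one_le_rpow h1x hγ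
    have b1 := norm_rightDeriv_le hC hα hη hη1 hz hzc hs (hst.trans htt) ht
    have b2 := norm_rightDeriv_le hC hα hη hη1 hz hzc hs hst (htt.le.trans ht)
    refine (norm_sub_le _ _).trans ((add_le_add b1 b2).trans ?_)
    have : 0 ≤ (Real.Gamma η)⁻¹ * C * t₀ ^ (η - α) := by positivity
    calc _ = (Real.Gamma η)⁻¹ * C * t₀ ^ (η - α) * (2 + 2 / (η - α)) := by ring
      _ ≤ (Real.Gamma η)⁻¹ * C * t₀ ^ (η - α) * (3 + 2 / (η - α)) := by gcongr; norm_num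
      _ = rightConst α η C * t₀ ^ (η - α) * 1 := by rw [rightConst]; ring
      _ ≤ _ := by
        have := rightConst_nonneg hC hα hη
        gcongr
  · -- here `t - t' ≤ t' - s`
    have hsplit : ∫ τ in Ioo s t, rightKernel η z s τ
        = (∫ τ in Ioo s t', rightKernel η z s τ) + ∫ τ in Ioo t' t, rightKernel η z s τ := by
      have hi := (integrableOn_rightKernel hη hz hzc hs (hst.trans htt).le ht).1
      rw [← integral_Ioc_eq_integral_Ioo, ← integral_Ioc_eq_integral_Ioo,
        ← integral_Ioc_eq_integral_Ioo, ← Ioc_union_Ioc_eq_Ioc hst.le htt.le]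
      have hi : IntegrableOn (rightKernel η z s) (Ioc s t) :=
        (integrableOn_Ioc_iff_integrableOn_Ioo).2 hi
      exact setIntegral_union (Ioc_disjoint_Ioc_of_le le_rfl) measurableSet_Ioc
        (hi.mono_set (Ioc_subset_Ioc_right htt.le)) (hi.mono_set (Ioc_subset_Ioc_left hst.le))
    have key : rightDeriv η z t s - rightDeriv η z t' s = (Real.Gamma η)⁻¹ •
        (((t - s) ^ (1 - η))⁻¹ • (z t' - z t)
          + (((t - s) ^ (1 - η))⁻¹ - ((t' - s) ^ (1 - η))⁻¹) • (z s - z t')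
          + (1 - η) • ∫ τ in Ioo t' t, rightKernel η z s τ) := by
      rw [rightDeriv, rightDeriv, ← smul_sub, hsplit]
      congr 1
      simp only [smul_sub, smul_add, sub_smul]
      abel
    have hst' : s ∈ Icc 0 t₀ := ⟨hs, by linarith⟩
    have ht't : t' ∈ Icc 0 t₀ := ⟨by linarith, by linarith⟩
    have htt₀ : t ∈ Icc 0 t₀ := ⟨by linarith, ht⟩
    have z1 := hz t htt₀ t' ht't
    rw [abs_sub_comm, abs_of_pos hh] at z1
    have z2 := hz t' ht't s hst'
    rw [abs_sub_comm, abs_of_pos hr] at z2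
    have hxγ : x ≤ x ^ γ := by
      simpa using Real.rpow_le_rpow_of_exponent_ge' hx0.le hx1 hγ (by linarith : γ ≤ 1)
    have hxα : x ^ (1 - α) ≤ x ^ γ := Real.rpow_le_rpow_of_exponent_ge' hx0.le hx1 hγ hγα
    have hrη : (t' - s) ^ (η - α) ≤ t₀ ^ (η - α) :=
      Real.rpow_le_rpow hr.le (by linarith) hηα.le
    have hxr : t - t' = x * (t' - s) := by rw [hx]; field_simp
    -- the increment of the boundary term splits into two summands, for `z` and for the weight
    have b1 : ‖((t - s) ^ (1 - η))⁻¹ • (z t' - z t)‖ ≤ C * (t₀ ^ (η - α) * x ^ γ) := by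
      rw [norm_smul, Real.norm_of_nonneg (by positivity), ← Real.rpow_neg hrh.le]
      have : (t - s) ^ (-(1 - η)) ≤ (t' - s) ^ (-(1 - η)) :=
        Real.rpow_le_rpow_of_nonpos hr (by linarith) (by linarith)
      calc _ ≤ (t' - s) ^ (-(1 - η)) * (C * (t - t') ^ (1 - α)) := by gcongr
        _ = C * ((t' - s) ^ (η - α) * x ^ (1 - α)) := by
          rw [hxr, Real.mul_rpow hx0.le hr.le, show η - α = -(1 - η) + (1 - α) by ring,
            Real.rpow_add hr]
          ring
        _ ≤ _ := by gcongr
    have b2 : ‖(((t - s) ^ (1 - η))⁻¹ - ((t' - s) ^ (1 - η))⁻¹) • (z s - z t')‖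
        ≤ C * (t₀ ^ (η - α) * x ^ γ) := by
      have h3 : (t - s) = (1 + x) * (t' - s) := by
        have : t - s = (t - t') + (t' - s) := by ring
        rw [this, hxr]; ring
      have h4 : |((t - s) ^ (1 - η))⁻¹ - ((t' - s) ^ (1 - η))⁻¹| ≤ (t' - s) ^ (-(1 - η)) * x := by
        rw [← Real.rpow_neg hrh.le, ← Real.rpow_neg hr.le, h3,
          Real.mul_rpow (by linarith) hr.le, abs_le]
        have h5 : (1 + x) ^ (-(1 - η)) ≤ 1 :=
          Real.rpow_le_one_of_one_le_of_nonpos (by linarith) (by linarith)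
        have h6 : 1 - x ≤ (1 + x) ^ (-(1 - η)) := by
          have : (1 + x) ^ (-1 : ℝ) ≤ (1 + x) ^ (-(1 - η)) :=
            Real.rpow_le_rpow_of_exponent_le (by linarith) (by linarith)
          refine le_trans ?_ this
          rw [Real.rpow_neg_one, ← one_div, le_div_iff₀ (by linarith)]
          nlinarith
        have h7 : 0 ≤ (t' - s) ^ (-(1 - η)) := by positivity
        constructor <;> nlinarith
      rw [norm_smul, Real.norm_eq_abs]
      calc _ ≤ ((t' - s) ^ (-(1 - η)) * x) * (C * (t' - s) ^ (1 - α)) := by gcongr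
        _ = C * ((t' - s) ^ (η - α) * x) := by
          rw [show η - α = -(1 - η) + (1 - α) by ring, Real.rpow_add hr]; ring
        _ ≤ _ := by gcongr
    have b3 : ‖(1 - η) • ∫ τ in Ioo t' t, rightKernel η z s τ‖ ≤ C * (t₀ ^ (η - α) * x ^ γ) := by
      rw [norm_smul, Real.norm_of_nonneg (by linarith : 0 ≤ 1 - η)]
      have h3 : ‖∫ τ in Ioo t' t, rightKernel η z s τ‖ ≤
          (C * (t' - s) ^ (η - α - 1)) * volume.real (Ioo t' t) := by
        refine norm_setIntegral_le_of_norm_le_const (by simp) fun τ hτ => ?_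
        refine (norm_rightKernel_le hz hs (hst.trans hτ.1) (hτ.2.le.trans ht)).trans ?_
        have : (τ - s) ^ (η - α - 1) ≤ (t' - s) ^ (η - α - 1) :=
          Real.rpow_le_rpow_of_nonpos hr (by linarith [hτ.1]) (by linarith)
        gcongr
      rw [Real.volume_real_Ioo_of_le htt.le] at h3
      calc _ ≤ 1 * ((C * (t' - s) ^ (η - α - 1)) * (t - t')) := by gcongr; linarith
        _ = C * ((t' - s) ^ (η - α) * x) := by
          rw [hxr, Real.rpow_sub hr, Real.rpow_one]; field_simp
        _ ≤ _ := by gcongr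
    rw [key, norm_smul, norm_inv, Real.norm_of_nonneg hΓ.le]
    have : 0 ≤ (Real.Gamma η)⁻¹ * C * (t₀ ^ (η - α) * x ^ γ) := by positivity
    calc _ ≤ (Real.Gamma η)⁻¹ * (C * (t₀ ^ (η - α) * x ^ γ) + C * (t₀ ^ (η - α) * x ^ γ)
          + C * (t₀ ^ (η - α) * x ^ γ)) := by
          gcongr
          exact (norm_add_le _ _).trans (add_le_add ((norm_add_le _ _).trans (add_le_add b1 b2)) b3)
      _ = ((Real.Gamma η)⁻¹ * C * (t₀ ^ (η - α) * x ^ γ)) * 3 := by ring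
      _ ≤ ((Real.Gamma η)⁻¹ * C * (t₀ ^ (η - α) * x ^ γ)) * (3 + 2 / (η - α)) := by
          gcongr
          have : 0 ≤ 2 / (η - α) := by positivity
          linarith
      _ = _ := by rw [rightConst]; ring

end RightDeriv

/-! ### The two convolution operators -/

section Drift

variable {H Y : Type*} [NormedAddCommGroup H] [NormedSpace ℝ H] [NormedAddCommGroup Y]
  [NormedSpace ℝ Y] {t₀ κ K : ℝ} {P : ℝ → H →L[ℝ] Y} {h : ℝ → H}

theorem IsSingularOp.continuousOn_sub {W : Type*} [NormedAddCommGroup W] {m : ℝ → W}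
    (hm : IsSingularOp t₀ κ K m) (hκ : 0 ≤ κ) (hK : 0 ≤ K) {t : ℝ} (htt : t ≤ t₀) :
    ContinuousOn (fun s => m (t - s)) (Ioo 0 t) :=
  (hm.continuousOn hκ hK).comp (continuousOn_const.sub continuousOn_id)
    fun s hs => ⟨sub_pos.2 hs.2, by linarith [hs.1]⟩

theorem integrableOn_drift (hP : IsSingularOp t₀ κ K P) (hκ : 0 ≤ κ) (hκ1 : κ < 1) (hK : 0 ≤ K)
    (hh : AEStronglyMeasurable h (volume.restrict (Icc 0 t₀))) {A : ℝ}
    (hhA : ∀ s ∈ Icc 0 t₀, ‖h s‖ ≤ A) {t : ℝ} (htt : t ≤ t₀) :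
    IntegrableOn (fun s => P (t - s) (h s)) (Ioo 0 t) := by
  rcases le_or_gt t 0 with h0 | h0
  · simp [Ioo_eq_empty (not_lt.2 h0)]
  have h1 : AEStronglyMeasurable h (volume.restrict (Ioo 0 t)) :=
    hh.mono_measure (Measure.restrict_mono
      (Ioo_subset_Icc_self.trans (Icc_subset_Icc_right htt)) le_rfl)
  have h2 : AEStronglyMeasurable (fun s => P (t - s) (h s)) (volume.restrict (Ioo 0 t)) :=
    (ContinuousLinearMap.id ℝ (H →L[ℝ] Y)).aestronglyMeasurable_comp₂
      ((hP.continuousOn_sub hκ hK htt).aestronglyMeasurable measurableSet_Ioo) h1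
  refine Integrable.mono' (((integrableOn_sub_rpow (a := 0) (t := t) (c := -κ) h0.le
    (by linarith)).1.const_mul (K * A))) h2 (ae_restrict_of_forall_mem measurableSet_Ioo
    fun s hs => ?_)
  have hts : 0 < t - s := sub_pos.2 hs.2
  refine ((P (t - s)).le_opNorm _).trans ?_
  calc _ ≤ (K * (t - s) ^ (-κ)) * A := by
        gcongr
        · exact hP.norm_le _ hts (by linarith [hs.1])
        · exact hhA s ⟨hs.1.le, hs.2.le.trans htt⟩
    _ = _ := by ring

/-- The convolution `∫₀ᵗ P(t-s) h(s) ds` in the weighted norms. -/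
theorem exists_drift_bound (hP : IsSingularOp t₀ κ K P) (hκ : 0 ≤ κ) (hK : 0 ≤ K) {γ l : ℝ}
    (hγ : 0 ≤ γ) (hγ1 : γ ≤ 1) (hl : 0 ≤ l) (hsum : κ + γ + l < 1) :
    ∃ C, 0 ≤ C ∧ ∀ (ρ A : ℝ) (h : ℝ → H), 0 < ρ → 0 ≤ A →
      AEStronglyMeasurable h (volume.restrict (Icc 0 t₀)) →
      (∀ s ∈ Icc 0 t₀, ‖h s‖ ≤ A * Real.exp (ρ * s)) →
      (∀ t ∈ Icc 0 t₀, ‖∫ s in Ioo 0 t, P (t - s) (h s)‖ ≤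
        C * A * ρ ^ (-l) * Real.exp (ρ * t)) ∧
      ∀ t' ∈ Icc 0 t₀, ∀ t ∈ Icc 0 t₀, t' < t →
        ‖(∫ s in Ioo 0 t, P (t - s) (h s)) - ∫ s in Ioo 0 t', P (t' - s) (h s)‖ ≤
          C * A * ρ ^ (-l) * Real.exp (ρ * t) * (t - t') ^ γ := by
  have hc1 : 0 < 1 - (κ + l) := by linarith
  have hc2 : 0 < 1 - (κ + γ + l) := by linarith
  set C₁ := 4 / (1 - (κ + l)) * t₀ ^ (1 - (κ + l)) with hC₁
  set C₂ := 4 / (1 - (κ + γ + l)) * t₀ ^ (1 - (κ + γ + l)) +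
    4 / (1 - (κ + l)) * t₀ ^ (1 - (κ + l) - γ) with hC₂
  rcases le_or_gt t₀ 0 with ht₀ | ht₀
  · refine ⟨0, le_rfl, fun ρ A h _ _ _ _ => ⟨fun t ht => ?_, fun t' ht' t ht htt => ?_⟩⟩
    · rw [Ioo_eq_empty (not_lt.2 (ht.2.trans ht₀))]; simp
    · linarith [ht'.1, ht.2]
  refine ⟨(C₁ + C₂) * K, by positivity, fun ρ A h hρ hA hm hb => ?_⟩
  have hbt : ∀ s ∈ Icc 0 t₀, ‖h s‖ ≤ A * Real.exp (ρ * t₀) := fun s hs =>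
    (hb s hs).trans (by have := hs.2; gcongr)
  have hpt : ∀ t ∈ Icc 0 t₀, ∀ s ∈ Ioo 0 t, ‖P (t - s) (h s)‖ ≤
      K * A * Real.exp (ρ * s) * ((t - s) ^ (-κ) + s ^ (-κ)) := by
    intro t ht s hs
    have hts : 0 < t - s := sub_pos.2 hs.2
    have hs0 : 0 < s := hs.1
    refine ((P (t - s)).le_opNorm _).trans ?_
    calc _ ≤ (K * (t - s) ^ (-κ)) * (A * Real.exp (ρ * s)) := by
          gcongr
          · exact hP.norm_le _ hts (by linarith [hs.1, ht.2])
          · exact hb s ⟨hs.1.le, hs.2.le.trans ht.2⟩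
      _ = K * A * Real.exp (ρ * s) * (t - s) ^ (-κ) := by ring
      _ ≤ _ := by
          gcongr
          exact le_add_of_nonneg_right (by positivity)
  have hρl : 0 ≤ ρ ^ (-l) := by positivity
  have hC₁0 : 0 ≤ C₁ := by positivity
  have hC₂0 : 0 ≤ C₂ := by positivity
  constructor
  · intro t ht
    have b := norm_integral_le_of_singular (q := fun s => P (t - s) (h s)) (a := 0) ht.1 hκ hl
      (by linarith) hρ (B := K * A) (by positivity) (fun s hs => by simpa using hpt t ht s hs)
    refine b.trans ?_
    have e : (t - 0) ^ (1 - (κ + l)) ≤ t₀ ^ (1 - (κ + l)) :=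
      Real.rpow_le_rpow (by linarith [ht.1]) (by linarith [ht.2]) hc1.le
    calc _ ≤ 4 / (1 - (κ + l)) * t₀ ^ (1 - (κ + l)) * (K * A) * ρ ^ (-l) * Real.exp (ρ * t) := by
          gcongr
      _ = C₁ * K * A * ρ ^ (-l) * Real.exp (ρ * t) := by rw [hC₁]; ring
      _ ≤ _ := by gcongr; linarith
  · intro t' ht' t ht htt
    have b := norm_integral_sub_le_of_singular (q := fun s => P (t - s) (h s))
      (q' := fun s => P (t' - s) (h s)) ht'.1 htt hκ hγ hl le_rfl hsum hρ (B := K * A)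
      (by positivity) (integrableOn_drift hP hκ (by linarith) hK hm hbt ht.2)
      (integrableOn_drift hP hκ (by linarith) hK hm hbt ht'.2) (hpt t ht) (fun s hs => by
        have hts : 0 < t' - s := sub_pos.2 hs.2
        have hs0 : 0 < s := hs.1
        have hd : 0 < t - t' := sub_pos.2 htt
        rw [← sub_apply]
        refine (ContinuousLinearMap.le_opNorm _ _).trans ?_
        have h1 := hP.diff_le_rpow hK (h := t - t') (θ := γ) hts (by linarith [hs.1, ht'.2])
          (sub_nonneg.2 htt.le) hγ hγ1
        rw [show t' - s + (t - t') = t - s by ring] at h1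
        calc _ ≤ (K * (t' - s) ^ (-(κ + γ)) * (t - t') ^ γ) * (A * Real.exp (ρ * s)) := by
              gcongr
              exact hb s ⟨hs.1.le, hs.2.le.trans ht'.2⟩
          _ = K * A * (t - t') ^ γ * Real.exp (ρ * s) * (t' - s) ^ (-(κ + γ)) := by ring
          _ ≤ _ := by
              gcongr
              exact le_add_of_nonneg_right (by positivity))
    refine b.trans ?_
    have hd : 0 < t - t' := sub_pos.2 htt
    have ht0 : 0 ≤ t := ht.1
    have htt₀ := ht.2
    have hx : 0 ≤ 1 - (κ + l) - γ := by linarith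
    calc _ ≤ C₂ * (K * A) * ρ ^ (-l) * Real.exp (ρ * t) * (t - t') ^ γ := by
          rw [hC₂]
          gcongr
      _ ≤ (C₁ + C₂) * (K * A) * ρ ^ (-l) * Real.exp (ρ * t) * (t - t') ^ γ := by
          gcongr; linarith
      _ = _ := by ring

end Drift

section Noise

variable {𝔾 Z Y : Type*} [NormedAddCommGroup 𝔾] [NormedSpace ℝ 𝔾] [NormedAddCommGroup Z]
  [NormedSpace ℝ Z] [NormedAddCommGroup Y] [NormedSpace ℝ Y] {t₀ κ K : ℝ}
  {M : ℝ → 𝔾 →L[ℝ] Z →L[ℝ] Y} {α η θ C : ℝ} {z : ℝ → Z}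

theorem IsSingularFamily.isSingularOp (hM : IsSingularFamily t₀ κ K M) : IsSingularOp t₀ κ K M :=
  ⟨hM.norm_le, hM.diff_le⟩

theorem IsSingularFamily.diff_diff_le_rpow (hM : IsSingularFamily t₀ κ K M) (hK : 0 ≤ K)
    {r h k γ : ℝ} (hr : 0 < r) (hrt : r ≤ t₀) (hh : 0 ≤ h) (hk : 0 ≤ k) (hγ : 0 ≤ γ) (hγ1 : γ ≤ 1)
    (hθ : 0 ≤ θ) (hθ1 : θ ≤ 1) :
    ‖(M (r + h + k) - M (r + k)) - (M (r + h) - M r)‖ ≤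
      K * h ^ γ * r ^ (-(κ + γ + θ)) * k ^ θ := by
  have e : (M (r + h + k) - M (r + k)) - (M (r + h) - M r)
      = M (r + h + k) - M (r + h) - M (r + k) + M r := by abel
  rw [e]
  refine (hM.diff_diff_le r h k hr hrt hh hk).trans ?_
  calc _ ≤ K * r ^ (-κ) * (h / r) ^ γ * (k / r) ^ θ := by
        gcongr
        · exact min_one_le_rpow (by positivity) hγ hγ1
        · exact min_one_le_rpow (by positivity) hθ hθ1
    _ = _ := by
        rw [Real.div_rpow hh hr.le, Real.div_rpow hk hr.le,
          show -(κ + γ + θ) = -κ - γ - θ by ring, Real.rpow_sub hr, Real.rpow_sub hr]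
        ring

/-- The estimates of `V(s) = M(t-s) g(s)` and of its fractional derivative. -/
theorem IsSingularFamily.leftDeriv_bound (hM : IsSingularFamily t₀ κ K M) (hκ : 0 ≤ κ) (hK : 0 ≤ K)
    (hη : 0 < η) (hη1 : η < 1) (hηθ : η < θ) (hθ1 : θ ≤ 1) {ρ A : ℝ} (hρ : 0 ≤ ρ) {g : ℝ → 𝔾}
    (hg : IsWeighted η t₀ ρ A g) {t : ℝ} (htt : t ≤ t₀) :
    AEStronglyMeasurable (fun s => M (t - s) (g s)) (volume.restrict (Ioo 0 t)) ∧
    ∀ s ∈ Ioo 0 t, IntegrableOn (leftKernel η (fun s => M (t - s) (g s)) s) (Ioo 0 s) ∧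
      ∫ τ in Ioo 0 s, ‖leftKernel η (fun s => M (t - s) (g s)) s τ‖ ≤ K * A * Real.exp (ρ * s) *
        ((t - s) ^ (-(κ + θ)) * (s ^ (θ - η) / (θ - η)) + (t - s) ^ (-κ)) ∧
      ‖leftDeriv η (fun s => M (t - s) (g s)) s‖ ≤ leftConst η θ t₀ * K * A * Real.exp (ρ * s) *
        ((t - s) ^ (-(κ + θ)) + s ^ (-(κ + θ))) := by
  have hmc := hM.isSingularOp.continuousOn_sub hκ hK htt
  have hm1 : ∀ s ∈ Ioo 0 t, ‖M (t - s)‖ ≤ K * (t - s) ^ (-κ) := fun s hs =>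
    hM.norm_le _ (sub_pos.2 hs.2) (by linarith [hs.1])
  have hm2 : ∀ s ∈ Ioo 0 t, ∀ τ ∈ Ioo 0 s,
      ‖M (t - s) - M (t - τ)‖ ≤ K * (t - s) ^ (-(κ + θ)) * (s - τ) ^ θ := by
    intro s hs τ hτ
    have h1 := hM.isSingularOp.diff_le_rpow hK (r := t - s) (h := s - τ) (sub_pos.2 hs.2)
      (by linarith [hs.1]) (sub_nonneg.2 hτ.2.le) (hη.trans hηθ).le hθ1
    rwa [show t - s + (s - τ) = t - τ by ring, norm_sub_rev] at h1
  refine ⟨aestronglyMeasurable_apply htt hmc hg, fun s hs => ?_⟩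
  obtain ⟨h1, h2⟩ := norm_integral_leftKernel_le htt hηθ hρ hK hm1 hm2 hmc hg hs
  exact ⟨h1, h2, norm_leftDeriv_le htt hη hη1 hηθ hκ hρ hK hm1 hm2 hmc hg hs⟩

theorem IsSingularFamily.integrableOn_leftDeriv (hM : IsSingularFamily t₀ κ K M) (hκ : 0 ≤ κ)
    (hK : 0 ≤ K) (hη : 0 < η) (hη1 : η < 1) (hηθ : η < θ) (hθ1 : θ ≤ 1) (hκθ : κ + θ < 1)
    {ρ A : ℝ} (hρ : 0 ≤ ρ) {g : ℝ → 𝔾} (hg : IsWeighted η t₀ ρ A g) {t : ℝ} (htt : t ≤ t₀) :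
    IntegrableOn (leftDeriv η (fun s => M (t - s) (g s))) (Ioo 0 t) ∧
    IntegrableOn (fun s => ∫ τ in Ioo 0 s, ‖leftKernel η (fun s => M (t - s) (g s)) s τ‖)
      (Ioo 0 t) := by
  rcases le_or_gt t 0 with h0 | h0
  · simp [Ioo_eq_empty (not_lt.2 h0)]
  obtain ⟨hVm, hb⟩ := hM.leftDeriv_bound hκ hK hη hη1 hηθ hθ1 hρ hg htt
  have hA := hg.nonneg
  have ht₀ : 0 < t₀ := h0.trans_le htt
  have hL := leftConst_nonneg hη hη1 hηθ ht₀.le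
  constructor
  · have hi := (integrableOn_singular (a := 0) (t := t) (c := κ + θ) h0.le hκθ).const_mul
      (leftConst η θ t₀ * K * A * Real.exp (ρ * t₀))
    refine Integrable.mono' hi (aestronglyMeasurable_leftDeriv hVm)
      (ae_restrict_of_forall_mem measurableSet_Ioo fun s hs => ?_)
    have hts : 0 < t - s := sub_pos.2 hs.2
    have hs0 : 0 < s := hs.1
    refine ((hb s hs).2.2).trans ?_
    rw [sub_zero]
    gcongr
    exact hs.2.le.trans htt
  · have hi := ((integrableOn_sub_rpow (a := 0) (t := t) (c := -(κ + θ)) h0.le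
      (by linarith)).1.mul_const (t₀ ^ (θ - η) / (θ - η))).add (integrableOn_sub_rpow (a := 0)
        (t := t) (c := -κ) h0.le (by linarith)).1
    have hkm : AEStronglyMeasurable (fun s => ∫ τ in Ioo 0 s,
        ‖leftKernel η (fun s => M (t - s) (g s)) s τ‖) (volume.restrict (Ioo 0 t)) := by
      have hk : AEStronglyMeasurable (fun p : ℝ × ℝ => {p : ℝ × ℝ | p.2 < p.1}.indicator
          (fun p => ‖leftKernel η (fun s => M (t - s) (g s)) p.1 p.2‖) p)
          ((volume.restrict (Ioo 0 t)).prod (volume.restrict (Ioo 0 t))) := by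
        refine AEStronglyMeasurable.indicator ?_ (measurableSet_lt measurable_snd measurable_fst)
        have h1 : Measurable fun p : ℝ × ℝ => ((p.1 - p.2) ^ (η + 1))⁻¹ := by fun_prop
        exact (h1.aestronglyMeasurable.smul (hVm.comp_fst.sub hVm.comp_snd)).norm
      refine hk.integral_prod_right'.congr (ae_restrict_of_forall_mem measurableSet_Ioo
        fun s hs => ?_)
      have : ∀ τ, {p : ℝ × ℝ | p.2 < p.1}.indicator
          (fun p => ‖leftKernel η (fun s => M (t - s) (g s)) p.1 p.2‖) (s, τ)
          = (Iio s).indicator (fun τ => ‖leftKernel η (fun s => M (t - s) (g s)) s τ‖) τ :=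
        fun τ => by simp [indicator_apply]
      simp only [this]
      rw [setIntegral_indicator measurableSet_Iio]
      congr 2
      ext τ
      simp only [mem_inter_iff, mem_Ioo, mem_Iio]
      exact ⟨fun h => ⟨h.1.1, h.2⟩, fun h => ⟨⟨h.1, h.2.trans hs.2⟩, h.2⟩⟩
    refine Integrable.mono' (hi.const_mul (K * A * Real.exp (ρ * t₀))) hkm
      (ae_restrict_of_forall_mem measurableSet_Ioo fun s hs => ?_)
    have hts : 0 < t - s := sub_pos.2 hs.2
    have hs0 : 0 < s := hs.1
    have hθη : 0 < θ - η := by linarith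
    rw [Real.norm_of_nonneg (integral_nonneg fun _ => norm_nonneg _)]
    refine ((hb s hs).2.1).trans ?_
    simp only [Pi.add_apply]
    have := hs.2.le.trans htt
    gcongr

/-- The convolution with the noise in the weighted norms. -/
theorem exists_noise_bound (hM : IsSingularFamily t₀ κ K M) (hκ : 0 ≤ κ) (hK : 0 ≤ K) {γ l : ℝ}
    (hα : 0 < α) (hη : α < η) (hηθ : η < θ) (hγ : 0 ≤ γ) (hγα : γ ≤ 1 - α)
    (hl : 0 ≤ l) (hsum : κ + γ + θ + l < 1) (hz : MemC (1 - α) t₀ z) :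
    ∃ C, 0 ≤ C ∧ ∀ (ρ A : ℝ) (g : ℝ → 𝔾), 0 < ρ → IsWeighted η t₀ ρ A g →
      (∀ t ∈ Icc 0 t₀, IntegrableOn (fun s => leftDeriv η (fun s => M (t - s) (g s)) s
        (rightDeriv η z t s)) (Ioo 0 t)) ∧
      (∀ t ∈ Icc 0 t₀, ‖∫ s in Ioo 0 t, leftDeriv η (fun s => M (t - s) (g s)) s
        (rightDeriv η z t s)‖ ≤ C * A * ρ ^ (-l) * Real.exp (ρ * t)) ∧
      ∀ t' ∈ Icc 0 t₀, ∀ t ∈ Icc 0 t₀, t' < t →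
        ‖(∫ s in Ioo 0 t, leftDeriv η (fun s => M (t - s) (g s)) s (rightDeriv η z t s)) -
          ∫ s in Ioo 0 t', leftDeriv η (fun s => M (t' - s) (g s)) s (rightDeriv η z t' s)‖ ≤
          C * A * ρ ^ (-l) * Real.exp (ρ * t) * (t - t') ^ γ := by
  obtain ⟨Cz, -, hz'⟩ := id hz
  have hη0 : 0 < η := hα.trans hη
  have hθ0 : 0 < θ := hη0.trans hηθ
  have hθ1 : θ ≤ 1 := by linarith
  have hη1 : η < 1 := by linarith
  have hzc : ContinuousOn z (Icc 0 t₀) := hz.continuousOn (by linarith)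
  rcases le_or_gt t₀ 0 with ht₀ | ht₀
  · refine ⟨0, le_rfl, fun ρ A g _ _ => ⟨fun t ht => ?_, fun t ht => ?_, fun t' ht' t ht htt => ?_⟩⟩
    · rw [Ioo_eq_empty (not_lt.2 (ht.2.trans ht₀))]; simp
    · rw [Ioo_eq_empty (not_lt.2 (ht.2.trans ht₀))]; simp
    · linarith [ht'.1, ht.2]
  have hCz : 0 ≤ Cz := by
    have h1 := hz' 0 ⟨le_rfl, ht₀.le⟩ t₀ ⟨ht₀.le, le_rfl⟩
    have h2 : 0 < |t₀ - 0| ^ (1 - α) := by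
      rw [sub_zero, abs_of_pos ht₀]; positivity
    exact nonneg_of_mul_nonneg_left ((norm_nonneg _).trans h1) h2
  have hηα : 0 < η - α := by linarith
  have hΓ := Real.Gamma_pos_of_pos hη0
  set R₁ := (Real.Gamma η)⁻¹ * Cz * (1 + 1 / (η - α)) * t₀ ^ (η - α) with hR₁
  set R₂ := rightConst α η Cz * t₀ ^ (η - α) with hR₂
  have hR₁0 : 0 ≤ R₁ := by positivity
  have hR₂0 : 0 ≤ R₂ := mul_nonneg (rightConst_nonneg hCz hα hη) (by positivity)
  set L := leftConst η θ t₀ with hL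
  have hL0 : 0 ≤ L := leftConst_nonneg hη0 hη1 hηθ ht₀.le
  have hc1 : 0 < 1 - (κ + θ + l) := by linarith
  have hc2 : 0 < 1 - (κ + γ + θ + l) := by linarith
  have hc3 : 0 ≤ 1 - (κ + θ + l) - γ := by linarith
  set C₁ := 4 / (1 - (κ + θ + l)) * t₀ ^ (1 - (κ + θ + l)) with hC₁
  set C₂ := 4 / (1 - (κ + γ + θ + l)) * t₀ ^ (1 - (κ + γ + θ + l)) +
    4 / (1 - (κ + θ + l)) * t₀ ^ (1 - (κ + θ + l) - γ) with hC₂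
  have hC₁0 : 0 ≤ C₁ := by positivity
  have hC₂0 : 0 ≤ C₂ := by positivity
  refine ⟨(C₁ + C₂) * (L * K * (R₁ + 3 * R₂)), by positivity, fun ρ A g hρ hg => ?_⟩
  have hA := hg.nonneg
  have hR : ∀ t ∈ Icc 0 t₀, ∀ s ∈ Ioo 0 t, ‖rightDeriv η z t s‖ ≤ R₁ := fun t ht s hs =>
    norm_rightDeriv_le hCz hα hη hη1 hz' hzc hs.1.le hs.2 ht.2
  have hLb := fun t (ht : t ∈ Icc 0 t₀) =>
    hM.leftDeriv_bound hκ hK hη0 hη1 hηθ hθ1 hρ.le hg ht.2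
  have hint : ∀ t ∈ Icc 0 t₀, ∀ t' ∈ Icc 0 t₀, t' ≤ t → IntegrableOn (fun s =>
      leftDeriv η (fun s => M (t' - s) (g s)) s (rightDeriv η z t s)) (Ioo 0 t') := by
    intro t ht t' ht' htt
    have h1 := (hM.integrableOn_leftDeriv hκ hK hη0 hη1 hηθ hθ1 (by linarith) hρ.le hg ht'.2).1
    have h2 : AEStronglyMeasurable (rightDeriv η z t) (volume.restrict (Ioo 0 t')) :=
      (aestronglyMeasurable_rightDeriv ((hzc.mono (Ioo_subset_Icc_self.trans
        (Icc_subset_Icc_right ht.2))).aestronglyMeasurable measurableSet_Ioo)).mono_measure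
        (Measure.restrict_mono (Ioo_subset_Ioo_right htt) le_rfl)
    refine Integrable.mono' (h1.norm.mul_const R₁)
      ((ContinuousLinearMap.id ℝ (Z →L[ℝ] Y)).aestronglyMeasurable_comp₂ h1.1 h2)
      (ae_restrict_of_forall_mem measurableSet_Ioo fun s hs => ?_)
    refine (ContinuousLinearMap.le_opNorm _ _).trans ?_
    have := hR t ht s ⟨hs.1, hs.2.trans_le htt⟩
    gcongr
  have hpt : ∀ t ∈ Icc 0 t₀, ∀ s ∈ Ioo 0 t,
      ‖leftDeriv η (fun s => M (t - s) (g s)) s (rightDeriv η z t s)‖ ≤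
      L * K * (R₁ + 3 * R₂) * A * Real.exp (ρ * s) * ((t - s) ^ (-(κ + θ)) + s ^ (-(κ + θ))) := by
    intro t ht s hs
    have hts : 0 < t - s := sub_pos.2 hs.2
    have hs0 : 0 < s := hs.1
    refine (ContinuousLinearMap.le_opNorm _ _).trans ?_
    calc _ ≤ (L * K * A * Real.exp (ρ * s) * ((t - s) ^ (-(κ + θ)) + s ^ (-(κ + θ)))) * R₁ := by
          gcongr
          · exact ((hLb t ht).2 s hs).2.2
          · exact hR t ht s hs
      _ ≤ (L * K * A * Real.exp (ρ * s) * ((t - s) ^ (-(κ + θ)) + s ^ (-(κ + θ)))) *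
          (R₁ + 3 * R₂) := by gcongr; linarith
      _ = _ := by ring
  have hρl : 0 ≤ ρ ^ (-l) := by positivity
  refine ⟨fun t ht => hint t ht t ht le_rfl, fun t ht => ?_, fun t' ht' t ht htt => ?_⟩
  · have b := norm_integral_le_of_singular (a := 0) (l := l) ht.1 (by positivity : 0 ≤ κ + θ) hl
      (by linarith) hρ (B := L * K * (R₁ + 3 * R₂) * A) (by positivity)
      (q := fun s => leftDeriv η (fun s => M (t - s) (g s)) s (rightDeriv η z t s))
      (fun s hs => by simpa using hpt t ht s hs)
    refine b.trans ?_
    have e : (t - 0) ^ (1 - (κ + θ + l)) ≤ t₀ ^ (1 - (κ + θ + l)) :=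
      Real.rpow_le_rpow (by linarith [ht.1]) (by linarith [ht.2]) hc1.le
    calc _ ≤ 4 / (1 - (κ + θ + l)) * t₀ ^ (1 - (κ + θ + l)) * (L * K * (R₁ + 3 * R₂) * A)
          * ρ ^ (-l) * Real.exp (ρ * t) := by gcongr
      _ = C₁ * (L * K * (R₁ + 3 * R₂)) * A * ρ ^ (-l) * Real.exp (ρ * t) := by rw [hC₁]; ring
      _ ≤ _ := by gcongr; linarith
  · have hd : 0 < t - t' := sub_pos.2 htt
    have hdiff : ∀ s ∈ Ioo 0 t', ‖leftDeriv η (fun s => M (t - s) (g s)) s (rightDeriv η z t s) -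
        leftDeriv η (fun s => M (t' - s) (g s)) s (rightDeriv η z t' s)‖ ≤
        L * K * (R₁ + 3 * R₂) * A * (t - t') ^ γ * Real.exp (ρ * s) *
          ((t' - s) ^ (-(κ + γ + θ)) + s ^ (-(κ + γ + θ))) := by
      intro s hs
      have hts : 0 < t' - s := sub_pos.2 hs.2
      have hs0 : 0 < s := hs.1
      have hst : s ∈ Ioo 0 t := ⟨hs.1, hs.2.trans htt⟩
      -- the difference of the two operator families
      have hmc : ContinuousOn (fun s => M (t - s) - M (t' - s)) (Ioo 0 t') :=
        ((hM.isSingularOp.continuousOn_sub hκ hK ht.2).mono (Ioo_subset_Ioo_right htt.le)).sub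
          (hM.isSingularOp.continuousOn_sub hκ hK ht'.2)
      have hm1 : ∀ s ∈ Ioo 0 t', ‖M (t - s) - M (t' - s)‖ ≤
          (K * (t - t') ^ γ) * (t' - s) ^ (-(κ + γ)) := by
        intro s hs
        have h1 := hM.isSingularOp.diff_le_rpow hK (r := t' - s) (h := t - t') (sub_pos.2 hs.2)
          (by linarith [hs.1, ht'.2]) hd.le hγ (by linarith)
        rw [show t' - s + (t - t') = t - s by ring] at h1
        refine h1.trans (le_of_eq (by ring))
      have hm2 : ∀ s ∈ Ioo 0 t', ∀ τ ∈ Ioo 0 s,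
          ‖(M (t - s) - M (t' - s)) - (M (t - τ) - M (t' - τ))‖ ≤
          (K * (t - t') ^ γ) * (t' - s) ^ (-(κ + γ + θ)) * (s - τ) ^ θ := by
        intro s hs τ hτ
        have h1 := hM.diff_diff_le_rpow hK (r := t' - s) (h := t - t') (k := s - τ)
          (sub_pos.2 hs.2) (by linarith [hs.1, ht'.2]) hd.le (sub_nonneg.2 hτ.2.le) hγ
          (by linarith) hθ0.le hθ1
        rw [show t' - s + (t - t') + (s - τ) = t - τ by ring,
          show t' - s + (s - τ) = t' - τ by ring, show t' - s + (t - t') = t - s by ring,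
          norm_sub_rev] at h1
        exact h1
      have hb1 := norm_leftDeriv_le ht'.2 hη0 hη1 hηθ (by positivity : 0 ≤ κ + γ) hρ.le
        (by positivity) hm1 hm2 hmc hg hs
      simp only [sub_apply] at hb1
      have hk' : IntegrableOn (leftKernel η (fun s => M (t - s) (g s)) s) (Ioo 0 s) :=
        ((hLb t ht).2 s hst).1
      rw [leftDeriv_sub hk' ((hLb t' ht').2 s hs).1] at hb1
      have hb2 := ((hLb t' ht').2 s hs).2.2
      have hb3 := norm_rightDeriv_sub_le hCz hα hη hη1 hz' hzc hγ hγα hs.1.le hs.2 htt ht.2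
      rw [← hR₂] at hb3
      rw [← hL] at hb1 hb2
      have e : leftDeriv η (fun s => M (t - s) (g s)) s (rightDeriv η z t s) -
          leftDeriv η (fun s => M (t' - s) (g s)) s (rightDeriv η z t' s)
          = (leftDeriv η (fun s => M (t - s) (g s)) s - leftDeriv η (fun s => M (t' - s) (g s)) s)
            (rightDeriv η z t s) + leftDeriv η (fun s => M (t' - s) (g s)) s
            (rightDeriv η z t s - rightDeriv η z t' s) := by
        rw [sub_apply, map_sub]; abel
      set x := (t' - s) ^ (-(κ + γ + θ)) with hx
      set y := s ^ (-(κ + γ + θ)) with hy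
      have hx0 : 0 ≤ x := by positivity
      have hy0 : 0 ≤ y := by positivity
      have e4 : ((t' - s) ^ (-(κ + θ)) + s ^ (-(κ + θ))) * (t' - s) ^ (-γ) ≤ 3 * (x + y) := by
        have h1 : (t' - s) ^ (-(κ + θ)) * (t' - s) ^ (-γ) = x := by
          rw [hx, ← Real.rpow_add hts]; congr 1; ring
        have h2 := rpow_neg_mul_rpow_neg_le hs0 hts (by positivity : 0 ≤ κ + θ) hγ
        rw [show κ + θ + γ = κ + γ + θ by ring, ← hx, ← hy] at h2
        rw [add_mul, h1]; linarith
      rw [e]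
      calc _ ≤ (L * (K * (t - t') ^ γ) * A * Real.exp (ρ * s) * (x + y)) * R₁ +
            (L * K * A * Real.exp (ρ * s) * ((t' - s) ^ (-(κ + θ)) + s ^ (-(κ + θ)))) *
              (R₂ * (t - t') ^ γ * (t' - s) ^ (-γ)) := by
            refine (norm_add_le _ _).trans (add_le_add ?_ ?_)
            · refine (ContinuousLinearMap.le_opNorm _ _).trans ?_
              have := hR t ht s hst
              gcongr
            · refine (ContinuousLinearMap.le_opNorm _ _).trans ?_
              gcongr
        _ = L * K * A * (t - t') ^ γ * Real.exp (ρ * s) * (R₁ * (x + y) + R₂ *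
            (((t' - s) ^ (-(κ + θ)) + s ^ (-(κ + θ))) * (t' - s) ^ (-γ))) := by ring
        _ ≤ L * K * A * (t - t') ^ γ * Real.exp (ρ * s) * (R₁ * (x + y) + R₂ * (3 * (x + y))) := by
            gcongr
        _ = _ := by ring
    have b := norm_integral_sub_le_of_singular (l := l) ht'.1 htt (by positivity : 0 ≤ κ + θ) hγ hl
      (by linarith : κ + θ + γ ≤ κ + γ + θ) hsum hρ (B := L * K * (R₁ + 3 * R₂) * A)
      (by positivity) (hint t ht t ht le_rfl) (hint t' ht' t' ht' le_rfl) (hpt t ht) hdiff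
    refine b.trans ?_
    have ht0 : 0 ≤ t := ht.1
    have htt₀ := ht.2
    calc _ ≤ C₂ * (L * K * (R₁ + 3 * R₂) * A) * ρ ^ (-l) * Real.exp (ρ * t) * (t - t') ^ γ := by
          rw [hC₂]
          gcongr
      _ ≤ (C₁ + C₂) * (L * K * (R₁ + 3 * R₂) * A) * ρ ^ (-l) * Real.exp (ρ * t) *
          (t - t') ^ γ := by
          gcongr; linarith
      _ = _ := by ring

end Noise

/-! ### Independence of the order of the fractional derivatives -/

section FractionalIntegral

variable {E : Type*} [NormedAddCommGroup E] [NormedSpace ℝ E]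

theorem aestronglyMeasurable_integral_Ioo_sub {r e : ℝ} (he : 0 ≤ e) {f : ℝ → ℝ → E}
    (hf : AEStronglyMeasurable (fun p : ℝ × ℝ => f p.1 p.2)
      ((volume.restrict (Ioo 0 r)).prod (volume.restrict (Ioo 0 r)))) :
    AEStronglyMeasurable (fun s => ∫ τ in Ioo 0 (s - e), f s τ) (volume.restrict (Ioo 0 r)) := by
  have hk : AEStronglyMeasurable (fun p : ℝ × ℝ => {p : ℝ × ℝ | p.2 < p.1 - e}.indicator
      (fun p => f p.1 p.2) p)
      ((volume.restrict (Ioo 0 r)).prod (volume.restrict (Ioo 0 r))) :=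
    hf.indicator (measurableSet_lt measurable_snd (measurable_fst.sub_const e))
  refine hk.integral_prod_right'.congr (ae_restrict_of_forall_mem measurableSet_Ioo
    fun s hs => ?_)
  have : ∀ τ, {p : ℝ × ℝ | p.2 < p.1 - e}.indicator (fun p => f p.1 p.2) (s, τ)
      = (Iio (s - e)).indicator (f s) τ := fun τ => by simp [indicator_apply]
  simp only [this]
  rw [setIntegral_indicator measurableSet_Iio]
  congr 2
  ext τ
  simp only [mem_inter_iff, mem_Ioo, mem_Iio]
  exact ⟨fun h => ⟨h.1.1, h.2⟩, fun h => ⟨⟨h.1, by linarith [hs.2, h.2]⟩, h.2⟩⟩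

/-- The kernel of the Riemann-Liouville integral is integrable on the triangle. -/
theorem integrable_prod_rpow_smul {t η : ℝ} (hη : 0 < η) {D : ℝ → E}
    (hD : IntegrableOn D (Ioo 0 t)) :
    Integrable (fun p : ℝ × ℝ => {p : ℝ × ℝ | p.1 < p.2}.indicator
      (fun p => (p.2 - p.1) ^ (η - 1) • D p.1) p)
      ((volume.restrict (Ioo 0 t)).prod (volume.restrict (Ioo 0 t))) := by
  have hm : AEStronglyMeasurable (fun p : ℝ × ℝ => {p : ℝ × ℝ | p.1 < p.2}.indicator
      (fun p => (p.2 - p.1) ^ (η - 1) • D p.1) p)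
      ((volume.restrict (Ioo 0 t)).prod (volume.restrict (Ioo 0 t))) := by
    refine AEStronglyMeasurable.indicator ?_ (measurableSet_lt measurable_fst measurable_snd)
    have h1 : Measurable fun p : ℝ × ℝ => (p.2 - p.1) ^ (η - 1) := by fun_prop
    exact h1.aestronglyMeasurable.smul hD.1.comp_fst
  have hsec : ∀ s r, {p : ℝ × ℝ | p.1 < p.2}.indicator
      (fun p => (p.2 - p.1) ^ (η - 1) • D p.1) (s, r)
      = (Ioi s).indicator (fun r => (r - s) ^ (η - 1) • D s) r := fun s r => by
    simp [indicator_apply]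
  have hset : ∀ s ∈ Ioo 0 t, Ioo 0 t ∩ Ioi s = Ioo s t := fun s hs => by
    ext r; simp only [mem_inter_iff, mem_Ioo, mem_Ioi]
    exact ⟨fun h => ⟨h.2, h.1.2⟩, fun h => ⟨⟨hs.1.trans h.1, h.2⟩, h.1⟩⟩
  rw [integrable_prod_iff hm]
  constructor
  · refine ae_restrict_of_forall_mem measurableSet_Ioo fun s hs => ?_
    simp only [hsec]
    rw [integrable_indicator_iff measurableSet_Ioi, IntegrableOn,
      Measure.restrict_restrict measurableSet_Ioi, inter_comm, hset s hs]
    exact (integrableOn_sub_rpow' hs.2.le (by linarith)).1.smul_const (D s)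
  · have heq : ∀ s ∈ Ioo 0 t, ∫ r in Ioo 0 t, ‖{p : ℝ × ℝ | p.1 < p.2}.indicator
        (fun p => (p.2 - p.1) ^ (η - 1) • D p.1) (s, r)‖ = (t - s) ^ η / η * ‖D s‖ := by
      intro s hs
      simp only [hsec, norm_indicator_eq_indicator_norm]
      rw [setIntegral_indicator measurableSet_Ioi, hset s hs]
      have : ∫ r in Ioo s t, ‖(r - s) ^ (η - 1) • D s‖
          = ∫ r in Ioo s t, (r - s) ^ (η - 1) * ‖D s‖ :=
        setIntegral_congr_fun measurableSet_Ioo fun r hr => by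
          have : 0 < r - s := sub_pos.2 hr.1
          simp only [norm_smul]
          rw [Real.norm_of_nonneg (by positivity)]
      rw [this, integral_mul_const, (integrableOn_sub_rpow' hs.2.le (by linarith)).2,
        sub_add_cancel]
    refine Integrable.mono' (hD.norm.const_mul (t ^ η / η)) hm.norm.integral_prod_right'
      (ae_restrict_of_forall_mem measurableSet_Ioo fun s hs => ?_)
    rw [heq s hs]
    have h1 : 0 < t - s := sub_pos.2 hs.2
    have h2 : (t - s) ^ η ≤ t ^ η := Real.rpow_le_rpow h1.le (by linarith [hs.1]) hη.le
    rw [Real.norm_of_nonneg (by positivity)]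
    gcongr

theorem ae_integrableOn_rpow_smul {t η : ℝ} (hη : 0 < η) {D : ℝ → E}
    (hD : IntegrableOn D (Ioo 0 t)) :
    ∀ᵐ r ∂(volume.restrict (Ioo 0 t)),
      IntegrableOn (fun s => (r - s) ^ (η - 1) • D s) (Ioo 0 r) := by
  have h := (integrable_prod_rpow_smul hη hD).prod_left_ae
  filter_upwards [h, ae_restrict_mem measurableSet_Ioo] with r hr hrt
  have hsec : ∀ s, {p : ℝ × ℝ | p.1 < p.2}.indicator
      (fun p => (p.2 - p.1) ^ (η - 1) • D p.1) (s, r)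
      = (Iio r).indicator (fun s => (r - s) ^ (η - 1) • D s) s := fun s => by
    simp [indicator_apply]
  simp only [hsec] at hr
  rw [integrable_indicator_iff measurableSet_Iio, IntegrableOn,
    Measure.restrict_restrict measurableSet_Iio] at hr
  have hset : Iio r ∩ Ioo 0 t = Ioo 0 r := by
    ext s; simp only [mem_inter_iff, mem_Ioo, mem_Iio]
    exact ⟨fun h => ⟨h.2.1, h.1⟩, fun h => ⟨h.2, h.1, h.2.trans hrt.2⟩⟩
  rwa [hset] at hr

theorem rpow_sub_rpow_le {η e x : ℝ} (hη : 0 < η) (hη1 : η < 1) (he : 0 < e) (hx : 0 < x) :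
    0 ≤ x ^ η - (max (x - e) 0) ^ η ∧ x ^ η - (max (x - e) 0) ^ η ≤ e ^ η ∧
      (e ≤ x → x ^ η - (max (x - e) 0) ^ η ≤ e * x ^ (η - 1)) := by
  have h0 : 0 ≤ max (x - e) 0 := le_max_right _ _
  refine ⟨sub_nonneg.2 (Real.rpow_le_rpow h0 (max_le (by linarith) hx.le) hη.le), ?_, fun hex => ?_⟩
  · have h1 : x ≤ max (x - e) 0 + e := by linarith [le_max_left (x - e) 0]
    have h2 := Real.rpow_add_le_add_rpow h0 he.le hη.le hη1.le
    have h3 := Real.rpow_le_rpow hx.le h1 hη.le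
    linarith
  · rw [max_eq_left (by linarith)]
    have h1 : 0 ≤ 1 - e / x := by rw [sub_nonneg, div_le_one hx]; exact hex
    have h2 : 1 - e / x ≤ 1 := by have : 0 < e / x := by positivity
                                  linarith
    have h3 : x - e = x * (1 - e / x) := by field_simp
    have h4 : 1 - e / x ≤ (1 - e / x) ^ η := by
      simpa using Real.rpow_le_rpow_of_exponent_ge' h1 h2 hη.le hη1.le
    rw [h3, Real.mul_rpow hx.le h1, Real.rpow_sub hx, Real.rpow_one]
    have h5 : 0 < x ^ η := by positivity
    have h6 : e * (x ^ η / x) = x ^ η * (e / x) := by ring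
    rw [h6]
    nlinarith

/-- The kernel of the composition of the Riemann-Liouville integral with the Marchaud derivative
that is truncated at distance `e`. -/
def composedKernel (η e r s : ℝ) : ℝ :=
  (r - s) ^ (η - 1) * (min s e) ^ (-η) - e ^ (-η) * (max (r - s - e) 0) ^ η / (r - s)

theorem composedKernel_bound {η e r s : ℝ} (hη : 0 < η) (hη1 : η < 1) (he : 0 < e)
    (hs : s ∈ Ioo 0 r) :
    |composedKernel η e r s| ≤ (r - s) ^ (η - 1) * s ^ (-η) + r ^ η * (r - s) ^ (-(η + 1)) := by
  have hx : 0 < r - s := sub_pos.2 hs.2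
  have hs0 : 0 < s := hs.1
  obtain ⟨h1, h2, -⟩ := rpow_sub_rpow_le hη hη1 he hx
  have hm : 0 < min s e := lt_min hs0 he
  have e1 : composedKernel η e r s = (r - s) ^ (η - 1) * ((min s e) ^ (-η) - e ^ (-η))
      + e ^ (-η) * ((r - s) ^ η - (max (r - s - e) 0) ^ η) / (r - s) := by
    rw [composedKernel, Real.rpow_sub hx, Real.rpow_one]; ring
  have e2 : e ^ (-η) ≤ (min s e) ^ (-η) :=
    Real.rpow_le_rpow_of_nonpos hm (min_le_right _ _) (by linarith)
  have e3 : (min s e) ^ (-η) - e ^ (-η) ≤ s ^ (-η) := by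
    have p1 : 0 < e ^ (-η) := by positivity
    have p2 : 0 < s ^ (-η) := by positivity
    rcases le_total s e with h | h
    · rw [min_eq_left h]; linarith
    · rw [min_eq_right h]; linarith
  have e4 : e ^ (-η) * ((r - s) ^ η - (max (r - s - e) 0) ^ η) / (r - s)
      ≤ r ^ η * (r - s) ^ (-(η + 1)) := by
    have p1 : e ^ (-η) * e ^ η = 1 := by rw [← Real.rpow_add he]; simp
    have p2 : (r - s) ^ (-(η + 1)) = (r - s) ^ (-η) / (r - s) := by
      rw [neg_add, ← sub_eq_add_neg, Real.rpow_sub hx, Real.rpow_one]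
    have p3 : 1 ≤ r ^ η * (r - s) ^ (-η) := by
      rw [Real.rpow_neg hx.le, ← div_eq_mul_inv, one_le_div (by positivity)]
      exact Real.rpow_le_rpow hx.le (by linarith) hη.le
    rw [p2, ← mul_div_assoc]
    have p4 : e ^ (-η) * ((r - s) ^ η - (max (r - s - e) 0) ^ η) ≤ 1 := by
      rw [← p1]; gcongr
    exact div_le_div_of_nonneg_right (p4.trans p3) hx.le
  rw [e1, abs_of_nonneg (add_nonneg (mul_nonneg (by positivity) (by linarith)) (by positivity))]
  gcongr

theorem tendsto_composedKernel {η r s : ℝ} (hη : 0 < η) (hη1 : η < 1) (hs : s ∈ Ioo 0 r) :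
    Tendsto (fun e => composedKernel η e r s) (𝓝[>] 0) (𝓝 0) := by
  have hx : 0 < r - s := sub_pos.2 hs.2
  have hlim : Tendsto (fun e : ℝ => e ^ (1 - η) * ((r - s) ^ (η - 1) / (r - s))) (𝓝[>] 0)
      (𝓝 0) := by
    have : Continuous fun e : ℝ => e ^ (1 - η) * ((r - s) ^ (η - 1) / (r - s)) :=
      (Real.continuous_rpow_const (by linarith)).mul continuous_const
    have h1 := (this.tendsto 0).mono_left (nhdsWithin_le_nhds (s := Ioi 0))
    rwa [Real.zero_rpow (by linarith), zero_mul] at h1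
  have hev : ∀ᶠ e in 𝓝[>] (0 : ℝ), e ∈ Ioo 0 (min s (r - s)) :=
    Ioo_mem_nhdsGT (lt_min hs.1 hx)
  have hform : ∀ e ∈ Ioo 0 (min s (r - s)), composedKernel η e r s
      = e ^ (-η) * ((r - s) ^ η - (max (r - s - e) 0) ^ η) / (r - s) := fun e he => by
    rw [composedKernel, min_eq_right (he.2.le.trans (min_le_left _ _)), Real.rpow_sub hx,
      Real.rpow_one]
    ring
  refine squeeze_zero' ?_ ?_ hlim
  · filter_upwards [hev] with e he
    rw [hform e he]
    have := (rpow_sub_rpow_le hη hη1 he.1 hx).1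
    have := he.1
    positivity
  · filter_upwards [hev] with e he
    have he0 : 0 < e := he.1
    rw [hform e he]
    have := (rpow_sub_rpow_le hη hη1 he.1 hx).2.2 (he.2.le.trans (min_le_right _ _))
    calc _ ≤ e ^ (-η) * (e * (r - s) ^ (η - 1)) / (r - s) := by gcongr
      _ = _ := by
        rw [show (1 : ℝ) - η = -η + 1 by ring, Real.rpow_add he0, Real.rpow_one]; ring

theorem integrableOn_sub_rpow_neg {η e s : ℝ} (hη : 0 < η) (he : 0 < e) (hes : e < s) :
    IntegrableOn (fun τ => (s - τ) ^ (-(η + 1))) (Ioo 0 (s - e)) ∧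
      η * ∫ τ in Ioo 0 (s - e), (s - τ) ^ (-(η + 1)) = e ^ (-η) - s ^ (-η) := by
  have h0 : (0 : ℝ) ∉ uIcc e s := by
    rw [uIcc_of_le hes.le]; exact fun h => he.not_ge h.1
  have hle : 0 ≤ s - e := by linarith
  constructor
  · refine (ContinuousOn.integrableOn_Icc ?_).mono_set Ioo_subset_Icc_self
    refine ContinuousOn.rpow_const (by fun_prop) fun τ hτ => Or.inl ?_
    linarith [hτ.2]
  · rw [← integral_Ioc_eq_integral_Ioo, ← intervalIntegral.integral_of_le hle,
      intervalIntegral.integral_comp_sub_left (fun x => x ^ (-(η + 1))) s, sub_sub_cancel, sub_zero,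
      integral_rpow (Or.inr ⟨by linarith, h0⟩), show -(η + 1) + 1 = -η by ring]
    field_simp
    ring

variable [CompleteSpace E]

/-- The Riemann-Liouville integral of the Marchaud derivative that is truncated at distance `e`. -/
theorem integral_truncated_leftDeriv {η r e : ℝ} (hη : 0 < η) (hη1 : η < 1) (he : 0 < e)
    {w : ℝ → E} (hw : IntegrableOn w (Ioo 0 r))
    (hw1 : IntegrableOn (fun s => (r - s) ^ (η - 1) • w s) (Ioo 0 r))
    (hw2 : IntegrableOn (fun s => ((r - s) ^ (η - 1) * s ^ (-η)) • w s) (Ioo 0 r)) :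
    ∫ s in Ioo 0 r, (r - s) ^ (η - 1) • ((s ^ η)⁻¹ • w s +
        η • ∫ τ in Ioo 0 (s - e), leftKernel η w s τ)
      = ∫ s in Ioo 0 r, composedKernel η e r s • w s := by
  rcases le_or_gt r 0 with hr | hr
  · simp [Ioo_eq_empty (not_lt.2 hr)]
  have hj := integrableOn_sub_rpow (a := 0) (t := r) (c := η - 1) hr.le (by linarith)
  -- the integrand on the triangle `τ < s - e`
  let F : ℝ → ℝ → E := fun s τ => {p : ℝ × ℝ | p.2 < p.1 - e}.indicator
    (fun p => ((r - p.1) ^ (η - 1) * (p.1 - p.2) ^ (-(η + 1))) • w p.2) (s, τ)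
  have hFm : AEStronglyMeasurable (Function.uncurry F)
      ((volume.restrict (Ioo 0 r)).prod (volume.restrict (Ioo 0 r))) := by
    refine AEStronglyMeasurable.indicator ?_ (measurableSet_lt measurable_snd
      (measurable_fst.sub_const e))
    have h1 : Measurable fun p : ℝ × ℝ => (r - p.1) ^ (η - 1) * (p.1 - p.2) ^ (-(η + 1)) := by
      fun_prop
    exact h1.aestronglyMeasurable.smul hw.1.comp_snd
  have hFi : Integrable (Function.uncurry F)
      ((volume.restrict (Ioo 0 r)).prod (volume.restrict (Ioo 0 r))) := by
    refine Integrable.mono' ((hj.1.mul_prod hw.norm).const_mul (e ^ (-(η + 1)))) hFm ?_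
    rw [Measure.prod_restrict]
    refine ae_restrict_of_forall_mem (measurableSet_Ioo.prod measurableSet_Ioo) ?_
    rintro ⟨s, τ⟩ ⟨hs, hτ⟩
    have hrs : 0 < r - s := sub_pos.2 hs.2
    simp only [Function.uncurry_apply_pair, F, indicator_apply, mem_ofPred_eq]
    split_ifs with h
    · rw [norm_smul, Real.norm_eq_abs, abs_mul, abs_of_nonneg (by positivity),
        abs_of_nonneg (Real.rpow_nonneg (by linarith) _)]
      have : (s - τ) ^ (-(η + 1)) ≤ e ^ (-(η + 1)) :=
        Real.rpow_le_rpow_of_nonpos he (by linarith) (by linarith)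
      calc _ ≤ (r - s) ^ (η - 1) * e ^ (-(η + 1)) * ‖w τ‖ := by gcongr
        _ = _ := by ring
    · rw [norm_zero]; positivity
  have hF1 : ∀ s ∈ Ioo 0 r, ∫ τ in Ioo 0 r, F s τ
      = (r - s) ^ (η - 1) • ∫ τ in Ioo 0 (s - e), (s - τ) ^ (-(η + 1)) • w τ := by
    intro s hs
    have : ∀ τ, F s τ = (Iio (s - e)).indicator
        (fun τ => ((r - s) ^ (η - 1) * (s - τ) ^ (-(η + 1))) • w τ) τ := fun τ => by
      simp [F, indicator_apply]
    simp only [this]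
    have hset : Ioo 0 r ∩ Iio (s - e) = Ioo 0 (s - e) := by
      ext τ; simp only [mem_inter_iff, mem_Ioo, mem_Iio]
      exact ⟨fun h => ⟨h.1.1, h.2⟩, fun h => ⟨⟨h.1, by linarith [hs.2, h.2]⟩, h.2⟩⟩
    rw [setIntegral_indicator measurableSet_Iio, hset, ← integral_smul]
    simp only [smul_smul]
  have hF2 : ∀ τ ∈ Ioo 0 r, η • ∫ s in Ioo 0 r, F s τ
      = (e ^ (-η) * (max (r - τ - e) 0) ^ η / (r - τ)) • w τ := by
    intro τ hτ
    have hx : 0 < r - τ := sub_pos.2 hτ.2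
    have : ∀ s, F s τ = (Ioi (τ + e)).indicator
        (fun s => ((r - s) ^ (η - 1) * (s - τ) ^ (-(η + 1))) • w τ) s := fun s => by
      simp [F, indicator_apply, lt_sub_iff_add_lt]
    simp only [this]
    have hset : Ioo 0 r ∩ Ioi (τ + e) = Ioo (τ + e) r := by
      ext s; simp only [mem_inter_iff, mem_Ioo, mem_Ioi]
      exact ⟨fun h => ⟨h.2, h.1.2⟩, fun h => ⟨⟨by linarith [hτ.1, h.1], h.2⟩, h.1⟩⟩
    rw [setIntegral_indicator measurableSet_Ioi, hset, integral_smul_const, smul_smul]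
    congr 1
    rcases le_or_gt (r - τ) e with h | h
    · rw [Ioo_eq_empty (by linarith), max_eq_right (by linarith), Real.zero_rpow hη.ne']; simp
    · obtain ⟨-, h2⟩ := integral_rpow_neg_mul_sub_rpow hη he h
      have h3 : ∫ s in Ioo (τ + e) r, (r - s) ^ (η - 1) * (s - τ) ^ (-(η + 1))
          = ∫ σ in Ioc e (r - τ), σ ^ (-η - 1) * (r - τ - σ) ^ (η - 1) := by
        rw [← integral_Ioc_eq_integral_Ioo, ← intervalIntegral.integral_of_le (by linarith),
          ← intervalIntegral.integral_of_le h.le,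
          show e = (τ + e) - τ by ring, ← intervalIntegral.integral_comp_sub_right
            (fun σ => σ ^ (-η - 1) * (r - τ - σ) ^ (η - 1)) τ]
        rw [show τ + e - τ = e by ring]
        refine intervalIntegral.integral_congr fun s _ => ?_
        rw [show r - τ - (s - τ) = r - s by ring, show -(η + 1) = -η - 1 by ring]; ring
      rw [h3, h2, max_eq_left (by linarith), Real.div_rpow (by linarith) he.le, Real.rpow_neg he.le]
      field_simp
  -- the truncated derivative
  have hT : ∀ s ∈ Ioo 0 r, (r - s) ^ (η - 1) • ((s ^ η)⁻¹ • w s +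
        η • ∫ τ in Ioo 0 (s - e), leftKernel η w s τ)
      = ((r - s) ^ (η - 1) * (min s e) ^ (-η)) • w s - η • ∫ τ in Ioo 0 r, F s τ := by
    intro s hs
    have hs0 : 0 < s := hs.1
    rw [hF1 s hs, ← Real.rpow_neg hs0.le, mul_smul, smul_comm η, ← smul_sub]
    congr 1
    rcases le_or_gt s e with h | h
    · rw [Ioo_eq_empty (by linarith), min_eq_left h]; simp
    · obtain ⟨i1, i2⟩ := integrableOn_sub_rpow_neg hη he h
      have hwi : IntegrableOn w (Ioo 0 (s - e)) :=
        hw.mono_set (Ioo_subset_Ioo_right (by linarith [hs.2]))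
      have i3 : IntegrableOn (fun τ => (s - τ) ^ (-(η + 1)) • w τ) (Ioo 0 (s - e)) := by
        have hm : AEStronglyMeasurable (fun τ => (s - τ) ^ (-(η + 1)) • w τ)
            (volume.restrict (Ioo 0 (s - e))) := by
          have h1 : Measurable fun τ : ℝ => (s - τ) ^ (-(η + 1)) := by fun_prop
          exact h1.aestronglyMeasurable.smul hwi.1
        refine Integrable.mono' (hwi.norm.const_mul (e ^ (-(η + 1)))) hm
          (ae_restrict_of_forall_mem measurableSet_Ioo fun τ hτ => ?_)
        have hp : 0 < s - τ := by linarith [hτ.2]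
        rw [norm_smul, Real.norm_of_nonneg (by positivity)]
        exact mul_le_mul_of_nonneg_right
          (Real.rpow_le_rpow_of_nonpos he (by linarith [hτ.2]) (by linarith)) (norm_nonneg _)
      have i4 : ∫ τ in Ioo 0 (s - e), leftKernel η w s τ
          = (∫ τ in Ioo 0 (s - e), (s - τ) ^ (-(η + 1))) • w s
            - ∫ τ in Ioo 0 (s - e), (s - τ) ^ (-(η + 1)) • w τ := by
        rw [← integral_smul_const, ← integral_sub (i1.smul_const _) i3]
        refine setIntegral_congr_fun measurableSet_Ioo fun τ hτ => ?_
        have hp : 0 < s - τ := by linarith [hτ.2]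
        simp only [leftKernel]
        rw [Real.rpow_neg hp.le, smul_sub]
      rw [i4, smul_sub, smul_smul, i2, min_eq_right h.le, sub_smul]
      abel
  rw [setIntegral_congr_fun measurableSet_Ioo hT]
  have hmin : IntegrableOn (fun s => ((r - s) ^ (η - 1) * (min s e) ^ (-η)) • w s) (Ioo 0 r) := by
    have hm : AEStronglyMeasurable (fun s => ((r - s) ^ (η - 1) * (min s e) ^ (-η)) • w s)
        (volume.restrict (Ioo 0 r)) := by
      have h1 : Measurable fun s : ℝ => (r - s) ^ (η - 1) * (min s e) ^ (-η) := by fun_prop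
      exact h1.aestronglyMeasurable.smul hw.1
    refine Integrable.mono' (hw2.norm.add (hw1.norm.const_mul (e ^ (-η)))) hm
      (ae_restrict_of_forall_mem measurableSet_Ioo fun s hs => ?_)
    have hrs : 0 < r - s := sub_pos.2 hs.2
    have hs0 : 0 < s := hs.1
    have hms : 0 < min s e := lt_min hs0 he
    simp only [Pi.add_apply]
    rw [norm_smul, norm_smul, norm_smul, Real.norm_of_nonneg (by positivity),
      Real.norm_of_nonneg (by positivity), Real.norm_of_nonneg (by positivity)]
    have : (min s e) ^ (-η) ≤ s ^ (-η) + e ^ (-η) := by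
      rcases le_total s e with h | h
      · rw [min_eq_left h]; exact le_add_of_nonneg_right (by positivity)
      · rw [min_eq_right h]; exact le_add_of_nonneg_left (by positivity)
    calc _ ≤ (r - s) ^ (η - 1) * (s ^ (-η) + e ^ (-η)) * ‖w s‖ := by gcongr
      _ = _ := by ring
  have hFl : IntegrableOn (fun s => η • ∫ τ in Ioo 0 r, F s τ) (Ioo 0 r) :=
    hFi.integral_prod_left.smul η
  rw [integral_sub hmin hFl, integral_smul, integral_integral_swap hFi, ← integral_smul,
    setIntegral_congr_fun measurableSet_Ioo hF2, ← integral_sub hmin]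
  · refine setIntegral_congr_fun measurableSet_Ioo fun s _ => ?_
    simp only [composedKernel, sub_smul]
  · have := (hFi.integral_prod_right.smul η)
    exact this.congr (ae_restrict_of_forall_mem measurableSet_Ioo hF2)

end FractionalIntegral

section Inversion

variable {E : Type*} [NormedAddCommGroup E] [NormedSpace ℝ E]

/-- Conditions under which `V` has an integrable Weyl-Marchaud derivative of order `η` on
`(0,t)`. -/
structure IsFracDiff (η t : ℝ) (V : ℝ → E) : Prop where
  aestronglyMeasurable : AEStronglyMeasurable V (volume.restrict (Ioo 0 t))
  integrableOn_smul : IntegrableOn (fun s => (s ^ η)⁻¹ • V s) (Ioo 0 t)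
  integrableOn_leftKernel : ∀ s ∈ Ioo 0 t, IntegrableOn (leftKernel η V s) (Ioo 0 s)
  integrableOn_integral : IntegrableOn (fun s => ∫ τ in Ioo 0 s, ‖leftKernel η V s τ‖) (Ioo 0 t)

theorem IsFracDiff.integrableOn {η t : ℝ} {V : ℝ → E} (hV : IsFracDiff η t V) (hη : 0 < η) :
    IntegrableOn V (Ioo 0 t) := by
  refine Integrable.mono' (hV.integrableOn_smul.norm.const_mul (t ^ η)) hV.aestronglyMeasurable
    (ae_restrict_of_forall_mem measurableSet_Ioo fun s hs => ?_)
  have hs0 : 0 < s := hs.1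
  rw [norm_smul, Real.norm_of_nonneg (by positivity), ← mul_assoc]
  refine le_mul_of_one_le_left (norm_nonneg _) ?_
  rw [← div_eq_mul_inv, one_le_div (by positivity)]
  exact Real.rpow_le_rpow hs0.le hs.2.le hη.le

theorem IsFracDiff.integrableOn_leftDeriv {η t : ℝ} {V : ℝ → E} (hV : IsFracDiff η t V)
    (hη : 0 < η) : IntegrableOn (leftDeriv η V) (Ioo 0 t) := by
  refine Integrable.mono' ((hV.integrableOn_smul.norm.add
    (hV.integrableOn_integral.const_mul η)).const_mul ‖(Real.Gamma (1 - η))⁻¹‖)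
    (aestronglyMeasurable_leftDeriv hV.aestronglyMeasurable)
    (ae_restrict_of_forall_mem measurableSet_Ioo fun s hs => ?_)
  rw [leftDeriv, norm_smul]
  refine mul_le_mul_of_nonneg_left ((norm_add_le _ _).trans ?_) (norm_nonneg _)
  refine add_le_add le_rfl ?_
  rw [norm_smul, Real.norm_of_nonneg hη.le]
  exact mul_le_mul_of_nonneg_left (norm_integral_le_integral_norm _) hη.le

theorem tendsto_integral_Ioo_sub {s : ℝ} {f : ℝ → E} (hf : IntegrableOn f (Ioo 0 s)) :
    Tendsto (fun e => ∫ τ in Ioo 0 (s - e), f τ) (𝓝[>] 0) (𝓝 (∫ τ in Ioo 0 s, f τ)) := by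
  have h1 : Tendsto (fun e => ∫ τ in Ioo 0 s, (Iio (s - e)).indicator f τ) (𝓝[>] 0)
      (𝓝 (∫ τ in Ioo 0 s, f τ)) := by
    refine tendsto_integral_filter_of_dominated_convergence (fun τ => ‖f τ‖)
      (Eventually.of_forall fun e => hf.1.indicator measurableSet_Iio)
      (Eventually.of_forall fun e => Eventually.of_forall fun τ => norm_indicator_le_norm_self _ _)
      hf.norm (ae_restrict_of_forall_mem measurableSet_Ioo fun τ hτ => ?_)
    refine tendsto_const_nhds.congr' ?_
    have : ∀ᶠ e in 𝓝[>] (0 : ℝ), e ∈ Ioo 0 (s - τ) := Ioo_mem_nhdsGT (sub_pos.2 hτ.2)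
    filter_upwards [this] with e he
    rw [indicator_of_mem]
    exact mem_Iio.2 (by linarith [he.2])
  refine h1.congr' (eventually_nhdsWithin_of_forall fun e he => ?_)
  have he : (0 : ℝ) < e := he
  rw [setIntegral_indicator measurableSet_Iio]
  congr 2
  ext τ; simp only [mem_inter_iff, mem_Ioo, mem_Iio]
  exact ⟨fun h => ⟨h.1.1, h.2⟩, fun h => ⟨⟨h.1, by linarith [h.2]⟩, h.2⟩⟩

theorem leftKernel_sub_const (η s τ : ℝ) (V : ℝ → E) (c : E) :
    leftKernel η (fun s => V s - c) s τ = leftKernel η V s τ := by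
  simp [leftKernel]

variable [CompleteSpace E]

/-- The Riemann-Liouville integral of order `η` inverts the Weyl-Marchaud derivative: almost every
point is a strong Lebesgue point, since `∫₀ʳ ‖V(r) - V(s)‖ / (r - s)^{η+1} ds` is finite. -/
theorem IsFracDiff.ae_integral_leftDeriv {η t : ℝ} {V : ℝ → E} (hV : IsFracDiff η t V)
    (hη : 0 < η) (hη1 : η < 1) :
    ∀ᵐ r ∂(volume.restrict (Ioo 0 t)),
      ∫ s in Ioo 0 r, (r - s) ^ (η - 1) • leftDeriv η V s = Real.Gamma η • V r := by
  rcases le_or_gt t 0 with ht | ht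
  · simp [Ioo_eq_empty (not_lt.2 ht)]
  have hpow : IntegrableOn (fun s : ℝ => (s ^ η)⁻¹) (Ioo 0 t) := by
    have := (integrableOn_sub_rpow' (a := 0) (t := t) (c := -η) ht.le (by linarith)).1
    refine this.congr_fun (fun s hs => ?_) measurableSet_Ioo
    simp only [sub_zero]
    rw [Real.rpow_neg hs.1.le]
  filter_upwards [ae_restrict_mem measurableSet_Ioo,
    ae_integrableOn_rpow_smul hη hV.integrableOn_smul,
    ae_integrableOn_rpow_smul hη hV.integrableOn_integral,
    ae_integrableOn_rpow_smul hη (hV.integrableOn hη),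
    ae_integrableOn_rpow_smul hη hpow] with r hr hA1 hA2 hA0 hp
  have hr0 : 0 < r := hr.1
  have hA3 := hV.integrableOn_leftKernel r hr
  have hsub : Ioo 0 r ⊆ Ioo 0 t := Ioo_subset_Ioo_right hr.2.le
  let w : ℝ → E := fun s => V s - V r
  have hw : IntegrableOn w (Ioo 0 r) := ((hV.integrableOn hη).mono_set hsub).sub (by simp)
  have hw1 : IntegrableOn (fun s => (r - s) ^ (η - 1) • w s) (Ioo 0 r) := by
    have h1 := (integrableOn_sub_rpow (a := 0) (t := r) (c := η - 1) hr0.le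
      (by linarith)).1.smul_const (V r)
    have h2 := hA0.sub h1
    refine h2.congr (Eventually.of_forall fun s => ?_)
    simp only [w, Pi.sub_apply, smul_sub]
  have hw2' : IntegrableOn (fun s => (r - s) ^ (η - 1) • (s ^ η)⁻¹ • w s) (Ioo 0 r) := by
    have h2 := hA1.sub (hp.smul_const (V r))
    refine h2.congr (Eventually.of_forall fun s => ?_)
    simp only [w, Pi.sub_apply, smul_sub, smul_smul, smul_eq_mul]
  have hw2 : IntegrableOn (fun s => ((r - s) ^ (η - 1) * s ^ (-η)) • w s) (Ioo 0 r) :=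
    hw2'.congr_fun (fun s hs => by
      simp only [smul_smul]; rw [Real.rpow_neg hs.1.le]) measurableSet_Ioo
  -- the truncated derivatives converge
  have hlim1 : Tendsto (fun e => ∫ s in Ioo 0 r, (r - s) ^ (η - 1) • ((s ^ η)⁻¹ • w s +
        η • ∫ τ in Ioo 0 (s - e), leftKernel η w s τ)) (𝓝[>] 0)
      (𝓝 (∫ s in Ioo 0 r, (r - s) ^ (η - 1) • ((s ^ η)⁻¹ • w s +
        η • ∫ τ in Ioo 0 s, leftKernel η w s τ))) := by
    refine tendsto_integral_filter_of_dominated_convergence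
      (fun s => ‖(r - s) ^ (η - 1) • (s ^ η)⁻¹ • w s‖ + η * ‖(r - s) ^ (η - 1) •
        ∫ τ in Ioo 0 s, ‖leftKernel η V s τ‖‖) ?_ ?_ (hw2'.norm.add (hA2.norm.const_mul η)) ?_
    · refine eventually_nhdsWithin_of_forall fun e he => ?_
      have he : (0 : ℝ) < e := he
      have hk : AEStronglyMeasurable (fun s => ∫ τ in Ioo 0 (s - e), leftKernel η w s τ)
          (volume.restrict (Ioo 0 r)) := by
        refine aestronglyMeasurable_integral_Ioo_sub he.le ?_
        have h1 : Measurable fun p : ℝ × ℝ => ((p.1 - p.2) ^ (η + 1))⁻¹ := by fun_prop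
        exact h1.aestronglyMeasurable.smul (hw.1.comp_fst.sub hw.1.comp_snd)
      have h1 : Measurable fun s : ℝ => (r - s) ^ (η - 1) := by fun_prop
      have h3 : Measurable fun s : ℝ => (s ^ η)⁻¹ := by fun_prop
      exact h1.aestronglyMeasurable.smul ((h3.aestronglyMeasurable.smul hw.1).add
        (hk.const_smul η))
    · refine eventually_nhdsWithin_of_forall fun e he => ?_
      have he : (0 : ℝ) < e := he
      refine ae_restrict_of_forall_mem measurableSet_Ioo fun s hs => ?_
      rw [smul_add]
      refine (norm_add_le _ _).trans (add_le_add le_rfl ?_)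
      rw [smul_comm, norm_smul η, Real.norm_of_nonneg hη.le, norm_smul, norm_smul]
      refine mul_le_mul_of_nonneg_left (mul_le_mul_of_nonneg_left ?_ (norm_nonneg _)) hη.le
      rw [Real.norm_of_nonneg (integral_nonneg fun _ => norm_nonneg _)]
      refine (norm_integral_le_integral_norm _).trans ?_
      simp only [w, leftKernel_sub_const]
      exact setIntegral_mono_set (hV.integrableOn_leftKernel s (hsub hs)).norm
        (Eventually.of_forall fun _ => norm_nonneg _)
        (LE.le.eventuallyLE (Ioo_subset_Ioo_right (by linarith)))
    · refine ae_restrict_of_forall_mem measurableSet_Ioo fun s hs => ?_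
      refine Tendsto.const_smul (Tendsto.const_add _ (Tendsto.const_smul ?_ _)) _
      refine tendsto_integral_Ioo_sub ?_
      have : leftKernel η w s = leftKernel η V s := funext fun τ => leftKernel_sub_const _ _ _ _ _
      rw [this]
      exact hV.integrableOn_leftKernel s (hsub hs)
  -- and their Riemann-Liouville integrals vanish in the limit
  have hlim2 : Tendsto (fun e => ∫ s in Ioo 0 r, composedKernel η e r s • w s) (𝓝[>] 0)
      (𝓝 (∫ _ in Ioo 0 r, (0 : E))) := by
    refine tendsto_integral_filter_of_dominated_convergence
      (fun s => ‖((r - s) ^ (η - 1) * s ^ (-η)) • w s‖ + r ^ η * ‖leftKernel η V r s‖) ?_ ?_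
      (hw2.norm.add (hA3.norm.const_mul _)) ?_
    · refine Eventually.of_forall fun e => ?_
      have h1 : Measurable fun s : ℝ => composedKernel η e r s := by
        unfold composedKernel; fun_prop
      exact h1.aestronglyMeasurable.smul hw.1
    · refine eventually_nhdsWithin_of_forall fun e he => ?_
      refine ae_restrict_of_forall_mem measurableSet_Ioo fun s hs => ?_
      have hrs : 0 < r - s := sub_pos.2 hs.2
      have hs0 : 0 < s := hs.1
      rw [norm_smul, norm_smul, leftKernel, norm_smul, norm_sub_rev (V r), Real.norm_eq_abs,
        Real.norm_of_nonneg (by positivity), Real.norm_of_nonneg (by positivity),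
        ← Real.rpow_neg hrs.le, ← mul_assoc, ← add_mul]
      exact mul_le_mul_of_nonneg_right (composedKernel_bound hη hη1 he hs) (norm_nonneg _)
    · refine ae_restrict_of_forall_mem measurableSet_Ioo fun s hs => ?_
      have := (tendsto_composedKernel hη hη1 hs).smul_const (w s)
      rwa [zero_smul] at this
  have hzero : ∫ s in Ioo 0 r, (r - s) ^ (η - 1) • ((s ^ η)⁻¹ • w s +
        η • ∫ τ in Ioo 0 s, leftKernel η w s τ) = 0 := by
    refine tendsto_nhds_unique hlim1 ((hlim2.congr' ?_).trans (by simp))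
    exact eventually_nhdsWithin_of_forall fun e he =>
      (integral_truncated_leftDeriv hη hη1 he hw hw1 hw2).symm
  have hint : IntegrableOn (fun s => (r - s) ^ (η - 1) • ((s ^ η)⁻¹ • w s +
        η • ∫ τ in Ioo 0 s, leftKernel η w s τ)) (Ioo 0 r) := by
    have hk : AEStronglyMeasurable (fun s => ∫ τ in Ioo 0 (s - 0), leftKernel η w s τ)
        (volume.restrict (Ioo 0 r)) := by
      refine aestronglyMeasurable_integral_Ioo_sub le_rfl ?_
      have h1 : Measurable fun p : ℝ × ℝ => ((p.1 - p.2) ^ (η + 1))⁻¹ := by fun_prop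
      exact h1.aestronglyMeasurable.smul (hw.1.comp_fst.sub hw.1.comp_snd)
    simp only [sub_zero] at hk
    have h1 : Measurable fun s : ℝ => (r - s) ^ (η - 1) := by fun_prop
    have h3 : Measurable fun s : ℝ => (s ^ η)⁻¹ := by fun_prop
    refine Integrable.mono' (hw2'.norm.add (hA2.norm.const_mul η))
      (h1.aestronglyMeasurable.smul ((h3.aestronglyMeasurable.smul hw.1).add (hk.const_smul η)))
      (ae_restrict_of_forall_mem measurableSet_Ioo fun s hs => ?_)
    rw [smul_add]
    refine (norm_add_le _ _).trans (add_le_add le_rfl ?_)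
    change _ ≤ η * ‖(r - s) ^ (η - 1) • ∫ τ in Ioo 0 s, ‖leftKernel η V s τ‖‖
    rw [smul_comm, norm_smul η, Real.norm_of_nonneg hη.le, norm_smul, norm_smul]
    refine mul_le_mul_of_nonneg_left (mul_le_mul_of_nonneg_left ?_ (norm_nonneg _)) hη.le
    rw [Real.norm_of_nonneg (integral_nonneg fun _ => norm_nonneg _)]
    refine (norm_integral_le_integral_norm _).trans ?_
    simp only [w, leftKernel_sub_const, le_refl]
  have hΓ := Real.Gamma_pos_of_pos (s := 1 - η) (by linarith)
  have hsplit : ∀ s, (r - s) ^ (η - 1) • leftDeriv η V s = (Real.Gamma (1 - η))⁻¹ •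
      ((r - s) ^ (η - 1) • ((s ^ η)⁻¹ • w s + η • ∫ τ in Ioo 0 s, leftKernel η w s τ)
        + ((r - s) ^ (η - 1) • (s ^ η)⁻¹) • V r) := by
    intro s
    simp only [w, leftKernel_sub_const]
    rw [leftDeriv, smul_comm, smul_sub, smul_assoc, ← smul_add]
    congr 2
    abel
  have hbeta : ∫ s in Ioo 0 r, (r - s) ^ (η - 1) • (s ^ η)⁻¹
      = Real.Gamma (1 - η) * Real.Gamma η := by
    have h1 := integral_rpow_mul_sub_rpow (a := 1 - η) (b := η) (by linarith) hη hr0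
    rw [show 1 - η + η - 1 = 0 by ring, Real.rpow_zero, one_mul, show 1 - η + η = 1 by ring,
      Real.Gamma_one, div_one] at h1
    rw [← h1]
    refine setIntegral_congr_fun measurableSet_Ioo fun s hs => ?_
    simp only [smul_eq_mul]
    rw [show 1 - η - 1 = -η by ring, Real.rpow_neg hs.1.le, mul_comm]
  simp only [hsplit]
  rw [integral_smul, integral_add hint (hp.smul_const _), hzero, zero_add, integral_smul_const,
    hbeta, smul_smul, inv_mul_cancel_left₀ hΓ.ne']

end Inversion

section Pairing

variable {Z Y : Type*} [NormedAddCommGroup Z] [NormedSpace ℝ Z] [NormedAddCommGroup Y]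
  [NormedSpace ℝ Y] [CompleteSpace Y] [CompleteSpace Z]

theorem IsFracDiff.integral_leftDeriv_apply {η t : ℝ} {V : ℝ → Z →L[ℝ] Y}
    (hV : IsFracDiff η t V) (hη : 0 < η) (hη1 : η < 1) {ζ : ℝ → Z} (hζ : Continuous ζ) {C : ℝ}
    (hC : ∀ r, ‖ζ r‖ ≤ C) :
    ∫ s in Ioo 0 t, leftDeriv η V s (∫ r in Ioo s t, (r - s) ^ (η - 1) • ζ r)
      = Real.Gamma η • ∫ r in Ioo 0 t, V r (ζ r) := by
  have hD := hV.integrableOn_leftDeriv hη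
  have hF := integrable_prod_rpow_smul hη hD
  set F : ℝ × ℝ → Z →L[ℝ] Y := fun p => {p : ℝ × ℝ | p.1 < p.2}.indicator
      (fun p => (p.2 - p.1) ^ (η - 1) • leftDeriv η V p.1) p with hFdef
  have hG : Integrable (Function.uncurry fun s r => F (s, r) (ζ r))
      ((volume.restrict (Ioo 0 t)).prod (volume.restrict (Ioo 0 t))) := by
    refine Integrable.mono' (hF.norm.mul_const C)
      ((ContinuousLinearMap.id ℝ (Z →L[ℝ] Y)).aestronglyMeasurable_comp₂ hF.1
        (hζ.comp continuous_snd).aestronglyMeasurable) (Eventually.of_forall fun p => ?_)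
    refine (ContinuousLinearMap.le_opNorm _ _).trans ?_
    gcongr
    exact hC _
  have h1 : ∀ s ∈ Ioo 0 t, leftDeriv η V s (∫ r in Ioo s t, (r - s) ^ (η - 1) • ζ r)
      = ∫ r in Ioo 0 t, F (s, r) (ζ r) := by
    intro s hs
    have hi : IntegrableOn (fun r => (r - s) ^ (η - 1) • ζ r) (Ioo s t) := by
      have hj := (integrableOn_sub_rpow' (a := s) (t := t) (c := η - 1) hs.2.le (by linarith)).1
      have hm : AEStronglyMeasurable (fun r => (r - s) ^ (η - 1) • ζ r)
        (volume.restrict (Ioo s t)) := hj.1.smul hζ.aestronglyMeasurable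
      refine Integrable.mono' (hj.norm.mul_const C) hm (Eventually.of_forall fun r => ?_)
      rw [norm_smul]
      gcongr
      exact hC r
    rw [← ContinuousLinearMap.integral_comp_comm _ hi]
    have : ∀ r, F (s, r) (ζ r) = (Ioi s).indicator
        (fun r => leftDeriv η V s ((r - s) ^ (η - 1) • ζ r)) r := fun r => by
      by_cases h : s < r <;> simp [hFdef, indicator_apply, h]
    simp only [this]
    rw [setIntegral_indicator measurableSet_Ioi]
    congr 2
    ext r; simp only [mem_inter_iff, mem_Ioo, mem_Ioi]
    exact ⟨fun h => ⟨⟨hs.1.trans h.1, h.2⟩, h.1⟩, fun h => ⟨h.2, h.1.2⟩⟩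
  rw [setIntegral_congr_fun measurableSet_Ioo h1, integral_integral_swap hG, ← integral_smul]
  refine integral_congr_ae ?_
  filter_upwards [hV.ae_integral_leftDeriv hη hη1, hF.prod_left_ae,
    ae_restrict_mem measurableSet_Ioo] with r hr hFr hrt
  rw [← ContinuousLinearMap.integral_apply hFr (ζ r), ← smul_apply, ← hr]
  congr 1
  have : ∀ s, F (s, r) = (Iio r).indicator (fun s => (r - s) ^ (η - 1) • leftDeriv η V s) s :=
    fun s => by simp [hFdef, indicator_apply]
  simp only [this]
  rw [setIntegral_indicator measurableSet_Iio]
  congr 2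
  ext s; simp only [mem_inter_iff, mem_Ioo, mem_Iio]
  exact ⟨fun h => ⟨h.1.1, h.2⟩, fun h => ⟨⟨h.1, h.2.trans hrt.2⟩, h.2⟩⟩

/-- For continuously differentiable functions the right-sided Weyl-Marchaud derivative is a
Riemann-Liouville integral of the derivative. -/
theorem rightDeriv_eq_of_hasDerivAt {α η C t₀ : ℝ} (hη : α < η) {y ζ : ℝ → Z}
    (hζ : Continuous ζ) (hy : ∀ τ, HasDerivAt y (ζ τ) τ)
    (hyC : ∀ s ∈ Icc 0 t₀, ∀ t ∈ Icc 0 t₀, ‖y t - y s‖ ≤ C * |t - s| ^ (1 - α))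
    {s t : ℝ} (hη0 : 0 < η) (hs : 0 ≤ s) (hst : s < t) (ht : t ≤ t₀) :
    rightDeriv η y t s = -((Real.Gamma η)⁻¹ • ∫ r in Ioo s t, (r - s) ^ (η - 1) • ζ r) := by
  have hyc : Continuous y := continuous_iff_continuousAt.2 fun τ => (hy τ).continuousAt
  let Ψ : ℝ → Z := fun τ => (τ - s) ^ (η - 1) • (y s - y τ)
  have hi1 := (integrableOn_rightKernel hη hyC hyc.continuousOn hs hst.le ht).1
  have hi2 : IntegrableOn (fun r => (r - s) ^ (η - 1) • ζ r) (Ioo s t) := by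
    have hj := (integrableOn_sub_rpow' (a := s) (t := t) (c := η - 1) hst.le (by linarith)).1
    obtain ⟨B, hB⟩ := isCompact_Icc.exists_bound_of_continuousOn (s := Icc s t) hζ.continuousOn
    have hm : AEStronglyMeasurable (fun r => (r - s) ^ (η - 1) • ζ r)
      (volume.restrict (Ioo s t)) := hj.1.smul hζ.aestronglyMeasurable
    refine Integrable.mono' (hj.norm.mul_const B) hm
      (ae_restrict_of_forall_mem measurableSet_Ioo fun r hr => ?_)
    rw [norm_smul]
    gcongr
    exact hB r (Ioo_subset_Icc_self hr)
  have hΨc : ContinuousOn Ψ (Icc s t) := by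
    intro τ hτ
    rcases hτ.1.eq_or_lt with h | h
    · subst h
      have h0 : Ψ s = 0 := by simp [Ψ]
      rw [ContinuousWithinAt, h0]
      have hc : Tendsto (fun τ => C * (τ - s) ^ (η - α)) (𝓝[Icc s t] s) (𝓝 0) := by
        have : Continuous fun τ : ℝ => C * (τ - s) ^ (η - α) :=
          continuous_const.mul (Continuous.rpow_const (by fun_prop) fun _ => Or.inr (by linarith))
        have h1 := (this.tendsto s).mono_left (nhdsWithin_le_nhds (s := Icc s t))
        simpa [Real.zero_rpow (by linarith : η - α ≠ 0)] using h1
      refine squeeze_zero_norm' (eventually_nhdsWithin_of_forall fun τ hτ => ?_) hc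
      rcases hτ.1.eq_or_lt with h | h
      · subst h; simp [Ψ, Real.zero_rpow (by linarith : η - α ≠ 0)]
      · have hp : 0 < τ - s := sub_pos.2 h
        have h1 := hyC τ ⟨hs.trans h.le, hτ.2.trans ht⟩ s ⟨hs, hst.le.trans ht⟩
        rw [abs_sub_comm, abs_of_pos hp] at h1
        simp only [Ψ]
        rw [norm_smul, Real.norm_of_nonneg (by positivity)]
        calc _ ≤ (τ - s) ^ (η - 1) * (C * (τ - s) ^ (1 - α)) := by gcongr
          _ = _ := by
            rw [show η - α = (η - 1) + (1 - α) by ring, Real.rpow_add hp]; ring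
    · refine ContinuousAt.continuousWithinAt ?_
      refine ContinuousAt.smul (ContinuousAt.rpow_const (by fun_prop) (Or.inl ?_))
        (continuousAt_const.sub hyc.continuousAt)
      linarith
  have hΨd : ∀ τ ∈ Ioo s t, HasDerivAt Ψ (-((1 - η) • rightKernel η y s τ
      + (τ - s) ^ (η - 1) • ζ τ)) τ := by
    intro τ hτ
    have hp : 0 < τ - s := sub_pos.2 hτ.1
    have h1 : HasDerivAt (fun τ : ℝ => (τ - s) ^ (η - 1)) ((η - 1) * (τ - s) ^ (η - 1 - 1)) τ := by
      have := ((hasDerivAt_id τ).sub_const s).rpow_const (p := η - 1) (Or.inl hp.ne')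
      simpa using this
    have h2 : HasDerivAt (fun τ => y s - y τ) (-ζ τ) τ := (hy τ).const_sub (y s)
    have h3 := h1.smul h2
    refine h3.congr_deriv ?_
    rw [rightKernel, ← Real.rpow_neg hp.le, show -(1 - η + 1) = η - 1 - 1 by ring, smul_neg,
      smul_smul, show (η - 1) * (τ - s) ^ (η - 1 - 1) = -((1 - η) * (τ - s) ^ (η - 1 - 1)) by ring,
      neg_smul, neg_add, add_comm]
  have hii : IntegrableOn (fun τ => -((1 - η) • rightKernel η y s τ + (τ - s) ^ (η - 1) • ζ τ))
      (Ioo s t) := ((hi1.smul (1 - η)).add hi2).neg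
  have hi1' : IntegrableOn (fun τ => (1 - η) • rightKernel η y s τ) (Ioo s t) := hi1.smul (1 - η)
  have hftc := intervalIntegral.integral_eq_sub_of_hasDerivAt_of_le hst.le hΨc hΨd
    ((intervalIntegrable_iff_integrableOn_Ioo_of_le hst.le).2 hii)
  rw [intervalIntegral.integral_of_le hst.le, integral_Ioc_eq_integral_Ioo, integral_neg,
    integral_add hi1' hi2, integral_smul] at hftc
  have hΨs : Ψ s = 0 := by simp [Ψ]
  rw [hΨs, sub_zero] at hftc
  have hp : 0 < t - s := sub_pos.2 hst
  rw [rightDeriv, ← Real.rpow_neg hp.le, show -(1 - η) = η - 1 by ring, ← smul_neg]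
  congr 1
  change Ψ t + _ = _
  rw [← hftc]
  abel

/-- The difference quotients of the extension of `z` by constants. -/
def diffQuot (t₀ : ℝ) (z : ℝ → Z) (h s : ℝ) : Z :=
  h⁻¹ • (z (max 0 (min (s + h) t₀)) - z (max 0 (min s t₀)))

/-- The fractional integral is the limit of the integrals with respect to mollified integrators. The
approximations do not depend on the order `η`. -/
theorem IsFracDiff.tendsto_integral_diffQuot {α η t₀ t : ℝ} {V : ℝ → Z →L[ℝ] Y}
    (hV : IsFracDiff η t V) (hα : 0 < α) (hα1 : α < 1) (hη : α < η) (hη1 : η < 1) {z : ℝ → Z}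
    (hz : MemC (1 - α) t₀ z) (ht0 : 0 < t) (ht : t ≤ t₀) :
    Tendsto (fun h => -∫ r in Ioo 0 t, V r (diffQuot t₀ z h r)) (𝓝[>] 0)
      (𝓝 (∫ s in Ioo 0 t, leftDeriv η V s (rightDeriv η z t s))) := by
  have ht₀ : 0 < t₀ := ht0.trans_le ht
  have hη0 : 0 < η := hα.trans hη
  have hα' : 0 < 1 - α := by linarith
  obtain ⟨C, hCb, hCz⟩ := id hz
  have hC : 0 ≤ C := (norm_nonneg _).trans (hCb 0 ⟨le_rfl, ht₀.le⟩)
  let p : ℝ → ℝ := fun s => max 0 (min s t₀)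
  have hpm : ∀ s, p s ∈ Icc 0 t₀ := fun s => ⟨le_max_left _ _, max_le ht₀.le (min_le_right _ _)⟩
  have hpe : ∀ s ∈ Icc 0 t₀, p s = s := fun s hs => by
    simp only [p]; rw [min_eq_left hs.2, max_eq_right hs.1]
  have hpl : ∀ s t, |p t - p s| ≤ |t - s| := fun s t => by
    refine (abs_max_sub_max_le_max _ _ _ _).trans (max_le (by simp) ?_)
    refine (abs_min_sub_min_le_max _ _ _ _).trans (max_le le_rfl (by simp))
  let y : ℝ → Z := fun s => z (p s)
  have hy : ∀ s t, ‖y t - y s‖ ≤ C * |t - s| ^ (1 - α) := fun s t =>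
    (hCz _ (hpm s) _ (hpm t)).trans (by have := hpl s t; gcongr)
  have hyc : Continuous y := by
    have hzc := hz.continuousOn hα'
    exact hzc.comp_continuous (by fun_prop) hpm
  have hyc' : ∀ s, Continuous fun u => y (s + u) := fun s => hyc.comp (by fun_prop)
  let yh : ℝ → ℝ → Z := fun h s => h⁻¹ • ∫ u in (0 : ℝ)..h, y (s + u)
  have hyi : ∀ a b, IntervalIntegrable y volume a b := fun a b => hyc.intervalIntegrable a b
  have hyhd : ∀ h s, HasDerivAt (yh h) (diffQuot t₀ z h s) s := by
    intro h s
    have e : yh h = fun s => h⁻¹ • ((∫ u in (0 : ℝ)..(s + h), y u) - ∫ u in (0 : ℝ)..s, y u) := by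
      ext s
      simp only [yh]
      rw [intervalIntegral.integral_comp_add_left, add_zero,
        intervalIntegral.integral_interval_sub_left (hyi _ _) (hyi _ _)]
    rw [e]
    have h1 : ∀ s, HasDerivAt (fun s => ∫ u in (0 : ℝ)..s, y u) (y s) s := fun s =>
      intervalIntegral.integral_hasDerivAt_right (hyi _ _)
        (hyc.stronglyMeasurableAtFilter _ _) hyc.continuousAt
    exact (((h1 (s + h)).comp_add_const s h).sub (h1 s)).const_smul h⁻¹
  have hyhh : ∀ h, 0 < h → ∀ s t, ‖yh h t - yh h s‖ ≤ C * |t - s| ^ (1 - α) := by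
    intro h hh s t
    simp only [yh]
    rw [← smul_sub, ← intervalIntegral.integral_sub
      ((hyc' t).intervalIntegrable _ _)
      ((hyc' s).intervalIntegrable _ _), norm_smul,
      norm_inv, Real.norm_of_nonneg hh.le, inv_mul_le_iff₀ hh]
    have := intervalIntegral.norm_integral_le_of_norm_le_const (a := 0) (b := h)
      (f := fun u => y (t + u) - y (s + u)) (C := C * |t - s| ^ (1 - α))
      (fun u _ => by simpa using hy (s + u) (t + u))
    rw [sub_zero, abs_of_pos hh] at this
    linarith
  have hyhlim : ∀ s, Tendsto (fun h => yh h s) (𝓝[>] 0) (𝓝 (y s)) := by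
    intro s
    have h1 : HasDerivAt (fun h => ∫ u in (0 : ℝ)..h, y (s + u)) (y (s + 0)) 0 :=
      intervalIntegral.integral_hasDerivAt_right
        ((hyc' s).intervalIntegrable _ _)
        ((hyc' s).stronglyMeasurableAtFilter _ _)
        (hyc' s).continuousAt
    have h2 := (hasDerivAt_iff_tendsto_slope.1 h1).mono_left
      (nhdsWithin_mono 0 fun x (hx : (0 : ℝ) < x) => hx.ne')
    rw [add_zero] at h2
    refine h2.congr fun h => ?_
    simp [slope_def_module, yh]
  have hqc : ∀ h, Continuous (diffQuot t₀ z h) := fun h => by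
    have : diffQuot t₀ z h = fun s => h⁻¹ • (y (s + h) - y s) := rfl
    rw [this]; fun_prop
  -- `y` need not be differentiable, but its averages `yh h` are, with derivative `diffQuot t₀ z h`
  have happ : ∀ h, 0 < h → -∫ r in Ioo 0 t, V r (diffQuot t₀ z h r)
      = ∫ s in Ioo 0 t, leftDeriv η V s (rightDeriv η (yh h) t s) := by
    intro h hh
    have hΓ := Real.Gamma_pos_of_pos hη0
    have h1 := hV.integral_leftDeriv_apply hη0 hη1 (hqc h) (C := ‖h⁻¹‖ * (C + C)) (fun r => by
      rw [diffQuot, norm_smul]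
      exact mul_le_mul_of_nonneg_left ((norm_sub_le _ _).trans
        (add_le_add (hCb _ (hpm _)) (hCb _ (hpm _)))) (norm_nonneg _))
    have h2 : ∫ s in Ioo 0 t, leftDeriv η V s (rightDeriv η (yh h) t s) = ∫ s in Ioo 0 t,
        -((Real.Gamma η)⁻¹ • leftDeriv η V s (∫ r in Ioo s t, (r - s) ^ (η - 1) •
          diffQuot t₀ z h r)) := by
      refine setIntegral_congr_fun measurableSet_Ioo fun s hs => ?_
      rw [rightDeriv_eq_of_hasDerivAt hη (hqc h) (hyhd h) (fun s _ t _ => hyhh h hh s t) hη0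
        hs.1.le hs.2 ht, map_neg, map_smul]
    rw [h2, integral_neg, integral_smul, h1, smul_smul, inv_mul_cancel₀ hΓ.ne', one_smul]
  have hyz : ∀ s ∈ Icc 0 t₀, y s = z s := fun s hs => by simp only [y, hpe s hs]
  have hlast : ∫ s in Ioo 0 t, leftDeriv η V s (rightDeriv η z t s)
      = ∫ s in Ioo 0 t, leftDeriv η V s (rightDeriv η y t s) := by
    refine setIntegral_congr_fun measurableSet_Ioo fun s hs => ?_
    congr 1
    have e1 : ∫ τ in Ioo s t, rightKernel η z s τ = ∫ τ in Ioo s t, rightKernel η y s τ :=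
      setIntegral_congr_fun measurableSet_Ioo fun τ hτ => by
        simp only [rightKernel]
        rw [hyz s ⟨hs.1.le, hs.2.le.trans ht⟩, hyz τ ⟨(hs.1.trans hτ.1).le, hτ.2.le.trans ht⟩]
    rw [rightDeriv, rightDeriv, e1, hyz s ⟨hs.1.le, hs.2.le.trans ht⟩, hyz t ⟨ht0.le, ht⟩]
  rw [hlast]
  have hD := hV.integrableOn_leftDeriv hη0
  have hyhc : ∀ h, Continuous (yh h) := fun h =>
    continuous_iff_continuousAt.2 fun s => (hyhd h s).continuousAt
  refine Tendsto.congr' (eventually_nhdsWithin_of_forall fun h hh => (happ h hh).symm) ?_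
  refine tendsto_integral_filter_of_dominated_convergence
    (fun s => ‖leftDeriv η V s‖ * ((Real.Gamma η)⁻¹ * C * (1 + 1 / (η - α)) * t₀ ^ (η - α)))
    (Eventually.of_forall fun h => ?_) (eventually_nhdsWithin_of_forall fun h hh => ?_)
    (hD.norm.mul_const _) (ae_restrict_of_forall_mem measurableSet_Ioo fun s hs => ?_)
  · exact (ContinuousLinearMap.id ℝ (Z →L[ℝ] Y)).aestronglyMeasurable_comp₂ hD.1
      (aestronglyMeasurable_rightDeriv (hyhc h).aestronglyMeasurable)
  · refine ae_restrict_of_forall_mem measurableSet_Ioo fun s hs => ?_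
    refine (ContinuousLinearMap.le_opNorm _ _).trans ?_
    gcongr
    exact norm_rightDeriv_le hC hα hη hη1 (fun s _ t _ => hyhh h hh s t) (hyhc h).continuousOn
      hs.1.le hs.2 ht
  · refine ((leftDeriv η V s).continuous.tendsto _).comp ?_
    refine Tendsto.const_smul (Tendsto.add (Tendsto.const_smul
      ((hyhlim s).sub (hyhlim t)) _) (Tendsto.const_smul ?_ _)) _
    have hj := (integrableOn_sub_rpow' (a := s) (t := t) (c := η - α - 1) hs.2.le
      (by linarith)).1.const_mul C
    refine tendsto_integral_filter_of_dominated_convergence _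
      (Eventually.of_forall fun h => ?_) (eventually_nhdsWithin_of_forall fun h hh => ?_) hj
      (ae_restrict_of_forall_mem measurableSet_Ioo fun τ hτ => ?_)
    · have h1 : Measurable fun τ : ℝ => ((τ - s) ^ (1 - η + 1))⁻¹ := by fun_prop
      exact h1.aestronglyMeasurable.smul
        (aestronglyMeasurable_const.sub (hyhc h).aestronglyMeasurable)
    · exact ae_restrict_of_forall_mem measurableSet_Ioo fun τ hτ =>
        norm_rightKernel_le (t₀ := t₀) (fun s _ t _ => hyhh h hh s t) hs.1.le hτ.1
          (hτ.2.le.trans ht)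
    · exact Tendsto.const_smul ((hyhlim s).sub (hyhlim τ)) _

end Pairing

/-! ### The fixed point argument -/

section FixedPoint

variable {H 𝔾 Z E : Type*} [NormedAddCommGroup H] [NormedSpace ℝ H] [NormedAddCommGroup 𝔾]
  [NormedSpace ℝ 𝔾] [NormedAddCommGroup Z] [NormedSpace ℝ Z] [NormedAddCommGroup E]
  [NormedSpace ℝ E]

/-- The convolution `∫₀ᵗ P(t-s) h(s) ds`. -/
def drift (P : ℝ → H →L[ℝ] E) (h : ℝ → H) (t : ℝ) : E := ∫ s in Ioo 0 t, P (t - s) (h s)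

/-- The fractional integral `∫₀ᵗ D^η (M(t-·) g)(s) D^{1-η} z_t(s) ds`, without its sign. -/
def noise (η : ℝ) (M : ℝ → 𝔾 →L[ℝ] Z →L[ℝ] E) (z : ℝ → Z) (g : ℝ → 𝔾) (t : ℝ) : E :=
  ∫ s in Ioo 0 t, leftDeriv η (fun s => M (t - s) (g s)) s (rightDeriv η z t s)

variable {t₀ α η θ γ γ' l κ κ' K K' : ℝ} {P : ℝ → H →L[ℝ] E} {M : ℝ → 𝔾 →L[ℝ] Z →L[ℝ] E} {z : ℝ → Z}

theorem exists_isWeighted_drift (ht₀ : 0 < t₀) (hP : IsSingularOp t₀ κ K P) (hκ : 0 ≤ κ)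
    (hK : 0 ≤ K) (hγ : 0 ≤ γ) (hγγ' : γ < γ') (hγ' : γ' ≤ 1) (hl : 0 ≤ l)
    (hsum : κ + γ' + l < 1) :
    ∃ C, 0 ≤ C ∧ ∀ (ρ A : ℝ) (h : ℝ → H), 0 < ρ → 0 ≤ A →
      AEStronglyMeasurable h (volume.restrict (Icc 0 t₀)) →
      (∀ s ∈ Icc 0 t₀, ‖h s‖ ≤ A * Real.exp (ρ * s)) →
      IsWeighted γ t₀ ρ (C * A * ρ ^ (-l)) (drift P h) := by
  obtain ⟨C, hC, hb⟩ := exists_drift_bound hP hκ hK (hγ.trans hγγ'.le) hγ' hl hsum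
  have hd : 0 < γ' - γ := sub_pos.2 hγγ'
  refine ⟨C * (1 + t₀ ^ (γ' - γ) / (γ' - γ)), by positivity, fun ρ A h hρ hA hm hh => ?_⟩
  obtain ⟨h1, h2⟩ := hb ρ A h hρ hA hm hh
  exact (IsWeighted.of_holder hγ hγγ' ht₀ hρ.le (by positivity) h1 h2).mono (le_of_eq (by ring))

theorem exists_isWeighted_noise (ht₀ : 0 < t₀) (hM : IsSingularFamily t₀ κ K M) (hκ : 0 ≤ κ)
    (hK : 0 ≤ K) (hα : 0 < α) (hη : α < η) (hηθ : η < θ) (hγ : 0 ≤ γ) (hγγ' : γ < γ')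
    (hγ' : γ' ≤ 1 - α) (hl : 0 ≤ l) (hsum : κ + γ' + θ + l < 1) (hz : MemC (1 - α) t₀ z) :
    ∃ C, 0 ≤ C ∧ ∀ (ρ A : ℝ) (g : ℝ → 𝔾), 0 < ρ → IsWeighted η t₀ ρ A g →
      IsWeighted γ t₀ ρ (C * A * ρ ^ (-l)) (noise η M z g) := by
  obtain ⟨C, hC, hb⟩ := exists_noise_bound hM hκ hK hα hη hηθ (hγ.trans hγγ'.le) hγ' hl hsum hz
  have hd : 0 < γ' - γ := sub_pos.2 hγγ'
  refine ⟨C * (1 + t₀ ^ (γ' - γ) / (γ' - γ)), by positivity, fun ρ A g hρ hg => ?_⟩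
  obtain ⟨-, h1, h2⟩ := hb ρ A g hρ hg
  have hA := hg.nonneg
  exact (IsWeighted.of_holder hγ hγγ' ht₀ hρ.le (by positivity) h1 h2).mono (le_of_eq (by ring))

/-- A nonlinear map whose second differences satisfy the estimate of a map with a locally Lipschitz
derivative; the constant grows linearly with the radius. -/
def HasSecondDiffBound (C : ℝ) (n : E → 𝔾) : Prop :=
  ∀ (a₁ b₁ a₂ b₂ : E) (R : ℝ), ‖a₁‖ ≤ R → ‖b₁‖ ≤ R → ‖a₂‖ ≤ R → ‖b₂‖ ≤ R →
    ‖(n a₁ - n b₁) - (n a₂ - n b₂)‖ ≤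
      C * (1 + R) * (‖(a₁ - b₁) - (a₂ - b₂)‖ + ‖a₂ - b₂‖ * (‖a₁ - a₂‖ + ‖b₁ - b₂‖))

namespace HasSecondDiffBound

variable {C : ℝ} {n : E → 𝔾}

theorem norm_sub_le (hn : HasSecondDiffBound C n) {a b : E} {R : ℝ} (ha : ‖a‖ ≤ R)
    (hb : ‖b‖ ≤ R) : ‖n a - n b‖ ≤ C * (1 + R) * ‖a - b‖ := by
  have h0 : ‖(0 : E)‖ ≤ R := by simpa using (norm_nonneg a).trans ha
  simpa using hn a b 0 0 R ha hb h0 h0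

theorem continuous (hn : HasSecondDiffBound C n) : Continuous n := by
  refine continuous_iff_continuousAt.2 fun a => ?_
  rw [ContinuousAt, tendsto_iff_norm_sub_tendsto_zero]
  have h1 : Tendsto (fun b => C * (1 + (‖a‖ + 1)) * ‖b - a‖) (𝓝 a) (𝓝 0) := by
    have : Continuous fun b : E => C * (1 + (‖a‖ + 1)) * ‖b - a‖ := by fun_prop
    simpa using this.tendsto a
  refine squeeze_zero' (Eventually.of_forall fun _ => norm_nonneg _) ?_ h1
  filter_upwards [Metric.ball_mem_nhds a one_pos] with b hb
  refine hn.norm_sub_le ?_ (by linarith)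
  have h2 : ‖b - a‖ < 1 := by rwa [← dist_eq_norm]
  have h3 := norm_add_le (b - a) a
  rw [sub_add_cancel] at h3
  linarith

theorem isWeighted_comp (hC : 0 ≤ C) (hn : HasSecondDiffBound C n) {ρ A : ℝ} (hρ : 0 ≤ ρ)
    {u : ℝ → E} (hu : IsWeighted γ t₀ ρ A u) :
    IsWeighted γ t₀ ρ (C * (1 + A * Real.exp (ρ * t₀)) * A + ‖n 0‖) (fun t => n (u t)) := by
  have hA := hu.nonneg
  set R := A * Real.exp (ρ * t₀) with hR
  have hR0 : 0 ≤ R := by positivity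
  have huR : ∀ t ∈ Icc 0 t₀, ‖u t‖ ≤ R := fun t ht =>
    (hu.norm_le t ht).trans (by rw [hR]; have := ht.2; gcongr)
  refine IsWeighted.of_integrableOn
    (hn.continuous.comp_aestronglyMeasurable hu.aestronglyMeasurable) (by positivity)
    (fun t ht => ?_) (fun t τ => C * (1 + R) * ((t - τ) ^ (-(γ + 1)) * ‖u t - u τ‖))
    (fun t ht τ hτ => ?_) (fun t ht => (hu.integrableOn ht).1.const_mul _) (fun t ht => ?_)
  · have h1 := hn.norm_sub_le (huR t ht) (b := 0) (by simpa using hR0)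
    rw [sub_zero] at h1
    have h2 := norm_add_le (n (u t) - n 0) (n 0)
    rw [sub_add_cancel] at h2
    have h3 : 1 ≤ Real.exp (ρ * t) := Real.one_le_exp (mul_nonneg hρ ht.1)
    calc _ ≤ C * (1 + R) * (A * Real.exp (ρ * t)) + ‖n 0‖ * 1 := by
          rw [mul_one]
          exact h2.trans (add_le_add (h1.trans (mul_le_mul_of_nonneg_left (hu.norm_le t ht)
            (by positivity))) le_rfl)
      _ ≤ C * (1 + R) * (A * Real.exp (ρ * t)) + ‖n 0‖ * Real.exp (ρ * t) := by gcongr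
      _ = _ := by ring
  · have h1 := hn.norm_sub_le (huR t ht) (huR τ ⟨hτ.1.le, hτ.2.le.trans ht.2⟩)
    calc _ ≤ (t - τ) ^ (-(γ + 1)) * (C * (1 + R) * ‖u t - u τ‖) :=
          mul_le_mul_of_nonneg_left h1 (Real.rpow_nonneg (sub_pos.2 hτ.2).le _)
      _ = _ := by ring
  · rw [integral_const_mul, add_mul]
    have h1 := (hu.integrableOn ht).2
    calc _ ≤ C * (1 + R) * (A * Real.exp (ρ * t)) := by gcongr
      _ = C * (1 + R) * A * Real.exp (ρ * t) := by ring
      _ ≤ _ := le_add_of_nonneg_right (by positivity)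

theorem isWeighted_comp_sub (hC : 0 ≤ C) (hn : HasSecondDiffBound C n) {ρ₀ ρ A B : ℝ}
    (hρ₀ : 0 ≤ ρ₀) (hρ : 0 ≤ ρ) {u v : ℝ → E} (hu : IsWeighted γ t₀ ρ₀ A u)
    (hv : IsWeighted γ t₀ ρ₀ A v) (huv : IsWeighted γ t₀ ρ B (fun t => u t - v t)) :
    IsWeighted γ t₀ ρ (C * (1 + A * Real.exp (ρ₀ * t₀)) * (1 + 2 * (A * Real.exp (ρ₀ * t₀))) * B)
      (fun t => n (u t) - n (v t)) := by
  have hA := hu.nonneg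
  have hB := huv.nonneg
  set R := A * Real.exp (ρ₀ * t₀) with hR
  have hR0 : 0 ≤ R := by positivity
  have hexp : ∀ t ∈ Icc 0 t₀, A * Real.exp (ρ₀ * t) ≤ R := fun t ht => by
    rw [hR]; have := ht.2; gcongr
  have huR : ∀ t ∈ Icc 0 t₀, ‖u t‖ ≤ R := fun t ht => (hu.norm_le t ht).trans (hexp t ht)
  have hvR : ∀ t ∈ Icc 0 t₀, ‖v t‖ ≤ R := fun t ht => (hv.norm_le t ht).trans (hexp t ht)
  refine IsWeighted.of_integrableOn
    ((hn.continuous.comp_aestronglyMeasurable hu.aestronglyMeasurable).sub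
      (hn.continuous.comp_aestronglyMeasurable hv.aestronglyMeasurable)) (by positivity)
    (fun t ht => ?_) (fun t τ => C * (1 + R) * ((t - τ) ^ (-(γ + 1)) * ‖(u t - v t) - (u τ - v τ)‖
      + B * Real.exp (ρ * t) * ((t - τ) ^ (-(γ + 1)) * ‖u t - u τ‖
        + (t - τ) ^ (-(γ + 1)) * ‖v t - v τ‖)))
    (fun t ht τ hτ => ?_) (fun t ht => (((huv.integrableOn ht).1.add
      (((hu.integrableOn ht).1.add (hv.integrableOn ht).1).const_mul _)).const_mul _))
    (fun t ht => ?_)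
  · have h1 := hn.norm_sub_le (huR t ht) (hvR t ht)
    calc _ ≤ C * (1 + R) * (B * Real.exp (ρ * t)) :=
          h1.trans (mul_le_mul_of_nonneg_left (huv.norm_le t ht) (by positivity))
      _ = C * (1 + R) * 1 * B * Real.exp (ρ * t) := by ring
      _ ≤ _ := by gcongr; linarith
  · have hτ' : τ ∈ Icc 0 t₀ := ⟨hτ.1.le, hτ.2.le.trans ht.2⟩
    have h1 := hn (u t) (v t) (u τ) (v τ) R (huR t ht) (hvR t ht) (huR τ hτ') (hvR τ hτ')
    have h2 : ‖u τ - v τ‖ ≤ B * Real.exp (ρ * t) := (huv.norm_le τ hτ').trans (by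
      have := hτ.2.le; gcongr)
    have hp : 0 ≤ (t - τ) ^ (-(γ + 1)) := Real.rpow_nonneg (sub_pos.2 hτ.2).le _
    calc _ ≤ (t - τ) ^ (-(γ + 1)) * (C * (1 + R) * (‖(u t - v t) - (u τ - v τ)‖ +
          B * Real.exp (ρ * t) * (‖u t - u τ‖ + ‖v t - v τ‖))) :=
          mul_le_mul_of_nonneg_left (h1.trans (by gcongr)) hp
      _ = _ := by ring
  · have i1 := huv.integrableOn ht
    have i2 := hu.integrableOn ht
    have i3 := hv.integrableOn ht
    have i4 : IntegrableOn (fun τ => B * Real.exp (ρ * t) * ((t - τ) ^ (-(γ + 1)) * ‖u t - u τ‖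
        + (t - τ) ^ (-(γ + 1)) * ‖v t - v τ‖)) (Ioo 0 t) := (i2.1.add i3.1).const_mul _
    rw [integral_const_mul, integral_add i1.1 i4, integral_const_mul, integral_add i2.1 i3.1]
    have e2 := i2.2.trans (hexp t ht)
    have e3 := i3.2.trans (hexp t ht)
    calc _ ≤ C * (1 + R) * (B * Real.exp (ρ * t) + B * Real.exp (ρ * t) * (R + R)) := by
          gcongr; exact i1.2
      _ = _ := by ring

end HasSecondDiffBound

theorem drift_sub (hP : IsSingularOp t₀ κ K P) (hκ : 0 ≤ κ) (hκ1 : κ < 1) (hK : 0 ≤ K) {A : ℝ}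
    {h h' : ℝ → H} (hh : AEStronglyMeasurable h (volume.restrict (Icc 0 t₀)))
    (hhA : ∀ s ∈ Icc 0 t₀, ‖h s‖ ≤ A)
    (hh' : AEStronglyMeasurable h' (volume.restrict (Icc 0 t₀)))
    (hhA' : ∀ s ∈ Icc 0 t₀, ‖h' s‖ ≤ A) {t : ℝ} (htt : t ≤ t₀) :
    drift P (fun s => h s - h' s) t = drift P h t - drift P h' t := by
  rw [drift, drift, drift, ← integral_sub (integrableOn_drift hP hκ hκ1 hK hh hhA htt)
    (integrableOn_drift hP hκ hκ1 hK hh' hhA' htt)]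
  simp only [map_sub]

theorem noise_sub (hM : IsSingularFamily t₀ κ K M) (hκ : 0 ≤ κ)
    (hK : 0 ≤ K) (hα : 0 < α) (hη : α < η) (hηθ : η < θ)
    (hsum : κ + θ < 1) (hz : MemC (1 - α) t₀ z) {ρ A A' : ℝ} {g g' : ℝ → 𝔾}
    (hρ : 0 < ρ) (hg : IsWeighted η t₀ ρ A g) (hg' : IsWeighted η t₀ ρ A' g') {t : ℝ}
    (ht : t ∈ Icc 0 t₀) :
    noise η M z (fun s => g s - g' s) t = noise η M z g t - noise η M z g' t := by
  obtain ⟨C, hC, hb⟩ := exists_noise_bound hM hκ hK hα hη hηθ (γ := 0) (l := 0) le_rfl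
    (by linarith) le_rfl (by linarith) hz
  have i1 := (hb ρ A g hρ hg).1 t ht
  have i2 := (hb ρ A' g' hρ hg').1 t ht
  rw [noise, noise, noise, ← integral_sub i1 i2]
  refine setIntegral_congr_fun measurableSet_Ioo fun s hs => ?_
  have k1 := ((hM.leftDeriv_bound hκ hK (hα.trans hη) (by linarith) hηθ (by linarith) hρ.le hg
    ht.2).2 s hs).1
  have k2 := ((hM.leftDeriv_bound hκ hK (hα.trans hη) (by linarith) hηθ (by linarith) hρ.le hg'
    ht.2).2 s hs).1
  simp only [map_sub]
  rw [leftDeriv_sub k1 k2, sub_apply]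

/-- In a norm with a large exponential weight the right-hand side of the mild equation is a
contraction on bounded sets of `W^γ`. -/
theorem exists_contraction (ht₀ : 0 < t₀) (hP : IsSingularOp t₀ κ K P) (hκ : 0 ≤ κ) (hK : 0 ≤ K)
    (hM : IsSingularFamily t₀ κ' K' M) (hκ' : 0 ≤ κ') (hK' : 0 ≤ K') (hα : 0 < α) (hη : α < η)
    (hηθ : η < θ) (hηγ : η ≤ γ) (hγγ' : γ < γ') (hγ' : γ' ≤ 1 - α) (hl : 0 < l)
    (hsum : κ + γ' + l < 1) (hsum' : κ' + γ' + θ + l < 1) (hz : MemC (1 - α) t₀ z)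
    {Φ : E → H} {L : ℝ} (hL : 0 ≤ L) (hΦ : ∀ a b, ‖Φ a - Φ b‖ ≤ L * ‖a - b‖)
    {n : E → 𝔾} {C : ℝ} (hC : 0 ≤ C) (hn : HasSecondDiffBound C n) {ρ₀ : ℝ} (hρ₀ : 0 ≤ ρ₀)
    (A : ℝ) :
    ∃ ρ, ρ₀ ≤ ρ ∧ 0 < ρ ∧ ∀ (u v : ℝ → E) (B : ℝ), IsWeighted γ t₀ ρ₀ A u →
      IsWeighted γ t₀ ρ₀ A v → IsWeighted γ t₀ ρ B (fun t => u t - v t) →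
      IsWeighted γ t₀ ρ (B / 2) (fun t =>
        (drift P (fun s => Φ (u s)) t - noise η M z (fun s => n (u s)) t) -
        (drift P (fun s => Φ (v s)) t - noise η M z (fun s => n (v s)) t)) := by
  have hγ : 0 ≤ γ := by linarith
  obtain ⟨C₁, hC₁, hd⟩ := exists_isWeighted_drift ht₀ hP hκ hK hγ hγγ' (by linarith) hl.le hsum
  obtain ⟨C₂, hC₂, hs⟩ := exists_isWeighted_noise ht₀ hM hκ' hK' hα hη hηθ hγ hγγ' hγ' hl.le
    hsum' hz
  set c := C₁ * L + C₂ * (max 1 (t₀ ^ (γ - η)) *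
    (C * (1 + |A| * Real.exp (ρ₀ * t₀)) * (1 + 2 * (|A| * Real.exp (ρ₀ * t₀))))) with hc
  have hc0 : 0 ≤ c := by
    have : 0 ≤ max 1 (t₀ ^ (γ - η)) := zero_le_one.trans (le_max_left _ _)
    positivity
  have hlim : Tendsto (fun ρ : ℝ => c * ρ ^ (-l)) atTop (𝓝 0) := by
    simpa using (tendsto_rpow_neg_atTop hl).const_mul c
  obtain ⟨ρ, hρ1, hρ2, hρ3⟩ := ((hlim.eventually (gt_mem_nhds (by norm_num : (0 : ℝ) < 1 / 2))).and
    ((eventually_ge_atTop ρ₀).and (eventually_gt_atTop 0))).exists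
  have hΦc : Continuous Φ := by
    have : LipschitzWith ⟨L, hL⟩ Φ := LipschitzWith.of_dist_le_mul fun a b => by
      rw [dist_eq_norm, dist_eq_norm]; exact hΦ a b
    exact this.continuous
  refine ⟨ρ, hρ2, hρ3, fun u v B hu hv huv => ?_⟩
  have hA := hu.nonneg
  rw [abs_of_nonneg hA] at hc
  have hB := huv.nonneg
  have hmu := hΦc.comp_aestronglyMeasurable hu.aestronglyMeasurable
  have hmv := hΦc.comp_aestronglyMeasurable hv.aestronglyMeasurable
  have hbd : ∀ w : ℝ → E, IsWeighted γ t₀ ρ₀ A w → ∀ s ∈ Icc 0 t₀,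
      ‖Φ (w s)‖ ≤ L * (A * Real.exp (ρ₀ * t₀)) + ‖Φ 0‖ := fun w hw s hs => by
    have h1 := hΦ (w s) 0
    have h2 := norm_add_le (Φ (w s) - Φ 0) (Φ 0)
    rw [sub_add_cancel] at h2
    rw [sub_zero] at h1
    have h3 : ‖w s‖ ≤ A * Real.exp (ρ₀ * t₀) := (hw.norm_le s hs).trans (by
      have := hs.2; gcongr)
    exact h2.trans (add_le_add (h1.trans (mul_le_mul_of_nonneg_left h3 hL)) le_rfl)
  have h1 := hd ρ (L * B) (fun s => Φ (u s) - Φ (v s)) hρ3 (by positivity) (hmu.sub hmv)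
    fun s hs => by
      rw [mul_assoc]
      exact (hΦ _ _).trans (mul_le_mul_of_nonneg_left (huv.norm_le s hs) hL)
  have hnu := ((hn.isWeighted_comp hC hρ₀ hu).mono_weight hρ2).mono_exponent hηγ
  have hnv := ((hn.isWeighted_comp hC hρ₀ hv).mono_weight hρ2).mono_exponent hηγ
  have h2 := hs ρ _ _ hρ3 ((hn.isWeighted_comp_sub hC hρ₀ hρ3.le hu hv huv).mono_exponent hηγ)
  refine ((h1.sub h2).mono (A' := B / 2) ?_).congr fun t ht => ?_
  · calc _ = c * ρ ^ (-l) * B := by rw [hc]; ring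
      _ ≤ 1 / 2 * B := by gcongr
      _ = _ := by ring
  · dsimp only
    rw [drift_sub hP hκ (by linarith) hK hmu (hbd u hu) hmv (hbd v hv) ht.2,
      noise_sub hM hκ' hK' hα hη hηθ (by linarith) hz hρ3 hnu hnv ht]
    abel

/-- A function that is bounded by each of a sequence of weights `B / 2 ^ n` vanishes. -/
theorem IsWeighted.eq_zero_of_forall {ρ B : ℝ} {w : ℝ → E}
    (h : ∀ k : ℕ, IsWeighted γ t₀ ρ (B / 2 ^ k) w) : ∀ t ∈ Icc 0 t₀, w t = 0 := by
  intro t ht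
  have hlim : Tendsto (fun k : ℕ => B / 2 ^ k * Real.exp (ρ * t)) atTop (𝓝 0) := by
    have h1 : Tendsto (fun k : ℕ => ((1 : ℝ) / 2) ^ k) atTop (𝓝 0) :=
      tendsto_pow_atTop_nhds_zero_of_lt_one (by norm_num) (by norm_num)
    have h2 := (h1.const_mul B).mul_const (Real.exp (ρ * t))
    simp only [mul_zero, zero_mul] at h2
    refine h2.congr fun k => ?_
    rw [one_div, inv_pow, div_eq_mul_inv]
  have := ge_of_tendsto' hlim fun k => (h k).norm_le t ht
  exact norm_le_zero_iff.1 this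

theorem eqOn_of_contraction {Ψ : (ℝ → E) → ℝ → E} {ρ₀ A ρ : ℝ} (hρ : ρ₀ ≤ ρ)
    (hΨ : ∀ (u v : ℝ → E) (B : ℝ), IsWeighted γ t₀ ρ₀ A u → IsWeighted γ t₀ ρ₀ A v →
      IsWeighted γ t₀ ρ B (fun t => u t - v t) →
      IsWeighted γ t₀ ρ (B / 2) (fun t => Ψ u t - Ψ v t))
    {u v : ℝ → E} (hu : IsWeighted γ t₀ ρ₀ A u) (hv : IsWeighted γ t₀ ρ₀ A v)
    (hΨu : EqOn (Ψ u) u (Icc 0 t₀)) (hΨv : EqOn (Ψ v) v (Icc 0 t₀)) : EqOn u v (Icc 0 t₀) := by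
  have h : ∀ k : ℕ, IsWeighted γ t₀ ρ ((A + A) / 2 ^ k) (fun t => u t - v t) := by
    intro k
    induction k with
    | zero => simpa using (hu.sub hv).mono_weight hρ
    | succ k ih =>
      refine ((hΨ u v _ hu hv ih).mono (le_of_eq ?_)).congr fun t ht => ?_
      · rw [pow_succ, div_div]
      · dsimp only
        rw [hΨu ht, hΨv ht]
  intro t ht
  exact sub_eq_zero.1 (IsWeighted.eq_zero_of_forall h t ht)

/-- Picard iteration in an invariant set that is closed under pointwise limits. -/
theorem exists_fixed_point [CompleteSpace E] {Ψ : (ℝ → E) → ℝ → E} {ρ₀ A ρ : ℝ} (hρ : ρ₀ ≤ ρ)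
    (hΨ : ∀ (u v : ℝ → E) (B : ℝ), IsWeighted γ t₀ ρ₀ A u → IsWeighted γ t₀ ρ₀ A v →
      IsWeighted γ t₀ ρ B (fun t => u t - v t) →
      IsWeighted γ t₀ ρ (B / 2) (fun t => Ψ u t - Ψ v t))
    (Q : (ℝ → E) → Prop) (hQ : ∀ u, Q u → IsWeighted γ t₀ ρ₀ A u) (hQ0 : Q 0)
    (hQΨ : ∀ u, Q u → Q (Ψ u))
    (hQl : ∀ (un : ℕ → ℝ → E) (u : ℝ → E), (∀ k, Q (un k)) →
      (∀ t ∈ Icc 0 t₀, Tendsto (fun k => un k t) atTop (𝓝 (u t))) → Q u) :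
    ∃ u, Q u ∧ EqOn (Ψ u) u (Icc 0 t₀) := by
  let un : ℕ → ℝ → E := fun k => Ψ^[k] 0
  have hun : ∀ k, un (k + 1) = Ψ (un k) := fun k => Function.iterate_succ_apply' _ _ _
  have hQn : ∀ k, Q (un k) := by
    intro k
    induction k with
    | zero => exact hQ0
    | succ k ih => rw [hun]; exact hQΨ _ ih
  set B := A + A with hB
  have hd : ∀ k : ℕ, IsWeighted γ t₀ ρ (B / 2 ^ k) (fun t => un (k + 1) t - un k t) := by
    intro k
    induction k with
    | zero => simpa using ((hQ _ (hQn 1)).sub (hQ _ (hQn 0))).mono_weight hρ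
    | succ k ih =>
      have := hΨ _ _ _ (hQ _ (hQn (k + 1))) (hQ _ (hQn k)) ih
      rw [← hun, ← hun] at this
      refine this.mono (le_of_eq ?_)
      rw [pow_succ, div_div]
  have hB0 : 0 ≤ B := by have := (hQ _ hQ0).nonneg; positivity
  have hdm : ∀ k m : ℕ, IsWeighted γ t₀ ρ (2 * B / 2 ^ k) (fun t => un (k + m) t - un k t) := by
    suffices h : ∀ k m : ℕ, IsWeighted γ t₀ ρ (2 * B / 2 ^ k - 2 * B / 2 ^ (k + m))
        (fun t => un (k + m) t - un k t) from fun k m =>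
      (h k m).mono (sub_le_self _ (by positivity))
    intro k m
    induction m with
    | zero =>
      refine ⟨by simpa using aestronglyMeasurable_const, by simp, by simp, by simp⟩
    | succ m ih =>
      refine ((ih.add (hd (k + m))).mono (le_of_eq ?_)).congr fun t ht => ?_
      · rw [← add_assoc, pow_succ 2 (k + m)]; field_simp; ring
      · dsimp only
        rw [← add_assoc]; abel
  have hconv : ∀ t ∈ Icc 0 t₀, ∃ x, Tendsto (fun k => un k t) atTop (𝓝 x) := by
    intro t ht
    refine cauchySeq_tendsto_of_complete (cauchySeq_of_le_geometric (1 / 2) (B * Real.exp (ρ * t))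
      (by norm_num) fun k => ?_)
    rw [dist_comm, dist_eq_norm]
    refine ((hd k).norm_le t ht).trans (le_of_eq ?_)
    rw [one_div, inv_pow, div_eq_mul_inv]; ring
  choose! u hu using hconv
  have hQu := hQl un u hQn hu
  have hdu : ∀ k : ℕ, IsWeighted γ t₀ ρ (2 * B / 2 ^ k) (fun t => u t - un k t) := fun k =>
    IsWeighted.of_tendsto (hdm k) fun t ht => by
      refine Tendsto.sub_const ((hu t ht).comp ?_) _
      exact tendsto_atTop_mono (fun m => Nat.le_add_left m k) tendsto_id
  refine ⟨u, hQu, fun t ht => ?_⟩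
  refine tendsto_nhds_unique ?_ ((hu t ht).comp (tendsto_add_atTop_nat 1))
  rw [tendsto_iff_norm_sub_tendsto_zero]
  have hlim : Tendsto (fun k : ℕ => 2 * B / 2 ^ k / 2 * Real.exp (ρ * t)) atTop (𝓝 0) := by
    have h1 : Tendsto (fun k : ℕ => ((1 : ℝ) / 2) ^ k) atTop (𝓝 0) :=
      tendsto_pow_atTop_nhds_zero_of_lt_one (by norm_num) (by norm_num)
    have h2 := (h1.const_mul (2 * B / 2)).mul_const (Real.exp (ρ * t))
    simp only [mul_zero, zero_mul] at h2
    refine h2.congr fun k => ?_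
    rw [one_div, inv_pow]; ring
  refine squeeze_zero (fun _ => norm_nonneg _) (fun k => ?_) hlim
  have := (hΨ _ _ _ (hQ _ hQu) (hQ _ (hQn k)) (hdu k)).norm_le t ht
  rw [← hun] at this
  rw [norm_sub_rev]
  exact this

end FixedPoint

/-! ### The convolution with the noise: order of the derivatives, bounded operators -/

section Noise

variable {𝔾 Z Y Y' : Type*} [NormedAddCommGroup 𝔾] [NormedSpace ℝ 𝔾] [NormedAddCommGroup Z]
  [NormedSpace ℝ Z] [NormedAddCommGroup Y] [NormedSpace ℝ Y] [NormedAddCommGroup Y']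
  [NormedSpace ℝ Y'] {t₀ κ K : ℝ} {M : ℝ → 𝔾 →L[ℝ] Z →L[ℝ] Y} {α η θ ρ A : ℝ} {z : ℝ → Z}

theorem IsSingularFamily.isFracDiff (hM : IsSingularFamily t₀ κ K M) (hκ : 0 ≤ κ)
    (hK : 0 ≤ K) (hη : 0 < η) (hη1 : η < 1) (hηθ : η < θ) (hθ1 : θ ≤ 1) (hκθ : κ + θ < 1)
    (hρ : 0 ≤ ρ) {g : ℝ → 𝔾} (hg : IsWeighted η t₀ ρ A g) {t : ℝ} (ht : t ∈ Icc 0 t₀) :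
    IsFracDiff η t (fun s => M (t - s) (g s)) := by
  obtain ⟨hVm, hb⟩ := hM.leftDeriv_bound hκ hK hη hη1 hηθ hθ1 hρ hg ht.2
  have hA := hg.nonneg
  refine ⟨hVm, ?_, fun s hs => (hb s hs).1,
    (hM.integrableOn_leftDeriv hκ hK hη hη1 hηθ hθ1 hκθ hρ hg ht.2).2⟩
  have hi := (integrableOn_singular (a := 0) (t := t) (c := κ + η) ht.1 (by linarith)).const_mul
    (K * (A * Real.exp (ρ * t₀)))
  have h3 : Measurable fun s : ℝ => (s ^ η)⁻¹ := by fun_prop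
  refine Integrable.mono' hi (h3.aestronglyMeasurable.smul hVm)
    (ae_restrict_of_forall_mem measurableSet_Ioo fun s hs => ?_)
  have hs0 : 0 < s := hs.1
  have hts : 0 < t - s := sub_pos.2 hs.2
  have h1 := rpow_neg_mul_rpow_neg_le hts hs0 hκ hη.le
  have h2 := hM.norm_le _ hts (by linarith [ht.2])
  have h4 : ‖g s‖ ≤ A * Real.exp (ρ * t₀) :=
    (hg.norm_le s ⟨hs0.le, hs.2.le.trans ht.2⟩).trans (by
      have := hs.2.le.trans ht.2; gcongr)
  rw [norm_smul, Real.norm_of_nonneg (by positivity), ← Real.rpow_neg hs0.le, sub_zero]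
  calc s ^ (-η) * ‖M (t - s) (g s)‖
      ≤ s ^ (-η) * (K * (t - s) ^ (-κ) * (A * Real.exp (ρ * t₀))) := by
        gcongr
        exact ((M (t - s)).le_opNorm _).trans (mul_le_mul h2 h4 (norm_nonneg _) (by positivity))
    _ = K * (A * Real.exp (ρ * t₀)) * ((t - s) ^ (-κ) * s ^ (-η)) := by ring
    _ ≤ _ := by gcongr

/-- The fractional integral does not depend on the order of the derivatives. -/
theorem noise_eq_noise [CompleteSpace Y] [CompleteSpace Z] (hM : IsSingularFamily t₀ κ K M)
    (hκ : 0 ≤ κ) (hK : 0 ≤ K) (hα : 0 < α) {η' θ' A' : ℝ} (hη : α < η) (hηθ : η < θ)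
    (hκθ : κ + θ < 1) (hη' : α < η') (hηθ' : η' < θ') (hκθ' : κ + θ' < 1) (hρ : 0 ≤ ρ) {g : ℝ → 𝔾}
    (hg : IsWeighted η t₀ ρ A g) (hg' : IsWeighted η' t₀ ρ A' g) (hz : MemC (1 - α) t₀ z) {t : ℝ}
    (ht : t ∈ Icc 0 t₀) : noise η M z g t = noise η' M z g t := by
  rcases ht.1.eq_or_lt with h0 | h0
  · simp [noise, ← h0]
  have h1 := (hM.isFracDiff hκ hK (hα.trans hη) (by linarith) hηθ (by linarith) hκθ hρ hg
    ht).tendsto_integral_diffQuot hα (by linarith) hη (by linarith) hz h0 ht.2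
  have h2 := (hM.isFracDiff hκ hK (hα.trans hη') (by linarith) hηθ' (by linarith) hκθ' hρ hg'
    ht).tendsto_integral_diffQuot hα (by linarith) hη' (by linarith) hz h0 ht.2
  exact tendsto_nhds_unique h1 h2

theorem map_leftDeriv [CompleteSpace Y] [CompleteSpace Y'] (Λ : Y →L[ℝ] Y') {V : ℝ → Y} {s : ℝ}
    (h : IntegrableOn (leftKernel η V s) (Ioo 0 s)) :
    Λ (leftDeriv η V s) = leftDeriv η (fun s => Λ (V s)) s := by
  have h1 : Λ (∫ τ in Ioo 0 s, leftKernel η V s τ)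
      = ∫ τ in Ioo 0 s, leftKernel η (fun s => Λ (V s)) s τ := by
    rw [← Λ.integral_comp_comm h]
    simp only [leftKernel, map_smul, map_sub]
  rw [leftDeriv, leftDeriv, map_smul, map_add, map_smul, map_smul, h1]

theorem map_noise [CompleteSpace Y] [CompleteSpace Y'] (Λ : Y →L[ℝ] Y')
    {M' : ℝ → 𝔾 →L[ℝ] Z →L[ℝ] Y'} (hΛ : ∀ r, 0 < r → ∀ g w, Λ (M r g w) = M' r g w)
    (hM : IsSingularFamily t₀ κ K M) (hκ : 0 ≤ κ) (hK : 0 ≤ K) (hα : 0 < α) (hη : α < η)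
    (hηθ : η < θ) (hκθ : κ + θ < 1) (hρ : 0 < ρ) {g : ℝ → 𝔾}
    (hg : IsWeighted η t₀ ρ A g) (hz : MemC (1 - α) t₀ z) {t : ℝ} (ht : t ∈ Icc 0 t₀) :
    Λ (noise η M z g t) = noise η M' z g t := by
  obtain ⟨C, hC, hb⟩ := exists_noise_bound hM hκ hK hα hη hηθ (γ := 0) (l := 0) le_rfl
    (by linarith) le_rfl (by linarith) hz
  rw [noise, noise, ← Λ.integral_comp_comm ((hb ρ A g hρ hg).1 t ht)]
  refine setIntegral_congr_fun measurableSet_Ioo fun s hs => ?_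
  have k := ((hM.leftDeriv_bound hκ hK (hα.trans hη) (by linarith) hηθ (by linarith) hρ.le hg
    ht.2).2 s hs).1
  have h1 := map_leftDeriv (ContinuousLinearMap.compL ℝ Z Y Y' Λ) k
  have h2 : leftDeriv η (fun s => ContinuousLinearMap.compL ℝ Z Y Y' Λ (M (t - s) (g s))) s
      = leftDeriv η (fun s => M' (t - s) (g s)) s :=
    leftDeriv_congr (t := t) (fun s hs => by
      ext w
      exact hΛ _ (sub_pos.2 hs.2) _ _) hs
  rw [← h2, ← h1]
  rfl

theorem map_drift [CompleteSpace Y] [CompleteSpace Y'] (Λ : Y →L[ℝ] Y')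
    {P : ℝ → 𝔾 →L[ℝ] Y} {P' : ℝ → 𝔾 →L[ℝ] Y'} (hΛ : ∀ r, 0 < r → ∀ g, Λ (P r g) = P' r g)
    (hP : IsSingularOp t₀ κ K P) (hκ : 0 ≤ κ) (hκ1 : κ < 1) (hK : 0 ≤ K) {h : ℝ → 𝔾}
    (hh : AEStronglyMeasurable h (volume.restrict (Icc 0 t₀)))
    (hhA : ∀ s ∈ Icc 0 t₀, ‖h s‖ ≤ A) {t : ℝ} (htt : t ≤ t₀) :
    Λ (drift P h t) = drift P' h t := by
  rw [drift, drift, ← Λ.integral_comp_comm (integrableOn_drift hP hκ hκ1 hK hh hhA htt)]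
  exact setIntegral_congr_fun measurableSet_Ioo fun s hs => hΛ _ (sub_pos.2 hs.2) _

end Noise

namespace SymmMarkovSemigroup

variable {X : Type*} [MeasurableSpace X] {μ : Measure X}

/-! ### The orbits of the semigroup -/

section Smoothing

variable {S : SymmMarkovSemigroup μ} {Y : Type*} [NormedAddCommGroup Y] [NormedSpace ℝ Y]
  {ι : Y →L[ℝ] Lp ℝ 2 μ} {t₀ κ K : ℝ} {P : ℝ → Lp ℝ 2 μ →L[ℝ] Y}

theorem IsSmoothing.isSingularOp (hP : S.IsSmoothing ι t₀ κ K P) (hκ : 0 ≤ κ) (hK : 0 ≤ K) :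
    IsSingularOp t₀ κ (2 * 2 ^ κ * K) P where
  norm_le r hr hrt := by
    refine (hP.norm_le r hr hrt).trans ?_
    have h1 : (1 : ℝ) ≤ 2 ^ κ := Real.one_le_rpow (by norm_num) hκ
    have h2 : 0 ≤ K * r ^ (-κ) := by positivity
    calc _ = 1 * (K * r ^ (-κ)) := by ring
      _ ≤ 2 * 2 ^ κ * (K * r ^ (-κ)) := by gcongr; linarith
      _ = _ := by ring
  diff_le r h hr hrt hh := by
    have hr2 : 0 < r / 2 := by positivity
    have hm : 0 ≤ min 1 (h / r) := le_min zero_le_one (by positivity)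
    refine ContinuousLinearMap.opNorm_le_bound _ (by positivity) fun v => ?_
    have e1 : (P (r + h) - P r) v = P (r / 2) (S.T (r / 2 + h) v - S.T (r / 2) v) := by
      rw [sub_apply, map_sub, ← hP.add_eq _ _ hr2 (by positivity), ← hP.add_eq _ _ hr2 hr2.le,
        ← add_assoc, add_halves]
    have e2 : min 1 (h / (r / 2)) ≤ 2 * min 1 (h / r) := by
      rw [mul_min_of_nonneg _ _ (by norm_num : (0 : ℝ) ≤ 2)]
      refine min_le_min (by norm_num) (le_of_eq ?_)
      field_simp
    rw [e1]
    calc _ ≤ ‖P (r / 2)‖ * ‖S.T (r / 2 + h) v - S.T (r / 2) v‖ := (P (r / 2)).le_opNorm _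
      _ ≤ (K * (r / 2) ^ (-κ)) * (2 * min 1 (h / r) * ‖v‖) := by
          gcongr
          · exact hP.norm_le _ hr2 (by linarith)
          · exact (S.norm_T_add_sub_le hr2 hh v).trans (by gcongr)
      _ = _ := by
          rw [Real.div_rpow hr.le (by norm_num), Real.rpow_neg (by norm_num : (0 : ℝ) ≤ 2),
            div_inv_eq_mul]
          ring

theorem IsSmoothing.norm_le_of_le (hP : S.IsSmoothing ι t₀ κ K P) (ht₀ : 0 < t₀) {r : ℝ}
    (hr : t₀ ≤ r) : ‖P r‖ ≤ ‖P t₀‖ := by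
  refine ContinuousLinearMap.opNorm_le_bound _ (norm_nonneg _) fun v => ?_
  have h1 := hP.add_eq t₀ (r - t₀) ht₀ (sub_nonneg.2 hr) v
  rw [add_sub_cancel] at h1
  rw [h1]
  exact ((P t₀).le_opNorm _).trans (mul_le_mul_of_nonneg_left
    (S.norm_T_le (sub_nonneg.2 hr) v) (norm_nonneg _))

theorem IsSmoothing.extend (hP : S.IsSmoothing ι t₀ κ K P) (ht₀ : 0 < t₀) (hκ : 0 ≤ κ)
    (hK : 0 ≤ K) {t₁ : ℝ} (ht₁ : 0 < t₁) :
    S.IsSmoothing ι t₁ κ (K + ‖P t₀‖ * t₁ ^ κ) P where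
  apply_eq := hP.apply_eq
  add_eq := hP.add_eq
  norm_le r hr hrt := by
    rw [add_mul]
    rcases le_total r t₀ with h | h
    · exact (hP.norm_le r hr h).trans (le_add_of_nonneg_right (by positivity))
    · refine (hP.norm_le_of_le ht₀ h).trans (le_trans ?_ (le_add_of_nonneg_left (by positivity)))
      rw [mul_assoc]
      refine le_mul_of_one_le_right (norm_nonneg _) ?_
      rw [Real.rpow_neg hr.le, ← div_eq_mul_inv, one_le_div (by positivity)]
      exact Real.rpow_le_rpow hr.le hrt hκ

theorem IsSmoothing.continuousOn (hP : S.IsSmoothing ι t₀ κ K P) (ht₀ : 0 < t₀) (hκ : 0 ≤ κ)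
    (hK : 0 ≤ K) : ContinuousOn P (Ioi 0) := by
  intro r hr
  have hr : 0 < r := hr
  have hK' : 0 ≤ K + ‖P t₀‖ * (r + 1) ^ κ := by positivity
  have h1 := ((hP.extend ht₀ hκ hK (t₁ := r + 1) (by linarith)).isSingularOp hκ hK').continuousOn
    hκ (by positivity)
  exact (h1.continuousAt (Ioc_mem_nhds hr (by linarith))).continuousWithinAt

/-- The Bessel potential operator `J^σ` maps `L₂` to every space to which the semigroup is
smoothing with an exponent less than `σ / 2`. -/
theorem IsSmoothing.exists_bessel_lift [CompleteSpace Y] (hP : S.IsSmoothing ι t₀ κ K P)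
    (ht₀ : 0 < t₀) (hκ : 0 ≤ κ) (hK : 0 ≤ K) {σ : ℝ} (hσ : κ < σ / 2) :
    ∃ R : Lp ℝ 2 μ →L[ℝ] Y, ∀ ψ, ι (R ψ) = S.bessel σ ψ := by
  have hσ0 : 0 < σ := by linarith
  let k : ℝ → ℝ := fun t => Real.exp (-t) * t ^ (σ / 2 - 1)
  have hi : IntegrableOn (fun t => k t • P t) (Ioi 0) := by
    have hm : Measurable k := by fun_prop
    have h1 := (Real.GammaIntegral_convergent (s := σ / 2 - κ) (by linarith)).const_mul K
    have h2 := (Real.GammaIntegral_convergent (s := σ / 2) (by linarith)).const_mul ‖P t₀‖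
    refine Integrable.mono' (h1.add h2) (hm.aestronglyMeasurable.smul
      ((hP.continuousOn ht₀ hκ hK).aestronglyMeasurable measurableSet_Ioi))
      (ae_restrict_of_forall_mem measurableSet_Ioi fun t ht => ?_)
    have ht : 0 < t := ht
    rw [norm_smul, Real.norm_of_nonneg (by positivity)]
    have h3 : ‖P t‖ ≤ K * t ^ (-κ) + ‖P t₀‖ := by
      rcases le_total t t₀ with h | h
      · exact (hP.norm_le t ht h).trans (le_add_of_nonneg_right (norm_nonneg _))
      · exact (hP.norm_le_of_le ht₀ h).trans (le_add_of_nonneg_left (by positivity))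
    calc k t * ‖P t‖ ≤ k t * (K * t ^ (-κ) + ‖P t₀‖) := by gcongr
      _ = _ := by
        simp only [k, Pi.add_apply]
        rw [show σ / 2 - κ - 1 = (σ / 2 - 1) + -κ by ring, Real.rpow_add ht]
        ring
  refine ⟨(Real.Gamma (σ / 2))⁻¹ • ∫ t in Ioi 0, k t • P t, fun ψ => ?_⟩
  have h1 : ι ((∫ t in Ioi 0, k t • P t) ψ) = ∫ t in Ioi 0, k t • S.T t ψ := by
    have h2 := (ι ∘L ContinuousLinearMap.apply ℝ Y ψ).integral_comp_comm hi
    refine Eq.trans h2.symm (setIntegral_congr_fun measurableSet_Ioi fun t ht => ?_)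
    simp only [ContinuousLinearMap.comp_apply, map_smul, ContinuousLinearMap.apply_apply]
    rw [hP.apply_eq t ht]
  rw [smul_apply, map_smul, h1]
  simp [bessel, hσ0, k]

end Smoothing

theorem form_add_le (S : SymmMarkovSemigroup μ) {r : ℝ} (hr : 0 ≤ r) (u v : Lp ℝ 2 μ) :
    S.form r (u + v) ≤ 2 * S.form r u + 2 * S.form r v := by
  have h := S.form_nonneg hr (u - v)
  have hsum : S.form r (u + v) + S.form r (u - v) = 2 * S.form r u + 2 * S.form r v := by
    simp only [form, map_add, map_sub, inner_add_right, inner_sub_right, inner_add_left,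
      inner_sub_left]
    ring
  linarith

theorem continuous_form (S : SymmMarkovSemigroup μ) (r : ℝ) : Continuous (S.form r) := by
  unfold form
  exact (continuous_id.sub (S.T r).continuous).inner continuous_id

/-- If `δ + ε > d_S / 2`, the orbit of an element of `H^{2γ+δ+ε}` lies in `W^γ([0,t₀], H^δ_∞)`. -/
theorem exists_memW_flow (S : SymmMarkovSemigroup μ) {dS t₀ γ δ ε : ℝ}
    (hS : S.Ultracontractive dS) (ht₀ : 0 < t₀) (hγ : γ ∈ Ioo (0 : ℝ) 1) (hδ : δ ∈ Ioo (0 : ℝ) 1)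
    (hε : 0 < ε) (hd : dS / 2 < δ + ε) (φ : Lp ℝ 2 μ) :
    ∃ v : ℝ → S.BddPot δ, MemW γ t₀ v ∧
      ∀ t ∈ Icc 0 t₀, (v t).toL2 = S.T t (S.bessel (2 * γ + δ + ε) φ) := by
  obtain ⟨K, hK, P, hP⟩ := S.exists_isSmoothing_bddPot hS hδ.1 hδ.2 1
  -- `e` is the part of `ε` that is spent on the regularity in time
  obtain ⟨e, he, he1, he2, he3⟩ : ∃ e, 0 < e ∧ e < ε ∧ e < δ + ε - dS / 2 ∧ γ + e / 2 ≤ 1 := by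
    refine ⟨min (ε / 2) (min ((δ + ε - dS / 2) / 2) (2 * (1 - γ))), lt_min (by linarith)
      (lt_min (by linarith) (by linarith [hγ.2])), ?_, ?_, ?_⟩
    · exact (min_le_left _ _).trans_lt (by linarith)
    · exact ((min_le_right _ _).trans (min_le_left _ _)).trans_lt (by linarith)
    · have := (min_le_right (ε / 2) _).trans (min_le_right ((δ + ε - dS / 2) / 2) (2 * (1 - γ)))
      linarith
  obtain ⟨R, hR⟩ := hP.exists_bessel_lift one_pos
    (by have := hδ.1.le.trans (le_max_left δ (dS / 2)); positivity) hK.le (σ := δ + ε - e) (by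
      have : max δ (dS / 2) < δ + ε - e := max_lt (by linarith) (by linarith)
      linarith)
  set a := γ + e / 2 with ha
  set ψ := S.bessel (2 * a) φ with hψ
  have ha0 : 0 < a := by have := hγ.1; positivity
  have hb : ∀ t' ∈ Icc 0 t₀, ∀ t ∈ Icc 0 t₀, t' < t →
      ‖R (S.T t ψ) - R (S.T t' ψ)‖ ≤
        ‖R‖ * ((Real.Gamma a)⁻¹ * (2 / a) * (t - t') ^ a * ‖φ‖) := by
    intro t' ht' t ht htt
    rw [← map_sub]
    refine (R.le_opNorm _).trans (mul_le_mul_of_nonneg_left ?_ (norm_nonneg _))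
    have h1 : S.T t ψ - S.T t' ψ = S.T t' (S.T (t - t') ψ - ψ) := by
      rw [map_sub, ← S.T_add _ _ ht'.1 (sub_nonneg.2 htt.le), add_sub_cancel]
    rw [h1]
    exact (S.norm_T_le ht'.1 _).trans
      (S.norm_T_bessel_sub_le ha0 he3 (sub_nonneg.2 htt.le) φ)
  have hΓ : 0 < Real.Gamma a := Real.Gamma_pos_of_pos ha0
  refine ⟨fun t => R (S.T t ψ), (IsWeighted.of_holder (ρ := 0) hγ.1.le (γ := a) (by linarith) ht₀
    le_rfl (A := ‖R‖ * ‖ψ‖ + ‖R‖ * ((Real.Gamma a)⁻¹ * (2 / a) * ‖φ‖)) (by positivity)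
    (fun t ht => ?_) fun t' ht' t ht htt => ?_).memW le_rfl, fun t ht => ?_⟩
  · rw [zero_mul, Real.exp_zero, mul_one]
    refine (R.le_opNorm _).trans ?_
    exact (mul_le_mul_of_nonneg_left (S.norm_T_le ht.1 ψ) (norm_nonneg _)).trans
      (le_add_of_nonneg_right (by positivity))
  · rw [zero_mul, Real.exp_zero, mul_one, add_mul]
    have : 0 ≤ (t - t') ^ a := Real.rpow_nonneg (sub_nonneg.2 htt.le) _
    refine (hb t' ht' t ht htt).trans (le_trans (le_of_eq (by ring))
      (le_add_of_nonneg_left (by positivity)))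
  · have h1 := hR (S.T t ψ)
    rw [BddPot.toL2L_apply] at h1
    rw [h1, ← S.T_bessel (by linarith [hδ.1]) ht.1, hψ, S.bessel_bessel (by linarith [hδ.1])
      (by positivity)]
    congr 2
    congr 1
    rw [ha]; ring

/-! ### The invariant set -/

/-- The a priori bounds on a solution: the weighted norm of `W^γ([0,t₀], H^δ_∞)`, Hölder continuity
of order `γ₀` in `L₂`, and the form bound that holds on `H^{δ₁}`. -/
structure IsTame (S : SymmMarkovSemigroup μ) {δ : ℝ} (γ γ₀ δ₁ t₀ ρ A : ℝ)
    (u : ℝ → S.BddPot δ) : Prop where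
  isWeighted : IsWeighted γ t₀ ρ A u
  holder : ∀ t' ∈ Icc 0 t₀, ∀ t ∈ Icc 0 t₀, t' < t →
    ‖(u t).toL2 - (u t').toL2‖ ≤ A * Real.exp (ρ * t) * (t - t') ^ γ₀
  form_le : ∀ t ∈ Icc 0 t₀, ∀ r, 0 < r →
    S.damp.form r (u t).toL2 ≤ (A * Real.exp (ρ * t)) ^ 2 * r ^ δ₁

section Tame

variable {S : SymmMarkovSemigroup μ} {β δ γ γ₀ δ₁ t₀ ρ A A' : ℝ} {u v : ℝ → S.BddPot δ}

theorem IsTame.zero (hA : 0 ≤ A) : S.IsTame γ γ₀ δ₁ t₀ ρ A (0 : ℝ → S.BddPot δ) where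
  isWeighted := by
    refine ⟨aestronglyMeasurable_const, hA, fun t _ => ?_, fun t _ => ?_⟩
    · rw [Pi.zero_apply, norm_zero]; positivity
    · simp
  holder t' _ t _ h := by
    have : 0 ≤ (t - t') ^ γ₀ := Real.rpow_nonneg (sub_nonneg.2 h.le) _
    rw [Pi.zero_apply, Pi.zero_apply, sub_self, norm_zero]
    positivity
  form_le t _ r hr := by
    rw [Pi.zero_apply, BddPot.toL2_zero, form, inner_zero_right]
    positivity

theorem IsTame.mono (hu : S.IsTame γ γ₀ δ₁ t₀ ρ A u) (h : A ≤ A') :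
    S.IsTame γ γ₀ δ₁ t₀ ρ A' u where
  isWeighted := hu.isWeighted.mono h
  holder t' ht' t ht htt := (hu.holder t' ht' t ht htt).trans (by
    have : 0 ≤ (t - t') ^ γ₀ := Real.rpow_nonneg (sub_nonneg.2 htt.le) _
    gcongr)
  form_le t ht r hr := (hu.form_le t ht r hr).trans (by
    have := hu.isWeighted.nonneg
    gcongr)

theorem IsTame.add (hu : S.IsTame γ γ₀ δ₁ t₀ ρ A u) (hv : S.IsTame γ γ₀ δ₁ t₀ ρ A' v) :
    S.IsTame γ γ₀ δ₁ t₀ ρ (2 * (A + A')) (fun t => u t + v t) where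
  isWeighted := (hu.isWeighted.add hv.isWeighted).mono (by
    linarith [hu.isWeighted.nonneg, hv.isWeighted.nonneg])
  holder t' ht' t ht htt := by
    have hA := hu.isWeighted.nonneg
    have hA' := hv.isWeighted.nonneg
    have h1 := hu.holder t' ht' t ht htt
    have h2 := hv.holder t' ht' t ht htt
    have h3 : 0 ≤ (t - t') ^ γ₀ := Real.rpow_nonneg (sub_nonneg.2 htt.le) _
    rw [BddPot.toL2_add, BddPot.toL2_add, add_sub_add_comm]
    refine (norm_add_le _ _).trans ((add_le_add h1 h2).trans ?_)
    calc _ = 1 * ((A + A') * Real.exp (ρ * t) * (t - t') ^ γ₀) := by ring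
      _ ≤ 2 * ((A + A') * Real.exp (ρ * t) * (t - t') ^ γ₀) := by gcongr; norm_num
      _ = _ := by ring
  form_le t ht r hr := by
    have hA := hu.isWeighted.nonneg
    have hA' := hv.isWeighted.nonneg
    have h1 := hu.form_le t ht r hr
    have h2 := hv.form_le t ht r hr
    rw [BddPot.toL2_add]
    refine (S.damp.form_add_le hr.le _ _).trans ?_
    calc _ ≤ 2 * ((A * Real.exp (ρ * t)) ^ 2 * r ^ δ₁)
          + 2 * ((A' * Real.exp (ρ * t)) ^ 2 * r ^ δ₁) := by gcongr
      _ = (2 * A ^ 2 + 2 * A' ^ 2) * (Real.exp (ρ * t) ^ 2 * r ^ δ₁) := by ring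
      _ ≤ (2 * (A + A')) ^ 2 * (Real.exp (ρ * t) ^ 2 * r ^ δ₁) := by
          gcongr
          nlinarith [mul_nonneg hA hA', sq_nonneg A, sq_nonneg A']
      _ = _ := by ring

theorem IsTame.neg (hu : S.IsTame γ γ₀ δ₁ t₀ ρ A u) :
    S.IsTame γ γ₀ δ₁ t₀ ρ A (fun t => -u t) := by
  have hneg : ∀ w : S.BddPot δ, (-w).toL2 = -w.toL2 := fun w => (BddPot.toL2L S δ).map_neg w
  refine ⟨hu.isWeighted.neg, fun t' ht' t ht htt => ?_, fun t ht r hr => ?_⟩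
  · rw [hneg, hneg, ← neg_sub', norm_neg]
    exact hu.holder t' ht' t ht htt
  · rw [hneg, form, map_neg, ← neg_sub', inner_neg_neg]
    exact hu.form_le t ht r hr

theorem IsTame.of_tendsto {un : ℕ → ℝ → S.BddPot δ} (hun : ∀ k, S.IsTame γ γ₀ δ₁ t₀ ρ A (un k))
    (h : ∀ t ∈ Icc 0 t₀, Tendsto (fun k => un k t) atTop (𝓝 (u t))) :
    S.IsTame γ γ₀ δ₁ t₀ ρ A u := by
  have hL : ∀ t ∈ Icc 0 t₀, Tendsto (fun k => (un k t).toL2) atTop (𝓝 (u t).toL2) := fun t ht =>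
    ((BddPot.toL2L S δ).continuous.tendsto _).comp (h t ht)
  exact ⟨IsWeighted.of_tendsto (fun k => (hun k).isWeighted) h,
    fun t' ht' t ht htt => le_of_tendsto' ((hL t ht).sub (hL t' ht')).norm
      fun k => (hun k).holder t' ht' t ht htt,
    fun t ht r hr => le_of_tendsto' (((S.damp.continuous_form r).tendsto _).comp (hL t ht))
      fun k => (hun k).form_le t ht r hr⟩

theorem isTame_of_lift (hδ₁ : 0 < δ₁) (hδ₁1 : δ₁ ≤ 1) {B : ℝ} {w : ℝ → S.BddPot δ}
    (hw : IsWeighted γ t₀ ρ B w)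
    (hh : ∀ t' ∈ Icc 0 t₀, ∀ t ∈ Icc 0 t₀, t' < t →
      ‖(w t).toL2 - (w t').toL2‖ ≤ B * Real.exp (ρ * t) * (t - t') ^ γ₀)
    (hl : ∀ t ∈ Icc 0 t₀, ∃ y : S.Pot δ₁, Pot.toL2 S δ₁ y = (w t).toL2 ∧
      ‖y‖ ≤ B * Real.exp (ρ * t)) :
    S.IsTame γ γ₀ δ₁ t₀ ρ (((Real.Gamma δ₁)⁻¹ * (2 / δ₁) + 1) * B) w := by
  have hΓ := Real.Gamma_pos_of_pos hδ₁
  have hB := hw.nonneg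
  have hc : 1 ≤ (Real.Gamma δ₁)⁻¹ * (2 / δ₁) + 1 := le_add_of_nonneg_left (by positivity)
  have hBc : B ≤ ((Real.Gamma δ₁)⁻¹ * (2 / δ₁) + 1) * B := le_mul_of_one_le_left hB hc
  refine ⟨hw.mono hBc, fun t' ht' t ht htt => (hh t' ht' t ht htt).trans ?_, fun t ht r hr => ?_⟩
  · have : 0 ≤ (t - t') ^ γ₀ := Real.rpow_nonneg (sub_nonneg.2 htt.le) _
    gcongr
  · obtain ⟨y, hy, hyB⟩ := hl t ht
    obtain ⟨φ, rfl⟩ := (Pot.equiv S δ₁).surjective y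
    rw [Pot.toL2_equiv] at hy
    rw [Pot.norm_equiv] at hyB
    rw [← hy]
    refine (S.form_bessel_le hδ₁ hδ₁1 hr.le φ).trans ?_
    set c := (Real.Gamma δ₁)⁻¹ * (2 / δ₁) + 1
    calc c * r ^ δ₁ * ‖φ‖ ^ 2 ≤ c * r ^ δ₁ * (B * Real.exp (ρ * t)) ^ 2 := by gcongr
      _ = c * 1 * (r ^ δ₁ * (B * Real.exp (ρ * t)) ^ 2) := by ring
      _ ≤ c * c * (r ^ δ₁ * (B * Real.exp (ρ * t)) ^ 2) := by gcongr
      _ = _ := by ring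

/-- The orbit of the initial value satisfies the a priori bounds. -/
theorem exists_isTame_flow (hδ₁ : 0 < δ₁) (hδ₁1 : δ₁ ≤ 1) {ε : ℝ} (hε : 0 < ε)
    (hγ₀ : γ₀ = γ + δ / 2) (hγ₀0 : 0 < γ₀) (hγ₀1 : γ₀ ≤ 1) (hδδ : δ₁ ≤ 2 * γ + δ) (φ : Lp ℝ 2 μ)
    (hv : MemW γ t₀ v) (hvT : ∀ t ∈ Icc 0 t₀, (v t).toL2 = S.T t (S.bessel (2 * γ + δ + ε) φ)) :
    ∃ A, 0 ≤ A ∧ ∀ ρ, 0 ≤ ρ → S.IsTame γ γ₀ δ₁ t₀ ρ A v := by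
  obtain ⟨A, hA⟩ := hv.exists_isWeighted
  have hA0 := hA.nonneg
  have hΓ := Real.Gamma_pos_of_pos hγ₀0
  set ψ := S.bessel ε φ
  set χ := S.bessel (2 * γ + δ + ε - δ₁) φ
  have hψ : S.bessel (2 * γ + δ + ε) φ = S.bessel (2 * γ₀) ψ := by
    rw [S.bessel_bessel (by positivity) hε, hγ₀]
    congr 2; ring
  have hχ : S.bessel (2 * γ + δ + ε) φ = S.bessel δ₁ χ := by
    rw [S.bessel_bessel hδ₁ (by linarith)]
    congr 2; ring
  set B := A + (Real.Gamma γ₀)⁻¹ * (2 / γ₀) * ‖ψ‖ + ‖χ‖ with hB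
  have hB0 : 0 ≤ B := by positivity
  have hΓ' := Real.Gamma_pos_of_pos hδ₁
  refine ⟨((Real.Gamma δ₁)⁻¹ * (2 / δ₁) + 1) * B, by positivity, fun ρ hρ => isTame_of_lift hδ₁
    hδ₁1 ((hA.mono_weight hρ).mono ?_) (fun t' ht' t ht htt => ?_) fun t ht => ?_⟩
  · rw [hB, add_assoc]; exact le_add_of_nonneg_right (by positivity)
  · rw [hvT t ht, hvT t' ht', hψ]
    have h1 : S.T t (S.bessel (2 * γ₀) ψ) - S.T t' (S.bessel (2 * γ₀) ψ)
        = S.T t' (S.T (t - t') (S.bessel (2 * γ₀) ψ) - S.bessel (2 * γ₀) ψ) := by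
      rw [map_sub, ← S.T_add _ _ ht'.1 (sub_nonneg.2 htt.le), add_sub_cancel]
    have h2 : 0 ≤ (t - t') ^ γ₀ := Real.rpow_nonneg (sub_nonneg.2 htt.le) _
    have h3 : 1 ≤ Real.exp (ρ * t) := Real.one_le_exp (mul_nonneg hρ ht.1)
    rw [h1]
    refine (S.norm_T_le ht'.1 _).trans ((S.norm_T_bessel_sub_le hγ₀0 hγ₀1
      (sub_nonneg.2 htt.le) ψ).trans ?_)
    calc _ = (Real.Gamma γ₀)⁻¹ * (2 / γ₀) * ‖ψ‖ * 1 * (t - t') ^ γ₀ := by ring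
      _ ≤ B * Real.exp (ρ * t) * (t - t') ^ γ₀ := by
          gcongr
          rw [hB]
          linarith [norm_nonneg χ]
  · have h3 : 1 ≤ Real.exp (ρ * t) := Real.one_le_exp (mul_nonneg hρ ht.1)
    refine ⟨Pot.equiv S δ₁ (S.T t χ), ?_, ?_⟩
    · rw [Pot.toL2_equiv, hvT t ht, hχ, S.T_bessel hδ₁ ht.1]
    · rw [Pot.norm_equiv]
      refine (S.norm_T_le ht.1 χ).trans ?_
      calc ‖χ‖ = ‖χ‖ * 1 := by ring
        _ ≤ B * Real.exp (ρ * t) := by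
          gcongr
          rw [hB]
          have : 0 ≤ (Real.Gamma γ₀)⁻¹ * (2 / γ₀) * ‖ψ‖ := by positivity
          linarith

/-- A Lipschitz superposition operator maps the invariant set to `W^η`, with a bound that is linear
in the size of the set; this excludes blow-up. -/
theorem exists_isWeighted_nemytskii {η : ℝ} (hηγ : η ≤ γ) (ht₀ : 0 < t₀)
    (hηγ₀ : η < γ₀ * (1 - β / δ₁)) {n : S.BddPot δ → S.BddPot β} (hnc : Continuous n) {C : ℝ}
    (hC : 0 ≤ C) (hn : ∀ a, ‖n a‖ ≤ C * ‖a‖)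
    (hnn : ∀ (a b : S.BddPot δ) (N h : ℝ), 0 ≤ N → 0 < h →
      (∀ r, 0 < r → S.damp.form r a.toL2 ≤ N ^ 2 * r ^ δ₁) →
      (∀ r, 0 < r → S.damp.form r b.toL2 ≤ N ^ 2 * r ^ δ₁) →
      ‖a.toL2 - b.toL2‖ ≤ N * h ^ γ₀ →
      ‖n a - n b‖ ≤ C * (‖a - b‖ + N * h ^ (γ₀ * (1 - β / δ₁)))) :
    ∃ C', 0 ≤ C' ∧ ∀ (ρ A : ℝ) (u : ℝ → S.BddPot δ), 0 ≤ ρ → S.IsTame γ γ₀ δ₁ t₀ ρ A u →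
      IsWeighted η t₀ ρ (C' * A) (fun t => n (u t)) := by
  set e := γ₀ * (1 - β / δ₁) with he
  have heη : 0 < e - η := sub_pos.2 hηγ₀
  set m := max 1 (t₀ ^ (γ - η)) with hm
  have hm0 : 1 ≤ m := le_max_left _ _
  refine ⟨C * (m + t₀ ^ (e - η) / (e - η)), by positivity, fun ρ A u hρ hu => ?_⟩
  have huw := hu.isWeighted.mono_exponent hηγ
  rw [← hm] at huw
  have hA := hu.isWeighted.nonneg
  have hk : 0 ≤ t₀ ^ (e - η) / (e - η) := by positivity
  have hp : ∀ t, 0 ≤ t → IntegrableOn (fun τ => (t - τ) ^ (e - η - 1)) (Ioo 0 t) ∧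
      ∫ τ in Ioo 0 t, (t - τ) ^ (e - η - 1) = t ^ (e - η) / (e - η) := fun t ht => by
    simpa using integrableOn_sub_rpow (a := 0) (t := t) (c := e - η - 1) ht (by linarith)
  refine IsWeighted.of_integrableOn (hnc.comp_aestronglyMeasurable huw.aestronglyMeasurable)
    (by positivity) (fun t ht => ?_)
    (fun t τ => C * ((t - τ) ^ (-(η + 1)) * ‖u t - u τ‖
      + A * Real.exp (ρ * t) * (t - τ) ^ (e - η - 1)))
    (fun t ht τ hτ => ?_)
    (fun t ht => ((huw.integrableOn ht).1.add ((hp t ht.1).1.const_mul _)).const_mul _)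
    (fun t ht => ?_)
  · calc _ ≤ C * (A * Real.exp (ρ * t)) :=
          (hn _).trans (mul_le_mul_of_nonneg_left (hu.isWeighted.norm_le t ht) hC)
      _ = C * 1 * A * Real.exp (ρ * t) := by ring
      _ ≤ _ := by gcongr; linarith
  · have hτ' : τ ∈ Icc 0 t₀ := ⟨hτ.1.le, hτ.2.le.trans ht.2⟩
    have htτ : 0 < t - τ := sub_pos.2 hτ.2
    have h1 := hnn (u t) (u τ) (A * Real.exp (ρ * t)) (t - τ) (by positivity) htτ
      (hu.form_le t ht) (fun r hr => (hu.form_le τ hτ' r hr).trans (by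
        have := hτ.2.le; gcongr)) (hu.holder τ hτ' t ht hτ.2)
    have hpw : (t - τ) ^ (e - η - 1) = (t - τ) ^ (-(η + 1)) * (t - τ) ^ e := by
      rw [← Real.rpow_add htτ]; congr 1; ring
    rw [hpw]
    calc _ ≤ (t - τ) ^ (-(η + 1)) * (C * (‖u t - u τ‖ + A * Real.exp (ρ * t) * (t - τ) ^ e)) := by
          gcongr
      _ = _ := by ring
  · have i2 : IntegrableOn (fun τ => A * Real.exp (ρ * t) * (t - τ) ^ (e - η - 1)) (Ioo 0 t) :=
      (hp t ht.1).1.const_mul _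
    rw [integral_const_mul, integral_add (huw.integrableOn ht).1 i2, integral_const_mul,
      (hp t ht.1).2]
    have h1 := (huw.integrableOn ht).2
    have h2 : t ^ (e - η) ≤ t₀ ^ (e - η) := Real.rpow_le_rpow ht.1 ht.2 heη.le
    calc _ ≤ C * (m * A * Real.exp (ρ * t) + A * Real.exp (ρ * t) *
          (t₀ ^ (e - η) / (e - η))) := by gcongr
      _ = _ := by ring

end Tame

section TameOperators

variable {S : SymmMarkovSemigroup μ} {β δ γ γ' γ₀ δ₁ t₀ α η θ κ κD κN l K KD KN : ℝ}
  {P : ℝ → Lp ℝ 2 μ →L[ℝ] S.BddPot δ} {PD : ℝ → Lp ℝ 2 μ →L[ℝ] S.Pot δ₁}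

theorem exists_isTame_drift (ht₀ : 0 < t₀) (hδ₁ : 0 < δ₁) (hδ₁1 : δ₁ ≤ 1)
    (hP : S.IsSmoothing (BddPot.toL2L S δ) t₀ κ K P) (hκ : 0 ≤ κ) (hK : 0 ≤ K)
    (hPD : S.IsSmoothing (Pot.toL2 S δ₁) t₀ κD KD PD) (hκD : 0 ≤ κD) (hKD : 0 ≤ KD)
    (hγ : 0 ≤ γ) (hγγ' : γ < γ') (hγ' : γ' ≤ 1) (hγ₀ : 0 ≤ γ₀) (hγ₀1 : γ₀ ≤ 1) (hl : 0 ≤ l)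
    (hsum : κ + γ' + l < 1) (hsum₀ : γ₀ + l < 1) (hsumD : κD + l < 1) :
    ∃ C, 0 ≤ C ∧ ∀ (ρ A : ℝ) (h : ℝ → Lp ℝ 2 μ), 0 < ρ → 0 ≤ A →
      AEStronglyMeasurable h (volume.restrict (Icc 0 t₀)) →
      (∀ s ∈ Icc 0 t₀, ‖h s‖ ≤ A * Real.exp (ρ * s)) →
      S.IsTame γ γ₀ δ₁ t₀ ρ (C * A * ρ ^ (-l)) (drift P h) := by
  have hP' := hP.isSingularOp hκ hK
  have hPD' := hPD.isSingularOp hκD hKD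
  have hPH := (S.isSmoothing_id t₀).isSingularOp le_rfl zero_le_one
  obtain ⟨C₁, hC₁, h1⟩ := exists_isWeighted_drift ht₀ hP' hκ (by positivity) hγ hγγ' hγ' hl hsum
  obtain ⟨C₂, hC₂, h2⟩ := exists_drift_bound hPH le_rfl (by positivity) hγ₀ hγ₀1 hl (by linarith)
  obtain ⟨C₃, hC₃, h3⟩ := exists_drift_bound hPD' hκD (by positivity) le_rfl zero_le_one hl
    (by linarith)
  have hΓ' := Real.Gamma_pos_of_pos hδ₁
  refine ⟨((Real.Gamma δ₁)⁻¹ * (2 / δ₁) + 1) * (C₁ + C₂ + C₃), by positivity,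
    fun ρ A h hρ hA hm hh => ?_⟩
  have hρl : 0 ≤ ρ ^ (-l) := by positivity
  have hhA : ∀ s ∈ Icc 0 t₀, ‖h s‖ ≤ A * Real.exp (ρ * t₀) := fun s hs =>
    (hh s hs).trans (by have := hs.2; gcongr)
  have hH : ∀ t ∈ Icc 0 t₀, (drift P h t).toL2 = drift S.T h t := fun t ht =>
    map_drift (BddPot.toL2L S δ) (fun r hr g => hP.apply_eq r hr g) hP' hκ (by linarith)
      (by positivity) hm hhA ht.2
  have hD : ∀ t ∈ Icc 0 t₀, Pot.toL2 S δ₁ (drift PD h t) = drift S.T h t := fun t ht =>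
    map_drift (Pot.toL2 S δ₁) (fun r hr g => hPD.apply_eq r hr g) hPD' hκD (by linarith)
      (by positivity) hm hhA ht.2
  refine (isTame_of_lift (B := (C₁ + C₂ + C₃) * A * ρ ^ (-l)) hδ₁ hδ₁1
    ((h1 ρ A h hρ hA hm hh).mono ?_) (fun t' ht' t ht htt => ?_) fun t ht => ?_).mono
    (le_of_eq (by ring))
  · gcongr; linarith
  · rw [hH t ht, hH t' ht']
    refine ((h2 ρ A h hρ hA hm hh).2 t' ht' t ht htt).trans ?_
    have : 0 ≤ (t - t') ^ γ₀ := Real.rpow_nonneg (sub_nonneg.2 htt.le) _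
    gcongr; linarith
  · refine ⟨drift PD h t, by rw [hD t ht, hH t ht],
      ((h3 ρ A h hρ hA hm hh).1 t ht).trans ?_⟩
    gcongr; linarith

theorem exists_isTame_noise (ht₀ : 0 < t₀) (hδ₁ : 0 < δ₁) (hδ₁1 : δ₁ ≤ 1)
    (hP : S.IsSmoothing (BddPot.toL2L S δ) t₀ κ K P) (hκ : 0 ≤ κ) (hK : 0 ≤ K)
    (hPD : S.IsSmoothing (Pot.toL2 S δ₁) t₀ κD KD PD) (hκD : 0 ≤ κD) (hKD : 0 ≤ KD)
    {N : ℝ → S.BddPot β →L[ℝ] S.NegPot β →L[ℝ] Lp ℝ 2 μ} (hκN : 0 ≤ κN) (hKN : 0 ≤ KN)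
    (hN : ∀ r s, 0 < r → 0 ≤ s → ∀ g w, N (r + s) g w = S.T s (N r g w))
    (hNb : ∀ r, 0 < r → r ≤ t₀ → ∀ g w, ‖N r g w‖ ≤ KN * r ^ (-κN) * ‖g‖ * ‖w‖)
    (hα : 0 < α) (hη : α < η) (hηθ : η < θ)
    (hγ : 0 ≤ γ) (hγγ' : γ < γ') (hγ' : γ' ≤ 1 - α) (hγ₀ : 0 ≤ γ₀) (hγ₀1 : γ₀ ≤ 1 - α)
    (hl : 0 ≤ l) (hsum : κ + κN + γ' + θ + l < 1) (hsum₀ : κN + γ₀ + θ + l < 1)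
    (hsumD : κD + κN + θ + l < 1) {z : ℝ → S.NegPot β} (hz : MemC (1 - α) t₀ z) :
    ∃ C, 0 ≤ C ∧ ∀ (ρ A : ℝ) (g : ℝ → S.BddPot β), 0 < ρ → IsWeighted η t₀ ρ A g →
      S.IsTame γ γ₀ δ₁ t₀ ρ (C * A * ρ ^ (-l)) (noise η (opM P N) z g) := by
  have hM := isSingularFamily_opM hK hKN hP hN hNb
  have hMD := isSingularFamily_opM hKD hKN hPD hN hNb
  have hMH := isSingularFamily_opM zero_le_one hKN (S.isSmoothing_id t₀) hN hNb
  obtain ⟨C₁, hC₁, h1⟩ := exists_isWeighted_noise ht₀ hM (by positivity) (by positivity) hα hη hηθ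
    hγ hγγ' hγ' hl (by linarith) hz
  obtain ⟨C₂, hC₂, h2⟩ := exists_noise_bound hMH (by positivity) (by positivity) hα hη hηθ
    hγ₀ hγ₀1 hl (by linarith) hz
  obtain ⟨C₃, hC₃, h3⟩ := exists_noise_bound hMD (by positivity) (by positivity) hα hη hηθ
    le_rfl (by linarith) hl (by linarith) hz
  have hΓ' := Real.Gamma_pos_of_pos hδ₁
  refine ⟨((Real.Gamma δ₁)⁻¹ * (2 / δ₁) + 1) * (C₁ + C₂ + C₃), by positivity,
    fun ρ A g hρ hg => ?_⟩
  have hA := hg.nonneg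
  have hρl : 0 ≤ ρ ^ (-l) := by positivity
  have hι : ∀ r, 0 < r → ∀ g w, BddPot.toL2L S δ (opM P N r g w) = opM S.T N r g w :=
    fun r hr g w => by
      rw [ι_opM hP hN hr, ← ι_opM (S.isSmoothing_id t₀) hN hr]; rfl
  have hιD : ∀ r, 0 < r → ∀ g w, Pot.toL2 S δ₁ (opM PD N r g w) = opM S.T N r g w :=
    fun r hr g w => by
      rw [ι_opM hPD hN hr, ← ι_opM (S.isSmoothing_id t₀) hN hr]; rfl
  have hH : ∀ t ∈ Icc 0 t₀,
      (noise η (opM P N) z g t).toL2 = noise η (opM S.T N) z g t := fun t ht =>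
    map_noise (BddPot.toL2L S δ) hι hM (by positivity) (by positivity) hα hη hηθ (by linarith)
      hρ hg hz ht
  have hD : ∀ t ∈ Icc 0 t₀,
      Pot.toL2 S δ₁ (noise η (opM PD N) z g t) = noise η (opM S.T N) z g t := fun t ht =>
    map_noise (Pot.toL2 S δ₁) hιD hMD (by positivity) (by positivity) hα hη hηθ (by linarith)
      hρ hg hz ht
  refine (isTame_of_lift (B := (C₁ + C₂ + C₃) * A * ρ ^ (-l)) hδ₁ hδ₁1
    ((h1 ρ A g hρ hg).mono ?_) (fun t' ht' t ht htt => ?_) fun t ht => ?_).mono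
    (le_of_eq (by ring))
  · gcongr; linarith
  · rw [hH t ht, hH t' ht']
    refine ((h2 ρ A g hρ hg).2.2 t' ht' t ht htt).trans ?_
    have : 0 ≤ (t - t') ^ γ₀ := Real.rpow_nonneg (sub_nonneg.2 htt.le) _
    gcongr; linarith
  · refine ⟨noise η (opM PD N) z g t, by rw [hD t ht, hH t ht],
      ((h3 ρ A g hρ hg).2.1 t ht).trans ?_⟩
    gcongr; linarith

end TameOperators

/-! ### The fractional integral of a function in `W^γ` -/

theorem fracIntegrable_of_isWeighted {S : SymmMarkovSemigroup μ} {β δ t₀ κ K α η θ ρ A : ℝ}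
    {M : ℝ → S.BddPot β →L[ℝ] S.NegPot β →L[ℝ] S.BddPot δ}
    (hM : IsSingularFamily t₀ κ K M) (hκ : 0 ≤ κ) (hK : 0 ≤ K) (hα : 0 < α) (hη : α < η)
    (hηθ : η < θ) (hκθ : κ + θ < 1) (hρ : 0 ≤ ρ) {z : ℝ → S.NegPot β} (hz : MemC (1 - α) t₀ z)
    {G : ℝ → ℝ} {u : ℝ → S.BddPot δ} {g : ℝ → S.BddPot β} (hg : IsWeighted η t₀ ρ A g)
    (hMu : ∀ r, 0 < r → ∀ s, S.IsSmoothedMul β δ r (fun x => G ((u s).toL2 x)) (M r (g s)))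
    {t : ℝ} (ht : t ∈ Icc 0 t₀) :
    S.FracIntegrable β δ η G z u t ∧ S.fracIntegral β δ η G z u t = -noise η M z g t := by
  have hη0 := hα.trans hη
  have hV : EqOn (S.opU β δ G u t) (fun s => M (t - s) (g s)) (Ioo 0 t) := fun s hs =>
    smoothedMul_eq (hMu _ (sub_pos.2 hs.2) s)
  have hV' : EqOn (fun s => M (t - s) (g s)) (S.opU β δ G u t) (Ioo 0 t) := hV.symm
  have hfd := hM.isFracDiff hκ hK hη0 (by linarith) hηθ (by linarith) hκθ hρ hg ht
  obtain ⟨C, hCb, hCz⟩ := id hz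
  have hzc := hz.continuousOn (by linarith)
  refine ⟨⟨fun s hs => ⟨_, hMu _ (sub_pos.2 hs.2) s⟩,
    ae_restrict_of_forall_mem measurableSet_Ioo fun s hs => ?_, ?_,
    ae_restrict_of_forall_mem measurableSet_Ioo fun s hs =>
      (integrableOn_rightKernel hη hCz hzc hs.1.le hs.2.le ht.2).1, ?_⟩, ?_⟩
  · refine (hfd.integrableOn_leftKernel s hs).congr_fun (fun τ hτ => ?_) measurableSet_Ioo
    simp only [leftKernel]
    rw [hV hs, hV ⟨hτ.1, hτ.2.trans hs.2⟩]
  · exact (hfd.integrableOn_leftDeriv hη0).congr_fun (fun s hs => leftDeriv_congr hV' hs)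
      measurableSet_Ioo
  · refine memLp_top_of_bound (aestronglyMeasurable_rightDeriv ((hzc.mono
      (Ioo_subset_Icc_self.trans (Icc_subset_Icc_right ht.2))).aestronglyMeasurable
      measurableSet_Ioo)) ((Real.Gamma η)⁻¹ * C * (1 + 1 / (η - α)) * t₀ ^ (η - α))
      (ae_restrict_of_forall_mem measurableSet_Ioo fun s hs => ?_)
    exact norm_rightDeriv_le ((norm_nonneg _).trans (hCb t ht)) hα hη (by linarith) hCz hzc hs.1.le
      hs.2 ht.2
  · rw [fracIntegral, noise]
    congr 1
    refine setIntegral_congr_fun measurableSet_Ioo fun s hs => ?_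
    rw [leftDeriv_congr hV hs]

/-- Functions in `W^γ` that agree on `[0,t₀)` agree at `t₀`, since `(t₀ - τ)^{-γ-1}` is not
integrable. -/
theorem _root_.MemW.eq_right {E : Type*} [NormedAddCommGroup E] [NormedSpace ℝ E] {γ t₀ : ℝ}
    (hγ : 0 ≤ γ) (ht₀ : 0 < t₀) {u v : ℝ → E} (hu : MemW γ t₀ u) (hv : MemW γ t₀ v)
    (h : EqOn u v (Ico 0 t₀)) : u t₀ = v t₀ := by
  obtain ⟨-, C, hC⟩ := hu
  obtain ⟨-, C', hC'⟩ := hv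
  have h1 := (hC t₀ ⟨ht₀.le, le_rfl⟩).1.add (hC' t₀ ⟨ht₀.le, le_rfl⟩).1
  by_contra hne
  have hd : 0 < ‖u t₀ - v t₀‖ := norm_pos_iff.2 (sub_ne_zero.2 hne)
  have hm : Measurable fun τ : ℝ => (t₀ - τ) ^ (-(γ + 1)) := by fun_prop
  have h2 : IntegrableOn (fun τ : ℝ => (t₀ - τ) ^ (-(γ + 1))) (Ioo 0 t₀) := by
    refine Integrable.mono' (h1.const_mul ‖u t₀ - v t₀‖⁻¹) hm.aestronglyMeasurable
      (ae_restrict_of_forall_mem measurableSet_Ioo fun τ hτ => ?_)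
    have hp : 0 < t₀ - τ := sub_pos.2 hτ.2
    have h3 : ‖u t₀ - v t₀‖ ≤ ‖u t₀ - u τ‖ + ‖v t₀ - v τ‖ := by
      have e : u t₀ - v t₀ = (u t₀ - u τ) - (v t₀ - v τ) := by
        rw [h ⟨hτ.1.le, hτ.2⟩]; abel
      rw [e]
      exact norm_sub_le _ _
    simp only [Pi.add_apply]
    rw [Real.norm_of_nonneg (by positivity), ← add_div, Real.rpow_neg hp.le, ← div_eq_inv_mul,
      le_div_iff₀ hd, inv_mul_le_iff₀ (by positivity), mul_div_cancel₀ _ (by positivity)]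
    exact h3
  have h4 : IntervalIntegrable (fun τ : ℝ => τ ^ (-(γ + 1))) volume 0 t₀ := by
    have h5 : IntervalIntegrable (fun τ : ℝ => (t₀ - τ) ^ (-(γ + 1))) volume 0 t₀ :=
      (intervalIntegrable_iff_integrableOn_Ioo_of_le ht₀.le).2 h2
    simpa using (h5.comp_sub_left t₀).symm
  have := (intervalIntegral.integrableOn_Ioo_rpow_iff ht₀).1
    ((intervalIntegrable_iff_integrableOn_Ioo_of_le ht₀.le).1 h4)
  linarith

end SymmMarkovSemigroup

/-! ### Existence and uniqueness -/

theorem IsSingularOp.mono_right {W : Type*} [NormedAddCommGroup W] {t₀ t₁ κ K : ℝ} {m : ℝ → W}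
    (hm : IsSingularOp t₀ κ K m) (h : t₁ ≤ t₀) : IsSingularOp t₁ κ K m :=
  ⟨fun r hr hrt => hm.norm_le r hr (hrt.trans h), fun r k hr hrt => hm.diff_le r k hr (hrt.trans h)⟩

theorem IsSingularFamily.mono_right {𝔾 Z Y : Type*} [NormedAddCommGroup 𝔾] [NormedSpace ℝ 𝔾]
    [NormedAddCommGroup Z] [NormedSpace ℝ Z] [NormedAddCommGroup Y] [NormedSpace ℝ Y]
    {t₀ t₁ κ K : ℝ} {M : ℝ → 𝔾 →L[ℝ] Z →L[ℝ] Y} (hM : IsSingularFamily t₀ κ K M)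
    (h : t₁ ≤ t₀) : IsSingularFamily t₁ κ K M :=
  ⟨fun r hr hrt => hM.norm_le r hr (hrt.trans h),
    fun r k hr hrt => hM.diff_le r k hr (hrt.trans h),
    fun r k k' hr hrt => hM.diff_diff_le r k k' hr (hrt.trans h)⟩

theorem MemC.mono_right {E : Type*} [NormedAddCommGroup E] {η t₀ t₁ : ℝ} {v : ℝ → E}
    (hv : MemC η t₀ v) (h : t₁ ≤ t₀) : MemC η t₁ v := by
  obtain ⟨C, h1, h2⟩ := hv
  exact ⟨C, fun t ht => h1 t ⟨ht.1, ht.2.trans h⟩,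
    fun s hs t ht => h2 s ⟨hs.1, hs.2.trans h⟩ t ⟨ht.1, ht.2.trans h⟩⟩

/-- The choice of the exponents: `δ₁` is the order of the form bound in the invariant set, and `x`
is the room between the exponents. Here `m` and `b` stand for `max δ (d_S / 2)` and
`max β (d_S / 2)`. -/
theorem exists_exponents {α β γ δ m b : ℝ} (hα : 0 < α) (hβ : 0 < β) (hβ1 : β < 1) (hαγ : α < γ)
    (hγα : γ < 1 - α) (hβδ : β ≤ δ) (hm : δ ≤ m) (hb : β ≤ b)
    (hmain : 2 * γ + m < 2 - 2 * α - b) :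
    ∃ δ₁ x, 0 < x ∧ β < δ₁ ∧ δ₁ < 1 ∧ δ₁ ≤ 2 * γ + δ ∧ α + x ≤ γ ∧
      α + x < (γ + δ / 2) * (1 - β / δ₁) ∧ γ + x ≤ 1 - α ∧ m / 2 + b / 2 + γ + α + 4 * x < 1 := by
  have hδ₁ : ∃ δ₁, β < δ₁ ∧ δ₁ < 1 ∧ δ₁ ≤ 2 * γ + δ ∧ α < (γ + δ / 2) * (1 - β / δ₁) := by
    rcases lt_or_ge (2 * γ + δ) 1 with h | h
    · refine ⟨2 * γ + δ, by linarith, h, le_rfl, ?_⟩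
      have h1 : (γ + δ / 2) * (1 - β / (2 * γ + δ)) = (2 * γ + δ - β) / 2 := by
        have h2 : (2 * γ + δ) * (β / (2 * γ + δ)) = β := mul_div_cancel₀ β (by linarith)
        linear_combination (-1 / 2) * h2
      rw [h1]; linarith
    · have hγ₀ : 0 < γ + δ / 2 - α := by linarith
      have h1 : β * (γ + δ / 2) / (γ + δ / 2 - α) < 1 := by
        rw [div_lt_one hγ₀]
        nlinarith
      obtain ⟨δ₁, h2, h3⟩ := exists_between (max_lt hβ1 h1)
      have h4 := (le_max_left _ _).trans_lt h2
      have h5 := (le_max_right _ _).trans_lt h2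
      refine ⟨δ₁, h4, h3, by linarith, ?_⟩
      have h6 : 0 < δ₁ := hβ.trans h4
      rw [div_lt_iff₀ hγ₀] at h5
      have h7 : (γ + δ / 2) * (1 - β / δ₁) = ((γ + δ / 2) * (δ₁ - β)) / δ₁ := by
        field_simp
      rw [h7, lt_div_iff₀ h6]
      linarith
  obtain ⟨δ₁, h1, h2, h3, h4⟩ := hδ₁
  set f := (γ + δ / 2) * (1 - β / δ₁)
  set s := 1 - (m / 2 + b / 2 + γ + α) with hs
  have hs0 : 0 < s := by linarith
  refine ⟨δ₁, min (min (γ - α) ((f - α) / 2)) (min (1 - α - γ) (s / 8)),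
    lt_min (lt_min (by linarith) (by linarith)) (lt_min (by linarith) (by linarith)), h1, h2, h3,
    ?_, ?_, ?_, ?_⟩
  · linarith [(min_le_left (min (γ - α) ((f - α) / 2)) (min (1 - α - γ) (s / 8))).trans
      (min_le_left _ _)]
  · change _ < f
    linarith [(min_le_left (min (γ - α) ((f - α) / 2)) (min (1 - α - γ) (s / 8))).trans
      (min_le_right _ _)]
  · linarith [(min_le_right (min (γ - α) ((f - α) / 2)) (min (1 - α - γ) (s / 8))).trans
      (min_le_left _ _)]
  · linarith [(min_le_right (min (γ - α) ((f - α) / 2)) (min (1 - α - γ) (s / 8))).trans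
      (min_le_right _ _)]

namespace SymmMarkovSemigroup

variable {X : Type*} [MeasurableSpace X] {μ : Measure X}

/-- The superposition operator `u ↦ G ∘ u` from `H^δ_∞` to `H^β_∞`, and its estimates. -/
theorem exists_nemytskii_incl (S : SymmMarkovSemigroup μ) {β δ δ₁ : ℝ} (hβ : 0 < β)
    (hβ1 : β < 1) (hβδ : β ≤ δ) (hβδ₁ : β < δ₁) {G : ℝ → ℝ} (hG : ContDiff ℝ 2 G) (hG0 : G 0 = 0)
    (hGL : ∃ K, LipschitzWith K G) (hG'' : ∃ C : ℝ, ∀ x, |deriv (deriv G) x| ≤ C)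
    (hG''L : ∃ K, LipschitzWith K (deriv (deriv G))) :
    ∃ n : S.BddPot δ → S.BddPot β, (∀ u, (n u).toL2 =ᵐ[μ] fun x => G (u.toL2 x)) ∧
      (∃ C, 0 ≤ C ∧ HasSecondDiffBound C n) ∧
      ∃ C, 0 ≤ C ∧ (∀ u, ‖n u‖ ≤ C * ‖u‖) ∧ ∀ (a b : S.BddPot δ) (N h γ₀ : ℝ), 0 ≤ N → 0 < h →
        (∀ r, 0 < r → S.damp.form r a.toL2 ≤ N ^ 2 * r ^ δ₁) →
        (∀ r, 0 < r → S.damp.form r b.toL2 ≤ N ^ 2 * r ^ δ₁) →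
        ‖a.toL2 - b.toL2‖ ≤ N * h ^ γ₀ →
        ‖n a - n b‖ ≤ C * (‖a - b‖ + N * h ^ (γ₀ * (1 - β / δ₁))) := by
  obtain ⟨L, hL⟩ := hGL
  obtain ⟨B, hB⟩ := hG''
  obtain ⟨K, hK⟩ := hG''L
  have hGd : Differentiable ℝ G := hG.differentiable (by norm_num)
  have hGd' : Differentiable ℝ (deriv G) := hG.differentiable_deriv_two
  have hL' : ∀ x, |deriv G x| ≤ L := fun x => by
    simpa using norm_deriv_le_of_lipschitz (x₀ := x) hL
  have hK' : ∀ x y, |deriv (deriv G) x - deriv (deriv G) y| ≤ K * |x - y| := fun x y => by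
    simpa [Real.dist_eq] using hK.dist_le_mul x y
  obtain ⟨i, hi, hin⟩ := S.exists_inclL hβ hβδ
  obtain ⟨C₀, hC₀, n, hn, hnC⟩ := S.exists_nemytskii hβ hβ1 hG0 hGd hL'
  obtain ⟨C₁, hC₁, h1⟩ := S.exists_norm_nemytskii_sub_sub_sub_le hβ hβ1 hGd hGd' hL' hB hK' hn
  obtain ⟨C₂, hC₂, h2⟩ := S.exists_norm_nemytskii_sub_le hβ hβ1 hβδ₁ hG0 hGd hL' hn
  have hins : ∀ a b, ‖i a - i b‖ ≤ ‖a - b‖ := fun a b => by rw [← map_sub]; exact hin _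
  refine ⟨fun u => n (i u), fun u => by rw [← hi u]; exact hn (i u), ⟨C₁, hC₁, ?_⟩,
    C₀ + C₂, by positivity, fun u => ?_, fun a b N h γ₀ hN hh ha hb hab => ?_⟩
  · intro a₁ b₁ a₂ b₂ R ha₁ hb₁ ha₂ hb₂
    have hR : 0 ≤ R := (norm_nonneg _).trans ha₁
    refine (h1 (i a₁) (i b₁) (i a₂) (i b₂) R ((hin _).trans ha₁) ((hin _).trans hb₁)
      ((hin _).trans ha₂) ((hin _).trans hb₂)).trans ?_
    have e1 : ‖(i a₁ - i b₁) - (i a₂ - i b₂)‖ ≤ ‖(a₁ - b₁) - (a₂ - b₂)‖ := by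
      rw [← map_sub, ← map_sub]; exact hins _ _
    have e2 := hins a₂ b₂
    have e3 := hins a₁ a₂
    have e4 := hins b₁ b₂
    gcongr
  · exact (hnC _).trans (mul_le_mul (by linarith) (hin u) (norm_nonneg _) (by positivity))
  · rw [← hi a] at ha hab
    rw [← hi b] at hb hab
    refine (h2 (i a) (i b) N h γ₀ hN hh ha hb hab).trans ?_
    have := hins a b
    have h0 : 0 ≤ N * h ^ (γ₀ * (1 - β / δ₁)) := by positivity
    gcongr
    linarith

end SymmMarkovSemigroup

end

theorem theorem1 {X : Type*} [MeasurableSpace X] (μ : Measure X) [SigmaFinite μ]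
    (t₀ : ℝ) (ht₀ : 0 < t₀)
    (S : SymmMarkovSemigroup μ) (dS : ℝ) (hdS : 0 < dS) (hS : S.Ultracontractive dS)
    (α β γ δ ε : ℝ) (hα : α ∈ Ioo (0 : ℝ) 1) (hβ : β ∈ Ioo (0 : ℝ) 1) (hγ : γ ∈ Ioo (0 : ℝ) 1)
    (hδ : δ ∈ Ioo (0 : ℝ) 1) (hε : ε ∈ Ioo (0 : ℝ) 1)
    (z : ℝ → S.NegPot β) (hz : MemC (1 - α) t₀ z)
    (F : ℝ → ℝ) (hF : ContDiff ℝ 1 F) (hF0 : F 0 = 0)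
    (hF' : ∃ C : ℝ, ∀ x, |deriv F x| ≤ C) (hF'L : ∃ K, LipschitzWith K (deriv F))
    (G : ℝ → ℝ) (hG : ContDiff ℝ 2 G) (hG0 : G 0 = 0) (hGL : ∃ K, LipschitzWith K G)
    (hG'' : ∃ C : ℝ, ∀ x, |deriv (deriv G) x| ≤ C)
    (hG''L : ∃ K, LipschitzWith K (deriv (deriv G)))
    (f : S.Pot (2 * γ + δ + ε))
    (hf : dS / 2 < δ + ε ∨ ∃ v : ℝ → S.BddPot δ, MemW γ t₀ v ∧
      ∀ t ∈ Icc 0 t₀, (v t).toL2 = S.T t (SymmMarkovSemigroup.Pot.toL2 S _ f))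
    (hαγ : α < γ) (hγα : γ < 1 - α) (hβδ : β ≤ δ)
    (hmain : 2 * γ + max δ (dS / 2) < 2 - 2 * α - max β (dS / 2)) :
    ∃ u : ℝ → S.BddPot δ, MemW γ t₀ u ∧
      (∀ η, α < η → η ≤ γ →
        S.IsMildSolution β δ η t₀ F G z (SymmMarkovSemigroup.Pot.toL2 S _ f) u) ∧
      ∀ v : ℝ → S.BddPot δ, MemW γ t₀ v → ∀ η, α < η → η ≤ γ →
        S.IsMildSolution β δ η t₀ F G z (SymmMarkovSemigroup.Pot.toL2 S _ f) v →
        EqOn v u (Icc 0 t₀) := by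
  open SymmMarkovSemigroup in
  obtain ⟨hα0, -⟩ := hα
  obtain ⟨hβ0, hβ1⟩ := hβ
  obtain ⟨hγ0, hγ1⟩ := hγ
  obtain ⟨hδ0, hδ1⟩ := hδ
  have hm1 := le_max_left δ (dS / 2)
  have hb1 := le_max_left β (dS / 2)
  obtain ⟨δ₁, x, hx, hβδ₁, hδ₁1, hδδ, hxγ, hxe, hxα, hxs⟩ :=
    exists_exponents hα0 hβ0 hβ1 hαγ hγα hβδ hm1 hb1 hmain
  have hδ₁ : 0 < δ₁ := hβ0.trans hβδ₁
  set κ := max δ (dS / 2) / 2 with hκ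
  set κN := max β (dS / 2) / 2 with hκN
  have hκ0 : 0 ≤ κ := by linarith
  have hκN0 : 0 ≤ κN := by linarith
  -- `f = J^{2γ+δ+ε} φ`, and `v₀` is its orbit
  obtain ⟨φ, rfl⟩ := (Pot.equiv S (2 * γ + δ + ε)).surjective f
  rw [Pot.toL2_equiv] at hf ⊢
  obtain ⟨v₀, hv₀, hv₀T⟩ := hf.elim
    (fun hd => S.exists_memW_flow hS ht₀ ⟨hγ0, hγ1⟩ ⟨hδ0, hδ1⟩ hε.1 hd φ) id
  set f₀ := S.bessel (2 * γ + δ + ε) φ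
  obtain ⟨A₀, hA₀, hv₀A⟩ := exists_isTame_flow hδ₁ hδ₁1.le hε.1 rfl (by linarith) (by linarith)
    hδδ φ hv₀ hv₀T
  -- `F` acts from `H^δ_∞` to `L₂`, and `G` from `H^δ_∞` to `H^β_∞`
  obtain ⟨L, hL⟩ := hF'
  have hL0 : 0 ≤ L := (abs_nonneg _).trans (hL 0)
  obtain ⟨hFm, hFl, hF00⟩ := norm_superpos_sub_le (μ := μ) hF0 (hF.differentiable (by norm_num)) hL
  let Φ : S.BddPot δ → Lp ℝ 2 μ := fun u => superpos F u.toL2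
  have hΦ : ∀ a b, ‖Φ a - Φ b‖ ≤ L * ‖a - b‖ := fun a b => (hFl _ _).trans
    (mul_le_mul_of_nonneg_left (by rw [← BddPot.toL2_sub]; exact BddPot.norm_toL2_le _) hL0)
  have hΦ0 : ∀ a, ‖Φ a‖ ≤ L * ‖a‖ := fun a => by
    have h := hΦ a 0
    have h0 : Φ 0 = 0 := by simp only [Φ]; rw [BddPot.toL2_zero, hF00]
    rwa [h0, sub_zero, sub_zero] at h
  have hΦc : Continuous Φ := by
    have : LipschitzWith ⟨L, hL0⟩ Φ := LipschitzWith.of_dist_le_mul fun a b => by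
      rw [dist_eq_norm, dist_eq_norm]; exact hΦ a b
    exact this.continuous
  obtain ⟨n, hnG, ⟨Cn, hCn, hn⟩, Cl, hCl, hnl, hnn⟩ :=
    S.exists_nemytskii_incl hβ0 hβ1 hβδ hβδ₁ hG hG0 hGL hG'' hG''L
  -- `T(r)(g w)` is factorized through `L₂`, as `T(r/2)` applied to `T(r/2)(g w)`
  obtain ⟨Kβ, hKβ, Pβ, hPβ⟩ := S.exists_isSmoothing_bddPot hS hβ0 hβ1 t₀
  obtain ⟨K, hK, P, hP⟩ := S.exists_isSmoothing_bddPot hS hδ0 hδ1 t₀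
  obtain ⟨KD, hKD, PD, hPD⟩ := S.exists_isSmoothing_pot hδ₁ hδ₁1 t₀
  obtain ⟨m, hm⟩ := S.exists_mul hβ0 hβ1
  obtain ⟨N, hNi, hNb, hN⟩ := S.exists_dualFlow hPβ m
  have hKN : 0 ≤ ‖m‖ * Kβ := by positivity
  set M := opM P N with hMdef
  have hM := isSingularFamily_opM hK.le hKN hP hN hNb
  rw [← hMdef, ← hκ, ← hκN] at hM
  set KM := 16 * (K * (‖m‖ * Kβ) * 4 ^ (κ + κN))
  have hKM : 0 ≤ KM := by positivity
  have hP' := hP.isSingularOp hκ0 hK.le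
  set KP := 2 * 2 ^ κ * K
  have hKP : 0 ≤ KP := by positivity
  have hMu : ∀ u : ℝ → S.BddPot δ, ∀ r, 0 < r → ∀ s,
      S.IsSmoothedMul β δ r (fun x => G ((u s).toL2 x)) (M r (n (u s))) := fun u r hr s =>
    isSmoothedMul_opM hPβ hP hm hNi hN hr (hnG (u s))
  set η₀ := α + x with hη₀
  -- the right-hand side of the mild equation, as a map on functions with values in `H^δ_∞`
  let Ψ : (ℝ → S.BddPot δ) → ℝ → S.BddPot δ := fun u t =>
    v₀ t + (drift P (fun s => Φ (u s)) t - noise η₀ M z (fun s => n (u s)) t)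
  have hterms : ∀ u, MemW γ t₀ u → ∀ t ∈ Icc 0 t₀,
      IntegrableOn (fun s => S.T (t - s) (Φ (u s))) (Ioo 0 t) ∧
      (drift P (fun s => Φ (u s)) t).toL2 = ∫ s in Ioo 0 t, S.T (t - s) (Φ (u s)) := by
    intro u hu t ht
    obtain ⟨A, hA⟩ := hu.exists_isWeighted
    have hmu := hΦc.comp_aestronglyMeasurable hA.aestronglyMeasurable
    have hbd : ∀ s ∈ Icc 0 t₀, ‖Φ (u s)‖ ≤ L * A := fun s hs => (hΦ0 _).trans
      (mul_le_mul_of_nonneg_left (by simpa using hA.norm_le s hs) hL0)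
    exact ⟨integrableOn_drift ((S.isSmoothing_id t₀).isSingularOp le_rfl zero_le_one) le_rfl
      one_pos (by positivity) hmu hbd ht.2, map_drift (BddPot.toL2L S δ)
        (fun r hr g => hP.apply_eq r hr g) hP' hκ0 (by linarith) hKP hmu hbd ht.2⟩
  have hfrac : ∀ u, MemW γ t₀ u → ∀ η, α < η → η ≤ γ → ∀ t ∈ Icc 0 t₀,
      S.FracIntegrable β δ η G z u t ∧
      S.fracIntegral β δ η G z u t = -noise η₀ M z (fun s => n (u s)) t := by
    intro u hu η hη hηγ t ht
    obtain ⟨A, hA⟩ := hu.exists_isWeighted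
    have hnu := hn.isWeighted_comp hCn le_rfl hA
    have h1 := fracIntegrable_of_isWeighted hM (by positivity) hKM hα0 hη (θ := η + x)
      (by linarith) (by linarith) le_rfl hz (hnu.mono_exponent hηγ) (hMu u) ht
    refine ⟨h1.1, h1.2.trans ?_⟩
    rw [noise_eq_noise hM (by positivity) hKM hα0 hη (θ := η + x) (θ' := η₀ + x) (by linarith)
      (by linarith) (by linarith) (by linarith) (by linarith) le_rfl (hnu.mono_exponent hηγ)
      (hnu.mono_exponent hxγ) hz ht]
  have hΨ : ∀ u, MemW γ t₀ u → ∀ η, α < η → η ≤ γ → ∀ t ∈ Icc 0 t₀, (Ψ u t).toL2 =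
      S.T t f₀ + (∫ s in Ioo 0 t, S.T (t - s) (superpos F (u s).toL2)) +
        (S.fracIntegral β δ η G z u t).toL2 := by
    intro u hu η hη hηγ t ht
    simp only [Ψ]
    rw [(hfrac u hu η hη hηγ t ht).2, sub_eq_add_neg, ← add_assoc, BddPot.toL2_add,
      BddPot.toL2_add, hv₀T t ht, (hterms u hu t ht).2]
  have hΨ0 : ∀ u, Ψ u 0 = v₀ 0 := fun u => by simp [Ψ, drift, noise]
  have hv₀0 : (v₀ 0).toL2 = f₀ := by rw [hv₀T 0 ⟨le_rfl, ht₀.le⟩, S.T_zero]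
  have hcontr : ∀ t₁, 0 < t₁ → t₁ ≤ t₀ → ∀ ρ₀, 0 ≤ ρ₀ → ∀ A, ∃ ρ, ρ₀ ≤ ρ ∧ 0 < ρ ∧
      ∀ (u v : ℝ → S.BddPot δ) (B : ℝ), IsWeighted γ t₁ ρ₀ A u → IsWeighted γ t₁ ρ₀ A v →
      IsWeighted γ t₁ ρ B (fun t => u t - v t) →
      IsWeighted γ t₁ ρ (B / 2) (fun t => Ψ u t - Ψ v t) := by
    intro t₁ ht₁ ht₁₀ ρ₀ hρ₀ A
    obtain ⟨ρ, h1, h2, h3⟩ := exists_contraction ht₁ (hP'.mono_right ht₁₀) hκ0 hKP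
      (hM.mono_right ht₁₀) (by positivity) hKM hα0 (η := η₀) (θ := η₀ + x) (by linarith)
      (by linarith) hxγ (γ' := γ + x) (by linarith) hxα hx (by linarith) (by linarith)
      (hz.mono_right ht₁₀) hL0 hΦ hCn hn hρ₀ A
    refine ⟨ρ, h1, h2, fun u v B hu hv huv => (h3 u v B hu hv huv).congr fun t _ => ?_⟩
    simp only [Ψ]
    abel
  -- The drift and the noise map tame functions to tame functions whose size is linear in the given
  -- one, with a factor that is a negative power of the weight `ρ`.
  obtain ⟨Cd, hCd, hd⟩ := exists_isTame_drift (γ := γ) (γ' := γ + x) (γ₀ := γ + δ / 2) (l := x) ht₀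
    hδ₁ hδ₁1.le hP hκ0 hK.le hPD (by positivity) hKD.le hγ0.le (by linarith) (by linarith)
    (by linarith) (by linarith) hx.le (by linarith) (by linarith) (by linarith)
  obtain ⟨Cs, hCs, hs⟩ := exists_isTame_noise (γ := γ) (γ' := γ + x) (γ₀ := γ + δ / 2) (l := x)
    (η := η₀) (θ := η₀ + x) ht₀ hδ₁ hδ₁1.le hP hκ0 hK.le hPD (by positivity) hKD.le hκN0 hKN hN hNb
    hα0 (by linarith) (by linarith) hγ0.le (by linarith) hxα (by linarith) (by linarith) hx.le
    (by linarith) (by linarith) (by linarith) hz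
  obtain ⟨Ct, hCt, ht⟩ := exists_isWeighted_nemytskii (η := η₀) (γ := γ) hxγ ht₀ hxe hn.continuous
    hCl hnl fun a b N h => hnn a b N h _
  have hlim : Tendsto (fun ρ : ℝ => (Cd * L + Cs * Ct) * ρ ^ (-x)) atTop (𝓝 0) := by
    simpa using (tendsto_rpow_neg_atTop hx).const_mul (Cd * L + Cs * Ct)
  -- Both sums in `v₀ + (drift - noise)` double the size of tame functions; with the factor `1 / 8`
  -- the size `4 A₀` reproduces itself: `2 (A₀ + 2 * (1 / 8) * 4 A₀) = 4 A₀`.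
  obtain ⟨ρ₀, hρ1, hρ0⟩ := ((hlim.eventually (gt_mem_nhds (by norm_num : (0 : ℝ) < 1 / 8))).and
    (eventually_gt_atTop 0)).exists
  have hinv : ∀ u, S.IsTame γ (γ + δ / 2) δ₁ t₀ ρ₀ (4 * A₀) u →
      S.IsTame γ (γ + δ / 2) δ₁ t₀ ρ₀ (4 * A₀) (Ψ u) := by
    intro u hu
    have h1 := hd ρ₀ (L * (4 * A₀)) (fun s => Φ (u s)) hρ0 (by positivity)
      (hΦc.comp_aestronglyMeasurable hu.isWeighted.aestronglyMeasurable) fun s hs => by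
        rw [mul_assoc]
        exact (hΦ0 _).trans (mul_le_mul_of_nonneg_left (hu.isWeighted.norm_le s hs) hL0)
    have h2 := hs ρ₀ _ _ hρ0 (ht ρ₀ _ u hρ0.le hu)
    have h3 := ((hv₀A ρ₀ hρ0.le).add (h1.add h2.neg)).mono (A' := 4 * A₀) (by
      calc _ = 2 * A₀ + 16 * ((Cd * L + Cs * Ct) * ρ₀ ^ (-x)) * A₀ := by ring
        _ ≤ 2 * A₀ + 16 * (1 / 8) * A₀ := by gcongr
        _ = _ := by ring)
    simpa only [← sub_eq_add_neg] using h3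
  obtain ⟨ρ, hρ, -, hρc⟩ := hcontr t₀ ht₀ le_rfl ρ₀ hρ0.le (4 * A₀)
  obtain ⟨u, hu, hΨu⟩ := exists_fixed_point hρ hρc
    (S.IsTame γ (γ + δ / 2) δ₁ t₀ ρ₀ (4 * A₀)) (fun _ h => h.isWeighted)
    (IsTame.zero (by positivity)) hinv fun _ _ h h' => IsTame.of_tendsto h h'
  have huW : MemW γ t₀ u := hu.isWeighted.memW hρ0.le
  refine ⟨u, huW, fun η hη hηγ => ⟨?_, fun s _ => hFm _, fun t ht =>
    (hterms u huW t (Ioo_subset_Icc_self ht)).1, fun t ht =>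
    (hfrac u huW η hη hηγ t (Ioo_subset_Icc_self ht)).1, fun t ht => ?_⟩,
    fun v hv η hη hηγ hmild => ?_⟩
  · rw [← hΨu ⟨le_rfl, ht₀.le⟩, hΨ0, hv₀0]
  · rw [← hΨ u huW η hη hηγ t (Ioo_subset_Icc_self ht), hΨu (Ioo_subset_Icc_self ht)]
  -- The equation for `v` holds on `[0, t₀)` only: the contraction property gives `v = u` on each
  -- `[0, t₁]` with `t₁ < t₀`, and `t₀` itself is treated by `MemW.eq_right`.
  · have hΨv : ∀ t ∈ Ico 0 t₀, Ψ v t = v t := by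
      intro t ht
      apply BddPot.toL2_injective
      rcases ht.1.eq_or_lt with h | h
      · rw [← h, hΨ0, hv₀0, hmild.init]
      · rw [hΨ v hv η hη hηγ t (Ico_subset_Icc_self ht), hmild.eqn t ⟨h, ht.2⟩]
    have hIco : EqOn v u (Ico 0 t₀) := by
      intro t ht
      obtain ⟨t₁, h1, h2⟩ := exists_between ht.2
      obtain ⟨A, hA⟩ := hv.exists_isWeighted
      obtain ⟨A', hA'⟩ := huW.exists_isWeighted
      obtain ⟨ρ', hρ', -, hc⟩ := hcontr t₁ (ht.1.trans_lt h1) h2.le 0 le_rfl (max A A')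
      exact eqOn_of_contraction hρ' hc ((hA.mono (le_max_left _ _)).mono_right h2.le)
        ((hA'.mono (le_max_right _ _)).mono_right h2.le)
        (fun s hs => hΨv s ⟨hs.1, hs.2.trans_lt h2⟩)
        (fun s hs => hΨu ⟨hs.1, hs.2.trans h2.le⟩) ⟨ht.1, h1.le⟩
    intro t ht
    rcases ht.2.eq_or_lt with h | h
    · rw [h]
      exact MemW.eq_right hγ0.le ht₀ hv huW hIco
    · exact hIco ⟨ht.1, h⟩
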